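/- **Setting.** Let $E$ be a locally convex real topological vector space which is Polish (a separable Fréchet space), with dual $E'$, and let $(H,|\cdot|,\langle\cdot,\cdot\rangle)$ be a real Hilbert space embedded continuously and densely in $E$. Let $\mathscr F C_b^\infty$ be the space of functions $F=f(l_1,\dots,l_m)$ with $m\in\mathbb N$, $l_1,\dots,l_m\in E'$ and $f\in C^\infty(\mathbb R^m)$ bounded together with all its derivatives; $\nabla F(z)\in H$ is the element representing $h\mapsto\frac{d}{dt}F(z+th)|_{t=0}$ on $H$. Let $\mu_N$ ($N\in\mathbb N$) and $\mu_\infty$ be Borel probability measures on $E$ with $\mu_N\to\mu_\infty$ weakly and $\operatorname{supp}\mu_N\subset\operatorname{supp}\mu_\infty$; put $\overline{\mathbb N}=\mathbb N\cup\{\infty\}$. For $N\in\overline{\mathbb N}$ the minimal gradient form $(\mathcal E^N,\mathcal D(\mathcal E^N))$ is the closure in $L^2(E,\mu_N)$ of $\mathcal E^N(u,u)=\int_E|\nabla u|^2\,d\mu_N$, $u\in\mathscr F C_b^\infty$ (whenever this form is well defined on $\mu_N$-classes and closable). **Mosco convergence.** A section $u_N\in L^2(E,\mu_N)$, $N\in\overline{\mathbb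 N}$, converges strongly if $\int u_N\varphi\,d\mu_N\to\int u_\infty\varphi\,d\mu_\infty$ for all $\varphi\in C_b(E)$ and $\|u_N\|\to\|u_\infty\|$; it converges weakly if $\int u_Nv_N\,d\mu_N\to\int u_\infty v_\infty\,d\mu_\infty$ for every strongly convergent section $(v_N)$. With $\mathcal E(u,u):=\infty$ off the domain, $\mathcal E^N\to\mathcal E^\infty$ in the sense of Mosco if (a) $\mathcal E^\infty(u_\infty,u_\infty)\le\liminf_N\mathcal E^N(u_N,u_N)$ for every weakly convergent section, and (b) every $u_\infty\in\mathcal D(\mathcal E^\infty)$ is the asymptotic element of a strongly convergent section with $u_N\in\mathcal D(\mathcal E^N)$ and $\mathcal E^N(u_N,u_N)\to\mathcal E^\infty(u_\infty,u_\infty)$. **Forms on $S\times\mathbb R^d$.** Let $S$ be Polish, $d\ge1$, and let a probability measure $\mu$ on $S\times\mathbb R^d$ be disintegrated as $\mu(ds\,dx)=m_s(dx)\,\nu(ds)$, where $\nu$ is its first marginal; let $\varrho(s,\cdot)$ be the Lebesgue density of $m_s$ (where it exists). For measurable $\kappa:S\times\mathbb R^d\to[0,1]$ put $q^\kappa_\mu(u)=\int_S\int_{\mathbb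 R^d}\sum_{i=1}^d|\partial^x_iu(s,x)|^2\,\kappa(s,x)\varrho(s,x)\,dx\,d\nu(s)$, with weak derivatives. The form $\bar{\mathcal E}_\mu$ is the closure in $L^2(\mu)$ of $q^1_\mu$ on the bounded measurable $u$ such that every $u(s,\cdot)$ is continuous with weak partial derivatives in $L^\infty(dx)$ and $q^1_\mu(u)<\infty$. The form $(\mathcal E^\kappa_\mu,\mathcal D_{\min}(\mathcal E^\kappa_\mu))$ is the closure in $L^2(\kappa\mu)$ of $q^\kappa_\mu$ on the linear span of the functions $f(s)g(x)$ with $f\in C_b(S)$, $g\in C^1_c(\mathbb R^d)$. A measurable $\varphi:\mathbb R^d\to[0,1]$ is primal if it vanishes off $[-2,2]^d$, $\int\varphi\,dx=1$ and $\sum_{\alpha\in\mathbb Z^d}\varphi(x-\alpha)=1$ for all $x$; for $r>0$, $\alpha\in r\mathbb Z^d$ put $\varphi^\alpha_r(x)=\varphi((x-\alpha)/r)$. For integrable $g\ge0$ let $$R^{\varphi,\eta}_r(g)(y)=\sum_{\alpha\in r\mathbb Z^d}r^{-d}\int|g(y)-g(x)|\,\eta^\alpha_r(x)\,dx\;\varphi^\alpha_r(y),\qquad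 I^{\varphi,\eta}_r(g)(y)=\sum_{\alpha\in r\mathbb Z^d}r^{-d}\int \eta^\alpha_r(x)g(x)\,dx\;\varphi^\alpha_r(y).$$ For $m=\varrho\,dx$ and measurable $\kappa:\mathbb R^d\to[0,1]$ let $\delta^\kappa_r(m)$, respectively $C^\kappa_r(m)$, be the supremum over primal $\varphi,\eta$ and bounded measurable $f$ of $|\int fR^{\varphi,\eta}_r(\kappa\varrho)\,dx|/\|f\|_{L^2(m)}$, respectively $|\int fI^{\varphi,\eta}_r(\kappa\varrho)\,dx|/\|f\|_{L^1(m)}$ (with $0/0=0$ and $a/0=\infty$ for $a>0$). A family $\mu_N$, $N\in\overline{\mathbb N}$, of probability measures on $S\times\mathbb R^d$ (with $\nu_N$, $m^N_s$, $\varrho_N$ as above) satisfies condition (H) if for every $N\in\overline{\mathbb N}$ the measure $m^N_s$ is absolutely continuous for $\nu_N$-a.e. $s$ and $$\int_Sm^N_s\Big(\Big\{x:\int_{x+[-\varepsilon,\varepsilon]^d}\varrho_N(s,y)^{-1}dy<\infty\text{ for some }\varepsilon>0\Big\}\Big)d\nu_N(s)=1.$$ It satisfies condition (C) if * $\int_S|\int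 g(s,\cdot)\,dm^N_s|^2d\nu_N(s)\to\int_S|\int g(s,\cdot)\,dm^\infty_s|^2d\nu_\infty(s)$ for all $g\in C_b(S\times\mathbb R^d)$; and * there is an at most countable set $\mathscr U$ of continuous functions $S\times\mathbb R^d\to[0,1]$ such that $\lim_m\sup_{N\in\mathbb N}\|\delta^{\kappa(s,\cdot)}_{1/m}(m^N_s)\|_{L^2(\nu_N)}=0$ and $\limsup_m\sup_{N\in\mathbb N}\|C^{\kappa(s,\cdot)}_{1/m}(m^N_s)\|_{L^\infty(\nu_N)}<\infty$ for each $\kappa\in\mathscr U$, $\sup_{\kappa\in\mathscr U}\kappa=1$ $\mu_\infty$-a.e., and $\mathcal D_{\min}(\mathcal E^1_{\mu_\infty})$ is the set of all $u\in L^2(\mu_\infty)$ with $u\in\mathcal D_{\min}(\mathcal E^\kappa_{\mu_\infty})$ for all $\kappa\in\mathscr U$ and $\sup_{\kappa\in\mathscr U}\mathcal E^\kappa_{\mu_\infty}(u,u)<\infty$. **Component forms.** Let $K=\{\xi_1,\dots,\xi_d\}\subset H$ be linearly independent, $S_K$ a closed complement of $\operatorname{span}K$ in $E$, $\pi_K:E\to\mathbb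 R^d$ the continuous linear map with kernel $S_K$ and $\pi_K\xi_i=e_i$, and $J_K:E\to S_K\times\mathbb R^d$, $J_Kz=(z-\sum_i(\pi_Kz)_i\xi_i,\ \pi_Kz)$. For $N\in\overline{\mathbb N}$ put $\mathcal E^{N,K}(u,u)=\bar{\mathcal E}_{\mu_N\circ J_K^{-1}}(u\circ J_K^{-1},u\circ J_K^{-1})$, with domain the $u\in L^2(E,\mu_N)$ for which $u\circ J_K^{-1}$ is in the domain of $\bar{\mathcal E}_{\mu_N\circ J_K^{-1}}$. For $K=\{\eta\}$ write $J_\eta$, $\mathcal E^{N,\eta}$. **Theorem.** Suppose that one of the following two conditions holds. 1. There are an orthonormal basis $(\eta_i)_{i\in\mathbb N}$ of $H$ and closed complements $S_{\eta_i}$ of $\operatorname{span}\{\eta_i\}$ in $E$ such that for each $i\in\mathbb N$ the family $\mu_N\circ J_{\eta_i}^{-1}$, $N\in\overline{\mathbb N}$, satisfies (H) and (C), and $$\Big\{u\in\bigcap_i\mathcal D(\mathcal E^{\infty,\eta_i}):\sum_{i}\mathcal E^{\infty,\eta_i}(u,u)<\infty\Big\}=\mathcal D(\mathcal E^\infty).$$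 2. For each $d\ge1$ there are a linearly independent family $K_d=\{\xi^d_1,\dots,\xi^d_d\}\subset H$ and a closed complement $S_{K_d}$ of $\operatorname{span}K_d$ in $E$ such that $\sup_d\sum_{i=1}^d\langle h,\xi^d_i\rangle^2=|h|^2$ for all $h\in H$, for each $d$ the family $\mu_N\circ J_{K_d}^{-1}$, $N\in\overline{\mathbb N}$, satisfies (H) and (C), and $$\Big\{u\in\bigcap_d\mathcal D(\mathcal E^{\infty,K_d}):\sup_d\mathcal E^{\infty,K_d}(u,u)<\infty\Big\}=\mathcal D(\mathcal E^\infty).$$ Then for every $N\in\overline{\mathbb N}$ the form $u\mapsto\int_E|\nabla u|^2d\mu_N$ on $\mathscr F C_b^\infty$ is well defined on $\mu_N$-classes and closable on $L^2(E,\mu_N)$, and the minimal gradient forms $(\mathcal E^N)_{N\in\mathbb N}$ converge to $\mathcal E^\infty$ in the sense of Mosco. -/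

import Mathlib

open MeasureTheory Filter Topology ProbabilityTheory
open scoped ENNReal BoundedContinuousFunction ContDiff

noncomputable section

namespace MoscoGradient

/-! ### Closure of a quadratic form

A symmetric non-negative form is encoded by its diagonal `u ↦ 𝓔(u, u)` with values in `[0, ∞]`,
the value `∞` being taken exactly outside the domain.  A form which is given on functions
(representatives) consists of a linear space `V` of functions and of the energy `q` on `V`. -/

section Closure

variable {Ω : Type*} [MeasurableSpace Ω]

/-- The sequence `v` in `V` is Cauchy with respect to the energy `q`. -/
def EnergyCauchy (V : Set (Ω → ℝ)) (q : (Ω → ℝ) → ℝ≥0∞) (v : ℕ → Ω → ℝ) : Prop :=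
  (∀ n, v n ∈ V) ∧ Tendsto (fun p : ℕ × ℕ => q (v p.1 - v p.2)) atTop (𝓝 0)

/-- The form `(q, V)` is closable on `L²(μ)`.  Constant sequences show that this contains the
well-definedness of the form on `μ`-classes: an element of `V` which vanishes `μ`-a.e. has zero
energy. -/
def FormClosable (μ : Measure Ω) (V : Set (Ω → ℝ)) (q : (Ω → ℝ) → ℝ≥0∞) : Prop :=
  ∀ v : ℕ → Ω → ℝ, EnergyCauchy V q v →
    Tendsto (fun n => eLpNorm (v n) 2 μ) atTop (𝓝 0) →
      Tendsto (fun n => q (v n)) atTop (𝓝 0)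

/-- The closure on `L²(μ)` of the form `(q, V)`: the limit of the energies of any energy-Cauchy
sequence in `V` which converges to `u` in `L²(μ)`, and `∞` if there is no such sequence.  (If the
form is closable then the set below has at most one element.) -/
def formClosure (μ : Measure Ω) (V : Set (Ω → ℝ)) (q : (Ω → ℝ) → ℝ≥0∞) (u : Ω → ℝ) : ℝ≥0∞ :=
  sInf {c : ℝ≥0∞ | ∃ v : ℕ → Ω → ℝ, EnergyCauchy V q v ∧
    Tendsto (fun n => eLpNorm (v n - u) 2 μ) atTop (𝓝 0) ∧
    Tendsto (fun n => q (v n)) atTop (𝓝 c)}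

end Closure

/-! ### Convergence of sections and of forms on varying `L²` spaces -/

section Mosco

variable {E : Type*} [TopologicalSpace E] [PolishSpace E] [MeasurableSpace E] [BorelSpace E]

/-- Strong convergence of a section of the spaces `L²(μ N)` with asymptotic space `L²(μ')`. -/
def StrongConv (μ : ℕ → ProbabilityMeasure E) (μ' : ProbabilityMeasure E)
    (u : ∀ N, Lp ℝ 2 (μ N : Measure E)) (u' : Lp ℝ 2 (μ' : Measure E)) : Prop :=
  (∀ φ : E →ᵇ ℝ,
    Tendsto (fun N => inner ℝ (u N) (BoundedContinuousFunction.toLp 2 (μ N : Measure E) ℝ φ))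
      atTop (𝓝 (inner ℝ u' (BoundedContinuousFunction.toLp 2 (μ' : Measure E) ℝ φ)))) ∧
  Tendsto (fun N => ‖u N‖) atTop (𝓝 ‖u'‖)

/-- Weak convergence of a section. -/
def WeakConv (μ : ℕ → ProbabilityMeasure E) (μ' : ProbabilityMeasure E)
    (u : ∀ N, Lp ℝ 2 (μ N : Measure E)) (u' : Lp ℝ 2 (μ' : Measure E)) : Prop :=
  ∀ (v : ∀ N, Lp ℝ 2 (μ N : Measure E)) (v' : Lp ℝ 2 (μ' : Measure E)),
    StrongConv μ μ' v v' → Tendsto (fun N => inner ℝ (u N) (v N)) atTop (𝓝 (inner ℝ u' v'))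

/-- Mosco convergence of forms on `L²(μ N)` to a form on `L²(μ')`. -/
def MoscoConv (μ : ℕ → ProbabilityMeasure E) (μ' : ProbabilityMeasure E)
    (𝓔 : ∀ N, Lp ℝ 2 (μ N : Measure E) → ℝ≥0∞) (𝓔' : Lp ℝ 2 (μ' : Measure E) → ℝ≥0∞) : Prop :=
  (∀ u u', WeakConv μ μ' u u' → 𝓔' u' ≤ liminf (fun N => 𝓔 N (u N)) atTop) ∧
  (∀ u', 𝓔' u' < ⊤ → ∃ u : ∀ N, Lp ℝ 2 (μ N : Measure E), (∀ N, 𝓔 N (u N) < ⊤) ∧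
    StrongConv μ μ' u u' ∧ Tendsto (fun N => 𝓔 N (u N)) atTop (𝓝 (𝓔' u')))

end Mosco

/-! ### Weak partial derivatives on `ℝ^d` -/

section Weak

variable {d : ℕ}

/-- `g` is a weak partial derivative of `f` in the `i`-th coordinate. -/
def IsWeakPartial (i : Fin d) (f g : (Fin d → ℝ) → ℝ) : Prop :=
  LocallyIntegrable g volume ∧
  ∀ φ : (Fin d → ℝ) → ℝ, ContDiff ℝ ∞ φ → HasCompactSupport φ →
    (∫ x, f x * fderiv ℝ φ x (Pi.single i 1)) = - ∫ x, g x * φ x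

open Classical in
/-- A version of the `i`-th weak partial derivative of `f` (zero if there is none). -/
def weakPartial (i : Fin d) (f : (Fin d → ℝ) → ℝ) : (Fin d → ℝ) → ℝ :=
  if h : ∃ g, IsWeakPartial i f g then h.choose else 0

/-- Bounded continuous functions whose weak partial derivatives exist and belong to `L^∞(dx)`. -/
def IsSliceRegular (f : (Fin d → ℝ) → ℝ) : Prop :=
  Continuous f ∧ (∃ C, ∀ x, |f x| ≤ C) ∧
    ∀ i, ∃ g, IsWeakPartial i f g ∧ MemLp g ⊤ volume

/-- The energy `∫ ∑ᵢ |∂ᵢ f|² ρ dx`. -/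
def sliceEnergy (ρ : (Fin d → ℝ) → ℝ≥0∞) (f : (Fin d → ℝ) → ℝ) : ℝ≥0∞ :=
  ∫⁻ x, (∑ i, ENNReal.ofReal ((weakPartial i f x) ^ 2)) * ρ x

end Weak

/-! ### Primal functions, residuals and perturbations -/

section Primal

variable {d : ℕ}

/-- Primal functions on `ℝ^d`. -/
structure IsPrimal (φ : (Fin d → ℝ) → ℝ) : Prop where
  measurable : Measurable φ
  mem_Icc : ∀ x, φ x ∈ Set.Icc (0 : ℝ) 1
  eq_zero : ∀ x, x ∉ Set.Icc (fun _ => (-2 : ℝ)) (fun _ => 2) → φ x = 0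
  integral_eq_one : ∫ x, φ x = 1
  partition : ∀ x, HasSum (fun α : Fin d → ℤ => φ (x - fun k => (α k : ℝ))) 1

/-- The rescaled function `φ_r^α(x) = φ((x - α) / r)` with node `α = r z`, `z ∈ ℤ^d`. -/
def rescale (φ : (Fin d → ℝ) → ℝ) (r : ℝ) (z : Fin d → ℤ) (x : Fin d → ℝ) : ℝ :=
  φ (r⁻¹ • (x - fun k => r * (z k : ℝ)))

/-- The residual `R_r^{φ,η}(g)`. -/
def residual (φ η : (Fin d → ℝ) → ℝ) (r : ℝ) (g : (Fin d → ℝ) → ℝ) (y : Fin d → ℝ) : ℝ :=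
  ∑' z : Fin d → ℤ, (r ^ d)⁻¹ * (∫ x, |g y - g x| * rescale η r z x) * rescale φ r z y

/-- The perturbation `I_r^{φ,η}(g)`. -/
def perturbation (φ η : (Fin d → ℝ) → ℝ) (r : ℝ) (g : (Fin d → ℝ) → ℝ) (y : Fin d → ℝ) : ℝ :=
  ∑' z : Fin d → ℤ, (r ^ d)⁻¹ * (∫ x, rescale η r z x * g x) * rescale φ r z y

/-- The density with respect to Lebesgue measure of (the absolutely continuous part of) `m`. -/
def leb (m : Measure (Fin d → ℝ)) (x : Fin d → ℝ) : ℝ≥0∞ := m.rnDeriv volume x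

/-- `δ_r^κ(m)`, the supremum over all primal `φ, η` and all bounded measurable `f`.  The division
in `[0, ∞]` obeys `a / 0 = ∞` for `a ≠ 0` and `0 / 0 = 0`. -/
def deltaConst (κ : (Fin d → ℝ) → ℝ) (r : ℝ) (m : Measure (Fin d → ℝ)) : ℝ≥0∞ :=
  ⨆ (φ : (Fin d → ℝ) → ℝ) (_ : IsPrimal φ) (η : (Fin d → ℝ) → ℝ) (_ : IsPrimal η)
    (f : (Fin d → ℝ) → ℝ) (_ : Measurable f) (_ : ∃ C, ∀ x, |f x| ≤ C),
    ENNReal.ofReal |∫ x, f x * residual φ η r (fun y => κ y * (leb m y).toReal) x| / eLpNorm f 2 m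

/-- `C_r^κ(m)`, with the same conventions. -/
def pertConst (κ : (Fin d → ℝ) → ℝ) (r : ℝ) (m : Measure (Fin d → ℝ)) : ℝ≥0∞ :=
  ⨆ (φ : (Fin d → ℝ) → ℝ) (_ : IsPrimal φ) (η : (Fin d → ℝ) → ℝ) (_ : IsPrimal η)
    (f : (Fin d → ℝ) → ℝ) (_ : Measurable f) (_ : ∃ C, ∀ x, |f x| ≤ C),
    ENNReal.ofReal |∫ x, f x * perturbation φ η r (fun y => κ y * (leb m y).toReal) x| /
      eLpNorm f 1 m

end Primal

/-! ### Superposed gradient forms on `S × ℝ^d`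

The measure `μ` on `S × ℝ^d` is disintegrated along the first coordinate: `μ.fst` is the mixing
measure `ν` and `μ.condKernel s` is the conditional distribution `m_s`. -/

section Superposition

variable {S : Type*} [TopologicalSpace S] [MeasurableSpace S] {d : ℕ}

/-- `∫_S E^{κ(s,·) ρ(s,·)}(u(s,·), u(s,·)) dν(s)`. -/
def superEnergy (μ : Measure (S × (Fin d → ℝ))) [IsFiniteMeasure μ]
    (κ : S × (Fin d → ℝ) → ℝ) (u : S × (Fin d → ℝ) → ℝ) : ℝ≥0∞ :=
  ∫⁻ s, sliceEnergy (fun x => ENNReal.ofReal (κ (s, x)) * leb (μ.condKernel s) x)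
    (fun x => u (s, x)) ∂μ.fst

/-- The domain of the direct integral of the forms `E^{ρ(s,·)}`. -/
def superPre (μ : Measure (S × (Fin d → ℝ))) [IsFiniteMeasure μ] : Set (S × (Fin d → ℝ) → ℝ) :=
  {u | Measurable u ∧ (∃ C, ∀ p, |u p| ≤ C) ∧ (∀ s, IsSliceRegular fun x => u (s, x)) ∧
    AEMeasurable (fun s => sliceEnergy (leb (μ.condKernel s)) fun x => u (s, x)) μ.fst ∧
    (∫⁻ s, sliceEnergy (leb (μ.condKernel s)) (fun x => u (s, x)) ∂μ.fst) < ⊤}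

/-- The superposed gradient form `𝓔` on `L²(μ)`: the closure of the direct integral. -/
def superForm (μ : Measure (S × (Fin d → ℝ))) [IsFiniteMeasure μ]
    (u : S × (Fin d → ℝ) → ℝ) : ℝ≥0∞ :=
  formClosure μ (superPre μ) (superEnergy μ fun _ => 1) u

/-- The linear span of the products `f(s) g(x)` with `f ∈ C_b(S)` and `g ∈ C_c¹(ℝ^d)`. -/
def productSpan (S : Type*) [TopologicalSpace S] (d : ℕ) : Set (S × (Fin d → ℝ) → ℝ) :=
  (Submodule.span ℝ {u : S × (Fin d → ℝ) → ℝ | ∃ (f : S →ᵇ ℝ) (g : (Fin d → ℝ) → ℝ),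
    ContDiff ℝ 1 g ∧ HasCompactSupport g ∧ u = fun p => f p.1 * g p.2} :
      Submodule ℝ (S × (Fin d → ℝ) → ℝ))

/-- The form `(𝓔^κ, D_min(𝓔^κ))` on `L²(κ μ)`. -/
def minForm (μ : Measure (S × (Fin d → ℝ))) [IsFiniteMeasure μ]
    (κ : S × (Fin d → ℝ) → ℝ) (u : S × (Fin d → ℝ) → ℝ) : ℝ≥0∞ :=
  formClosure (μ.withDensity fun p => ENNReal.ofReal (κ p)) (productSpan S d) (superEnergy μ κ) u

/-- Hamza's condition for the conditional distributions of `μ`. -/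
def Hamza (μ : Measure (S × (Fin d → ℝ))) [IsFiniteMeasure μ] : Prop :=
  (∀ᵐ s ∂μ.fst, μ.condKernel s ≪ volume) ∧
  ∫⁻ s, μ.condKernel s {x | ∃ ε : ℝ, 0 < ε ∧
    (∫⁻ y in Set.Icc (x - fun _ => ε) (x + fun _ => ε), (leb (μ.condKernel s) y)⁻¹) < ⊤} ∂μ.fst = 1

/-- The first part of the convergence condition on the conditional distributions. -/
def DisintegrationConv (μ : ℕ → Measure (S × (Fin d → ℝ))) [∀ N, IsFiniteMeasure (μ N)]
    (μ' : Measure (S × (Fin d → ℝ))) [IsFiniteMeasure μ'] : Prop :=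
  ∀ g : (S × (Fin d → ℝ)) →ᵇ ℝ,
    Tendsto (fun N => ∫ s, (∫ x, g (s, x) ∂(μ N).condKernel s) ^ 2 ∂(μ N).fst) atTop
      (𝓝 (∫ s, (∫ x, g (s, x) ∂μ'.condKernel s) ^ 2 ∂μ'.fst))

/-- The second part of the convergence condition, for a set `U` of weight functions. -/
structure IsWeightFamily (μ : ℕ → Measure (S × (Fin d → ℝ))) [∀ N, IsFiniteMeasure (μ N)]
    (μ' : Measure (S × (Fin d → ℝ))) [IsFiniteMeasure μ']
    (U : Set (S × (Fin d → ℝ) → ℝ)) : Prop where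
  countable : U.Countable
  continuous : ∀ κ ∈ U, Continuous κ
  mem_Icc : ∀ κ ∈ U, ∀ p, κ p ∈ Set.Icc (0 : ℝ) 1
  tendsto_delta : ∀ κ ∈ U, Tendsto (fun m : ℕ => ⨆ N,
    (∫⁻ s, deltaConst (fun x => κ (s, x)) (1 / (m : ℝ)) ((μ N).condKernel s) ^ 2 ∂(μ N).fst)
      ^ (1 / 2 : ℝ)) atTop (𝓝 0)
  limsup_pert : ∀ κ ∈ U, limsup (fun m : ℕ => ⨆ N,
    essSup (fun s => pertConst (fun x => κ (s, x)) (1 / (m : ℝ)) ((μ N).condKernel s)) (μ N).fst)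
      atTop < ⊤
  isLUB_one : ∀ᵐ p ∂μ', IsLUB ((fun κ : S × (Fin d → ℝ) → ℝ => κ p) '' U) 1
  domain_eq : {u : Lp ℝ 2 μ' | minForm μ' (fun _ => 1) u < ⊤} =
    {u : Lp ℝ 2 μ' | (∀ κ ∈ U, minForm μ' κ u < ⊤) ∧ (⨆ κ ∈ U, minForm μ' κ u) < ⊤}

/-- The two conditions on a sequence of measures on `S × ℝ^d` and its limit: Hamza's condition
for every measure including the limit, and the convergence condition. -/
structure ComponentConditions (μ : ℕ → Measure (S × (Fin d → ℝ))) [∀ N, IsFiniteMeasure (μ N)]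
    (μ' : Measure (S × (Fin d → ℝ))) [IsFiniteMeasure μ'] : Prop where
  hamza : ∀ N, Hamza (μ N)
  hamza_limit : Hamza μ'
  disintegration : DisintegrationConv μ μ'
  weights : ∃ U, IsWeightFamily μ μ' U

end Superposition

/-! ### Minimal gradient forms and component forms on a Fréchet space -/

section Frechet

variable {E : Type*} [AddCommGroup E] [Module ℝ E] [TopologicalSpace E]
  {H : Type*} [NormedAddCommGroup H] [InnerProductSpace ℝ H]

/-- Cylindrical smooth functions `f ∘ (l₁, …, l_m)`, where `f` and all its derivatives are
bounded. -/
def Cylindrical (E : Type*) [AddCommGroup E] [Module ℝ E] [TopologicalSpace E] : Set (E → ℝ) :=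
  {F | ∃ (m : ℕ) (f : (Fin m → ℝ) → ℝ) (l : Fin m → E →L[ℝ] ℝ), ContDiff ℝ ∞ f ∧
    (∀ k : ℕ, ∃ C : ℝ, ∀ x, ‖iteratedFDeriv ℝ k f x‖ ≤ C) ∧ F = fun z => f fun i => l i z}

/-- The gradient of `F` at `z` along the embedded Hilbert space: the element of `H` which
represents the derivative at `0` of `h ↦ F (z + h)`. -/
def hGradient [CompleteSpace H] (j : H →L[ℝ] E) (F : E → ℝ) (z : E) : H :=
  gradient (fun h : H => F (z + j h)) 0

/-- For cylindrical functions the gradient represents the Gâteaux derivatives. -/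
lemma hasDerivAt_hGradient [CompleteSpace H] (j : H →L[ℝ] E) {F : E → ℝ}
    (hF : F ∈ Cylindrical E) (z : E) (h : H) :
    HasDerivAt (fun t : ℝ => F (z + t • j h)) (inner ℝ (hGradient j F z) h) 0 := by
  obtain ⟨m, f, l, hf, -, rfl⟩ := hF
  have hd : DifferentiableAt ℝ (fun h : H => f fun i => l i (z + j h)) 0 := by
    have hL : DifferentiableAt ℝ (fun h : H => fun i => l i (z + j h)) 0 := by
      rw [differentiableAt_pi]
      intro i
      simp only [map_add]
      exact ((l i ∘L j).differentiableAt).const_add _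
    exact DifferentiableAt.comp (0 : H) (hf.differentiable (by simp) _) hL
  have h1 := hd.hasGradientAt.hasFDerivAt
  have h2 : HasDerivAt (fun t : ℝ => t • h) h 0 := by
    simpa using (hasDerivAt_id (0 : ℝ)).smul_const h
  have h3 := HasFDerivAt.comp_hasDerivAt_of_eq (0 : ℝ) h1 h2 (by simp)
  simpa [hGradient, Function.comp_def] using h3

/-- The pre-form `∫ |∇F|² dμ` of the minimal gradient form. -/
def gradEnergy [MeasurableSpace E] [CompleteSpace H] (j : H →L[ℝ] E) (μ : Measure E) (F : E → ℝ) : ℝ≥0∞ :=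
  ∫⁻ z, ENNReal.ofReal (‖hGradient j F z‖ ^ 2) ∂μ

/-- The minimal gradient form on `L²(μ)`. -/
def minGradForm [MeasurableSpace E] [CompleteSpace H] (j : H →L[ℝ] E) (μ : Measure E) (u : Lp ℝ 2 μ) : ℝ≥0∞ :=
  formClosure μ (Cylindrical E) (gradEnergy j μ) u

/-- A topological splitting of `E` into the span of vectors `ξ 0, …, ξ (d - 1)` of `H` and the
closed complement `ker π`.  The condition `π_ξ` forces the `ξ i` to be linearly independent, and
every closed complement of their span is the kernel of a unique such `π`. -/
structure Splitting (j : H →L[ℝ] E) (d : ℕ) where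
  ξ : Fin d → H
  π : E →L[ℝ] (Fin d → ℝ)
  π_ξ : ∀ i, π (j (ξ i)) = Pi.single i 1

namespace Splitting

variable {j : H →L[ℝ] E} {d : ℕ} (P : Splitting j d)

/-- The closed complement. -/
abbrev S : Type _ := {s : E // P.π s = 0}

lemma π_sub (z : E) : P.π (z - ∑ i, P.π z i • j (P.ξ i)) = 0 := by
  ext k
  simp [map_sub, map_sum, P.π_ξ, Finset.sum_apply, Pi.single_apply]

/-- The isomorphism `E → S × ℝ^d`. -/
def J (z : E) : P.S × (Fin d → ℝ) :=
  (⟨z - ∑ i, P.π z i • j (P.ξ i), P.π_sub z⟩, P.π z)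

/-- The inverse `(s, x) ↦ s + ∑ᵢ xᵢ ξᵢ` of `J`. -/
def Jinv (p : P.S × (Fin d → ℝ)) : E := p.1 + ∑ i, p.2 i • j (P.ξ i)

lemma Jinv_J (z : E) : P.Jinv (P.J z) = z := by
  simp [J, Jinv]

lemma J_Jinv (p : P.S × (Fin d → ℝ)) : P.J (P.Jinv p) = p := by
  have h : P.π (P.Jinv p) = p.2 := by
    ext k
    simp [Jinv, map_sum, P.π_ξ, p.1.2, Finset.sum_apply, Pi.single_apply]
  refine Prod.ext (Subtype.ext ?_) h
  change P.Jinv p - ∑ i, P.π (P.Jinv p) i • j (P.ξ i) = p.1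
  rw [h]
  simp [Jinv]

variable [MeasurableSpace E]

/-- The image measure `μ ∘ J⁻¹` on `S × ℝ^d`. -/
def image (μ : Measure E) : Measure (P.S × (Fin d → ℝ)) := μ.map P.J

instance (μ : Measure E) [IsFiniteMeasure μ] : IsFiniteMeasure (P.image μ) := by
  unfold image; infer_instance

/-- The component form on `L²(μ)`: the image under the inverse of `J` of the superposed gradient
form for `μ ∘ J⁻¹`. -/
def componentForm (μ : Measure E) [IsFiniteMeasure μ] (u : Lp ℝ 2 μ) : ℝ≥0∞ :=
  superForm (P.image μ) fun p => u (P.Jinv p)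

end Splitting

/-- First case: the splittings `E = S_{η_i} ⊕ span {η_i}` for an orthonormal basis `η` of `H`. -/
def BasisCondition [MeasurableSpace E] [CompleteSpace H] (j : H →L[ℝ] E)
    (μ : ℕ → ProbabilityMeasure E) (μ' : ProbabilityMeasure E) : Prop :=
  ∃ (η : HilbertBasis ℕ ℝ H) (P : ℕ → Splitting j 1), (∀ i, (P i).ξ 0 = η i) ∧
    (∀ i, ComponentConditions (fun N => (P i).image (μ N : Measure E))
      ((P i).image (μ' : Measure E))) ∧
    {u : Lp ℝ 2 (μ' : Measure E) | (∀ i, (P i).componentForm (μ' : Measure E) u < ⊤) ∧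
        (∑' i, (P i).componentForm (μ' : Measure E) u) < ⊤} =
      {u : Lp ℝ 2 (μ' : Measure E) | minGradForm j (μ' : Measure E) u < ⊤}

/-- Second case: the splittings `E = S_{K_d} ⊕ span K_d`.  The index `d` is shifted by one: the
`d`-th family consists of `d + 1` vectors. -/
def FamilyCondition [MeasurableSpace E] [CompleteSpace H] (j : H →L[ℝ] E)
    (μ : ℕ → ProbabilityMeasure E) (μ' : ProbabilityMeasure E) : Prop :=
  ∃ P : ∀ d : ℕ, Splitting j (d + 1),
    (∀ h : H, IsLUB (Set.range fun d : ℕ => ∑ i, (inner ℝ h ((P d).ξ i)) ^ 2) (‖h‖ ^ 2)) ∧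
    (∀ d, ComponentConditions (fun N => (P d).image (μ N : Measure E))
      ((P d).image (μ' : Measure E))) ∧
    {u : Lp ℝ 2 (μ' : Measure E) | (∀ d, (P d).componentForm (μ' : Measure E) u < ⊤) ∧
        (⨆ d, (P d).componentForm (μ' : Measure E) u) < ⊤} =
      {u : Lp ℝ 2 (μ' : Measure E) | minGradForm j (μ' : Measure E) u < ⊤}

end Frechet

end MoscoGradient

end

/-! The gradient form is studied through its components. In the coordinates of a splitting, a
cylindrical function is `C¹` in `x` and its partial derivatives are the inner products of its
gradient with the vectors `ξ k` (`Splitting.xderiv_comp_Jinv`). Hamza's condition makes these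
derivatives closable: near a point where `ρ⁻¹` is integrable, `L²(ρ)`-convergence implies
`L¹`-convergence, and the limit can be tested by partial integration (`xderiv_closable`). The
vectors of all splittings together separate the points of `H`, so the gradient is closable
(`formClosable_gradEnergy`), and the minimal form is the squared norm of a well defined gradient
(`formClosure_gradEnergy_eq`).

Beyond closability, recovery sequences only need the weak convergence of the measures. A cylindrical
function and its gradient are bounded and continuous, so their norms converge along `μ N`, and a
diagonal sequence suffices (`exists_recovery_sequence`).

The lower bound is the substance. Take cylindrical functions close to `u N` with energies at most
`c`; along an ultrafilter their gradients have a weak limit `G`, and it must be shown that `G` is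
the gradient of `u'`. In each component this says that the weak limit of the tuples (function,
partial derivatives) lies in the `L²`-closure of the graph of the gradient on product functions, or
equivalently that it is orthogonal to every `y` orthogonal to that graph
(`sum_integral_eq_zero_of_orthogonal`).

The difficulty is that the orthogonality of `y` is known only for the limit measure. Therefore `u N`
is replaced by a fibrewise finite element interpolation, with splines chosen such that interpolation
commutes with partial derivatives up to a change of primal functions (`sum_coeff_odrv`). The
interpolation is a finite sum of coefficients in `s` times fixed splines in `x`, so its pairing with
a continuous `Y` close to `y` involves only conditional expectations of fixed continuous functions.
In the limit these are small because `y` is orthogonal to products (`integral_sq_div_le`), and the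
convergence of squared conditional expectations transfers this to large `N`
(`eventually_abs_pairing_le`). The constants `pertConst` make the interpolation stable in weighted
`L²`, and the constants `deltaConst` make it symmetric up to a small error (`interp_duality`). It
can thus be moved onto `Y`, where weak convergence applies and where it tends to the identity as the
mesh shrinks.

The weights `κ` are then removed: the domain identity of condition (C) gives one approximating
sequence for the weight `1`, and closability identifies its derivatives on the sets `{κ > 0}`, which
cover almost every point (`MoscoGradient.exists_productSpan_seq`). Hence the component forms of `u'`
are bounded by integrals of squared inner products of `G`, the domain hypothesis places `u'` in the
domain of the limit form, closability identifies its gradient with `G`, and the norm bound on `G`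
finishes the argument (`minGradForm_le_liminf`). -/

noncomputable section

namespace MoscoGradient
/-! ### Fibrewise differentiable functions and closability -/

section FiberCalculus

/-- Weighted Cauchy–Schwarz inequality `∫ f ≤ (∫ f² W)^{1/2} (∫ W⁻¹)^{1/2}`. -/
lemma lintegral_le_sqrt_weight {α : Type*} [MeasurableSpace α] (μ : Measure α)
    {f W : α → ℝ≥0∞} (hf : AEMeasurable f μ) (hW : AEMeasurable W μ)
    (h0 : ∀ᵐ x ∂μ, W x ≠ 0) (hT : ∀ᵐ x ∂μ, W x ≠ ⊤) :
    ∫⁻ x, f x ∂μ ≤ (∫⁻ x, f x ^ 2 * W x ∂μ) ^ (1 / 2 : ℝ) * (∫⁻ x, (W x)⁻¹ ∂μ) ^ (1 / 2 : ℝ) := by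
  have hpq : (2 : ℝ).HolderConjugate 2 := by
    rw [Real.holderConjugate_iff]; norm_num
  have h := ENNReal.lintegral_mul_le_Lp_mul_Lq μ hpq
    (f := fun x => f x * (W x) ^ (1 / 2 : ℝ)) (g := fun x => ((W x)⁻¹) ^ (1 / 2 : ℝ))
    (hf.mul (hW.pow_const _)) (hW.inv.pow_const _)
  have e1 : ∫⁻ x, f x ∂μ =
      ∫⁻ x, ((fun x => f x * (W x) ^ (1 / 2 : ℝ)) * fun x => ((W x)⁻¹) ^ (1 / 2 : ℝ)) x ∂μ := by
    refine lintegral_congr_ae ?_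
    filter_upwards [h0, hT] with x hx0 hxT
    simp only [Pi.mul_apply]
    rw [mul_assoc, ← ENNReal.mul_rpow_of_nonneg _ _ (by norm_num), ENNReal.mul_inv_cancel hx0 hxT]
    simp
  have e2 : ∀ x, (f x * (W x) ^ (1 / 2 : ℝ)) ^ (2 : ℝ) = f x ^ 2 * W x := by
    intro x
    rw [ENNReal.mul_rpow_of_nonneg _ _ (by norm_num), ← ENNReal.rpow_mul]
    norm_num
  have e3 : ∀ x, (((W x)⁻¹) ^ (1 / 2 : ℝ)) ^ (2 : ℝ) = (W x)⁻¹ := by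
    intro x
    rw [← ENNReal.rpow_mul]
    norm_num
  rw [e1]
  simpa only [e2, e3] using h

variable {d : ℕ}

/-- If `wₙ → 0` and `∂ᵢ wₙ → k` in `L²(κ ρ dx)`, then `k` vanishes near every point of the
regular set of `κ ρ`. -/
lemma ae_eq_zero_near_of_weighted_limit {ρ : (Fin d → ℝ) → ℝ≥0∞} (hρ : Measurable ρ)
    (hρT : ∀ᵐ x, ρ x ≠ ⊤) {κ : (Fin d → ℝ) → ℝ} (hκ : Continuous κ) (i : Fin d)
    {w : ℕ → (Fin d → ℝ) → ℝ} (hw : ∀ n, ContDiff ℝ 1 (w n)) {k : (Fin d → ℝ) → ℝ}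
    (hk : Measurable k)
    (h0 : Tendsto (fun n => ∫⁻ x, ENNReal.ofReal (w n x ^ 2) * (ENNReal.ofReal (κ x) * ρ x))
      atTop (𝓝 0))
    (h1 : Tendsto (fun n => ∫⁻ x, ENNReal.ofReal ((fderiv ℝ (w n) x (Pi.single i 1) - k x) ^ 2) *
      (ENNReal.ofReal (κ x) * ρ x)) atTop (𝓝 0))
    (x₀ : Fin d → ℝ) (hx₀ : ∃ ε : ℝ, 0 < ε ∧
      (∫⁻ y in Set.Icc (x₀ - fun _ => ε) (x₀ + fun _ => ε), (ρ y)⁻¹) < ⊤) (hκ₀ : 0 < κ x₀) :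
    ∃ V : Set (Fin d → ℝ), IsOpen V ∧ x₀ ∈ V ∧ ∀ᵐ x, x ∈ V → k x = 0 := by
  obtain ⟨ε, hε, hfin⟩ := hx₀
  obtain ⟨δ, hδ, hδκ⟩ : ∃ δ > 0, ∀ x ∈ Metric.ball x₀ δ, κ x₀ / 2 < κ x := by
    have := hκ.continuousAt.eventually (lt_mem_nhds (show κ x₀ / 2 < κ x₀ by linarith))
    exact Metric.eventually_nhds_iff_ball.1 this
  -- Halving `δ` leaves room for a closed ball inside `ball x₀ δ`. In the sup norm this closed ball
  -- is a cube, so it sits inside the cube on which `ρ⁻¹` is integrable.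
  set ε' := min ε (δ / 2) with hε'
  have hε'0 : 0 < ε' := lt_min hε (by linarith)
  set Q := Metric.closedBall x₀ ε' with hQ
  have hQκ : ∀ x ∈ Q, κ x₀ / 2 < κ x := fun x hx => hδκ x (by
    rw [Metric.mem_ball]
    have : dist x x₀ ≤ ε' := hx
    have : ε' ≤ δ / 2 := min_le_right _ _
    linarith)
  have hQsub : Q ⊆ Set.Icc (x₀ - fun _ => ε) (x₀ + fun _ => ε) := by
    intro x hx
    have hx' : dist x x₀ ≤ ε := le_trans hx (min_le_left _ _)
    rw [dist_pi_le_iff hε.le] at hx'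
    constructor <;> intro j <;> have := abs_le.1 (Real.dist_eq (x j) (x₀ j) ▸ hx' j) <;>
      simp only [Pi.sub_apply, Pi.add_apply] <;> linarith
  have hQm : MeasurableSet Q := Metric.isClosed_closedBall.measurableSet
  set μ := (volume : Measure (Fin d → ℝ)).restrict Q with hμ
  have hfinQ : ∫⁻ y, (ρ y)⁻¹ ∂μ < ⊤ := lt_of_le_of_lt (lintegral_mono_set hQsub) hfin
  have hρ0 : ∀ᵐ x ∂μ, ρ x ≠ 0 := by
    filter_upwards [ae_lt_top hρ.inv hfinQ.ne] with x hx h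
    simp [h] at hx
  set W : (Fin d → ℝ) → ℝ≥0∞ := fun x => ENNReal.ofReal (κ x) * ρ x with hW
  have hWm : Measurable W := (ENNReal.measurable_ofReal.comp hκ.measurable).mul hρ
  have hQae : ∀ᵐ x ∂μ, x ∈ Q := ae_restrict_mem hQm
  have hW0 : ∀ᵐ x ∂μ, W x ≠ 0 := by
    filter_upwards [hρ0, hQae] with x hx hxQ
    have := hQκ x hxQ
    refine mul_ne_zero ?_ hx
    simp only [ne_eq, ENNReal.ofReal_eq_zero, not_le]; linarith
  have hWT : ∀ᵐ x ∂μ, W x ≠ ⊤ := by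
    filter_upwards [ae_restrict_of_ae hρT] with x hx
    exact ENNReal.mul_ne_top ENNReal.ofReal_ne_top hx
  have hWinv : ∫⁻ x, (W x)⁻¹ ∂μ < ⊤ := by
    have : ∫⁻ x, (W x)⁻¹ ∂μ ≤ ∫⁻ x, (ENNReal.ofReal (κ x₀ / 2))⁻¹ * (ρ x)⁻¹ ∂μ := by
      refine lintegral_mono_ae ?_
      filter_upwards [hQae] with x hxQ
      have h := hQκ x hxQ
      rw [← ENNReal.mul_inv (Or.inl (by simpa using by linarith)) (Or.inl ENNReal.ofReal_ne_top)]
      exact ENNReal.inv_le_inv.2 (mul_le_mul_left (ENNReal.ofReal_le_ofReal h.le) _)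
    refine lt_of_le_of_lt this ?_
    rw [lintegral_const_mul _ (f := fun x => (ρ x)⁻¹) hρ.inv]
    refine ENNReal.mul_lt_top ?_ hfinQ
    simp; linarith
  -- `L¹(Q)`-convergence
  have key : ∀ f : ℕ → (Fin d → ℝ) → ℝ, (∀ n, Measurable (f n)) →
      Tendsto (fun n => ∫⁻ x, ENNReal.ofReal (f n x ^ 2) * W x) atTop (𝓝 0) →
      Tendsto (fun n => ∫⁻ x, ‖f n x‖ₑ ∂μ) atTop (𝓝 0) := by
    intro f hf hlim
    have hub : Tendsto (fun n => (∫⁻ x, ENNReal.ofReal (f n x ^ 2) * W x) ^ (1 / 2 : ℝ) *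
        (∫⁻ x, (W x)⁻¹ ∂μ) ^ (1 / 2 : ℝ)) atTop (𝓝 0) := by
      have h2 := (ENNReal.continuous_rpow_const (y := (1 / 2 : ℝ))).tendsto 0 |>.comp hlim
      have h3 := ENNReal.Tendsto.mul_const (b := (∫⁻ x, (W x)⁻¹ ∂μ) ^ (1 / 2 : ℝ)) h2
        (Or.inr (ENNReal.rpow_lt_top_of_nonneg (by norm_num) hWinv.ne).ne)
      simpa using h3
    refine tendsto_of_tendsto_of_tendsto_of_le_of_le tendsto_const_nhds hub (fun _ => zero_le) ?_
    intro n
    refine (lintegral_le_sqrt_weight μ (hf n).enorm.aemeasurable hWm.aemeasurable hW0 hWT).trans ?_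
    refine mul_le_mul' (ENNReal.rpow_le_rpow ?_ (by norm_num)) le_rfl
    refine (lintegral_mono fun x => ?_).trans (setLIntegral_le_lintegral Q _)
    have : ‖f n x‖ₑ ^ 2 = ENNReal.ofReal (f n x ^ 2) := by
      rw [← ofReal_norm, ← ENNReal.ofReal_pow (norm_nonneg _), Real.norm_eq_abs, sq_abs]
    rw [this]
  have hdc : ∀ n, Continuous fun x => fderiv ℝ (w n) x (Pi.single i 1) := fun n =>
    ((hw n).continuous_fderiv (by norm_num)).clm_apply continuous_const
  have hw0 := key w (fun n => (hw n).continuous.measurable) h0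
  have hw1 := key _ (fun n => (hdc n).measurable.sub hk) h1
  have hcomp : IsCompact Q := isCompact_closedBall x₀ ε'
  -- Integrability of `k` is not assumed. On `Q` it differs from a continuous derivative by a
  -- function which, for suitable `n`, has `L¹`-norm below one.
  have hkint : IntegrableOn k Q := by
    obtain ⟨n, hn⟩ := ((hw1.eventually (gt_mem_nhds (zero_lt_one (α := ℝ≥0∞))))).exists
    have hA : IntegrableOn (fun x => fderiv ℝ (w n) x (Pi.single i 1)) Q :=
      (hdc n).continuousOn.integrableOn_compact hcomp
    have hB : IntegrableOn (fun x => fderiv ℝ (w n) x (Pi.single i 1) - k x) Q :=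
      ⟨((hdc n).measurable.sub hk).aestronglyMeasurable, lt_trans hn ENNReal.one_lt_top⟩
    refine (hA.sub hB).congr_fun (fun x _ => ?_) hQm
    simp
  refine ⟨Metric.ball x₀ ε', Metric.isOpen_ball, Metric.mem_ball_self hε'0, ?_⟩
  refine Metric.isOpen_ball.ae_eq_zero_of_integral_contDiff_smul_eq_zero
    (hkint.mono_set Metric.ball_subset_closedBall).locallyIntegrableOn ?_
  intro g hg hgc hgs
  have hgQ : ∀ x, x ∉ Q → g x = 0 := fun x hx => by
    by_contra h
    exact hx (Metric.ball_subset_closedBall (hgs (subset_tsupport _ h)))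
  have hgQ' : ∀ x, x ∉ Q → fderiv ℝ g x = 0 := fun x hx => by
    by_contra h
    exact hx (Metric.ball_subset_closedBall (hgs (support_fderiv_subset ℝ h)))
  have hgd : Continuous fun x => fderiv ℝ g x (Pi.single i 1) :=
    (hg.continuous_fderiv (by simp)).clm_apply continuous_const
  obtain ⟨C, hC⟩ := hgc.exists_bound_of_continuous hg.continuous
  obtain ⟨C', hC'⟩ := (hgc.fderiv_apply (𝕜 := ℝ) (Pi.single i 1)).exists_bound_of_continuous hgd
  -- passage to the limit in `L¹(Q)` against bounded functions
  have lim : ∀ (f : ℕ → (Fin d → ℝ) → ℝ) (f' g : (Fin d → ℝ) → ℝ) (C : ℝ), Continuous g →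
      (∀ x, ‖g x‖ ≤ C) → (∀ n, IntegrableOn (f n) Q) → IntegrableOn f' Q →
      Tendsto (fun n => ∫⁻ x, ‖f n x - f' x‖ₑ ∂μ) atTop (𝓝 0) →
      Tendsto (fun n => ∫ x in Q, g x * f n x) atTop (𝓝 (∫ x in Q, g x * f' x)) := by
    intro f f' g C hgc hC hf hf' hlim
    have hi : ∀ f : (Fin d → ℝ) → ℝ, IntegrableOn f Q → IntegrableOn (fun x => g x * f x) Q :=
      fun f hf => hf.bdd_mul (c := C) hgc.aestronglyMeasurable (ae_of_all _ hC)
    refine tendsto_integral_of_L1 _ (hi _ hf').aestronglyMeasurable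
      (Eventually.of_forall fun n => hi _ (hf n)) ?_
    have hub : Tendsto (fun n => ENNReal.ofReal C * ∫⁻ x, ‖f n x - f' x‖ₑ ∂μ) atTop (𝓝 0) := by
      simpa using ENNReal.Tendsto.const_mul (a := ENNReal.ofReal C) hlim
        (Or.inr ENNReal.ofReal_ne_top)
    refine tendsto_of_tendsto_of_tendsto_of_le_of_le tendsto_const_nhds hub (fun _ => zero_le) ?_
    intro n
    simp only
    rw [← lintegral_const_mul' _ _ ENNReal.ofReal_ne_top]
    refine lintegral_mono fun x => ?_
    rw [← mul_sub, enorm_mul]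
    gcongr
    rw [← ofReal_norm]
    exact ENNReal.ofReal_le_ofReal (hC x)
  have l1 := lim _ k g C hg.continuous hC
    (fun n => (hdc n).continuousOn.integrableOn_compact hcomp) hkint hw1
  have l0 := lim w 0 _ C' hgd hC'
    (fun n => (hw n).continuous.continuousOn.integrableOn_compact hcomp) integrableOn_zero
    (by simpa using hw0)
  have full : ∀ f h : (Fin d → ℝ) → ℝ, (∀ x, x ∉ Q → h x = 0) →
      ∫ x in Q, h x * f x = ∫ x, h x * f x := fun f h hh =>
    setIntegral_eq_integral_of_forall_compl_eq_zero fun x hx => by rw [hh x hx, zero_mul]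
  -- Partial integration moves the derivative onto the test function, where only `w n → 0` in
  -- `L¹(Q)` is needed; this forces `∫ g k = 0`.
  have ibp : ∀ n, ∫ x in Q, g x * fderiv ℝ (w n) x (Pi.single i 1) =
      - ∫ x in Q, fderiv ℝ g x (Pi.single i 1) * w n x := by
    intro n
    rw [full _ _ hgQ, full _ (fun x => fderiv ℝ g x (Pi.single i 1))
      (fun x hx => by rw [hgQ' x hx]; rfl)]
    refine integral_mul_fderiv_eq_neg_fderiv_mul_of_integrable ?_ ?_ ?_ ?_ ?_
    · exact (hgd.mul (hw n).continuous).integrable_of_hasCompactSupport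
        ((hgc.fderiv_apply (𝕜 := ℝ) (Pi.single i 1)).mul_right)
    · exact (hg.continuous.mul (hdc n)).integrable_of_hasCompactSupport hgc.mul_right
    · exact (hg.continuous.mul (hw n).continuous).integrable_of_hasCompactSupport hgc.mul_right
    · exact fun x _ => hg.differentiable (by simp) x
    · exact fun x _ => (hw n).differentiable (by simp) x
  simp only [ibp, Pi.zero_apply, mul_zero, integral_zero] at l1 l0
  have := tendsto_nhds_unique l1 (by simpa using l0.neg)
  rw [full _ _ hgQ] at this
  simpa using this

/-- The set of points near which `ρ⁻¹` is integrable is open. -/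
lemma isOpen_regularSet (ρ : (Fin d → ℝ) → ℝ≥0∞) :
    IsOpen {x : Fin d → ℝ | ∃ ε : ℝ, 0 < ε ∧
      (∫⁻ y in Set.Icc (x - fun _ => ε) (x + fun _ => ε), (ρ y)⁻¹) < ⊤} := by
  rw [Metric.isOpen_iff]
  rintro x ⟨ε, hε, h⟩
  refine ⟨ε / 2, by linarith, fun y hy => ⟨ε / 2, by linarith, ?_⟩⟩
  refine lt_of_le_of_lt (lintegral_mono_set ?_) h
  have hy' : dist y x ≤ ε / 2 := (Metric.mem_ball.1 hy).le
  rw [dist_pi_le_iff (by linarith)] at hy'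
  refine Set.Icc_subset_Icc ?_ ?_ <;> intro j <;>
    have := abs_le.1 (Real.dist_eq (y j) (x j) ▸ hy' j) <;>
    simp only [Pi.sub_apply, Pi.add_apply] <;> linarith

variable {S : Type*} [MeasurableSpace S]

/-- The partial derivative in the `i`-th coordinate of the second variable. -/
def xderiv (i : Fin d) (v : S × (Fin d → ℝ) → ℝ) (p : S × (Fin d → ℝ)) : ℝ :=
  fderiv ℝ (fun x => v (p.1, x)) p.2 (Pi.single i 1)

/-- Bounded measurable functions on `S × ℝ^d` which are `C¹` with bounded derivatives in the
second variable. -/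
structure FiberC1 (v : S × (Fin d → ℝ) → ℝ) : Prop where
  measurable : Measurable v
  bdd : ∃ C, ∀ p, |v p| ≤ C
  contDiff : ∀ s, ContDiff ℝ 1 fun x => v (s, x)
  bdd_deriv : ∃ C, ∀ i p, |xderiv i v p| ≤ C

namespace FiberC1

variable {v w : S × (Fin d → ℝ) → ℝ}

lemma differentiableAt (hv : FiberC1 v) (s : S) (x : Fin d → ℝ) :
    DifferentiableAt ℝ (fun x => v (s, x)) x :=
  (hv.contDiff s).differentiable (by simp) x

lemma hasDerivAt_line (hv : FiberC1 v) (i : Fin d) (s : S) (x : Fin d → ℝ) :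
    HasDerivAt (fun t : ℝ => v (s, x + t • Pi.single i 1)) (xderiv i v (s, x)) 0 := by
  have h := (hv.differentiableAt s x).hasFDerivAt.hasLineDerivAt (Pi.single i 1)
  exact h

lemma continuous_xderiv (hv : FiberC1 v) (i : Fin d) (s : S) :
    Continuous fun x => xderiv i v (s, x) :=
  ((hv.contDiff s).continuous_fderiv (by norm_num)).clm_apply continuous_const

/-- Regularity in `x` alone says nothing about joint measurability in `(s, x)`; it is inherited from
the difference quotients along `1 / (n + 1)`. -/
lemma measurable_xderiv (hv : FiberC1 v) (i : Fin d) : Measurable (xderiv i v) := by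
  have hlim : Tendsto (fun (n : ℕ) (p : S × (Fin d → ℝ)) =>
      ((1 : ℝ) / (n + 1))⁻¹ • (v (p.1, p.2 + ((1 : ℝ) / (n + 1)) • Pi.single i 1) - v p)) atTop
      (𝓝 (xderiv i v)) := by
    rw [tendsto_pi_nhds]
    intro p
    have h := (hv.hasDerivAt_line i p.1 p.2).tendsto_slope_zero
    have h2 : Tendsto (fun n : ℕ => (1 : ℝ) / (n + 1)) atTop (𝓝[≠] 0) := by
      refine tendsto_nhdsWithin_iff.2 ⟨tendsto_one_div_add_atTop_nhds_zero_nat, ?_⟩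
      exact Eventually.of_forall fun n => by
        have : (0 : ℝ) < 1 / (n + 1) := by positivity
        exact this.ne'
    have h3 := h.comp h2
    refine h3.congr fun n => ?_
    simp
  refine measurable_of_tendsto_metrizable (fun n => ?_) hlim
  refine Measurable.const_mul ?_ _
  refine (hv.measurable.comp ?_).sub hv.measurable
  exact measurable_fst.prodMk (measurable_snd.add_const _)

lemma xderiv_sub (hv : FiberC1 v) (hw : FiberC1 w) (i : Fin d) (p : S × (Fin d → ℝ)) :
    xderiv i (v - w) p = xderiv i v p - xderiv i w p := by
  simp only [xderiv, Pi.sub_apply]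
  rw [fderiv_fun_sub (hv.differentiableAt _ _) (hw.differentiableAt _ _)]
  rfl

lemma xderiv_add (hv : FiberC1 v) (hw : FiberC1 w) (i : Fin d) (p : S × (Fin d → ℝ)) :
    xderiv i (v + w) p = xderiv i v p + xderiv i w p := by
  simp only [xderiv, Pi.add_apply]
  rw [fderiv_fun_add (hv.differentiableAt _ _) (hw.differentiableAt _ _)]
  rfl

lemma xderiv_smul (hv : FiberC1 v) (c : ℝ) (i : Fin d) (p : S × (Fin d → ℝ)) :
    xderiv i (c • v) p = c * xderiv i v p := by
  simp only [xderiv, Pi.smul_apply]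
  rw [fderiv_fun_const_smul (hv.differentiableAt _ _)]
  rfl

lemma add (hv : FiberC1 v) (hw : FiberC1 w) : FiberC1 (v + w) := by
  obtain ⟨C, hC⟩ := hv.bdd
  obtain ⟨C', hC'⟩ := hw.bdd
  obtain ⟨D, hD⟩ := hv.bdd_deriv
  obtain ⟨D', hD'⟩ := hw.bdd_deriv
  refine ⟨hv.measurable.add hw.measurable, ⟨C + C', fun p => ?_⟩,
    fun s => (hv.contDiff s).add (hw.contDiff s), ⟨D + D', fun i p => ?_⟩⟩
  · exact (abs_add_le _ _).trans (add_le_add (hC p) (hC' p))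
  · rw [hv.xderiv_add hw]
    exact (abs_add_le _ _).trans (add_le_add (hD i p) (hD' i p))

lemma smul (hv : FiberC1 v) (c : ℝ) : FiberC1 (c • v) := by
  obtain ⟨C, hC⟩ := hv.bdd
  obtain ⟨D, hD⟩ := hv.bdd_deriv
  refine ⟨hv.measurable.const_smul c, ⟨|c| * C, fun p => ?_⟩,
    fun s => (hv.contDiff s).const_smul c, ⟨|c| * D, fun i p => ?_⟩⟩
  · simp only [Pi.smul_apply, smul_eq_mul, abs_mul]
    exact mul_le_mul_of_nonneg_left (hC p) (abs_nonneg c)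
  · rw [hv.xderiv_smul, abs_mul]
    exact mul_le_mul_of_nonneg_left (hD i p) (abs_nonneg c)

lemma sub (hv : FiberC1 v) (hw : FiberC1 w) : FiberC1 (v - w) := by
  have := hv.add (hw.smul (-1))
  rwa [neg_one_smul, ← sub_eq_add_neg] at this

lemma zero : FiberC1 (0 : S × (Fin d → ℝ) → ℝ) := by
  refine ⟨measurable_const, ⟨0, by simp⟩, fun s => contDiff_const, ⟨0, fun i p => ?_⟩⟩
  simp [xderiv]

end FiberC1

/-- Closability of the partial derivatives on `L²(κ μ)` under Hamza's condition. -/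
lemma xderiv_closable [TopologicalSpace S] {μ : Measure (S × (Fin d → ℝ))}
    [IsProbabilityMeasure μ]
    (hH : Hamza μ) {κ : S × (Fin d → ℝ) → ℝ} (hκ : Measurable κ)
    (hκc : ∀ s, Continuous fun x => κ (s, x)) (i : Fin d) {v : ℕ → S × (Fin d → ℝ) → ℝ}
    (hv : ∀ n, FiberC1 (v n)) {k : S × (Fin d → ℝ) → ℝ} (hk : Measurable k)
    (h0 : Tendsto (fun n => ∫⁻ p, ENNReal.ofReal (v n p ^ 2) * ENNReal.ofReal (κ p) ∂μ)
      atTop (𝓝 0))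
    (h1 : Tendsto (fun n => ∫⁻ p, ENNReal.ofReal ((xderiv i (v n) p - k p) ^ 2) *
      ENNReal.ofReal (κ p) ∂μ) atTop (𝓝 0)) :
    ∀ᵐ p ∂μ, 0 < κ p → k p = 0 := by
  set a : ℕ → S × (Fin d → ℝ) → ℝ≥0∞ := fun n p =>
    ENNReal.ofReal (v n p ^ 2) * ENNReal.ofReal (κ p) with ha
  set b : ℕ → S × (Fin d → ℝ) → ℝ≥0∞ := fun n p =>
    ENNReal.ofReal ((xderiv i (v n) p - k p) ^ 2) * ENNReal.ofReal (κ p) with hb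
  have ham : ∀ n, Measurable (a n) := fun n =>
    ((hv n).measurable.pow_const 2).ennreal_ofReal.mul hκ.ennreal_ofReal
  have hbm : ∀ n, Measurable (b n) := fun n =>
    (((hv n).measurable_xderiv i).sub hk |>.pow_const 2).ennreal_ofReal.mul hκ.ennreal_ofReal
  have hab : Tendsto (fun n => ∫⁻ p, a n p + b n p ∂μ) atTop (𝓝 0) := by
    have := h0.add h1
    rw [add_zero] at this
    exact this.congr fun n => (lintegral_add_left (ham n) _).symm
  -- A subsequence with geometrically small integrals has a finite sum of fibre integrals for almost
  -- every `s`, so the convergence holds along almost every fibre.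
  have hsub : ∀ n : ℕ, ∃ m, ∫⁻ p, a m p + b m p ∂μ < (2 : ℝ≥0∞)⁻¹ ^ n := fun n =>
    (hab.eventually (gt_mem_nhds (ENNReal.pow_pos (by simp) n))).exists
  choose m hm using hsub
  have hsum : ∀ᵐ s ∂μ.fst, Tendsto (fun n => ∫⁻ x, (a (m n) (s, x) + b (m n) (s, x))
      ∂μ.condKernel s) atTop (𝓝 0) := by
    have hmeas : ∀ n, Measurable fun s => ∫⁻ x, (a (m n) (s, x) + b (m n) (s, x))
        ∂μ.condKernel s := fun n => ((ham _).add (hbm _)).lintegral_kernel_prod_right'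
    have hfin : ∫⁻ s, ∑' n, ∫⁻ x, (a (m n) (s, x) + b (m n) (s, x)) ∂μ.condKernel s ∂μ.fst
        ≠ ⊤ := by
      rw [lintegral_tsum fun n => (hmeas n).aemeasurable]
      refine ne_top_of_le_ne_top (b := ∑' n : ℕ, (2 : ℝ≥0∞)⁻¹ ^ n) ?_
        (ENNReal.tsum_le_tsum fun n => ?_)
      · rw [ENNReal.tsum_geometric]; norm_num
      · rw [Measure.lintegral_condKernel (f := fun p => a (m n) p + b (m n) p)
          ((ham _).add (hbm _))]
        exact (hm n).le
    filter_upwards [ae_lt_top (Measurable.tsum hmeas) hfin] with s hs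
    exact ENNReal.tendsto_atTop_zero_of_tsum_ne_top hs.ne
  have hreg : ∀ᵐ s ∂μ.fst, μ.condKernel s {x | ∃ ε : ℝ, 0 < ε ∧
      (∫⁻ y in Set.Icc (x - fun _ => ε) (x + fun _ => ε), (leb (μ.condKernel s) y)⁻¹) < ⊤} = 1 := by
    -- The measure of the regular set is not known to be measurable in `s`. A measurable minorant
    -- with the same integral replaces it: it is at most one and has integral one, hence equals one
    -- almost everywhere.
    obtain ⟨g, hgm, hgle, hgint⟩ := exists_measurable_le_lintegral_eq μ.fst (fun s =>
      μ.condKernel s {x | ∃ ε : ℝ, 0 < ε ∧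
      (∫⁻ y in Set.Icc (x - fun _ => ε) (x + fun _ => ε), (leb (μ.condKernel s) y)⁻¹) < ⊤})
    rw [hH.2] at hgint
    have hg1 : ∀ᵐ s ∂μ.fst, g s = 1 := by
      have := ae_eq_of_ae_le_of_lintegral_le (μ := μ.fst) (f := g) (g := fun _ => 1)
        (ae_of_all _ fun s => (hgle s).trans prob_le_one) (by rw [← hgint]; simp)
        aemeasurable_const (by rw [← hgint]; simp)
      exact this
    filter_upwards [hg1] with s hs
    exact le_antisymm prob_le_one (hs ▸ hgle s)
  have main : ∀ᵐ s ∂μ.fst, ∀ᵐ x ∂μ.condKernel s, 0 < κ (s, x) → k (s, x) = 0 := by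
    filter_upwards [hsum, hreg, hH.1] with s hs hr hac
    set ρ := leb (μ.condKernel s) with hρ
    have hρm : Measurable ρ := Measure.measurable_rnDeriv _ _
    have hconv : ∀ f : (Fin d → ℝ) → ℝ≥0∞, Measurable f →
        ∫⁻ x, f x * (ENNReal.ofReal (κ (s, x)) * ρ x) =
          ∫⁻ x, f x * ENNReal.ofReal (κ (s, x)) ∂μ.condKernel s := by
      intro f hf
      rw [← lintegral_rnDeriv_mul hac (f := fun x => f x * ENNReal.ofReal (κ (s, x)))
        (hf.mul (hκc s).measurable.ennreal_ofReal).aemeasurable]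
      refine lintegral_congr fun x => ?_
      simp only [hρ, leb]; ring
    have hvm : ∀ n, Measurable fun x => v n (s, x) := fun n =>
      (hv n).measurable.comp measurable_prodMk_left
    have hkm : Measurable fun x => k (s, x) := hk.comp measurable_prodMk_left
    have l0 : Tendsto (fun n => ∫⁻ x, ENNReal.ofReal (v (m n) (s, x) ^ 2) *
        (ENNReal.ofReal (κ (s, x)) * ρ x)) atTop (𝓝 0) := by
      refine tendsto_of_tendsto_of_tendsto_of_le_of_le tendsto_const_nhds hs
        (fun _ => zero_le) fun n => ?_
      simp only
      rw [hconv _ ((hvm (m n)).pow_const 2).ennreal_ofReal]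
      exact lintegral_mono fun x => le_self_add
    have l1 : Tendsto (fun n => ∫⁻ x, ENNReal.ofReal
        ((fderiv ℝ (fun x => v (m n) (s, x)) x (Pi.single i 1) - k (s, x)) ^ 2) *
        (ENNReal.ofReal (κ (s, x)) * ρ x)) atTop (𝓝 0) := by
      refine tendsto_of_tendsto_of_tendsto_of_le_of_le tendsto_const_nhds hs
        (fun _ => zero_le) fun n => ?_
      simp only
      rw [hconv (fun x => ENNReal.ofReal
        ((fderiv ℝ (fun x => v (m n) (s, x)) x (Pi.single i 1) - k (s, x)) ^ 2))
        ((((hv (m n)).continuous_xderiv i s).measurable.sub hkm).pow_const 2).ennreal_ofReal]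
      exact lintegral_mono fun x => le_add_self
    set O := {x : Fin d → ℝ | ∃ ε : ℝ, 0 < ε ∧
      (∫⁻ y in Set.Icc (x - fun _ => ε) (x + fun _ => ε), (ρ y)⁻¹) < ⊤} with hO
    have hOc : ∀ᵐ x ∂μ.condKernel s, x ∈ O :=
      (mem_ae_iff_prob_eq_one (μ := μ.condKernel s) (isOpen_regularSet ρ).measurableSet).2 hr
    -- The vanishing of `k` is known only near each regular point with `κ > 0`; second countability
    -- turns local nullity into nullity.
    have hnull : volume {x | x ∈ O ∧ 0 < κ (s, x) ∧ k (s, x) ≠ 0} = 0 := by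
      refine measure_null_of_locally_null _ ?_
      rintro x ⟨hxO, hxκ, -⟩
      obtain ⟨V, hVo, hxV, hV⟩ := ae_eq_zero_near_of_weighted_limit hρm
        ((Measure.rnDeriv_lt_top _ _).mono fun x hx => hx.ne) (hκc s) i
        (fun n => (hv (m n)).contDiff s) hkm l0 l1 x hxO hxκ
      refine ⟨_, inter_mem_nhdsWithin _ (hVo.mem_nhds hxV), ?_⟩
      refine measure_mono_null ?_ (ae_iff.1 hV)
      rintro y ⟨⟨-, -, hy⟩, hyV⟩
      simpa using ⟨hyV, hy⟩
    have := hac hnull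
    filter_upwards [hOc, measure_eq_zero_iff_ae_notMem.1 this] with x hx hx' hκx
    by_contra hne
    exact hx' ⟨hx, hκx, hne⟩
  have hbad : MeasurableSet {p | 0 < κ p → k p = 0} := by
    have : {p | 0 < κ p → k p = 0} = {p | 0 < κ p}ᶜ ∪ {p | k p = 0} := by
      ext p; simp [imp_iff_not_or]
    rw [this]
    exact (measurableSet_lt measurable_const hκ).compl.union
      (measurableSet_eq_fun hk measurable_const)
  rw [← μ.disintegrate μ.condKernel]
  exact Measure.ae_compProd_of_ae_ae hbad main

end FiberCalculus

/-! ### Splines and tensor products as primal functions -/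

section Splines

/-- Continuous primal functions on the line. -/
structure IsPrimalLine (b : ℝ → ℝ) : Prop where
  continuous : Continuous b
  mem_Icc : ∀ x, b x ∈ Set.Icc (0 : ℝ) 1
  eq_zero : ∀ x, 2 ≤ |x| → b x = 0
  partition : ∀ x, HasSum (fun n : ℤ => b (x - n)) 1

namespace IsPrimalLine

variable {b : ℝ → ℝ}

lemma eq_zero_of_notMem (hb : IsPrimalLine b) (x : ℝ) {n : ℤ}
    (hn : n ∉ Finset.Icc (⌊x⌋ - 3) (⌊x⌋ + 4)) : b (x - n) = 0 := by
  refine hb.eq_zero _ ?_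
  have h1 := Int.floor_le x
  have h2 := Int.lt_floor_add_one x
  rw [Finset.mem_Icc, not_and_or, not_le, not_le] at hn
  rcases hn with hn | hn
  · have : (n : ℝ) + 1 ≤ ⌊x⌋ - 3 := by exact_mod_cast hn
    rw [le_abs]; left; linarith
  · have : (⌊x⌋ : ℝ) + 4 + 1 ≤ n := by exact_mod_cast hn
    rw [le_abs]; right; linarith

lemma sum_eq_one (hb : IsPrimalLine b) (x : ℝ) :
    ∑ n ∈ Finset.Icc (⌊x⌋ - 3) (⌊x⌋ + 4), b (x - n) = 1 :=
  (hasSum_sum_of_ne_finset_zero fun _ hn => hb.eq_zero_of_notMem x hn).unique (hb.partition x)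

/-- Cutting `[-2, 2]` into unit intervals and translating them all to `[0, 1]` turns the integral of
`b` into the integral over `[0, 1]` of four translates. On this interval no other translates
contribute, so their sum is the full partition of unity. -/
lemma integral_eq_one (hb : IsPrimalLine b) : ∫ x, b x = 1 := by
  have hi : ∀ u v, IntervalIntegrable b volume u v := fun u v => hb.continuous.intervalIntegrable u v
  have hsupp : Function.support b ⊆ Set.Ioc (-2) 2 := by
    intro x hx
    have : |x| < 2 := by
      by_contra h
      exact hx (hb.eq_zero x (not_lt.1 h))
    rw [abs_lt] at this
    exact ⟨this.1, this.2.le⟩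
  rw [← intervalIntegral.integral_eq_integral_of_support_subset hsupp,
    ← intervalIntegral.integral_add_adjacent_intervals (hi (-2) (-1)) (hi (-1) 2),
    ← intervalIntegral.integral_add_adjacent_intervals (hi (-1) 0) (hi 0 2),
    ← intervalIntegral.integral_add_adjacent_intervals (hi 0 1) (hi 1 2)]
  have s1 : ∫ x in (-2 : ℝ)..(-1), b x = ∫ x in (0 : ℝ)..1, b (x - 2) := by
    rw [intervalIntegral.integral_comp_sub_right]; norm_num
  have s2 : ∫ x in (-1 : ℝ)..0, b x = ∫ x in (0 : ℝ)..1, b (x - 1) := by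
    rw [intervalIntegral.integral_comp_sub_right]; norm_num
  have s3 : ∫ x in (1 : ℝ)..2, b x = ∫ x in (0 : ℝ)..1, b (x + 1) := by
    rw [intervalIntegral.integral_comp_add_right]; norm_num
  have hc : ∀ f : ℝ → ℝ, Continuous f → IntervalIntegrable f volume 0 1 :=
    fun f hf => hf.intervalIntegrable _ _
  have c1 : Continuous fun x => b (x - 2) := hb.continuous.comp (continuous_sub_right (2 : ℝ))
  have c2 : Continuous fun x => b (x - 1) := hb.continuous.comp (continuous_sub_right (1 : ℝ))
  have c3 : Continuous fun x => b (x + 1) := hb.continuous.comp (continuous_add_const (1 : ℝ))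
  rw [s1, s2, s3, ← intervalIntegral.integral_add (hc _ hb.continuous) (hc _ c3),
    ← intervalIntegral.integral_add (hc _ c2) (hc (fun x => b x + b (x + 1)) (hb.continuous.add c3)),
    ← intervalIntegral.integral_add (hc _ c1)
      (hc (fun x => b (x - 1) + (b x + b (x + 1))) (c2.add (hb.continuous.add c3)))]
  rw [intervalIntegral.integral_congr (g := fun _ => (1 : ℝ))]
  · simp
  · intro x hx
    rw [Set.uIcc_of_le zero_le_one] at hx
    have hs : HasSum (fun n : ℤ => b (x - n)) (∑ n ∈ ({2, 1, 0, -1} : Finset ℤ), b (x - n)) := by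
      refine hasSum_sum_of_ne_finset_zero fun n hn => hb.eq_zero _ ?_
      simp only [Finset.mem_insert, Finset.mem_singleton, not_or] at hn
      have : n ≤ -2 ∨ 3 ≤ n := by omega
      rcases this with h | h
      · have : (n : ℝ) ≤ -2 := by exact_mod_cast h
        rw [le_abs]; left; linarith [hx.1]
      · have : (3 : ℝ) ≤ n := by exact_mod_cast h
        rw [le_abs]; right; linarith [hx.2]
    have := hs.unique (hb.partition x)
    simpa using this

end IsPrimalLine

/-- The tent function. -/
def tent (x : ℝ) : ℝ := max 0 (1 - |x|)

lemma continuous_tent : Continuous tent := by unfold tent; fun_prop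

lemma tent_mem_Icc (x : ℝ) : tent x ∈ Set.Icc (0 : ℝ) 1 :=
  ⟨le_max_left _ _, max_le zero_le_one (by linarith [abs_nonneg x])⟩

lemma tent_eq_zero {x : ℝ} (hx : 1 ≤ |x|) : tent x = 0 := max_eq_left (by linarith)

lemma isPrimalLine_tent : IsPrimalLine tent := by
  refine ⟨continuous_tent, tent_mem_Icc, fun x hx => tent_eq_zero (by linarith), fun x => ?_⟩
  have hs : HasSum (fun n : ℤ => tent (x - n)) (∑ n ∈ ({⌊x⌋, ⌊x⌋ + 1} : Finset ℤ), tent (x - n)) := by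
    refine hasSum_sum_of_ne_finset_zero fun n hn => tent_eq_zero ?_
    simp only [Finset.mem_insert, Finset.mem_singleton, not_or] at hn
    have h1 := Int.floor_le x
    have h2 := Int.lt_floor_add_one x
    have : n + 1 ≤ ⌊x⌋ ∨ ⌊x⌋ + 2 ≤ n := by omega
    rcases this with h | h
    · have : (n : ℝ) + 1 ≤ ⌊x⌋ := by exact_mod_cast h
      rw [le_abs]; left; linarith
    · have : (⌊x⌋ : ℝ) + 2 ≤ n := by exact_mod_cast h
      rw [le_abs]; right; linarith
  convert hs using 1
  rw [Finset.sum_pair (by omega)]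
  have h1 := Int.floor_le x
  have h2 := Int.lt_floor_add_one x
  simp only [tent, Int.cast_add, Int.cast_one]
  rw [abs_of_nonneg (by linarith), abs_of_nonpos (by linarith), max_eq_right (by linarith),
    max_eq_right (by linarith)]
  ring

/-- The shift moves a support in `[-3/2, 3/2]` to `[-2, 1]`, which is still admissible. Such half
shifts appear when `bspline` is differentiated and when `tent` is averaged over `[0, 1]`. -/
lemma IsPrimalLine.comp_add_half {b : ℝ → ℝ} (hb : IsPrimalLine b)
    (h0 : ∀ x, 3 / 2 ≤ |x| → b x = 0) : IsPrimalLine fun x => b (x + 1 / 2) := by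
  refine ⟨hb.continuous.comp (continuous_add_const _), fun x => hb.mem_Icc _, fun x hx => h0 _ ?_,
    fun x => ?_⟩
  · have := abs_sub_abs_le_abs_add x (1 / 2)
    have e : |(1 / 2 : ℝ)| = 1 / 2 := abs_of_pos (by norm_num)
    linarith
  · convert hb.partition (x + 1 / 2) using 3
    ring

/-- The quadratic spline. -/
def bspline (x : ℝ) : ℝ := ∫ t in (-(1 / 2) : ℝ)..(1 / 2), tent (x + t)

lemma bspline_eq (x : ℝ) : bspline x = ∫ t in (x - 1 / 2)..(x + 1 / 2), tent t := by
  rw [bspline, intervalIntegral.integral_comp_add_left]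
  rfl

lemma bspline_eq_zero {x : ℝ} (hx : 3 / 2 ≤ |x|) : bspline x = 0 := by
  rw [bspline, intervalIntegral.integral_congr (g := fun _ => (0 : ℝ))]
  · simp
  · intro t ht
    rw [Set.uIcc_of_le (by norm_num)] at ht
    refine tent_eq_zero ?_
    have := abs_sub_abs_le_abs_add x t
    have : |t| ≤ 1 / 2 := abs_le.2 ht
    linarith

/-- `bspline` is a difference of two values of a primitive of `tent`. Its derivative is therefore a
unit difference of one function, a shifted `tent`, which is again primal; this is what allows a
derivative of an interpolation to be traded for a difference of nodal coefficients. -/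
lemma hasDerivAt_bspline (x : ℝ) :
    HasDerivAt bspline (tent (x + 1 / 2) - tent (x - 1 / 2)) x := by
  have hF : ∀ y : ℝ, HasDerivAt (fun u => ∫ t in (0 : ℝ)..u, tent t) (tent y) y := fun y =>
    intervalIntegral.integral_hasDerivAt_right (continuous_tent.intervalIntegrable _ _)
      continuous_tent.stronglyMeasurable.stronglyMeasurableAtFilter continuous_tent.continuousAt
  have e : bspline = fun x => (∫ t in (0 : ℝ)..(x + 1 / 2), tent t) -
      ∫ t in (0 : ℝ)..(x - 1 / 2), tent t := by
    funext x
    rw [bspline_eq, intervalIntegral.integral_interval_sub_left]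
    all_goals exact continuous_tent.intervalIntegrable _ _
  rw [e]
  exact ((hF (x + 1 / 2)).comp_add_const x (1 / 2)).sub ((hF (x - 1 / 2)).comp_sub_const x (1 / 2))

lemma continuous_bspline : Continuous bspline :=
  continuous_iff_continuousAt.2 fun x => (hasDerivAt_bspline x).continuousAt

lemma contDiff_bspline : ContDiff ℝ 1 bspline := by
  rw [contDiff_one_iff_deriv]
  refine ⟨fun x => (hasDerivAt_bspline x).differentiableAt, ?_⟩
  have : deriv bspline = fun x => tent (x + 1 / 2) - tent (x - 1 / 2) :=
    funext fun x => (hasDerivAt_bspline x).deriv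
  rw [this]
  exact (continuous_tent.comp (continuous_add_const _)).sub
    (continuous_tent.comp (continuous_sub_right _))

/-- Averaging over translates preserves bounds and partitions of unity. It widens the support by `1
/ 2` on each side, and the support of `tent` leaves room for this. -/
lemma isPrimalLine_bspline : IsPrimalLine bspline := by
  have hc : ∀ y : ℝ, Continuous fun t => tent (y + t) := fun y =>
    continuous_tent.comp (continuous_const_add y)
  refine ⟨continuous_bspline, fun x => ⟨?_, ?_⟩, fun x hx => bspline_eq_zero (by linarith),
    fun x => ?_⟩
  · exact intervalIntegral.integral_nonneg (by norm_num) fun t _ => (tent_mem_Icc _).1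
  · calc bspline x ≤ ∫ t in (-(1 / 2) : ℝ)..(1 / 2), (1 : ℝ) :=
          intervalIntegral.integral_mono_on (by norm_num) ((hc x).intervalIntegrable _ _)
            (continuous_const.intervalIntegrable _ _) fun t _ => (tent_mem_Icc _).2
      _ = 1 := by simp; norm_num
  -- The window of indices also accommodates the extra shift `|t| ≤ 1 / 2`, so one finite sum serves
  -- all `t` and can be exchanged with the integral.
  · have hz : ∀ n ∉ Finset.Icc (⌊x⌋ - 3) (⌊x⌋ + 4), ∀ t ∈ Set.Icc (-(1 / 2) : ℝ) (1 / 2),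
        tent (x - n + t) = 0 := by
      intro n hn t ht
      have h1 := Int.floor_le x
      have h2 := Int.lt_floor_add_one x
      refine tent_eq_zero ?_
      rw [Finset.mem_Icc, not_and_or, not_le, not_le] at hn
      rcases hn with hn | hn
      · have : (n : ℝ) + 1 ≤ ⌊x⌋ - 3 := by exact_mod_cast hn
        rw [le_abs]; left; linarith [ht.1]
      · have : (⌊x⌋ : ℝ) + 4 + 1 ≤ n := by exact_mod_cast hn
        rw [le_abs]; right; linarith [ht.2]
    have hs : HasSum (fun n : ℤ => bspline (x - n))
        (∑ n ∈ Finset.Icc (⌊x⌋ - 3) (⌊x⌋ + 4), bspline (x - n)) := by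
      refine hasSum_sum_of_ne_finset_zero fun n hn => ?_
      rw [bspline, intervalIntegral.integral_congr (g := fun _ => (0 : ℝ))]
      · simp
      · intro t ht
        rw [Set.uIcc_of_le (by norm_num)] at ht
        exact hz n hn t ht
    convert hs using 1
    simp only [bspline]
    rw [← intervalIntegral.integral_finsetSum fun n _ => (hc _).intervalIntegrable _ _,
      intervalIntegral.integral_congr (g := fun _ => (1 : ℝ))]
    · simp; norm_num
    · intro t ht
      rw [Set.uIcc_of_le (by norm_num)] at ht
      have h1 : HasSum (fun n : ℤ => tent (x - n + t))
          (∑ n ∈ Finset.Icc (⌊x⌋ - 3) (⌊x⌋ + 4), tent (x - n + t)) :=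
        hasSum_sum_of_ne_finset_zero fun n hn => hz n hn t ht
      refine h1.unique ?_
      convert isPrimalLine_tent.partition (x + t) using 3
      ring

/-- A continuous primal function on the line which is bounded below on `[-3/2, 3/2]`. -/
def plateau (x : ℝ) : ℝ := (tent (x - 1) + tent x + tent (x + 1)) / 3

lemma isPrimalLine_plateau : IsPrimalLine plateau := by
  have hc1 := continuous_tent.comp (continuous_sub_right (1 : ℝ))
  have hc2 := continuous_tent.comp (continuous_add_const (1 : ℝ))
  refine ⟨((hc1.add continuous_tent).add hc2).div_const 3, fun x => ?_, fun x hx => ?_, fun x => ?_⟩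
  · have h1 := tent_mem_Icc (x - 1)
    have h2 := tent_mem_Icc x
    have h3 := tent_mem_Icc (x + 1)
    simp only [Set.mem_Icc, plateau] at *
    constructor <;> linarith
  · have h1 := abs_sub_abs_le_abs_sub x 1
    have h2 := abs_sub_abs_le_abs_add x 1
    rw [abs_one] at h1 h2
    rw [plateau, tent_eq_zero (by linarith), tent_eq_zero (by linarith), tent_eq_zero (by linarith)]
    simp
  · have h := ((isPrimalLine_tent.partition (x - 1)).add (isPrimalLine_tent.partition x)).add
      (isPrimalLine_tent.partition (x + 1))
    have h' := h.div_const 3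
    norm_num at h'
    refine h'.congr_fun fun n => ?_
    simp only [plateau]
    ring_nf

/-- Every point of `[-3/2, 3/2]` is within `1 / 2` of one of `-1`, `0`, `1`, where the corresponding
tent is at least `1 / 2`. -/
lemma plateau_ge {x : ℝ} (hx : |x| ≤ 3 / 2) : 1 / 6 ≤ plateau x := by
  have h1 := (tent_mem_Icc (x - 1)).1
  have h2 := (tent_mem_Icc x).1
  have h3 := (tent_mem_Icc (x + 1)).1
  rw [abs_le] at hx
  have hge : ∀ y : ℝ, |y| ≤ 1 / 2 → 1 / 2 ≤ tent y := fun y hy =>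
    le_trans (by linarith) (le_max_right _ _)
  unfold plateau
  rcases le_total x (-(1 / 2)) with h | h
  · have := hge (x + 1) (abs_le.2 ⟨by linarith, by linarith⟩)
    linarith
  · rcases le_total x (1 / 2) with h' | h'
    · have := hge x (abs_le.2 ⟨by linarith, by linarith⟩)
      linarith
    · have := hge (x - 1) (abs_le.2 ⟨by linarith, by linarith⟩)
      linarith

variable {d : ℕ}

/-- The tensor product of functions on the line. -/
def tensor (b : Fin d → ℝ → ℝ) (x : Fin d → ℝ) : ℝ := ∏ k, b k (x k)

lemma continuous_tensor {b : Fin d → ℝ → ℝ} (hb : ∀ k, Continuous (b k)) :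
    Continuous (tensor b) :=
  continuous_finsetProd _ fun k _ => (hb k).comp (continuous_apply k)

/-- The integral and the partition of unity factorise over the coordinates. For the latter the sum
over `ℤ^d` is first cut down to a box, so that only finite sums are multiplied. -/
lemma isPrimal_tensor {b : Fin d → ℝ → ℝ} (hb : ∀ k, IsPrimalLine (b k)) :
    IsPrimal (tensor b) := by
  refine ⟨(continuous_tensor fun k => (hb k).continuous).measurable, fun x => ⟨?_, ?_⟩,
    fun x hx => ?_, ?_, fun x => ?_⟩
  · exact Finset.prod_nonneg fun k _ => ((hb k).mem_Icc _).1
  · exact Finset.prod_le_one (fun k _ => ((hb k).mem_Icc _).1) fun k _ => ((hb k).mem_Icc _).2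
  · have : ∃ k, 2 ≤ |x k| := by
      by_contra! h
      exact hx ⟨fun k => (abs_lt.1 (h k)).1.le, fun k => (abs_lt.1 (h k)).2.le⟩
    obtain ⟨k, hk⟩ := this
    exact Finset.prod_eq_zero (Finset.mem_univ k) ((hb k).eq_zero _ hk)
  · unfold tensor
    rw [integral_fintype_prod_volume_eq_prod]
    exact Finset.prod_eq_one fun k _ => (hb k).integral_eq_one
  · have hs : HasSum (fun α : Fin d → ℤ => tensor b (x - fun k => (α k : ℝ)))
        (∑ α ∈ Fintype.piFinset fun k => Finset.Icc (⌊x k⌋ - 3) (⌊x k⌋ + 4),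
          tensor b (x - fun k => (α k : ℝ))) := by
      refine hasSum_sum_of_ne_finset_zero fun α hα => ?_
      rw [Fintype.mem_piFinset, not_forall] at hα
      obtain ⟨k, hk⟩ := hα
      exact Finset.prod_eq_zero (Finset.mem_univ k) ((hb k).eq_zero_of_notMem _ hk)
    convert hs using 1
    simp only [tensor, Pi.sub_apply]
    rw [← Finset.prod_univ_sum (fun k => Finset.Icc (⌊x k⌋ - 3) (⌊x k⌋ + 4))
      (fun k n => b k (x k - (n : ℝ)))]
    exact (Finset.prod_eq_one fun k _ => (hb k).sum_eq_one _).symm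

end Splines

/-! ### Rescaled primal functions and the nodes that they meet -/

section Rescale

variable {d : ℕ} {φ : (Fin d → ℝ) → ℝ} {r : ℝ}

lemma measurable_rescale (hφ : Measurable φ) (r : ℝ) (z : Fin d → ℤ) :
    Measurable (rescale φ r z) :=
  hφ.comp (by fun_prop)

lemma continuous_rescale (hφ : Continuous φ) (r : ℝ) (z : Fin d → ℤ) :
    Continuous (rescale φ r z) :=
  hφ.comp (by fun_prop)

/-- A finite set of nodes which contains all those that matter on the ball of radius `R`. -/
def nodes (d : ℕ) (R r : ℝ) : Finset (Fin d → ℤ) :=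
  Fintype.piFinset fun _ => Finset.Icc (-(⌈R / r⌉ + 2)) (⌈R / r⌉ + 2)

namespace IsPrimal

lemma rescale_mem_Icc (hφ : IsPrimal φ) (r : ℝ) (z : Fin d → ℤ) (x : Fin d → ℝ) :
    rescale φ r z x ∈ Set.Icc (0 : ℝ) 1 := hφ.mem_Icc _

lemma abs_le_of_rescale_ne_zero (hφ : IsPrimal φ) (hr : 0 < r) {z : Fin d → ℤ} {x : Fin d → ℝ}
    (h : rescale φ r z x ≠ 0) (k : Fin d) : |x k - r * z k| ≤ 2 * r := by
  have hmem : r⁻¹ • (x - fun k => r * (z k : ℝ)) ∈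
      Set.Icc (fun _ => (-2 : ℝ)) (fun _ : Fin d => 2) := by
    by_contra hn
    exact h (hφ.eq_zero _ hn)
  have h1 := hmem.1 k
  have h2 := hmem.2 k
  simp only [Pi.smul_apply, Pi.sub_apply, smul_eq_mul] at h1 h2
  rw [inv_mul_eq_div, div_le_iff₀ hr] at h2
  rw [inv_mul_eq_div, le_div_iff₀ hr] at h1
  exact abs_le.2 ⟨by linarith, h2⟩

lemma mem_nodes (hφ : IsPrimal φ) (hr : 0 < r) {R : ℝ} {z : Fin d → ℤ} {x : Fin d → ℝ}
    (hx : ‖x‖ ≤ R) (h : rescale φ r z x ≠ 0) : z ∈ nodes d R r := by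
  rw [nodes, Fintype.mem_piFinset]
  intro k
  have h1 := abs_le.1 (hφ.abs_le_of_rescale_ne_zero hr h k)
  have h2 := abs_le.1 ((norm_le_pi_norm x k).trans hx)
  -- A node seen from `x` satisfies `|r z k| ≤ R + 2 r`, which explains the summand `2` in `nodes`.
  have h3 : R / r ≤ ⌈R / r⌉ := Int.le_ceil _
  rw [div_le_iff₀ hr] at h3
  rw [Finset.mem_Icc]
  constructor
  · have : -((⌈R / r⌉ : ℝ) + 2) ≤ z k := by
      refine le_of_mul_le_mul_right ?_ hr
      linarith
    exact_mod_cast this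
  · have : (z k : ℝ) ≤ ⌈R / r⌉ + 2 := by
      refine le_of_mul_le_mul_right ?_ hr
      linarith
    exact_mod_cast this

lemma rescale_eq_zero (hφ : IsPrimal φ) (hr : 0 < r) {R : ℝ} {z : Fin d → ℤ} {x : Fin d → ℝ}
    (hx : ‖x‖ ≤ R) (hz : z ∉ nodes d R r) : rescale φ r z x = 0 := by
  by_contra h
  exact hz (hφ.mem_nodes hr hx h)

lemma hasCompactSupport_rescale (hφ : IsPrimal φ) (hr : 0 < r) (z : Fin d → ℤ) :
    HasCompactSupport (rescale φ r z) := by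
  refine HasCompactSupport.intro (isCompact_closedBall (fun k => r * (z k : ℝ)) (2 * r)) ?_
  intro x hx
  by_contra h
  refine hx ?_
  rw [Metric.mem_closedBall, dist_pi_le_iff (by linarith)]
  exact fun k => hφ.abs_le_of_rescale_ne_zero hr h k

lemma integral_rescale (hφ : IsPrimal φ) (hr : 0 < r) (z : Fin d → ℤ) :
    ∫ x, rescale φ r z x = r ^ d := by
  unfold rescale
  rw [integral_sub_right_eq_self (fun x => φ (r⁻¹ • x)) (fun k => r * (z k : ℝ)),
    Measure.integral_comp_inv_smul, hφ.integral_eq_one]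
  simp [abs_of_pos hr]

lemma integrable_rescale (hφ : IsPrimal φ) (hr : 0 < r) (z : Fin d → ℤ) :
    Integrable (rescale φ r z) := by
  -- The integral of a non-integrable function is zero by convention, so the non-zero value `r ^ d`
  -- already yields integrability.
  refine Integrable.of_integral_ne_zero ?_
  rw [hφ.integral_rescale hr]
  positivity

lemma hasSum_rescale (hφ : IsPrimal φ) (hr : 0 < r) (x : Fin d → ℝ) :
    HasSum (fun z : Fin d → ℤ => rescale φ r z x) 1 := by
  convert hφ.partition (r⁻¹ • x) using 2 with z
  unfold rescale
  congr 1
  ext k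
  simp only [Pi.smul_apply, Pi.sub_apply, smul_eq_mul]
  field_simp

lemma sum_rescale_le_one (hφ : IsPrimal φ) (hr : 0 < r) (Z : Finset (Fin d → ℤ))
    (x : Fin d → ℝ) : ∑ z ∈ Z, rescale φ r z x ≤ 1 :=
  sum_le_hasSum Z (fun z _ => (hφ.rescale_mem_Icc r z x).1) (hφ.hasSum_rescale hr x)

lemma sum_nodes_rescale (hφ : IsPrimal φ) (hr : 0 < r) {R : ℝ} {x : Fin d → ℝ}
    (hx : ‖x‖ ≤ R) : ∑ z ∈ nodes d R r, rescale φ r z x = 1 :=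
  (hasSum_sum_of_ne_finset_zero fun _ hz => hφ.rescale_eq_zero hr hx hz).unique
    (hφ.hasSum_rescale hr x)

end IsPrimal

end Rescale

/-! ### Finite element interpolation on `ℝ^d` -/

section Interpolation

variable {d : ℕ}

/-- The nodal coefficient `r^{-d} ∫ η_r^z u dx`. -/
def coeff (η : (Fin d → ℝ) → ℝ) (r : ℝ) (u : (Fin d → ℝ) → ℝ) (z : Fin d → ℤ) : ℝ :=
  (r ^ d)⁻¹ * ∫ x, rescale η r z x * u x

/-- The interpolation `∑_z (r^{-d} ∫ η_r^z u dx) φ_r^z` over a finite set of nodes. -/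
def interp (φ η : (Fin d → ℝ) → ℝ) (r : ℝ) (Z : Finset (Fin d → ℤ)) (u : (Fin d → ℝ) → ℝ)
    (x : Fin d → ℝ) : ℝ := ∑ z ∈ Z, coeff η r u z * rescale φ r z x

/-- The function itself for `none` and its `i`-th partial derivative for `some i`. -/
def odrv (o : Option (Fin d)) (f : (Fin d → ℝ) → ℝ) (x : Fin d → ℝ) : ℝ :=
  match o with
  | none => f x
  | some i => fderiv ℝ f x (Pi.single i 1)

/-- The spline `⊗ bspline` and the splines which appear in its partial derivatives. -/
def outerSpline (o : Option (Fin d)) : (Fin d → ℝ) → ℝ :=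
  match o with
  | none => tensor fun _ => bspline
  | some i => tensor (Function.update (fun _ => bspline) i fun x => tent (x + 1 / 2))

/-- The spline `⊗ tent` and its averages in the coordinate directions. -/
def innerSpline (o : Option (Fin d)) : (Fin d → ℝ) → ℝ :=
  match o with
  | none => tensor fun _ => tent
  | some i => tensor (Function.update (fun _ => tent) i fun x => bspline (x + 1 / 2))

lemma tensor_update (b : Fin d → ℝ → ℝ) (i : Fin d) (f : ℝ → ℝ) (y : Fin d → ℝ) :
    tensor (Function.update b i f) y = f (y i) * ∏ k ∈ Finset.univ.erase i, b k (y k) := by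
  rw [tensor, ← Finset.mul_prod_erase _ _ (Finset.mem_univ i), Function.update_self]
  congr 1
  refine Finset.prod_congr rfl fun k hk => ?_
  rw [Function.update_of_ne (Finset.ne_of_mem_erase hk)]

lemma tensor_eq (b : Fin d → ℝ → ℝ) (i : Fin d) (y : Fin d → ℝ) :
    tensor b y = b i (y i) * ∏ k ∈ Finset.univ.erase i, b k (y k) := by
  rw [tensor, ← Finset.mul_prod_erase _ _ (Finset.mem_univ i)]

lemma isPrimalLine_outer (o : Option (Fin d)) :
    ∃ b : Fin d → ℝ → ℝ, outerSpline o = tensor b ∧ (∀ k, IsPrimalLine (b k)) ∧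
      ∀ k x, b k x ≠ 0 → |x| ≤ 3 / 2 := by
  have hb : ∀ x, bspline x ≠ 0 → |x| ≤ 3 / 2 := fun x hx => by
    by_contra h
    exact hx (bspline_eq_zero (not_le.1 h).le)
  have ht : ∀ x, tent (x + 1 / 2) ≠ 0 → |x| ≤ 3 / 2 := fun x hx => by
    by_contra h
    refine hx (tent_eq_zero ?_)
    have := abs_sub_abs_le_abs_add x (1 / 2)
    have e : |(1 / 2 : ℝ)| = 1 / 2 := abs_of_pos (by norm_num)
    linarith
  cases o with
  | none => exact ⟨_, rfl, fun _ => isPrimalLine_bspline, fun _ x => hb x⟩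
  | some i =>
    refine ⟨_, rfl, fun k => ?_, fun k x => ?_⟩
    · by_cases h : k = i
      · subst h
        rw [Function.update_self]
        exact isPrimalLine_tent.comp_add_half fun x hx => tent_eq_zero (by linarith)
      · rw [Function.update_of_ne h]
        exact isPrimalLine_bspline
    · by_cases h : k = i
      · subst h
        rw [Function.update_self]
        exact ht x
      · rw [Function.update_of_ne h]
        exact hb x

lemma isPrimal_outer (o : Option (Fin d)) : IsPrimal (outerSpline o) := by
  obtain ⟨b, hb, h, -⟩ := isPrimalLine_outer o
  exact hb ▸ isPrimal_tensor h

lemma isPrimalLine_inner (o : Option (Fin d)) :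
    ∃ b : Fin d → ℝ → ℝ, innerSpline o = tensor b ∧ ∀ k, IsPrimalLine (b k) := by
  cases o with
  | none => exact ⟨_, rfl, fun _ => isPrimalLine_tent⟩
  | some i =>
    refine ⟨_, rfl, fun k => ?_⟩
    by_cases h : k = i
    · subst h
      rw [Function.update_self]
      exact isPrimalLine_bspline.comp_add_half fun x hx => bspline_eq_zero hx
    · rw [Function.update_of_ne h]
      exact isPrimalLine_tent

lemma isPrimal_inner (o : Option (Fin d)) : IsPrimal (innerSpline o) := by
  obtain ⟨b, hb, h⟩ := isPrimalLine_inner o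
  exact hb ▸ isPrimal_tensor h

lemma continuous_inner_spline (o : Option (Fin d)) : Continuous (innerSpline o) := by
  obtain ⟨b, hb, h⟩ := isPrimalLine_inner o
  exact hb ▸ continuous_tensor fun k => (h k).continuous

/-- A primal function bounded below on the cube `[-3/2, 3/2]^d`. -/
def plateauTensor (d : ℕ) : (Fin d → ℝ) → ℝ := tensor fun _ => plateau

lemma isPrimal_plateauTensor : IsPrimal (plateauTensor d) :=
  isPrimal_tensor fun _ => isPrimalLine_plateau

lemma continuous_plateauTensor : Continuous (plateauTensor d) :=
  continuous_tensor fun _ => isPrimalLine_plateau.continuous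

lemma contDiff_rescale_outer (r : ℝ) (z : Fin d → ℤ) :
    ContDiff ℝ 1 (rescale (outerSpline none) r z) := by
  have h : ContDiff ℝ 1 (outerSpline (none : Option (Fin d))) :=
    contDiff_prod (t := Finset.univ) (f := fun k (x : Fin d → ℝ) => bspline (x k))
      fun k _ => contDiff_bspline.comp (contDiff_apply ℝ ℝ k)
  exact h.comp (by fun_prop)

lemma rescale_apply_coord (r : ℝ) (z : Fin d → ℤ) (x : Fin d → ℝ) (k : Fin d) :
    (r⁻¹ • (x - fun k => r * (z k : ℝ))) k = r⁻¹ * (x k - r * z k) := rfl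

/-- Only the `i`-th tensor factor depends on the `i`-th coordinate, and its derivative is a
difference of two tents at unit distance. After rescaling, the second one is the same spline
attached to the neighbouring node. -/
lemma fderiv_rescale_outer {r : ℝ} (hr : 0 < r) (z : Fin d → ℤ) (i : Fin d) (x : Fin d → ℝ) :
    fderiv ℝ (rescale (outerSpline none) r z) x (Pi.single i 1) =
      r⁻¹ * (rescale (outerSpline (some i)) r z x -
        rescale (outerSpline (some i)) r (z + Pi.single i 1) x) := by
  have hd : DifferentiableAt ℝ (rescale (outerSpline none) r z) x :=
    (contDiff_rescale_outer r z).differentiable (by simp) x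
  have h1 := hd.hasFDerivAt.hasLineDerivAt (Pi.single i 1)
  set y := r⁻¹ • (x - fun k => r * (z k : ℝ)) with hy
  set q := ∏ k ∈ Finset.univ.erase i, bspline (y k) with hq
  have e : ∀ t : ℝ, rescale (outerSpline none) r z (x + t • Pi.single i 1) =
      bspline (y i + r⁻¹ * t) * q := by
    intro t
    rw [rescale, outerSpline, tensor_eq _ i]
    congr 1
    · congr 1
      simp [hy]; ring
    · refine Finset.prod_congr rfl fun k hk => ?_
      simp [hy, Pi.single_eq_of_ne (Finset.ne_of_mem_erase hk)]
  have h2 : HasDerivAt (fun t : ℝ => bspline (y i + r⁻¹ * t) * q)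
      ((tent (y i + 1 / 2) - tent (y i - 1 / 2)) * r⁻¹ * q) 0 := by
    have hi : HasDerivAt (fun t : ℝ => y i + r⁻¹ * t) r⁻¹ 0 := by
      simpa using ((hasDerivAt_id (0 : ℝ)).const_mul r⁻¹).const_add (y i)
    have hb : HasDerivAt bspline (tent (y i + 1 / 2) - tent (y i - 1 / 2)) (y i + r⁻¹ * 0) := by
      simpa using hasDerivAt_bspline (y i)
    exact (hb.comp (0 : ℝ) hi).mul_const q
  have h3 : HasDerivAt (fun t : ℝ => rescale (outerSpline none) r z (x + t • Pi.single i 1))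
      ((tent (y i + 1 / 2) - tent (y i - 1 / 2)) * r⁻¹ * q) 0 := by
    simpa only [e] using h2
  have h4 : rescale (outerSpline (some i)) r z x = tent (y i + 1 / 2) * q := by
    rw [rescale, outerSpline, tensor_update]
  have h5 : rescale (outerSpline (some i)) r (z + Pi.single i 1) x = tent (y i - 1 / 2) * q := by
    rw [rescale, outerSpline, tensor_update]
    congr 1
    · congr 1
      simp only [hy, rescale_apply_coord, Pi.add_apply, Pi.single_eq_same]
      push_cast
      field_simp
      ring
    · refine Finset.prod_congr rfl fun k hk => ?_
      simp [hy, Pi.single_eq_of_ne (Finset.ne_of_mem_erase hk)]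
  rw [h4, h5, HasDerivAt.unique h1 h3]
  ring

/-- Outside the cube of half-width `3 / 2` around the node the spline vanishes near `x`; inside,
each factor of the plateau is at least `1 / 6`. With one primal majorant for the spline and all its
derivatives, a single fibre weight controls every component later on. The growth of the factor `1 +
r⁻¹` is harmless, because `r` stays fixed whenever the bound is used. -/
lemma abs_odrv_rescale_outer_le {r : ℝ} (hr : 0 < r) (o : Option (Fin d)) (z : Fin d → ℤ)
    (x : Fin d → ℝ) : |odrv o (rescale (outerSpline none) r z) x| ≤
      6 ^ d * (1 + r⁻¹) * rescale (plateauTensor d) r z x := by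
  set y := r⁻¹ • (x - fun k => r * (z k : ℝ)) with hy
  have hθ0 : 0 ≤ rescale (plateauTensor d) r z x := (isPrimal_plateauTensor.rescale_mem_Icc r z x).1
  by_cases h : ∀ k, |y k| ≤ 3 / 2
  · have hθ : 1 ≤ 6 ^ d * rescale (plateauTensor d) r z x := by
      have : ∏ k : Fin d, (1 / 6 : ℝ) ≤ plateauTensor d y :=
        Finset.prod_le_prod (fun _ _ => by norm_num) fun k _ => plateau_ge (h k)
      rw [Finset.prod_const, Finset.card_univ, Fintype.card_fin] at this
      have h2 : (6 : ℝ) ^ d * (1 / 6) ^ d = 1 := by rw [← mul_pow]; norm_num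
      calc (1 : ℝ) = 6 ^ d * (1 / 6) ^ d := h2.symm
        _ ≤ _ := mul_le_mul_of_nonneg_left this (by positivity)
    have hb : |odrv o (rescale (outerSpline none) r z) x| ≤ 1 + r⁻¹ := by
      have hri : 0 < r⁻¹ := inv_pos.2 hr
      cases o with
      | none =>
        have := (isPrimal_outer (none : Option (Fin d))).rescale_mem_Icc r z x
        simp only [odrv]
        rw [abs_of_nonneg this.1]
        linarith [this.2]
      | some i =>
        simp only [odrv]
        rw [fderiv_rescale_outer hr, abs_mul, abs_of_pos hri]
        have h1 := (isPrimal_outer (some i)).rescale_mem_Icc r z x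
        have h2 := (isPrimal_outer (some i)).rescale_mem_Icc r (z + Pi.single i 1) x
        have h3 : |rescale (outerSpline (some i)) r z x -
            rescale (outerSpline (some i)) r (z + Pi.single i 1) x| ≤ 1 :=
          abs_le.2 ⟨by linarith [h1.1, h2.2], by linarith [h1.2, h2.1]⟩
        nlinarith
    calc |odrv o (rescale (outerSpline none) r z) x| ≤ (1 + r⁻¹) * 1 := by linarith
      _ ≤ (1 + r⁻¹) * (6 ^ d * rescale (plateauTensor d) r z x) :=
          mul_le_mul_of_nonneg_left hθ (by positivity)
      _ = _ := by ring
  · push Not at h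
    obtain ⟨k, hk⟩ := h
    have hnear : rescale (outerSpline none) r z =ᶠ[𝓝 x] fun _ => 0 := by
      have hc : Continuous fun x' : Fin d → ℝ => |r⁻¹ * (x' k - r * z k)| := by fun_prop
      filter_upwards [(isOpen_lt continuous_const hc).mem_nhds
        (show (3 / 2 : ℝ) < |r⁻¹ * (x k - r * z k)| from hk)] with x' hx'
      exact Finset.prod_eq_zero (Finset.mem_univ k) (bspline_eq_zero (le_of_lt hx'))
    have h0 : odrv o (rescale (outerSpline none) r z) x = 0 := by
      cases o with
      | none => exact hnear.eq_of_nhds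
      | some i => simp only [odrv]; rw [hnear.fderiv_eq]; simp
    rw [h0, abs_zero]
    positivity

lemma coeff_eq_zero {η u : (Fin d → ℝ) → ℝ} (hη : IsPrimal η) {r R : ℝ} (hr : 0 < r)
    (hu : ∀ x, R < ‖x‖ → u x = 0) {z : Fin d → ℤ} (hz : z ∉ nodes d R r) : coeff η r u z = 0 := by
  unfold coeff
  rw [integral_eq_zero_of_ae, mul_zero]
  refine ae_of_all _ fun x => ?_
  simp only [Pi.zero_apply, mul_eq_zero]
  by_cases h : ‖x‖ ≤ R
  · exact Or.inl (hη.rescale_eq_zero hr h hz)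
  · exact Or.inr (hu x (not_le.1 h))

/-- Moving the node amounts to translating `u`, and the fundamental theorem of calculus writes the
difference as an average of the derivative over a segment. Fubini and translation invariance put
this average on the weight, where it turns the `i`-th tent into a shifted `bspline`. -/
lemma coeff_inner_sub {r : ℝ} (hr : 0 < r) {u : (Fin d → ℝ) → ℝ} (hu : ContDiff ℝ 1 u)
    (huc : HasCompactSupport u) (i : Fin d) (z : Fin d → ℤ) :
    coeff (innerSpline none) r u z - coeff (innerSpline none) r u (z - Pi.single i 1) =
      r * coeff (innerSpline (some i)) r (odrv (some i) u) z := by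
  set e : Fin d → ℝ := Pi.single i 1 with he
  set η := rescale (innerSpline none) r z with hη
  set du : (Fin d → ℝ) → ℝ := fun x => fderiv ℝ u x e with hdu
  have hηp := isPrimal_inner (none : Option (Fin d))
  have hηc : Continuous η := continuous_rescale (continuous_inner_spline _) r z
  have hηs : HasCompactSupport η := hηp.hasCompactSupport_rescale hr z
  have hduc : Continuous du := (hu.continuous_fderiv (by norm_num)).clm_apply continuous_const
  have hdus : HasCompactSupport du := huc.fderiv_apply (𝕜 := ℝ) e
  have hshift : ∀ x, rescale (innerSpline none) r (z - Pi.single i 1) x = η (x + r • e) := by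
    intro x
    simp only [hη, rescale]
    congr 1
    ext k
    simp only [Pi.smul_apply, Pi.sub_apply, Pi.add_apply, smul_eq_mul, he]
    by_cases h : k = i
    · subst h
      simp only [Pi.single_eq_same, Int.cast_sub, Int.cast_one]
      ring
    · simp [Pi.single_eq_of_ne h]
  have e1 : ∫ x, rescale (innerSpline none) r (z - Pi.single i 1) x * u x =
      ∫ x, η x * u (x - r • e) := by
    simp only [hshift]
    rw [← integral_sub_right_eq_self (fun x => η (x + r • e) * u x) (r • e)]
    simp
  have ftc : ∀ x, u x - u (x - r • e) = r * ∫ t in (0 : ℝ)..1, du (x - (t * r) • e) := by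
    intro x
    have hder : ∀ t : ℝ, HasDerivAt (fun t : ℝ => u (x - (t * r) • e))
        (-(r * du (x - (t * r) • e))) t := by
      intro t
      have h1 : HasDerivAt (fun t : ℝ => x - (t * r) • e) (-(r • e)) t := by
        have := (((hasDerivAt_id t).mul_const r).smul_const e).const_sub x
        simpa using this
      have h2 := (hu.differentiable (by simp) (x - (t * r) • e)).hasFDerivAt.comp_hasDerivAt t h1
      rw [map_neg, map_smul] at h2
      exact h2
    have hcont : Continuous fun t : ℝ => -(r * du (x - (t * r) • e)) := by fun_prop
    have := intervalIntegral.integral_eq_sub_of_hasDerivAt (fun t _ => hder t)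
      (hcont.intervalIntegrable 0 1)
    rw [intervalIntegral.integral_neg, intervalIntegral.integral_const_mul] at this
    simp only [one_mul, zero_mul, zero_smul, sub_zero] at this
    linarith
  have hi1 : Integrable fun x => η x * u x :=
    (hηc.mul hu.continuous).integrable_of_hasCompactSupport hηs.mul_right
  have hi2 : Integrable fun x => η x * u (x - r • e) :=
    (hηc.mul (hu.continuous.comp (continuous_sub_right _))).integrable_of_hasCompactSupport
      hηs.mul_right
  obtain ⟨C, hC⟩ := hdus.exists_bound_of_continuous hduc
  have hIf : Integrable (fun p : (Fin d → ℝ) × ℝ => η p.1 * du (p.1 - (p.2 * r) • e))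
      (volume.prod (volume.restrict (Set.uIoc (0 : ℝ) 1))) := by
    have hdom : Integrable (fun p : (Fin d → ℝ) × ℝ => |η p.1| * C)
        (volume.prod (volume.restrict (Set.uIoc (0 : ℝ) 1))) := by
      refine Integrable.mul_prod (f := fun x => |η x|) (g := fun _ : ℝ => C)
        (hηc.integrable_of_hasCompactSupport hηs).abs ?_
      rw [Set.uIoc_of_le zero_le_one]
      exact integrable_const _
    refine hdom.mono' ?_ (ae_of_all _ fun p => ?_)
    · exact Continuous.aestronglyMeasurable (by fun_prop)
    · rw [Real.norm_eq_abs, abs_mul]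
      exact mul_le_mul_of_nonneg_left (hC _) (abs_nonneg _)
  have hIg : Integrable (fun p : (Fin d → ℝ) × ℝ => η (p.1 + (p.2 * r) • e) * du p.1)
      (volume.prod (volume.restrict (Set.uIoc (0 : ℝ) 1))) := by
    have hdom : Integrable (fun p : (Fin d → ℝ) × ℝ => |du p.1| * 1)
        (volume.prod (volume.restrict (Set.uIoc (0 : ℝ) 1))) := by
      refine Integrable.mul_prod (f := fun x => |du x|) (g := fun _ : ℝ => (1 : ℝ))
        (hduc.integrable_of_hasCompactSupport hdus).abs ?_
      rw [Set.uIoc_of_le zero_le_one]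
      exact integrable_const _
    refine hdom.mono' ?_ (ae_of_all _ fun p => ?_)
    · exact Continuous.aestronglyMeasurable (by fun_prop)
    · rw [Real.norm_eq_abs, abs_mul, mul_comm]
      have := hηp.rescale_mem_Icc r z (p.1 + (p.2 * r) • e)
      refine mul_le_mul_of_nonneg_left ?_ (abs_nonneg _)
      rw [abs_of_nonneg this.1]
      exact this.2
  have avg : ∀ x, ∫ t in (0 : ℝ)..1, η (x + (t * r) • e) = rescale (innerSpline (some i)) r z x := by
    intro x
    set y := r⁻¹ • (x - fun k => r * (z k : ℝ)) with hy
    have e2 : ∀ t : ℝ, η (x + (t * r) • e) =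
        tent (y i + t) * ∏ k ∈ Finset.univ.erase i, tent (y k) := by
      intro t
      rw [hη, rescale, innerSpline, tensor_eq _ i]
      congr 1
      · congr 1
        rw [rescale_apply_coord, hy, rescale_apply_coord, he]
        simp only [Pi.add_apply, Pi.smul_apply, Pi.single_eq_same, smul_eq_mul]
        field_simp
        ring
      · refine Finset.prod_congr rfl fun k hk => ?_
        simp [hy, he, Pi.single_eq_of_ne (Finset.ne_of_mem_erase hk)]
    simp only [e2]
    rw [intervalIntegral.integral_mul_const, rescale, innerSpline, tensor_update]
    congr 1
    rw [bspline_eq, intervalIntegral.integral_comp_add_left]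
    congr 1 <;> ring
  calc coeff (innerSpline none) r u z - coeff (innerSpline none) r u (z - Pi.single i 1)
      = (r ^ d)⁻¹ * ∫ x, η x * (u x - u (x - r • e)) := by
        simp only [coeff, e1, mul_sub]
        rw [integral_sub hi1 hi2, mul_sub]
    _ = (r ^ d)⁻¹ * (r * ∫ x, ∫ t in (0 : ℝ)..1, η x * du (x - (t * r) • e)) := by
        congr 1
        rw [← integral_const_mul]
        congr 1
        funext x
        rw [ftc, intervalIntegral.integral_const_mul]
        ring
    _ = (r ^ d)⁻¹ * (r * ∫ t in (0 : ℝ)..1, ∫ x, η x * du (x - (t * r) • e)) := by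
        simp only [intervalIntegral.integral_of_le zero_le_one]
        rw [integral_integral_swap (by rw [Set.uIoc_of_le zero_le_one] at hIf; exact hIf)]
    _ = (r ^ d)⁻¹ * (r * ∫ t in (0 : ℝ)..1, ∫ x, η (x + (t * r) • e) * du x) := by
        congr 3
        funext t
        rw [← integral_sub_right_eq_self (fun x => η (x + (t * r) • e) * du x) ((t * r) • e)]
        simp
    _ = (r ^ d)⁻¹ * (r * ∫ x, ∫ t in (0 : ℝ)..1, η (x + (t * r) • e) * du x) := by
        simp only [intervalIntegral.integral_of_le zero_le_one]
        rw [← integral_integral_swap (by rw [Set.uIoc_of_le zero_le_one] at hIg; exact hIg)]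
    _ = _ := by
        simp only [intervalIntegral.integral_mul_const, avg]
        simp only [coeff, odrv]
        ring

/-- Interpolation commutes with partial derivatives up to a change of the splines. -/
lemma sum_coeff_odrv {r R : ℝ} (hr : 0 < r) {u : (Fin d → ℝ) → ℝ} (hu : ContDiff ℝ 1 u)
    (hR : ∀ x, R < ‖x‖ → u x = 0) (o : Option (Fin d)) (x : Fin d → ℝ) :
    ∑ z ∈ nodes d R r, coeff (innerSpline none) r u z *
        odrv o (rescale (outerSpline none) r z) x =
      interp (outerSpline o) (innerSpline o) r (nodes d R r) (odrv o u) x := by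
  cases o with
  | none => rfl
  | some i =>
    have huc : HasCompactSupport u := HasCompactSupport.intro
      (isCompact_closedBall (0 : Fin d → ℝ) R) fun x hx => hR x (by simpa using hx)
    have hR' : ∀ x, R < ‖x‖ → odrv (some i) u x = 0 := by
      intro x hx
      have : u =ᶠ[𝓝 x] fun _ => 0 := by
        filter_upwards [(isOpen_lt continuous_const continuous_norm).mem_nhds hx] with y hy
        exact hR y hy
      simp only [odrv]
      rw [this.fderiv_eq]; simp
    set c := coeff (innerSpline none) r u with hc
    set φ := fun z => rescale (outerSpline (some i)) r z x with hφ
    -- Translation by `Pi.single i 1` does not preserve `nodes d R r`, so the summation by parts is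
    -- done over all nodes, where `c` has finite support.
    have hc0 : ∀ z ∉ nodes d R r, c z = 0 := fun z hz => coeff_eq_zero (isPrimal_inner _) hr hR hz
    have s1 : Summable fun z => c z * φ z :=
      summable_of_ne_finset_zero (s := nodes d R r) fun z hz => by rw [hc0 z hz, zero_mul]
    have s2 : Summable fun z => c z * φ (z + Pi.single i 1) :=
      summable_of_ne_finset_zero (s := nodes d R r) fun z hz => by rw [hc0 z hz, zero_mul]
    have s3 : Summable fun z => c (z - Pi.single i 1) * φ z := by
      have := (Equiv.subRight (Pi.single i 1 : Fin d → ℤ)).summable_iff.2 s2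
      refine this.congr fun z => ?_
      simp
    have e1 : ∑' z, c z * φ (z + Pi.single i 1) = ∑' z, c (z - Pi.single i 1) * φ z := by
      refine ((Equiv.subRight (Pi.single i 1 : Fin d → ℤ)).tsum_eq
        fun z => c z * φ (z + Pi.single i 1)).symm.trans ?_
      simp
    calc ∑ z ∈ nodes d R r, c z * odrv (some i) (rescale (outerSpline none) r z) x
        = ∑' z, c z * (r⁻¹ * (φ z - φ (z + Pi.single i 1))) := by
          rw [tsum_eq_sum (s := nodes d R r) fun z hz => by rw [hc0 z hz, zero_mul]]
          refine Finset.sum_congr rfl fun z _ => ?_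
          simp only [odrv]
          rw [fderiv_rescale_outer hr]
      _ = r⁻¹ * (∑' z, c z * φ z - ∑' z, c z * φ (z + Pi.single i 1)) := by
          rw [← s1.tsum_sub s2, ← tsum_mul_left]
          congr 1; funext z; ring
      _ = r⁻¹ * ∑' z, (c z - c (z - Pi.single i 1)) * φ z := by
          rw [e1, ← s1.tsum_sub s3]
          congr 2; funext z; ring
      _ = ∑' z, coeff (innerSpline (some i)) r (odrv (some i) u) z * φ z := by
          rw [← tsum_mul_left]
          congr 1; funext z
          rw [hc, coeff_inner_sub hr hu huc]
          field_simp
      _ = _ := by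
          rw [interp, tsum_eq_sum (s := nodes d R r) fun z hz => by
            rw [coeff_eq_zero (isPrimal_inner _) hr hR' hz, zero_mul]]

end Interpolation

/-! ### Interpolation estimates with respect to a weighted measure -/

section FiberEstimates

variable {d : ℕ} {m : Measure (Fin d → ℝ)} {κ : (Fin d → ℝ) → ℝ}
  {φ η u f : (Fin d → ℝ) → ℝ} {r R : ℝ}

/-- The density of `κ m`. -/
def dens (κ : (Fin d → ℝ) → ℝ) (m : Measure (Fin d → ℝ)) (y : Fin d → ℝ) : ℝ :=
  κ y * (leb m y).toReal

lemma measurable_dens (hκ : Measurable κ) : Measurable (dens κ m) :=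
  hκ.mul (Measure.measurable_rnDeriv _ _).ennreal_toReal

lemma integral_mul_dens [IsFiniteMeasure m] (hm : m ≪ volume) (f : (Fin d → ℝ) → ℝ) :
    ∫ x, f x * dens κ m x = ∫ x, f x * κ x ∂m := by
  rw [← integral_rnDeriv_smul hm]
  congr 1
  funext x
  simp only [dens, leb, smul_eq_mul]
  ring

lemma integrable_dens [IsFiniteMeasure m] (hκ : Measurable κ) (h01 : ∀ x, κ x ∈ Set.Icc (0 : ℝ) 1) :
    Integrable (dens κ m) := by
  refine (Measure.integrable_toReal_rnDeriv (μ := m) (ν := volume)).bdd_mul (c := 1)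
    hκ.aestronglyMeasurable (ae_of_all _ fun x => ?_)
  rw [Real.norm_eq_abs, abs_of_nonneg (h01 x).1]
  exact (h01 x).2

lemma IsPrimal.norm_rescale_le (hφ : IsPrimal φ) (r : ℝ) (z : Fin d → ℤ) (x : Fin d → ℝ) :
    ‖rescale φ r z x‖ ≤ 1 := by
  rw [Real.norm_eq_abs, abs_of_nonneg (hφ.rescale_mem_Icc r z x).1]
  exact (hφ.rescale_mem_Icc r z x).2

lemma IsPrimal.integrable_rescale_mul_dens [IsFiniteMeasure m] (hφ : IsPrimal φ)
    (hκ : Measurable κ) (h01 : ∀ x, κ x ∈ Set.Icc (0 : ℝ) 1) (r : ℝ) (z : Fin d → ℤ) :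
    Integrable fun x => rescale φ r z x * dens κ m x :=
  (integrable_dens hκ h01).bdd_mul (c := 1)
    (measurable_rescale hφ.measurable r z).aestronglyMeasurable
    (ae_of_all _ fun x => hφ.norm_rescale_le r z x)

lemma IsPrimal.integrable_rescale_mul (hφ : IsPrimal φ) (hr : 0 < r) (z : Fin d → ℤ)
    (hf : Measurable f) {B : ℝ} (hB : ∀ x, |f x| ≤ B) :
    Integrable fun x => rescale φ r z x * f x := by
  simpa only [mul_comm] using (hφ.integrable_rescale hr z).bdd_mul (c := B)
    hf.aestronglyMeasurable (ae_of_all _ hB)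

/-- Jensen's inequality for nodal coefficients. -/
lemma coeff_sq_le (hη : IsPrimal η) (hr : 0 < r) (hu : Measurable u) {B : ℝ}
    (hB : ∀ x, |u x| ≤ B) (z : Fin d → ℤ) :
    coeff η r u z ^ 2 ≤ coeff η r (fun x => u x ^ 2) z := by
  set c := coeff η r u z with hc
  have hB0 : 0 ≤ B := (abs_nonneg _).trans (hB 0)
  have hi1 := hη.integrable_rescale_mul hr z hu hB
  have hi2 : Integrable fun x => rescale η r z x * u x ^ 2 :=
    hη.integrable_rescale_mul hr z (hu.pow_const 2) (B := B ^ 2) fun x => by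
      rw [abs_pow]; exact pow_le_pow_left₀ (abs_nonneg _) (hB x) 2
  -- Jensen's inequality in the form of a non-negative variance around the mean `c`.
  have hnn : 0 ≤ ∫ x, rescale η r z x * (u x - c) ^ 2 :=
    integral_nonneg fun x => mul_nonneg (hη.rescale_mem_Icc r z x).1 (sq_nonneg _)
  have hexp : ∫ x, rescale η r z x * (u x - c) ^ 2 =
      (∫ x, rescale η r z x * u x ^ 2) - 2 * c * (∫ x, rescale η r z x * u x) + c ^ 2 * r ^ d := by
    have hi3 : Integrable fun x => rescale η r z x * u x ^ 2 - 2 * c * (rescale η r z x * u x) :=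
      hi2.sub (hi1.const_mul _)
    rw [← hη.integral_rescale hr z, ← integral_const_mul, ← integral_const_mul, ← integral_sub hi2
      (hi1.const_mul _), ← integral_add hi3 ((hη.integrable_rescale hr z).const_mul _)]
    congr 1; funext x; ring
  have hrd : 0 < r ^ d := by positivity
  have h1 : ∫ x, rescale η r z x * u x = r ^ d * c := by
    rw [hc, coeff]; field_simp
  have h2 : ∫ x, rescale η r z x * u x ^ 2 = r ^ d * coeff η r (fun x => u x ^ 2) z := by
    rw [coeff]; field_simp
  rw [hexp, h1, h2] at hnn
  nlinarith

/-- Cauchy–Schwarz with the weights `rescale φ r z x`, whose sum is at most one, followed by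
Jensen's inequality for each coefficient. -/
lemma sq_interp_le (hφ : IsPrimal φ) (hη : IsPrimal η) (hr : 0 < r) (hu : Measurable u) {B : ℝ}
    (hB : ∀ x, |u x| ≤ B) (Z : Finset (Fin d → ℤ)) (x : Fin d → ℝ) :
    interp φ η r Z u x ^ 2 ≤ ∑ z ∈ Z, coeff η r (fun x => u x ^ 2) z * rescale φ r z x := by
  have h0 : ∀ z, 0 ≤ rescale φ r z x := fun z => (hφ.rescale_mem_Icc r z x).1
  have h1 : interp φ η r Z u x ^ 2 ≤
      (∑ z ∈ Z, coeff η r u z ^ 2 * rescale φ r z x) * ∑ z ∈ Z, rescale φ r z x := by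
    refine Finset.sum_sq_le_sum_mul_sum_of_sq_le_mul Z (fun z _ => mul_nonneg (sq_nonneg _) (h0 z))
      (fun z _ => h0 z) fun z _ => le_of_eq (by ring)
  have hnn : 0 ≤ ∑ z ∈ Z, coeff η r u z ^ 2 * rescale φ r z x :=
    Finset.sum_nonneg fun z _ => mul_nonneg (sq_nonneg _) (h0 z)
  calc interp φ η r Z u x ^ 2 ≤ (∑ z ∈ Z, coeff η r u z ^ 2 * rescale φ r z x) * 1 :=
        h1.trans (mul_le_mul_of_nonneg_left (hφ.sum_rescale_le_one hr Z x) hnn)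
    _ ≤ _ := by
        rw [mul_one]
        exact Finset.sum_le_sum fun z _ =>
          mul_le_mul_of_nonneg_right (coeff_sq_le hη hr hu hB z) (h0 z)

variable [IsProbabilityMeasure m]

/-- Exchanging sum and integral, the left side is the integral of `f` against the perturbation of
the density of `κ m`. It is thus the quantity tested in `pertConst`, and the denominator is `∫ f dm`
because `f` is non-negative. The conventions for division in `[0, ∞]` make the bound valid also when
this denominator is zero. -/
lemma sum_coeff_mul_le (hm : m ≪ volume) (hr : 0 < r) (hφ : IsPrimal φ) (hη : IsPrimal η)
    (hf : Measurable f) {B C : ℝ} (hB : ∀ x, |f x| ≤ B) (hf0 : ∀ x, 0 ≤ f x)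
    (hfR : ∀ x, R < ‖x‖ → f x = 0) (hC : pertConst κ r m ≤ ENNReal.ofReal C) (hC0 : 0 ≤ C) :
    ∑ z ∈ nodes d R r, coeff φ r f z * ∫ x, rescale η r z x * κ x ∂m ≤ C * ∫ x, f x ∂m := by
  have hfi : Integrable f m := Integrable.of_bound hf.aestronglyMeasurable B (ae_of_all _ hB)
  have hpt : ∀ x, f x * perturbation φ η r (dens κ m) x =
      ∑ z ∈ nodes d R r, coeff η r (dens κ m) z * (rescale φ r z x * f x) := by
    intro x
    by_cases hx : ‖x‖ ≤ R
    · rw [perturbation, tsum_eq_sum (s := nodes d R r) fun z hz => by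
        rw [hφ.rescale_eq_zero hr hx hz, mul_zero], Finset.mul_sum]
      refine Finset.sum_congr rfl fun z _ => ?_
      simp only [coeff]; ring
    · rw [hfR x (not_le.1 hx)]; simp
  have hint : ∫ x, f x * perturbation φ η r (dens κ m) x =
      ∑ z ∈ nodes d R r, coeff φ r f z * ∫ x, rescale η r z x * κ x ∂m := by
    simp only [hpt]
    rw [integral_finsetSum _ fun z _ => (hφ.integrable_rescale_mul hr z hf hB).const_mul _]
    refine Finset.sum_congr rfl fun z _ => ?_
    rw [integral_const_mul, ← integral_mul_dens hm]
    simp only [coeff]; ring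
  have hle : ENNReal.ofReal |∫ x, f x * perturbation φ η r (dens κ m) x| / eLpNorm f 1 m ≤
      ENNReal.ofReal C := by
    refine le_trans ?_ hC
    exact le_iSup₂_of_le φ hφ <| le_iSup₂_of_le η hη <| le_iSup₂_of_le f hf <|
      le_iSup_of_le ⟨B, hB⟩ le_rfl
  have hnorm : eLpNorm f 1 m = ENNReal.ofReal (∫ x, f x ∂m) := by
    rw [eLpNorm_one_eq_lintegral_enorm, ofReal_integral_eq_lintegral_ofReal hfi (ae_of_all _ hf0)]
    refine lintegral_congr fun x => ?_
    rw [← ofReal_norm, Real.norm_eq_abs, abs_of_nonneg (hf0 x)]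
  rw [hnorm, ENNReal.div_le_iff_le_mul (Or.inr ENNReal.ofReal_ne_top)
    (Or.inl ENNReal.ofReal_ne_top), ← ENNReal.ofReal_mul hC0,
    ENNReal.ofReal_le_ofReal_iff (mul_nonneg hC0 (integral_nonneg hf0)), hint] at hle
  exact (le_abs_self _).trans hle

/-- Weighted `L²`-stability of the interpolation. -/
lemma integral_sq_interp_le (hm : m ≪ volume) (hκ : Measurable κ)
    (h01 : ∀ x, κ x ∈ Set.Icc (0 : ℝ) 1) (hr : 0 < r) (hφ : IsPrimal φ) (hη : IsPrimal η)
    (hu : Measurable u) {B C : ℝ} (hB : ∀ x, |u x| ≤ B)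
    (huR : ∀ x, R < ‖x‖ → u x = 0) (hC : pertConst κ r m ≤ ENNReal.ofReal C) (hC0 : 0 ≤ C) :
    ∫ x, interp φ η r (nodes d R r) u x ^ 2 * κ x ∂m ≤ C * ∫ x, u x ^ 2 ∂m := by
  have hB2 : ∀ x, |u x ^ 2| ≤ B ^ 2 := fun x => by
    rw [abs_pow]; exact pow_le_pow_left₀ (abs_nonneg _) (hB x) 2
  -- The primal functions exchange their roles: `η` averages `u ^ 2`, while `φ` is integrated
  -- against `κ m`.
  refine le_trans ?_ (sum_coeff_mul_le (R := R) hm hr hη hφ (hu.pow_const 2) hB2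
    (fun x => sq_nonneg _) (fun x hx => by rw [huR x hx]; simp) hC hC0)
  have hi : ∀ z, Integrable (fun x => rescale φ r z x * κ x) m := fun z => by
    refine Integrable.of_bound ((measurable_rescale hφ.measurable r z).mul hκ).aestronglyMeasurable
      1 (ae_of_all _ fun x => ?_)
    rw [norm_mul]
    exact mul_le_one₀ (hφ.norm_rescale_le r z x) (norm_nonneg _)
      (by rw [Real.norm_eq_abs, abs_of_nonneg (h01 x).1]; exact (h01 x).2)
  have hrw : ∑ z ∈ nodes d R r, coeff η r (fun x => u x ^ 2) z * ∫ x, rescale φ r z x * κ x ∂m =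
      ∫ x, ∑ z ∈ nodes d R r, coeff η r (fun x => u x ^ 2) z * (rescale φ r z x * κ x) ∂m := by
    rw [integral_finsetSum _ fun z _ => (hi z).const_mul _]
    simp only [integral_const_mul]
  rw [hrw]
  refine integral_mono_of_nonneg (ae_of_all _ fun x => mul_nonneg (sq_nonneg _) (h01 x).1)
    (integrable_finsetSum _ fun z _ => (hi z).const_mul _) (ae_of_all _ fun x => ?_)
  simp only [← mul_assoc, ← Finset.sum_mul]
  exact mul_le_mul_of_nonneg_right (sq_interp_le hφ hη hr hu hB _ x) (h01 x).1

/-- A single term of a non-negative sum. Unlike the stability estimate, it controls one coefficient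
at a time; `φ` is free here, and is later taken to be the plateau rather than the spline of the
interpolation. -/
lemma coeff_sq_mul_le (hm : m ≪ volume)
    (h01 : ∀ x, κ x ∈ Set.Icc (0 : ℝ) 1) (hr : 0 < r) (hφ : IsPrimal φ) (hη : IsPrimal η)
    (hu : Measurable u) {B C : ℝ} (hB : ∀ x, |u x| ≤ B)
    (huR : ∀ x, R < ‖x‖ → u x = 0) (hC : pertConst κ r m ≤ ENNReal.ofReal C) (hC0 : 0 ≤ C)
    {z : Fin d → ℤ} (hz : z ∈ nodes d R r) :
    coeff η r u z ^ 2 * ∫ x, rescale φ r z x * κ x ∂m ≤ C * ∫ x, u x ^ 2 ∂m := by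
  have hB2 : ∀ x, |u x ^ 2| ≤ B ^ 2 := fun x => by
    rw [abs_pow]; exact pow_le_pow_left₀ (abs_nonneg _) (hB x) 2
  have hnn : ∀ z, 0 ≤ ∫ x, rescale φ r z x * κ x ∂m := fun z =>
    integral_nonneg fun x => mul_nonneg (hφ.rescale_mem_Icc r z x).1 (h01 x).1
  have hcnn : ∀ z, 0 ≤ coeff η r (fun x => u x ^ 2) z := fun z =>
    mul_nonneg (by positivity)
      (integral_nonneg fun x => mul_nonneg (hη.rescale_mem_Icc r z x).1 (sq_nonneg _))
  refine le_trans (mul_le_mul_of_nonneg_right (coeff_sq_le hη hr hu hB z) (hnn z)) ?_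
  refine le_trans ?_ (sum_coeff_mul_le (R := R) hm hr hη hφ (hu.pow_const 2) hB2
    (fun x => sq_nonneg _) (fun x hx => by rw [huR x hx]; simp) hC hC0)
  exact Finset.single_le_sum
    (f := fun z => coeff η r (fun x => u x ^ 2) z * ∫ x, rescale φ r z x * κ x ∂m)
    (fun z _ => mul_nonneg (hcnn z) (hnn z)) hz

/-- The interpolation is symmetric up to an error controlled by `deltaConst`. -/
lemma interp_duality (hm : m ≪ volume) (hκ : Measurable κ)
    (h01 : ∀ x, κ x ∈ Set.Icc (0 : ℝ) 1) (hr : 0 < r) (hφ : IsPrimal φ) (hη : IsPrimal η)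
    (hu : Measurable u) {A B : ℝ} (hA : ∀ x, |u x| ≤ A)
    (huR : ∀ x, R < ‖x‖ → u x = 0) (hf : Measurable f) (hB : ∀ x, |f x| ≤ B) :
    ENNReal.ofReal |(∫ x, interp φ η r (nodes d R r) u x * f x * κ x ∂m) -
        ∫ x, u x * interp η φ r (nodes d R r) f x * κ x ∂m| / eLpNorm u 2 m ≤
      ENNReal.ofReal B * deltaConst κ r m := by
  set w := dens κ m with hw
  have hwm : Measurable w := measurable_dens hκ
  have hwi : Integrable w := integrable_dens hκ h01
  have hB0 : 0 ≤ B := (abs_nonneg _).trans (hB 0)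
  set Z := nodes d R r with hZ
  have hηm := fun z => measurable_rescale hη.measurable r z
  have hφm := fun z => measurable_rescale hφ.measurable r z
  -- the inner integrals of the residual
  set q : (Fin d → ℤ) → (Fin d → ℝ) → ℝ := fun z x => ∫ y, |w x - w y| * rescale φ r z y with hq
  have hφw : ∀ z, Integrable fun y => rescale φ r z y * w y := fun z =>
    hφ.integrable_rescale_mul_dens hκ h01 r z
  have hqi : ∀ z x, Integrable fun y => |w x - w y| * rescale φ r z y := by
    intro z x
    refine (((hφ.integrable_rescale hr z).const_mul |w x|).add (hφw z).abs).mono'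
      ((measurable_const.sub hwm).abs.mul (hφm z)).aestronglyMeasurable (ae_of_all _ fun y => ?_)
    have h0 := (hφ.rescale_mem_Icc r z y).1
    rw [Real.norm_eq_abs, abs_mul, abs_abs, abs_of_nonneg h0]
    simp only [Pi.add_apply]
    rw [abs_mul, abs_of_nonneg h0, mul_comm (rescale φ r z y), ← add_mul]
    exact mul_le_mul_of_nonneg_right (abs_sub _ _) h0
  have hq0 : ∀ z x, 0 ≤ q z x := fun z x =>
    integral_nonneg fun y => mul_nonneg (abs_nonneg _) (hφ.rescale_mem_Icc r z y).1
  have hqm : ∀ z, Measurable (q z) := by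
    intro z
    have : StronglyMeasurable fun p : (Fin d → ℝ) × (Fin d → ℝ) =>
        |w p.1 - w p.2| * rescale φ r z p.2 :=
      (((hwm.comp measurable_fst).sub (hwm.comp measurable_snd)).abs.mul
        ((hφm z).comp measurable_snd)).stronglyMeasurable
    exact this.integral_prod_right'.measurable
  have hqle : ∀ z x, q z x ≤ |w x| * r ^ d + ∫ y, |rescale φ r z y * w y| := by
    intro z x
    rw [← hφ.integral_rescale hr z, ← integral_const_mul, ← integral_add
      ((hφ.integrable_rescale hr z).const_mul _) (hφw z).abs]
    refine integral_mono (hqi z x) (((hφ.integrable_rescale hr z).const_mul _).add (hφw z).abs)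
      fun y => ?_
    have h0 := (hφ.rescale_mem_Icc r z y).1
    simp only
    rw [abs_mul, abs_of_nonneg h0, mul_comm (rescale φ r z y), ← add_mul]
    exact mul_le_mul_of_nonneg_right (abs_sub _ _) h0
  have hui : ∀ z, Integrable fun x => rescale η r z x * u x := fun z =>
    hη.integrable_rescale_mul hr z hu hA
  have huw : ∀ z, Integrable fun x => rescale η r z x * u x * w x := fun z => by
    refine hwi.bdd_mul (c := A) ((hηm z).mul hu).aestronglyMeasurable (ae_of_all _ fun x => ?_)
    rw [norm_mul]
    calc ‖rescale η r z x‖ * ‖u x‖ ≤ 1 * A :=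
          mul_le_mul (hη.norm_rescale_le r z x) (hA x) (norm_nonneg _) zero_le_one
      _ = A := one_mul A
  have huq : ∀ z, Integrable fun x => |u x| * (rescale η r z x * q z x) := by
    intro z
    have hdom : Integrable fun x => |rescale η r z x * u x * w x| * r ^ d +
        |rescale η r z x * u x| * ∫ y, |rescale φ r z y * w y| :=
      ((huw z).abs.mul_const _).add ((hui z).abs.mul_const _)
    refine hdom.mono' (hu.abs.mul ((hηm z).mul (hqm z))).aestronglyMeasurable
      (ae_of_all _ fun x => ?_)
    have h0 := (hη.rescale_mem_Icc r z x).1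
    rw [Real.norm_eq_abs, abs_mul, abs_abs, abs_mul, abs_of_nonneg h0, abs_of_nonneg (hq0 z x)]
    rw [abs_mul, abs_mul, abs_of_nonneg h0]
    calc |u x| * (rescale η r z x * q z x) ≤
        |u x| * (rescale η r z x * (|w x| * r ^ d + ∫ y, |rescale φ r z y * w y|)) := by
          have := hqle z x
          gcongr
      _ = _ := by ring
  have hφf : ∀ z, Integrable fun y => rescale φ r z y * f y := fun z =>
    hφ.integrable_rescale_mul hr z hf hB
  have hφfw : ∀ z, Integrable fun y => rescale φ r z y * f y * w y := fun z => by
    refine hwi.bdd_mul (c := B) ((hφm z).mul hf).aestronglyMeasurable (ae_of_all _ fun x => ?_)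
    rw [norm_mul]
    calc ‖rescale φ r z x‖ * ‖f x‖ ≤ 1 * B :=
          mul_le_mul (hφ.norm_rescale_le r z x) (hB x) (norm_nonneg _) zero_le_one
      _ = B := one_mul B
  -- both integrals as sums over the nodes
  have e1 : ∫ x, interp φ η r Z u x * f x * κ x ∂m =
      ∑ z ∈ Z, coeff η r u z * ∫ y, rescale φ r z y * f y * w y := by
    rw [← integral_mul_dens hm]
    simp only [interp, Finset.sum_mul]
    rw [integral_finsetSum]
    · refine Finset.sum_congr rfl fun z _ => ?_
      rw [← integral_const_mul]
      congr 1; funext x; ring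
    · intro z _
      refine ((hφfw z).const_mul (coeff η r u z)).congr (ae_of_all _ fun x => ?_)
      simp only [hw]; ring
  have e2 : ∫ x, u x * interp η φ r Z f x * κ x ∂m =
      ∑ z ∈ Z, coeff φ r f z * ∫ x, rescale η r z x * u x * w x := by
    rw [← integral_mul_dens hm]
    simp only [interp, Finset.mul_sum, Finset.sum_mul]
    rw [integral_finsetSum]
    · refine Finset.sum_congr rfl fun z _ => ?_
      rw [← integral_const_mul]
      congr 1; funext x; ring
    · intro z _
      refine ((huw z).const_mul (coeff φ r f z)).congr (ae_of_all _ fun x => ?_)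
      simp only [hw]; ring
  have hrd : 0 < (r ^ d)⁻¹ := by positivity
  have hterm : ∀ z, |coeff η r u z * (∫ y, rescale φ r z y * f y * w y) -
      coeff φ r f z * ∫ x, rescale η r z x * u x * w x| ≤
      B * ((r ^ d)⁻¹ * ∫ x, |u x| * (rescale η r z x * q z x)) := by
    intro z
    -- Both products are double integrals of `η(x) u(x) φ(y) f(y)`, one with the factor `w y` and
    -- the other with `w x`. Only the increment of the density remains, and this is what the
    -- residual measures.
    have e3 : coeff η r u z * (∫ y, rescale φ r z y * f y * w y) -
        coeff φ r f z * ∫ x, rescale η r z x * u x * w x =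
        (r ^ d)⁻¹ * ∫ x, rescale η r z x * u x *
          ∫ y, rescale φ r z y * f y * (w y - w x) := by
      have : ∀ x, ∫ y, rescale φ r z y * f y * (w y - w x) =
          (∫ y, rescale φ r z y * f y * w y) - (∫ y, rescale φ r z y * f y) * w x := by
        intro x
        rw [← integral_mul_const, ← integral_sub (hφfw z) ((hφf z).mul_const _)]
        congr 1; funext y; ring
      simp only [this]
      simp only [mul_sub]
      rw [integral_sub ((hui z).mul_const _)]
      · rw [integral_mul_const]
        have : ∫ x, rescale η r z x * u x * ((∫ y, rescale φ r z y * f y) * w x) =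
            (∫ y, rescale φ r z y * f y) * ∫ x, rescale η r z x * u x * w x := by
          rw [← integral_const_mul]
          congr 1; funext x; ring
        rw [this]
        simp only [coeff]
        ring
      · refine ((huw z).const_mul (∫ y, rescale φ r z y * f y)).congr (ae_of_all _ fun x => ?_)
        simp only; ring
    rw [e3, abs_mul, abs_of_pos hrd, mul_left_comm]
    refine mul_le_mul_of_nonneg_left ?_ hrd.le
    rw [← integral_const_mul]
    refine abs_integral_le_integral_abs.trans ?_
    refine integral_mono_of_nonneg (ae_of_all _ fun x => abs_nonneg _) ((huq z).const_mul B)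
      (ae_of_all _ fun x => ?_)
    have hin : |∫ y, rescale φ r z y * f y * (w y - w x)| ≤ B * q z x := by
      rw [hq, ← integral_const_mul]
      refine abs_integral_le_integral_abs.trans ?_
      refine integral_mono_of_nonneg (ae_of_all _ fun y => abs_nonneg _) ((hqi z x).const_mul B)
        (ae_of_all _ fun y => ?_)
      have h0 := (hφ.rescale_mem_Icc r z y).1
      simp only
      rw [abs_mul, abs_mul, abs_of_nonneg h0, abs_sub_comm]
      calc rescale φ r z y * |f y| * |w x - w y| ≤ rescale φ r z y * B * |w x - w y| := by
            have := hB y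
            gcongr
        _ = _ := by ring
    have h0 := (hη.rescale_mem_Icc r z x).1
    simp only
    rw [abs_mul, abs_mul, abs_of_nonneg h0]
    calc rescale η r z x * |u x| * |∫ y, rescale φ r z y * f y * (w y - w x)| ≤
        rescale η r z x * |u x| * (B * q z x) := by gcongr
      _ = _ := by ring
  have hres : ∫ x, |u x| * residual η φ r w x =
      ∑ z ∈ Z, (r ^ d)⁻¹ * ∫ x, |u x| * (rescale η r z x * q z x) := by
    have hpt : ∀ x, |u x| * residual η φ r w x =
        ∑ z ∈ Z, (r ^ d)⁻¹ * (|u x| * (rescale η r z x * q z x)) := by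
      intro x
      by_cases hx : ‖x‖ ≤ R
      · rw [residual, tsum_eq_sum (s := Z) fun z hz => by
          rw [hη.rescale_eq_zero hr hx hz, mul_zero], Finset.mul_sum]
        refine Finset.sum_congr rfl fun z _ => ?_
        simp only [hq]; ring
      · rw [huR x (not_le.1 hx)]; simp
    simp only [hpt]
    rw [integral_finsetSum _ fun z _ => (huq z).const_mul _]
    simp only [integral_const_mul]
  have hE : |(∫ x, interp φ η r Z u x * f x * κ x ∂m) -
      ∫ x, u x * interp η φ r Z f x * κ x ∂m| ≤ B * ∫ x, |u x| * residual η φ r w x := by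
    rw [e1, e2, ← Finset.sum_sub_distrib, hres, Finset.mul_sum]
    exact (Finset.abs_sum_le_sum_abs _ _).trans (Finset.sum_le_sum fun z _ => hterm z)
  have hδ : ENNReal.ofReal |∫ x, |u x| * residual η φ r w x| / eLpNorm u 2 m ≤
      deltaConst κ r m := by
    have hn : eLpNorm u 2 m = eLpNorm (fun x => |u x|) 2 m := (eLpNorm_norm u).symm
    rw [hn]
    exact le_iSup₂_of_le η hη <| le_iSup₂_of_le φ hφ <| le_iSup₂_of_le (fun x => |u x|) hu.abs <|
      le_iSup_of_le ⟨A, fun x => by rw [abs_abs]; exact hA x⟩ le_rfl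
  calc _ ≤ ENNReal.ofReal (B * |∫ x, |u x| * residual η φ r w x|) / eLpNorm u 2 m := by
        refine ENNReal.div_le_div_right (ENNReal.ofReal_le_ofReal (hE.trans ?_)) _
        exact mul_le_mul_of_nonneg_left (le_abs_self _) hB0
    _ = ENNReal.ofReal B * (ENNReal.ofReal |∫ x, |u x| * residual η φ r w x| / eLpNorm u 2 m) := by
        rw [ENNReal.ofReal_mul hB0, mul_div_assoc]
    _ ≤ _ := by gcongr

end FiberEstimates

/-! ### Pairings of conditional expectations along converging measures -/

section Pairing

/-- Bounded measurable functions are integrable with respect to finite measures. -/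
lemma integrable_of_abs_le {α : Type*} [MeasurableSpace α] {μ : Measure α} [IsFiniteMeasure μ]
    {f : α → ℝ} (hf : Measurable f) {C : ℝ} (hC : ∀ x, |f x| ≤ C) : Integrable f μ :=
  Integrable.of_bound hf.aestronglyMeasurable C (ae_of_all _ hC)

lemma integral_sq_le_of_eLpNorm_le {α : Type*} [MeasurableSpace α] {μ : Measure α} {f : α → ℝ}
    (hf : AEStronglyMeasurable f μ) {ε : ℝ} (hε : 0 ≤ ε)
    (h : eLpNorm f 2 μ ≤ ENNReal.ofReal ε) : ∫ x, f x ^ 2 ∂μ ≤ ε ^ 2 := by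
  have h2 : ∫⁻ x, ENNReal.ofReal (f x ^ 2) ∂μ ≤ ENNReal.ofReal (ε ^ 2) := by
    have e : eLpNorm f 2 μ ^ (2 : ℝ) = ∫⁻ x, ENNReal.ofReal (f x ^ 2) ∂μ := by
      rw [eLpNorm_eq_lintegral_rpow_enorm_toReal (by norm_num) (by norm_num)]
      simp only [ENNReal.toReal_ofNat]
      rw [← ENNReal.rpow_mul]
      norm_num
      refine lintegral_congr fun x => ?_
      rw [← ofReal_norm, ← ENNReal.ofReal_pow (norm_nonneg _), Real.norm_eq_abs, sq_abs]
    rw [← e]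
    calc eLpNorm f 2 μ ^ (2 : ℝ) ≤ ENNReal.ofReal ε ^ (2 : ℝ) := by gcongr
      _ = ENNReal.ofReal (ε ^ 2) := by
        rw [ENNReal.ofReal_rpow_of_nonneg hε (by norm_num)]; norm_num
  rw [integral_eq_lintegral_of_nonneg_ae (ae_of_all _ fun x => sq_nonneg _) (hf.pow 2)]
  exact ENNReal.toReal_le_of_le_ofReal (sq_nonneg _) h2

/-- Bounded continuous functions are dense in a weighted `L²` space. -/
lemma exists_bcf_integral_sq_sub_le {α : Type*} [TopologicalSpace α] [PolishSpace α]
    [MeasurableSpace α] [BorelSpace α] {μ : Measure α} [IsFiniteMeasure μ] {κ : α → ℝ}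
    (hκ : Measurable κ) (h01 : ∀ x, κ x ∈ Set.Icc (0 : ℝ) 1) {y : α → ℝ} (hy : Measurable y)
    (hy2 : Integrable (fun x => y x ^ 2 * κ x) μ) {ε : ℝ} (hε : 0 < ε) :
    ∃ Y : α →ᵇ ℝ, Integrable (fun x => (y x - Y x) ^ 2 * κ x) μ ∧
      ∫ x, (y x - Y x) ^ 2 * κ x ∂μ ≤ ε ^ 2 := by
  set μκ := μ.withDensity fun x => ENNReal.ofReal (κ x) with hμκ
  have : IsFiniteMeasure μκ := isFiniteMeasure_withDensity_ofReal
    (integrable_of_abs_le hκ (C := 1) fun x => by rw [abs_of_nonneg (h01 x).1]; exact (h01 x).2).2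
  have hint : ∀ f : α → ℝ, Integrable f μκ ↔ Integrable (fun x => f x * κ x) μ := by
    intro f
    rw [hμκ, integrable_withDensity_iff hκ.ennreal_ofReal (ae_of_all _ fun _ => by simp)]
    simp only [ENNReal.toReal_ofReal (h01 _).1]
  have hmem : MemLp y 2 μκ := by
    rw [memLp_two_iff_integrable_sq hy.aestronglyMeasurable, hint]
    exact hy2
  obtain ⟨Y, hY, hYm⟩ := hmem.exists_boundedContinuous_eLpNorm_sub_le (by norm_num)
    (ε := ENNReal.ofReal ε) (by simpa using hε)
  refine ⟨Y, ?_, ?_⟩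
  · rw [← hint]
    have := (hmem.sub hYm)
    rw [memLp_two_iff_integrable_sq (hmem.sub hYm).1] at this
    exact this
  · have := integral_sq_le_of_eLpNorm_le (hmem.sub hYm).1 hε.le hY
    rw [hμκ, integral_withDensity_eq_integral_toReal_smul hκ.ennreal_ofReal
      (ae_of_all _ fun _ => by simp)] at this
    refine le_of_eq_of_le ?_ this
    congr 1; funext x
    simp only [ENNReal.toReal_ofReal (h01 _).1, Pi.sub_apply, smul_eq_mul]
    ring

/-- Pointwise Young inequality behind the pairing estimate. -/
lemma abs_mul_le_young {c Γ h f a t τ : ℝ} (h0 : 0 ≤ h) (hΓ : |Γ| ≤ a * h) (hf : |f| ≤ a)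
    (ht : 0 < t) (hτ : 0 < τ) :
    |c * Γ| ≤ t * (c ^ 2 * h) +
      (2 * t)⁻¹ * (f ^ 2 * h + 4 * a ^ 2 * τ + τ⁻¹ * (Γ - f * h) ^ 2) := by
  have ha : 0 ≤ a := (abs_nonneg _).trans hf
  set D := Γ - f * h with hD
  have hDle : |D| ≤ 2 * a * h := by
    calc |D| ≤ |Γ| + |f * h| := abs_sub _ _
      _ ≤ a * h + a * h := by
        rw [abs_mul, abs_of_nonneg h0]
        exact add_le_add hΓ (mul_le_mul_of_nonneg_right hf h0)
      _ = 2 * a * h := by ring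
  have young : ∀ x y : ℝ, |x * y| ≤ t / 2 * x ^ 2 + (2 * t)⁻¹ * y ^ 2 := by
    intro x y
    have h1 : 0 ≤ (2 * t)⁻¹ * (t * |x| - |y|) ^ 2 := by positivity
    have h2 : (2 * t)⁻¹ * (t * |x| - |y|) ^ 2 =
        t / 2 * x ^ 2 + (2 * t)⁻¹ * y ^ 2 - |x| * |y| := by
      rw [← sq_abs x, ← sq_abs y]
      field_simp
      ring
    rw [abs_mul]
    linarith
  have h1 : |c * (f * h)| ≤ t / 2 * (c ^ 2 * h) + (2 * t)⁻¹ * (f ^ 2 * h) := by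
    have := mul_le_mul_of_nonneg_right (young c f) h0
    rw [← mul_assoc, abs_mul, abs_of_nonneg h0]
    linarith
  have h2 : |c * D| ≤ t / 2 * (c ^ 2 * h) + (2 * t)⁻¹ * (4 * a ^ 2 * τ + τ⁻¹ * D ^ 2) := by
    rcases h0.eq_or_lt with hz | hpos
    · have : D = 0 := by
        rw [← hz, mul_zero] at hDle
        exact abs_nonpos_iff.1 hDle
      rw [this, ← hz]
      simp
      positivity
    · have hs : 0 < Real.sqrt h := Real.sqrt_pos.2 hpos
      have hy := young (c * Real.sqrt h) (D / Real.sqrt h)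
      have e1 : c * Real.sqrt h * (D / Real.sqrt h) = c * D := by field_simp
      have e2 : (c * Real.sqrt h) ^ 2 = c ^ 2 * h := by rw [mul_pow, Real.sq_sqrt h0]
      have e3 : (D / Real.sqrt h) ^ 2 = D ^ 2 / h := by rw [div_pow, Real.sq_sqrt h0]
      rw [e1, e2, e3] at hy
      refine hy.trans (add_le_add le_rfl (mul_le_mul_of_nonneg_left ?_ (by positivity)))
      -- Where `h` is small, `D ^ 2 / h` cannot be bounded through `D ^ 2`; there `|D| ≤ 2 a h`
      -- makes it at most `4 a ^ 2 τ`. Above the threshold, `h` is simply replaced by `τ`.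
      rcases le_total h τ with hle | hle
      · have hD2 : D ^ 2 ≤ (2 * a * h) ^ 2 := sq_le_sq' (by linarith [abs_le.1 hDle]) (abs_le.1 hDle).2
        have : D ^ 2 / h ≤ 4 * a ^ 2 * τ := by
          rw [div_le_iff₀ hpos]
          nlinarith [mul_nonneg (mul_nonneg (sq_nonneg a) h0) (sub_nonneg.2 hle)]
        have h3 : 0 ≤ τ⁻¹ * D ^ 2 := by positivity
        linarith
      · have : D ^ 2 / h ≤ τ⁻¹ * D ^ 2 := by
          rw [div_eq_inv_mul]
          exact mul_le_mul_of_nonneg_right (inv_anti₀ hτ hle) (sq_nonneg _)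
        have h3 : 0 ≤ 4 * a ^ 2 * τ := by positivity
        linarith
  have e : c * Γ = c * (f * h) + c * D := by rw [hD]; ring
  rw [e]
  refine (abs_add_le _ _).trans ((add_le_add h1 h2).trans (le_of_eq ?_))
  ring

variable {S : Type*} [MeasurableSpace S] {d : ℕ}

/-- The conditional expectation of a bounded measurable function is measurable. -/
lemma measurable_fiberIntegral (μ : Measure (S × (Fin d → ℝ))) [IsFiniteMeasure μ]
    {g : S × (Fin d → ℝ) → ℝ} (hg : Measurable g) :
    Measurable fun s => ∫ x, g (s, x) ∂μ.condKernel s :=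
  (hg.stronglyMeasurable.integral_kernel_prod_right').measurable

lemma abs_fiberIntegral_le (μ : Measure (S × (Fin d → ℝ))) [IsFiniteMeasure μ]
    {g : S × (Fin d → ℝ) → ℝ} {C : ℝ} (hC : ∀ p, |g p| ≤ C) (s : S) :
    |∫ x, g (s, x) ∂μ.condKernel s| ≤ C := by
  have := norm_integral_le_of_norm_le_const (μ := μ.condKernel s) (f := fun x => g (s, x)) (C := C)
    (ae_of_all _ fun x => hC (s, x))
  simpa using this

variable [TopologicalSpace S] [PolishSpace S] [BorelSpace S]

/-- The pairing of bounded coefficients with conditional expectations is asymptotically controlled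
by the limit of the conditional expectations. -/
lemma eventually_abs_pairing_le {M : ℕ → Measure (S × (Fin d → ℝ))}
    [∀ N, IsProbabilityMeasure (M N)] {M' : Measure (S × (Fin d → ℝ))} [IsProbabilityMeasure M']
    (hM : ∀ g : (S × (Fin d → ℝ)) →ᵇ ℝ,
      Tendsto (fun N => ∫ p, g p ∂M N) atTop (𝓝 (∫ p, g p ∂M')))
    (hD : DisintegrationConv M M') {l : Filter ℕ} (hl : l ≤ atTop)
    {H γ : (S × (Fin d → ℝ)) →ᵇ ℝ} (hH : ∀ p, 0 ≤ H p) {a : ℝ} (ha : 0 ≤ a)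
    (hγ : ∀ p, |γ p| ≤ a * H p) {c : ℕ → S → ℝ} (hc : ∀ N, Measurable (c N))
    (hcb : ∀ N, ∃ C, ∀ s, |c N s| ≤ C) {B : ℝ}
    (hB : ∀ᶠ N in l, ∫ s, c N s ^ 2 * ∫ x, H (s, x) ∂(M N).condKernel s ∂(M N).fst ≤ B)
    {T : ℝ} (hT : ∫ s, (∫ x, γ (s, x) ∂M'.condKernel s) ^ 2 /
      (∫ x, H (s, x) ∂M'.condKernel s) ∂M'.fst ≤ T) {t e : ℝ} (ht : 0 < t) (he : 0 < e) :
    ∀ᶠ N in l, |∫ s, c N s * ∫ x, γ (s, x) ∂(M N).condKernel s ∂(M N).fst| ≤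
      t * B + (2 * t)⁻¹ * T + e := by
  set b := ‖H‖ with hb
  have hHb : ∀ p, |H p| ≤ b := fun p => H.norm_coe_le_norm p
  have hb0 : 0 ≤ b := norm_nonneg _
  have hHm : Measurable H := H.continuous.measurable
  have hγm : Measurable γ := γ.continuous.measurable
  have hγb : ∀ p, |γ p| ≤ ‖γ‖ := fun p => γ.norm_coe_le_norm p
  -- general facts on conditional expectations
  have hfib : ∀ (μ : Measure (S × (Fin d → ℝ))) [IsProbabilityMeasure μ] (s : S),
      0 ≤ ∫ x, H (s, x) ∂μ.condKernel s ∧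
      |∫ x, γ (s, x) ∂μ.condKernel s| ≤ a * ∫ x, H (s, x) ∂μ.condKernel s := by
    intro μ _ s
    refine ⟨integral_nonneg fun x => hH _, ?_⟩
    rw [← integral_const_mul]
    refine abs_integral_le_integral_abs.trans (integral_mono ?_ ?_ fun x => hγ (s, x))
    · exact (integrable_of_abs_le (hγm.comp measurable_prodMk_left) fun x => hγb (s, x)).abs
    · exact (integrable_of_abs_le (hHm.comp measurable_prodMk_left) fun x => hHb (s, x)).const_mul a
  set h' : S → ℝ := fun s => ∫ x, H (s, x) ∂M'.condKernel s with hh'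
  set Γ' : S → ℝ := fun s => ∫ x, γ (s, x) ∂M'.condKernel s with hΓ'
  have hh'm : Measurable h' := measurable_fiberIntegral M' hHm
  have hΓ'm : Measurable Γ' := measurable_fiberIntegral M' hγm
  have hh'0 : ∀ s, 0 ≤ h' s := fun s => (hfib M' s).1
  have hh'b : ∀ s, h' s ≤ b := fun s => (le_abs_self _).trans (abs_fiberIntegral_le M' hHb s)
  -- If `g` were continuous, one would write `c Γ ≈ c g h` and apply Young's inequality with weight
  -- `h`. It is only measurable, so a continuous function has to replace it. The value `0` at zeros
  -- of `h'` does no harm, since `Γ'` vanishes there.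
  set g : S → ℝ := fun s => Γ' s / h' s with hg
  have hgm : Measurable g := hΓ'm.div hh'm
  have hgb : ∀ s, |g s| ≤ a := by
    intro s
    rw [hg, abs_div, abs_of_nonneg (hh'0 s)]
    exact div_le_of_le_mul₀ (hh'0 s) ha (hfib M' s).2
  have hgh : ∀ s, g s * h' s = Γ' s := by
    intro s
    by_cases hz : h' s = 0
    · have := (hfib M' s).2
      change |Γ' s| ≤ a * h' s at this
      rw [hz, mul_zero] at this
      rw [hz, mul_zero, abs_nonpos_iff.1 this]
    · exact div_mul_cancel₀ _ hz
  -- the accuracy of the approximation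
  set K := (2 * t)⁻¹ * (4 * a * b + 4 * a ^ 2 + b ^ 2) with hK
  have hK0 : 0 ≤ K := by positivity
  obtain ⟨ε, hε, hKε⟩ : ∃ ε > 0, K * ε < e / 2 := by
    refine ⟨e / (4 * (K + 1)), by positivity, ?_⟩
    rw [mul_div_assoc', div_lt_iff₀ (by positivity)]
    nlinarith
  have hg2 : Integrable (fun s => g s ^ 2) M'.fst :=
    integrable_of_abs_le (hgm.pow_const 2) (C := a ^ 2) fun s => by
      rw [abs_pow]
      exact pow_le_pow_left₀ (abs_nonneg _) (hgb s) 2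
  obtain ⟨f₀, -, hf₀⟩ := exists_bcf_integral_sq_sub_le (μ := M'.fst) (κ := fun _ => 1)
    measurable_const (fun _ => by simp) hgm (by simpa using hg2) hε
  -- Truncation at `± a` does not increase the distance to `g`, which takes values in `[-a, a]`, and
  -- it supplies the pointwise bound on the multiplier required by `abs_mul_le_young`.
  let f : S →ᵇ ℝ := BoundedContinuousFunction.ofNormedAddCommGroup
    (fun s => max (-a) (min (f₀ s) a)) (by fun_prop) a fun s => by
      rw [Real.norm_eq_abs, abs_le]
      exact ⟨le_max_left _ _, max_le (by linarith) (min_le_right _ _)⟩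
  have hfa : ∀ s, |f s| ≤ a := fun s => abs_le.2
    ⟨le_max_left _ _, max_le (by linarith) (min_le_right _ _)⟩
  have hfg : ∀ s, |g s - f s| ≤ |g s - f₀ s| := by
    intro s
    have h1 := abs_le.1 (hgb s)
    have e1 : g s = max (-a) (min (g s) a) := by
      rw [min_eq_left h1.2, max_eq_right h1.1]
    have e2 : f s = max (-a) (min (f₀ s) a) := rfl
    rw [e2]
    conv_lhs => rw [e1]
    calc |max (-a) (min (g s) a) - max (-a) (min (f₀ s) a)| ≤ |min (g s) a - min (f₀ s) a| := by
          rw [max_comm (-a), max_comm (-a)]; exact abs_max_sub_max_le_abs _ _ _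
      _ ≤ max |g s - f₀ s| |a - a| := abs_min_sub_min_le_max _ _ _ _
      _ = |g s - f₀ s| := by simp
  have hfm : Measurable f := f.continuous.measurable
  have hi1 : Integrable (fun s => (g s - f s) ^ 2) M'.fst :=
    integrable_of_abs_le ((hgm.sub hfm).pow_const 2) (C := (2 * a) ^ 2) fun s => by
      rw [abs_pow]
      refine pow_le_pow_left₀ (abs_nonneg _) ?_ 2
      calc |g s - f s| ≤ |g s| + |f s| := abs_sub _ _
        _ ≤ 2 * a := by linarith [hgb s, hfa s]
  have hsq : ∫ s, (g s - f s) ^ 2 ∂M'.fst ≤ ε ^ 2 := by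
    refine le_trans (integral_mono hi1 ?_ fun s => ?_) hf₀
    · simp only [mul_one]
      refine integrable_of_abs_le ((hgm.sub f₀.continuous.measurable).pow_const 2)
        (C := (a + ‖f₀‖) ^ 2) fun s => ?_
      rw [abs_pow]
      refine pow_le_pow_left₀ (abs_nonneg _) ?_ 2
      calc |g s - f₀ s| ≤ |g s| + |f₀ s| := abs_sub _ _
        _ ≤ a + ‖f₀‖ := add_le_add (hgb s) (f₀.norm_coe_le_norm s)
    · simp only [mul_one]
      exact sq_le_sq.2 (hfg s)
  -- limits of the two error terms
  let F : (S × (Fin d → ℝ)) →ᵇ ℝ := f.compContinuous ⟨Prod.fst, continuous_fst⟩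
  have lim1 := hM (F * F * H)
  -- Convergence of squared conditional expectations enters here: `γ - F * H` has the conditional
  -- expectation `Γ - f h`, so the mean square of this error converges to its value for the limit
  -- measure.
  have lim2 := hD (γ - F * H)
  have split : ∀ (μ : Measure (S × (Fin d → ℝ))) [IsProbabilityMeasure μ] (s : S),
      ∫ x, (γ - F * H) (s, x) ∂μ.condKernel s =
        (∫ x, γ (s, x) ∂μ.condKernel s) - f s * ∫ x, H (s, x) ∂μ.condKernel s := by
    intro μ _ s
    rw [← integral_const_mul, ← integral_sub]
    · rfl
    · exact integrable_of_abs_le (hγm.comp measurable_prodMk_left) fun x => hγb (s, x)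
    · exact (integrable_of_abs_le (hHm.comp measurable_prodMk_left) fun x => hHb (s, x)).const_mul _
  have split1 : ∀ (μ : Measure (S × (Fin d → ℝ))) [IsProbabilityMeasure μ],
      ∫ p, (F * F * H) p ∂μ = ∫ s, f s ^ 2 * ∫ x, H (s, x) ∂μ.condKernel s ∂μ.fst := by
    intro μ _
    rw [← Measure.integral_condKernel (BoundedContinuousFunction.integrable _ _)]
    congr 1; funext s
    rw [← integral_const_mul]
    congr 1; funext x
    change f s * f s * H (s, x) = _
    ring
  simp only [split1] at lim1
  simp only [split] at lim2
  have b1 : ∫ s, f s ^ 2 * h' s ∂M'.fst ≤ T + 4 * a * b * ε := by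
    have hint : Integrable (fun s => g s ^ 2 * h' s) M'.fst :=
      integrable_of_abs_le ((hgm.pow_const 2).mul hh'm) (C := a ^ 2 * b) fun s => by
        rw [abs_mul, abs_pow, abs_of_nonneg (hh'0 s)]
        exact mul_le_mul (pow_le_pow_left₀ (abs_nonneg _) (hgb s) 2) (hh'b s) (hh'0 s)
          (by positivity)
    have hpt : ∀ s, f s ^ 2 * h' s ≤ g s ^ 2 * h' s +
        2 * a * b * (ε + ε⁻¹ * (g s - f s) ^ 2) := by
      intro s
      have h1 : |g s - f s| ≤ ε + ε⁻¹ * (g s - f s) ^ 2 := by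
        rw [← sq_abs (g s - f s)]
        set x := |g s - f s|
        have : 0 ≤ ε⁻¹ * (x - ε) ^ 2 := by positivity
        have e2 : ε⁻¹ * (x - ε) ^ 2 = ε⁻¹ * x ^ 2 - 2 * x + ε := by field_simp; ring
        have : 0 ≤ x := abs_nonneg _
        linarith
      have h2 : f s ^ 2 - g s ^ 2 ≤ 2 * a * |g s - f s| := by
        have e3 : f s ^ 2 - g s ^ 2 = (f s + g s) * (f s - g s) := by ring
        rw [e3]
        refine (le_abs_self _).trans ?_
        rw [abs_mul, abs_sub_comm]
        refine mul_le_mul_of_nonneg_right ?_ (abs_nonneg _)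
        exact (abs_add_le _ _).trans (by linarith [hfa s, hgb s])
      have h3 : (f s ^ 2 - g s ^ 2) * h' s ≤ 2 * a * (ε + ε⁻¹ * (g s - f s) ^ 2) * b := by
        have hA : 0 ≤ 2 * a * (ε + ε⁻¹ * (g s - f s) ^ 2) := by positivity
        calc (f s ^ 2 - g s ^ 2) * h' s ≤ (2 * a * (ε + ε⁻¹ * (g s - f s) ^ 2)) * h' s := by
              refine mul_le_mul_of_nonneg_right (h2.trans ?_) (hh'0 s)
              exact mul_le_mul_of_nonneg_left h1 (by positivity)
          _ ≤ _ := mul_le_mul_of_nonneg_left (hh'b s) hA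
      linarith
    have hint2 : Integrable (fun s => 2 * a * b * (ε + ε⁻¹ * (g s - f s) ^ 2)) M'.fst :=
      ((integrable_const ε).add (hi1.const_mul _)).const_mul _
    calc ∫ s, f s ^ 2 * h' s ∂M'.fst
        ≤ ∫ s, (g s ^ 2 * h' s + 2 * a * b * (ε + ε⁻¹ * (g s - f s) ^ 2)) ∂M'.fst :=
          integral_mono_of_nonneg (ae_of_all _ fun s => mul_nonneg (sq_nonneg _) (hh'0 s))
            (hint.add hint2) (ae_of_all _ hpt)
      _ = (∫ s, g s ^ 2 * h' s ∂M'.fst) +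
          2 * a * b * (ε + ε⁻¹ * ∫ s, (g s - f s) ^ 2 ∂M'.fst) := by
          rw [integral_add hint hint2, integral_const_mul, integral_add (integrable_const _)
            (hi1.const_mul _), integral_const_mul]
          simp
      _ ≤ T + 2 * a * b * (ε + ε⁻¹ * ε ^ 2) := by
          have e4 : ∀ s, g s ^ 2 * h' s = Γ' s ^ 2 / h' s := by
            intro s
            have : g s ^ 2 * h' s = g s * Γ' s := by rw [← hgh s]; ring
            rw [this, hg]; ring
          simp only [e4]
          have : 0 ≤ 2 * a * b := by positivity
          gcongr
      _ = _ := by field_simp; ring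
  have b2 : ∫ s, (Γ' s - f s * h' s) ^ 2 ∂M'.fst ≤ b ^ 2 * ε ^ 2 := by
    have : ∀ s, (Γ' s - f s * h' s) ^ 2 ≤ b ^ 2 * (g s - f s) ^ 2 := by
      intro s
      have e5 : (Γ' s - f s * h' s) ^ 2 = h' s ^ 2 * (g s - f s) ^ 2 := by
        rw [← hgh s]; ring
      rw [e5]
      exact mul_le_mul_of_nonneg_right (pow_le_pow_left₀ (hh'0 s) (hh'b s) 2) (sq_nonneg _)
    calc _ ≤ ∫ s, b ^ 2 * (g s - f s) ^ 2 ∂M'.fst :=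
          integral_mono_of_nonneg (ae_of_all _ fun s => sq_nonneg _) (hi1.const_mul _)
            (ae_of_all _ this)
      _ ≤ _ := by
          rw [integral_const_mul]
          exact mul_le_mul_of_nonneg_left hsq (sq_nonneg _)
  -- the limit of the upper bound
  have lim : Tendsto (fun N => (2 * t)⁻¹ *
      ((∫ s, f s ^ 2 * ∫ x, H (s, x) ∂(M N).condKernel s ∂(M N).fst) + 4 * a ^ 2 * ε + ε⁻¹ *
        ∫ s, ((∫ x, γ (s, x) ∂(M N).condKernel s) -
          f s * ∫ x, H (s, x) ∂(M N).condKernel s) ^ 2 ∂(M N).fst)) l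
      (𝓝 ((2 * t)⁻¹ * ((∫ s, f s ^ 2 * h' s ∂M'.fst) + 4 * a ^ 2 * ε + ε⁻¹ *
        ∫ s, (Γ' s - f s * h' s) ^ 2 ∂M'.fst))) :=
    (((lim1.add_const _).add (lim2.const_mul _)).const_mul _).mono_left hl
  have hlt : (2 * t)⁻¹ * ((∫ s, f s ^ 2 * h' s ∂M'.fst) + 4 * a ^ 2 * ε + ε⁻¹ *
        ∫ s, (Γ' s - f s * h' s) ^ 2 ∂M'.fst) < (2 * t)⁻¹ * T + e := by
    have : (2 * t)⁻¹ * ((∫ s, f s ^ 2 * h' s ∂M'.fst) + 4 * a ^ 2 * ε + ε⁻¹ *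
        ∫ s, (Γ' s - f s * h' s) ^ 2 ∂M'.fst) ≤
        (2 * t)⁻¹ * ((T + 4 * a * b * ε) + 4 * a ^ 2 * ε + ε⁻¹ * (b ^ 2 * ε ^ 2)) := by
      gcongr
    -- The three summands of `K` correspond to three errors: `4ab` from exchanging `g` for `f` in `∫
    -- f² h'`, `4a²` from the threshold in Young's inequality, `b²` from the mean square distance of
    -- `Γ'` to `f h'`.
    have e6 : (2 * t)⁻¹ * ((T + 4 * a * b * ε) + 4 * a ^ 2 * ε + ε⁻¹ * (b ^ 2 * ε ^ 2)) =
        (2 * t)⁻¹ * T + K * ε := by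
      rw [hK]; field_simp; ring
    linarith
  filter_upwards [hB, lim.eventually (gt_mem_nhds hlt)] with N hBN hlN
  obtain ⟨C, hC⟩ := hcb N
  set h : S → ℝ := fun s => ∫ x, H (s, x) ∂(M N).condKernel s with hh
  set Γ : S → ℝ := fun s => ∫ x, γ (s, x) ∂(M N).condKernel s with hΓ
  have hhm : Measurable h := measurable_fiberIntegral (M N) hHm
  have hΓm : Measurable Γ := measurable_fiberIntegral (M N) hγm
  have hh0 : ∀ s, 0 ≤ h s := fun s => (hfib (M N) s).1
  have hhb : ∀ s, |h s| ≤ b := fun s => abs_fiberIntegral_le (M N) hHb s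
  have hΓb : ∀ s, |Γ s| ≤ ‖γ‖ := fun s => abs_fiberIntegral_le (M N) hγb s
  have i1 : Integrable (fun s => c N s ^ 2 * h s) (M N).fst :=
    integrable_of_abs_le (((hc N).pow_const 2).mul hhm) (C := C ^ 2 * b) fun s => by
      rw [abs_mul, abs_pow]
      exact mul_le_mul (pow_le_pow_left₀ (abs_nonneg _) (hC s) 2) (hhb s) (abs_nonneg _)
        (by positivity)
  have i2 : Integrable (fun s => f s ^ 2 * h s) (M N).fst :=
    integrable_of_abs_le ((hfm.pow_const 2).mul hhm) (C := a ^ 2 * b) fun s => by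
      rw [abs_mul, abs_pow]
      exact mul_le_mul (pow_le_pow_left₀ (abs_nonneg _) (hfa s) 2) (hhb s) (abs_nonneg _)
        (by positivity)
  have i3 : Integrable (fun s => (Γ s - f s * h s) ^ 2) (M N).fst :=
    integrable_of_abs_le ((hΓm.sub (hfm.mul hhm)).pow_const 2) (C := (‖γ‖ + a * b) ^ 2)
      fun s => by
        rw [abs_pow]
        refine pow_le_pow_left₀ (abs_nonneg _) ((abs_sub _ _).trans ?_) 2
        rw [abs_mul]
        exact add_le_add (hΓb s) (mul_le_mul (hfa s) (hhb s) (abs_nonneg _) ha)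
  have i4 : Integrable (fun s => f s ^ 2 * h s + 4 * a ^ 2 * ε + ε⁻¹ * (Γ s - f s * h s) ^ 2)
      (M N).fst := (i2.add (integrable_const _)).add (i3.const_mul _)
  have i5 : Integrable (fun s => f s ^ 2 * h s + 4 * a ^ 2 * ε) (M N).fst :=
    i2.add (integrable_const _)
  calc |∫ s, c N s * Γ s ∂(M N).fst|
      ≤ ∫ s, |c N s * Γ s| ∂(M N).fst := abs_integral_le_integral_abs
    _ ≤ ∫ s, (t * (c N s ^ 2 * h s) + (2 * t)⁻¹ *
          (f s ^ 2 * h s + 4 * a ^ 2 * ε + ε⁻¹ * (Γ s - f s * h s) ^ 2)) ∂(M N).fst :=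
        integral_mono_of_nonneg (ae_of_all _ fun s => abs_nonneg _)
          ((i1.const_mul _).add (i4.const_mul _))
          (ae_of_all _ fun s => abs_mul_le_young (hh0 s) (hfib (M N) s).2 (hfa s) ht hε)
    _ = t * (∫ s, c N s ^ 2 * h s ∂(M N).fst) + (2 * t)⁻¹ *
          ((∫ s, f s ^ 2 * h s ∂(M N).fst) + 4 * a ^ 2 * ε +
            ε⁻¹ * ∫ s, (Γ s - f s * h s) ^ 2 ∂(M N).fst) := by
        rw [integral_add (i1.const_mul _) (i4.const_mul _), integral_const_mul, integral_const_mul,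
          integral_add i5 (i3.const_mul _), integral_add i2 (integrable_const _)]
        simp only [integral_const_mul]
        simp
    _ ≤ t * B + ((2 * t)⁻¹ * T + e) := by
        refine add_le_add (mul_le_mul_of_nonneg_left hBN ht.le) hlN.le
    _ = _ := by ring

end Pairing

/-! ### Fibrewise interpolation on `S × ℝ^d` -/

section FiberInterpolation

variable {d : ℕ}

lemma odrv_eq_zero {R : ℝ} {u : (Fin d → ℝ) → ℝ} (hR : ∀ x, R < ‖x‖ → u x = 0)
    (o : Option (Fin d)) (x : Fin d → ℝ) (hx : R < ‖x‖) : odrv o u x = 0 := by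
  cases o with
  | none => exact hR x hx
  | some i =>
    have : u =ᶠ[𝓝 x] fun _ => 0 := by
      filter_upwards [(isOpen_lt continuous_const continuous_norm).mem_nhds hx] with y hy
      exact hR y hy
    simp only [odrv]
    rw [this.fderiv_eq]; simp

lemma abs_coeff_le {η u : (Fin d → ℝ) → ℝ} (hη : IsPrimal η) {r : ℝ} (hr : 0 < r) {B : ℝ}
    (hB : ∀ x, |u x| ≤ B) (z : Fin d → ℤ) : |coeff η r u z| ≤ B := by
  have hrd : 0 < r ^ d := by positivity
  rw [coeff, abs_mul, abs_of_pos (inv_pos.2 hrd), inv_mul_le_iff₀ hrd, ← hη.integral_rescale hr z,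
    ← integral_mul_const]
  refine abs_integral_le_integral_abs.trans (integral_mono_of_nonneg
    (ae_of_all _ fun x => abs_nonneg _) ((hη.integrable_rescale hr z).mul_const B)
    (ae_of_all _ fun x => ?_))
  have h0 := (hη.rescale_mem_Icc r z x).1
  simp only
  rw [abs_mul, abs_of_nonneg h0]
  exact mul_le_mul_of_nonneg_left (hB x) h0

lemma abs_interp_le {φ η u : (Fin d → ℝ) → ℝ} (hφ : IsPrimal φ) (hη : IsPrimal η) {r : ℝ}
    (hr : 0 < r) {B : ℝ} (hB : ∀ x, |u x| ≤ B) (Z : Finset (Fin d → ℤ)) (x : Fin d → ℝ) :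
    |interp φ η r Z u x| ≤ B := by
  have hB0 : 0 ≤ B := (abs_nonneg _).trans (hB 0)
  calc |interp φ η r Z u x| ≤ ∑ z ∈ Z, |coeff η r u z * rescale φ r z x| :=
        Finset.abs_sum_le_sum_abs _ _
    _ ≤ ∑ z ∈ Z, B * rescale φ r z x := by
        refine Finset.sum_le_sum fun z _ => ?_
        have h0 := (hφ.rescale_mem_Icc r z x).1
        rw [abs_mul, abs_of_nonneg h0]
        exact mul_le_mul_of_nonneg_right (abs_coeff_le hη hr hB z) h0
    _ ≤ B := by
        rw [← Finset.mul_sum]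
        exact mul_le_of_le_one_right hB0 (hφ.sum_rescale_le_one hr Z x)

variable {S : Type*} [MeasurableSpace S]

/-- The function itself for `none` and its `i`-th partial derivative in the second variable for
`some i`. -/
def gdrv (o : Option (Fin d)) (v : S × (Fin d → ℝ) → ℝ) (p : S × (Fin d → ℝ)) : ℝ :=
  odrv o (fun x => v (p.1, x)) p.2

lemma FiberC1.measurable_gdrv {v : S × (Fin d → ℝ) → ℝ} (hv : FiberC1 v) (o : Option (Fin d)) :
    Measurable (gdrv o v) := by
  cases o with
  | none => exact hv.measurable
  | some i => exact hv.measurable_xderiv i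

lemma FiberC1.exists_gdrv_bound {v : S × (Fin d → ℝ) → ℝ} (hv : FiberC1 v) :
    ∃ C, ∀ o p, |gdrv o v p| ≤ C := by
  obtain ⟨C, hC⟩ := hv.bdd
  obtain ⟨D, hD⟩ := hv.bdd_deriv
  refine ⟨max C D, fun o p => ?_⟩
  cases o with
  | none => exact (hC p).trans (le_max_left _ _)
  | some i => exact (hD i p).trans (le_max_right _ _)

/-- Nodal coefficients of the sections of a function on `S × ℝ^d`. -/
def xcoeff (η : (Fin d → ℝ) → ℝ) (r : ℝ) (u : S × (Fin d → ℝ) → ℝ) (z : Fin d → ℤ) (s : S) : ℝ :=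
  coeff η r (fun x => u (s, x)) z

/-- The interpolation of the `o`-derivative of the sections of `u`. -/
def xinterp (o : Option (Fin d)) (r R : ℝ) (u : S × (Fin d → ℝ) → ℝ) (p : S × (Fin d → ℝ)) : ℝ :=
  interp (outerSpline o) (innerSpline o) r (nodes d R r) (odrv o fun x => u (p.1, x)) p.2

/-- The transposed interpolation of the sections of `Y`. -/
def xdual (o : Option (Fin d)) (r R : ℝ) (Y : S × (Fin d → ℝ) → ℝ) (p : S × (Fin d → ℝ)) : ℝ :=
  interp (innerSpline o) (outerSpline o) r (nodes d R r) (fun x => Y (p.1, x)) p.2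

lemma measurable_xcoeff {η : (Fin d → ℝ) → ℝ} (hη : IsPrimal η) (r : ℝ)
    {u : S × (Fin d → ℝ) → ℝ} (hu : Measurable u) (z : Fin d → ℤ) :
    Measurable (xcoeff η r u z) := by
  have : StronglyMeasurable fun p : S × (Fin d → ℝ) => rescale η r z p.2 * u p :=
    (((measurable_rescale hη.measurable r z).comp measurable_snd).mul hu).stronglyMeasurable
  exact (this.integral_prod_right' (ν := volume)).measurable.const_mul _

lemma measurable_interp_section {φ η : (Fin d → ℝ) → ℝ} (hφ : IsPrimal φ) (hη : IsPrimal η) (r : ℝ)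
    (Z : Finset (Fin d → ℤ)) {u : S × (Fin d → ℝ) → ℝ} (hu : Measurable u) :
    Measurable fun p : S × (Fin d → ℝ) => interp φ η r Z (fun x => u (p.1, x)) p.2 :=
  Finset.measurable_sum _ fun z _ => ((measurable_xcoeff hη r hu z).comp measurable_fst).mul
    ((measurable_rescale hφ.measurable r z).comp measurable_snd)

lemma measurable_xinterp {u : S × (Fin d → ℝ) → ℝ} (hu : FiberC1 u) (o : Option (Fin d))
    (r R : ℝ) : Measurable (xinterp o r R u) :=
  measurable_interp_section (isPrimal_outer o) (isPrimal_inner o) r (nodes d R r)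
    (hu.measurable_gdrv o)

lemma measurable_xdual {Y : S × (Fin d → ℝ) → ℝ} (hY : Measurable Y) (o : Option (Fin d))
    (r R : ℝ) : Measurable (xdual o r R Y) :=
  measurable_interp_section (isPrimal_inner o) (isPrimal_outer o) r (nodes d R r) hY

/-- The interpolated derivatives are the derivatives of one interpolation. The coefficients depend
only on `s` and are the same for every `o`, which produces the product structure needed to use
orthogonality. -/
lemma xinterp_eq {u : S × (Fin d → ℝ) → ℝ} (hu : FiberC1 u) {r R : ℝ} (hr : 0 < r)
    (hR : ∀ s x, R < ‖x‖ → u (s, x) = 0) (o : Option (Fin d)) (p : S × (Fin d → ℝ)) :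
    xinterp o r R u p = ∑ z ∈ nodes d R r, xcoeff (innerSpline none) r u z p.1 *
      odrv o (rescale (outerSpline none) r z) p.2 :=
  (sum_coeff_odrv hr (hu.contDiff p.1) (hR p.1) o p.2).symm

variable {μ : Measure (S × (Fin d → ℝ))} [IsProbabilityMeasure μ] {κ : S × (Fin d → ℝ) → ℝ}
  {u : S × (Fin d → ℝ) → ℝ} {r R : ℝ}

lemma integral_sq_xinterp_le (hac : ∀ᵐ s ∂μ.fst, μ.condKernel s ≪ volume) (hκ : Measurable κ)
    (h01 : ∀ p, κ p ∈ Set.Icc (0 : ℝ) 1) (hr : 0 < r) (hu : FiberC1 u)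
    (hR : ∀ s x, R < ‖x‖ → u (s, x) = 0) {C : ℝ} (hC0 : 0 ≤ C)
    (hC : ∀ᵐ s ∂μ.fst, pertConst (fun x => κ (s, x)) r (μ.condKernel s) ≤ ENNReal.ofReal C)
    (o : Option (Fin d)) :
    ∫ p, xinterp o r R u p ^ 2 * κ p ∂μ ≤ C * ∫ p, gdrv o u p ^ 2 ∂μ := by
  obtain ⟨B, hB⟩ := hu.exists_gdrv_bound
  have hκ1 : ∀ p, |κ p| ≤ 1 := fun p => by rw [abs_of_nonneg (h01 p).1]; exact (h01 p).2
  have hW : ∀ p, |xinterp o r R u p ^ 2 * κ p| ≤ B ^ 2 * 1 := fun p => by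
    rw [abs_mul, abs_pow]
    refine mul_le_mul (pow_le_pow_left₀ (abs_nonneg _) ?_ 2) (hκ1 p) (abs_nonneg _) (by positivity)
    exact abs_interp_le (isPrimal_outer o) (isPrimal_inner o) hr (fun x => hB o (p.1, x)) _ _
  have hWi : Integrable (fun p => xinterp o r R u p ^ 2 * κ p) μ :=
    integrable_of_abs_le (((measurable_xinterp hu o r R).pow_const 2).mul hκ) hW
  have hGm := (hu.measurable_gdrv o).pow_const 2
  have hG : ∀ p, |gdrv o u p ^ 2| ≤ B ^ 2 := fun p => by
    rw [abs_pow]; exact pow_le_pow_left₀ (abs_nonneg _) (hB o p) 2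
  have hGi : Integrable (fun p => gdrv o u p ^ 2) μ := integrable_of_abs_le hGm hG
  rw [← Measure.integral_condKernel hWi, ← Measure.integral_condKernel hGi, ← integral_const_mul]
  refine integral_mono_ae ?_ ?_ ?_
  · exact integrable_of_abs_le (measurable_fiberIntegral μ
      (((measurable_xinterp hu o r R).pow_const 2).mul hκ)) (abs_fiberIntegral_le μ hW)
  · exact (integrable_of_abs_le (measurable_fiberIntegral μ hGm)
      (abs_fiberIntegral_le μ hG)).const_mul C
  · filter_upwards [hac, hC] with s hs hCs
    exact integral_sq_interp_le hs (hκ.comp measurable_prodMk_left) (fun x => h01 (s, x)) hr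
      (isPrimal_outer o) (isPrimal_inner o)
      ((hu.measurable_gdrv o).comp (measurable_prodMk_left (x := s))) (fun x => hB o (s, x))
      (odrv_eq_zero (hR s) o) hCs hC0

/-- The weight on the left is the plateau and not the spline itself, because the coefficient will be
paired with all derivatives of the spline and the plateau dominates each of them. -/
lemma integral_sq_xcoeff_le (hac : ∀ᵐ s ∂μ.fst, μ.condKernel s ≪ volume)
    (h01 : ∀ p, κ p ∈ Set.Icc (0 : ℝ) 1) (hr : 0 < r) (hu : FiberC1 u)
    (hR : ∀ s x, R < ‖x‖ → u (s, x) = 0) {C : ℝ} (hC0 : 0 ≤ C)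
    (hC : ∀ᵐ s ∂μ.fst, pertConst (fun x => κ (s, x)) r (μ.condKernel s) ≤ ENNReal.ofReal C)
    {z : Fin d → ℤ} (hz : z ∈ nodes d R r) :
    ∫ s, xcoeff (innerSpline none) r u z s ^ 2 *
      ∫ x, rescale (plateauTensor d) r z x * κ (s, x) ∂μ.condKernel s ∂μ.fst ≤
      C * ∫ p, gdrv none u p ^ 2 ∂μ := by
  obtain ⟨B, hB⟩ := hu.exists_gdrv_bound
  have hGm := (hu.measurable_gdrv none).pow_const 2
  have hG : ∀ p, |gdrv none u p ^ 2| ≤ B ^ 2 := fun p => by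
    rw [abs_pow]; exact pow_le_pow_left₀ (abs_nonneg _) (hB none p) 2
  have hGi : Integrable (fun p => gdrv none u p ^ 2) μ := integrable_of_abs_le hGm hG
  rw [← Measure.integral_condKernel hGi, ← integral_const_mul]
  refine integral_mono_of_nonneg (ae_of_all _ fun s => mul_nonneg (sq_nonneg _) (integral_nonneg
    fun x => mul_nonneg (isPrimal_plateauTensor.rescale_mem_Icc r z x).1 (h01 _).1)) ?_ ?_
  · exact (integrable_of_abs_le (measurable_fiberIntegral μ hGm)
      (abs_fiberIntegral_le μ hG)).const_mul C
  · filter_upwards [hac, hC] with s hs hCs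
    exact coeff_sq_mul_le hs (fun x => h01 (s, x)) hr
      isPrimal_plateauTensor (isPrimal_inner none)
      (hu.measurable.comp (measurable_prodMk_left (x := s))) (fun x => hB none (s, x))
      (hR s) hCs hC0 hz

lemma ennreal_mul_le_young (x y : ℝ≥0∞) {t : ℝ} (ht : 0 < t) :
    x * y ≤ ENNReal.ofReal t * x ^ 2 + ENNReal.ofReal t⁻¹ * y ^ 2 := by
  have ht0 : ENNReal.ofReal t ≠ 0 := by simpa using ht
  have hinv : ENNReal.ofReal t⁻¹ = (ENNReal.ofReal t)⁻¹ := ENNReal.ofReal_inv_of_pos ht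
  rcases le_total y (ENNReal.ofReal t * x) with h | h
  · refine le_trans ?_ le_self_add
    calc x * y ≤ x * (ENNReal.ofReal t * x) := by gcongr
      _ = _ := by ring
  · refine le_trans ?_ le_add_self
    have : x ≤ (ENNReal.ofReal t)⁻¹ * y := by
      calc x = (ENNReal.ofReal t)⁻¹ * (ENNReal.ofReal t * x) := by
            rw [← mul_assoc, ENNReal.inv_mul_cancel ht0 ENNReal.ofReal_ne_top, one_mul]
        _ ≤ _ := by gcongr
    calc x * y ≤ ((ENNReal.ofReal t)⁻¹ * y) * y := by gcongr
      _ = _ := by rw [hinv]; ring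

/-- The fibrewise interpolation is symmetric up to a small error. -/
lemma abs_xinterp_duality_le (hac : ∀ᵐ s ∂μ.fst, μ.condKernel s ≪ volume) (hκ : Measurable κ)
    (h01 : ∀ p, κ p ∈ Set.Icc (0 : ℝ) 1) (hr : 0 < r) (hu : FiberC1 u)
    (hR : ∀ s x, R < ‖x‖ → u (s, x) = 0) {D : ℝ} (hD0 : 0 ≤ D)
    (hD : ∫⁻ s, deltaConst (fun x => κ (s, x)) r (μ.condKernel s) ^ 2 ∂μ.fst ≤ ENNReal.ofReal D)
    {Y : S × (Fin d → ℝ) → ℝ} (hY : Measurable Y) {B : ℝ} (hYB : ∀ p, |Y p| ≤ B)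
    (o : Option (Fin d)) {t : ℝ} (ht : 0 < t) :
    |(∫ p, xinterp o r R u p * Y p * κ p ∂μ) - ∫ p, gdrv o u p * xdual o r R Y p * κ p ∂μ| ≤
      t * (∫ p, gdrv o u p ^ 2 ∂μ) + t⁻¹ * (B ^ 2 * D) := by
  obtain ⟨A, hA⟩ := hu.exists_gdrv_bound
  have hκ1 : ∀ p, |κ p| ≤ 1 := fun p => by rw [abs_of_nonneg (h01 p).1]; exact (h01 p).2
  obtain ⟨p₀⟩ : Nonempty (S × (Fin d → ℝ)) := μ.nonempty_of_neZero
  have hA0 : 0 ≤ A := (abs_nonneg _).trans (hA none p₀)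
  have hB0 : 0 ≤ B := (abs_nonneg _).trans (hYB p₀)
  have hWm : Measurable fun p => xinterp o r R u p * Y p * κ p :=
    ((measurable_xinterp hu o r R).mul hY).mul hκ
  have hQm : Measurable fun p => gdrv o u p * xdual o r R Y p * κ p :=
    ((hu.measurable_gdrv o).mul (measurable_xdual hY o r R)).mul hκ
  have hW : ∀ p, |xinterp o r R u p * Y p * κ p| ≤ A * B * 1 := fun p => by
    rw [abs_mul, abs_mul]
    refine mul_le_mul (mul_le_mul ?_ (hYB p) (abs_nonneg _) hA0) (hκ1 p) (abs_nonneg _)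
      (by positivity)
    exact abs_interp_le (isPrimal_outer o) (isPrimal_inner o) hr (fun x => hA o (p.1, x)) _ _
  have hQ : ∀ p, |gdrv o u p * xdual o r R Y p * κ p| ≤ A * B * 1 := fun p => by
    rw [abs_mul, abs_mul]
    refine mul_le_mul (mul_le_mul (hA o p) ?_ (abs_nonneg _) hA0) (hκ1 p) (abs_nonneg _)
      (by positivity)
    exact abs_interp_le (isPrimal_inner o) (isPrimal_outer o) hr (fun x => hYB (p.1, x)) _ _
  have hGm := (hu.measurable_gdrv o).pow_const 2
  have hG : ∀ p, |gdrv o u p ^ 2| ≤ A ^ 2 := fun p => by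
    rw [abs_pow]; exact pow_le_pow_left₀ (abs_nonneg _) (hA o p) 2
  have hGi : Integrable (fun p => gdrv o u p ^ 2) μ := integrable_of_abs_le hGm hG
  set E : S → ℝ := fun s =>
    (∫ x, xinterp o r R u (s, x) * Y (s, x) * κ (s, x) ∂μ.condKernel s) -
      ∫ x, gdrv o u (s, x) * xdual o r R Y (s, x) * κ (s, x) ∂μ.condKernel s with hE
  have hEm : Measurable E := (measurable_fiberIntegral μ hWm).sub (measurable_fiberIntegral μ hQm)
  have hEint : (∫ p, xinterp o r R u p * Y p * κ p ∂μ) -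
      ∫ p, gdrv o u p * xdual o r R Y p * κ p ∂μ = ∫ s, E s ∂μ.fst := by
    rw [← Measure.integral_condKernel (integrable_of_abs_le hWm hW),
      ← Measure.integral_condKernel (integrable_of_abs_le hQm hQ), ← integral_sub]
    · exact integrable_of_abs_le (measurable_fiberIntegral μ hWm) (abs_fiberIntegral_le μ hW)
    · exact integrable_of_abs_le (measurable_fiberIntegral μ hQm) (abs_fiberIntegral_le μ hQ)
  set n : S → ℝ≥0∞ := fun s => ∫⁻ x, ENNReal.ofReal (gdrv o u (s, x) ^ 2) ∂μ.condKernel s with hn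
  have hnorm : ∀ s, eLpNorm (fun x => gdrv o u (s, x)) 2 (μ.condKernel s) ^ 2 = n s := by
    intro s
    rw [eLpNorm_eq_lintegral_rpow_enorm_toReal (by norm_num) (by norm_num)]
    simp only [ENNReal.toReal_ofNat]
    rw [← ENNReal.rpow_natCast, ← ENNReal.rpow_mul]
    norm_num
    refine lintegral_congr fun x => ?_
    rw [← ofReal_norm, ← ENNReal.ofReal_pow (norm_nonneg _), Real.norm_eq_abs, sq_abs]
  have hnm : Measurable n := hGm.ennreal_ofReal.lintegral_kernel_prod_right'
  have hptw : ∀ᵐ s ∂μ.fst, ENNReal.ofReal |E s| ≤ ENNReal.ofReal t * n s + ENNReal.ofReal t⁻¹ *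
      (ENNReal.ofReal (B ^ 2) * deltaConst (fun x => κ (s, x)) r (μ.condKernel s) ^ 2) := by
    filter_upwards [hac] with s hs
    have hfib := interp_duality (R := R) hs (hκ.comp (measurable_prodMk_left (x := s)))
      (fun x => h01 (s, x)) hr (isPrimal_outer o) (isPrimal_inner o)
      ((hu.measurable_gdrv o).comp (measurable_prodMk_left (x := s))) (fun x => hA o (s, x))
      (odrv_eq_zero (hR s) o) (hY.comp (measurable_prodMk_left (x := s))) (fun x => hYB (s, x))
    set N := eLpNorm (fun x => gdrv o u (s, x)) 2 (μ.condKernel s) with hN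
    have hfib' : ENNReal.ofReal |E s| / N ≤
        ENNReal.ofReal B * deltaConst (fun x => κ (s, x)) r (μ.condKernel s) := hfib
    have hsq : (ENNReal.ofReal |E s| / N) ^ 2 ≤
        ENNReal.ofReal (B ^ 2) * deltaConst (fun x => κ (s, x)) r (μ.condKernel s) ^ 2 := by
      rw [ENNReal.ofReal_pow hB0, ← mul_pow]
      gcongr
    refine le_trans ?_ (add_le_add le_rfl (mul_le_mul_right hsq _))
    rw [← hnorm s]
    -- For a vanishing norm the convention `a / 0 = ∞` makes the right side infinite unless `E s` is
    -- zero, so the estimate holds in this case too.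
    by_cases hN0 : N = 0
    · by_cases hE0 : E s = 0
      · simp [hE0]
      · have : ENNReal.ofReal |E s| / N = ⊤ := by
          rw [hN0]; exact ENNReal.div_zero (by simpa using hE0)
        rw [this]
        have ht' : ENNReal.ofReal t⁻¹ ≠ 0 := by simpa using ht
        simp [ENNReal.mul_top ht']
    · have hNT : N ≠ ⊤ := by
        intro h
        have h2 := hnorm s
        rw [← hN, h] at h2
        have h3 : n s ≤ ENNReal.ofReal (A ^ 2) := by
          calc n s ≤ ∫⁻ _, ENNReal.ofReal (A ^ 2) ∂μ.condKernel s :=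
                lintegral_mono fun x => ENNReal.ofReal_le_ofReal ((le_abs_self _).trans (hG _))
            _ = _ := by simp
        rw [← h2] at h3
        simp at h3
      calc ENNReal.ofReal |E s| = N * (ENNReal.ofReal |E s| / N) :=
            (ENNReal.mul_div_cancel hN0 hNT).symm
        _ ≤ _ := ennreal_mul_le_young _ _ ht
  have hnint : ∫⁻ s, n s ∂μ.fst = ENNReal.ofReal (∫ p, gdrv o u p ^ 2 ∂μ) := by
    rw [ofReal_integral_eq_lintegral_ofReal hGi (ae_of_all _ fun p => sq_nonneg _)]
    exact Measure.lintegral_condKernel (f := fun p => ENNReal.ofReal (gdrv o u p ^ 2))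
      hGm.ennreal_ofReal
  have hGnn : 0 ≤ ∫ p, gdrv o u p ^ 2 ∂μ := integral_nonneg fun p => sq_nonneg _
  rw [hEint]
  refine abs_integral_le_integral_abs.trans ?_
  rw [integral_eq_lintegral_of_nonneg_ae (ae_of_all _ fun s => abs_nonneg _)
    hEm.abs.aestronglyMeasurable]
  refine ENNReal.toReal_le_of_le_ofReal (by positivity) ?_
  calc ∫⁻ s, ENNReal.ofReal |E s| ∂μ.fst
      ≤ ∫⁻ s, (ENNReal.ofReal t * n s + ENNReal.ofReal t⁻¹ * (ENNReal.ofReal (B ^ 2) *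
          deltaConst (fun x => κ (s, x)) r (μ.condKernel s) ^ 2)) ∂μ.fst := lintegral_mono_ae hptw
    _ = ENNReal.ofReal t * (∫⁻ s, n s ∂μ.fst) + ENNReal.ofReal t⁻¹ * (ENNReal.ofReal (B ^ 2) *
          ∫⁻ s, deltaConst (fun x => κ (s, x)) r (μ.condKernel s) ^ 2 ∂μ.fst) := by
        -- The function `deltaConst` is not known to be measurable in `s`. Additivity uses the
        -- measurability of the other summand only, and the constants are taken out by finiteness.
        rw [lintegral_add_left (hnm.const_mul _), lintegral_const_mul _ hnm,
          lintegral_const_mul' _ _ ENNReal.ofReal_ne_top,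
          lintegral_const_mul' _ _ ENNReal.ofReal_ne_top]
    _ ≤ ENNReal.ofReal t * ENNReal.ofReal (∫ p, gdrv o u p ^ 2 ∂μ) + ENNReal.ofReal t⁻¹ *
          (ENNReal.ofReal (B ^ 2) * ENNReal.ofReal D) := by
        rw [hnint]
        gcongr
    _ = _ := by
        rw [← ENNReal.ofReal_mul ht.le, ← ENNReal.ofReal_mul (sq_nonneg B),
          ← ENNReal.ofReal_mul (inv_pos.2 ht).le, ← ENNReal.ofReal_add (by positivity)
            (by positivity)]

end FiberInterpolation

/-! ### Orthogonality to the graph of the limit form -/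

section Orthogonality

variable {d : ℕ}

lemma continuous_odrv {f : (Fin d → ℝ) → ℝ} (hf : ContDiff ℝ 1 f) (o : Option (Fin d)) :
    Continuous (odrv o f) := by
  cases o with
  | none => exact hf.continuous
  | some i => exact (hf.continuous_fderiv (by norm_num)).clm_apply continuous_const

/-- If a node is seen by `φ` from `x` and by `η` from `y`, each point is within `2 r` of it in every
coordinate, so only points with `‖y - x‖ ≤ 4 * r` enter. The weights at `x` sum to one, hence the
error is an average of increments of `f`. -/
lemma abs_interp_sub_le {φ η f : (Fin d → ℝ) → ℝ} (hφ : IsPrimal φ) (hη : IsPrimal η) {r R : ℝ}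
    (hr : 0 < r) (hf : Measurable f) {B : ℝ} (hB : ∀ x, |f x| ≤ B) {x : Fin d → ℝ}
    (hx : ‖x‖ ≤ R) {ε : ℝ} (hε : ∀ y, ‖y - x‖ ≤ 4 * r → |f y - f x| ≤ ε) :
    |interp φ η r (nodes d R r) f x - f x| ≤ ε := by
  have hrd : 0 < r ^ d := by positivity
  have h1 : interp φ η r (nodes d R r) f x - f x =
      ∑ z ∈ nodes d R r, (coeff η r f z - f x) * rescale φ r z x := by
    simp only [sub_mul, Finset.sum_sub_distrib, ← Finset.mul_sum, hφ.sum_nodes_rescale hr hx,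
      mul_one]
    rfl
  rw [h1]
  have hterm : ∀ z, |(coeff η r f z - f x) * rescale φ r z x| ≤ ε * rescale φ r z x := by
    intro z
    have h0 := (hφ.rescale_mem_Icc r z x).1
    by_cases hz : rescale φ r z x = 0
    · simp [hz]
    rw [abs_mul, abs_of_nonneg h0]
    refine mul_le_mul_of_nonneg_right ?_ h0
    have e : coeff η r f z - f x = (r ^ d)⁻¹ * ∫ y, rescale η r z y * (f y - f x) := by
      simp only [mul_sub]
      rw [integral_sub (hη.integrable_rescale_mul hr z hf hB)
        ((hη.integrable_rescale hr z).mul_const _), integral_mul_const, hη.integral_rescale hr,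
        coeff]
      field_simp
    rw [e, abs_mul, abs_of_pos (inv_pos.2 hrd), inv_mul_le_iff₀ hrd, ← hη.integral_rescale hr z,
      ← integral_mul_const]
    refine abs_integral_le_integral_abs.trans (integral_mono_of_nonneg
      (ae_of_all _ fun x => abs_nonneg _) ((hη.integrable_rescale hr z).mul_const ε)
      (ae_of_all _ fun y => ?_))
    have h0' := (hη.rescale_mem_Icc r z y).1
    simp only
    rw [abs_mul, abs_of_nonneg h0']
    by_cases hy : rescale η r z y = 0
    · simp [hy]
    refine mul_le_mul_of_nonneg_left (hε y ?_) h0'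
    rw [pi_norm_le_iff_of_nonneg (by linarith)]
    intro k
    have h2 := abs_le.1 (hφ.abs_le_of_rescale_ne_zero hr hz k)
    have h3 := abs_le.1 (hη.abs_le_of_rescale_ne_zero hr hy k)
    rw [Real.norm_eq_abs, abs_le, Pi.sub_apply]
    constructor <;> linarith
  calc _ ≤ ∑ z ∈ nodes d R r, ε * rescale φ r z x :=
        (Finset.abs_sum_le_sum_abs _ _).trans (Finset.sum_le_sum fun z _ => hterm z)
    _ = ε := by rw [← Finset.mul_sum, hφ.sum_nodes_rescale hr hx, mul_one]

section

variable {S : Type*} [TopologicalSpace S]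

lemma abs_xdual_le {r : ℝ} (hr : 0 < r) (R : ℝ) (Y : (S × (Fin d → ℝ)) →ᵇ ℝ)
    (o : Option (Fin d)) (p : S × (Fin d → ℝ)) : |xdual o r R Y p| ≤ ‖Y‖ :=
  abs_interp_le (isPrimal_inner o) (isPrimal_outer o) hr (fun _ => Y.norm_coe_le_norm _) _ _

lemma tendsto_xdual (R : ℝ) (Y : (S × (Fin d → ℝ)) →ᵇ ℝ) (o : Option (Fin d))
    {p : S × (Fin d → ℝ)} (hp : ‖p.2‖ ≤ R) :
    Tendsto (fun m : ℕ => xdual o (1 / (m : ℝ)) R Y p) atTop (𝓝 (Y p)) := by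
  rw [Metric.tendsto_atTop]
  intro ε hε
  have hc : Continuous fun x => Y (p.1, x) := Y.continuous.comp (by fun_prop)
  obtain ⟨δ, hδ, hδY⟩ := Metric.continuous_iff.1 hc p.2 (ε / 2) (by linarith)
  obtain ⟨n, hn⟩ := exists_nat_gt (4 / δ)
  refine ⟨n + 1, fun m hm => ?_⟩
  have hnm : (n : ℝ) + 1 ≤ m := by exact_mod_cast hm
  have hn0 : (0 : ℝ) < n := lt_trans (by positivity) hn
  have hm0 : (0 : ℝ) < m := by linarith
  have h4 : 4 * (1 / (m : ℝ)) < δ := by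
    rw [mul_one_div, div_lt_iff₀ hm0]
    rw [div_lt_iff₀ hδ] at hn
    nlinarith
  have := abs_interp_sub_le (isPrimal_inner o) (isPrimal_outer o) (r := 1 / (m : ℝ)) (R := R)
    (f := fun x => Y (p.1, x)) (by positivity) hc.measurable (fun _ => Y.norm_coe_le_norm _) hp
    (ε := ε / 2) (fun y hy => (hδY y (by rw [dist_eq_norm]; linarith)).le)
  rw [Real.dist_eq]
  exact lt_of_le_of_lt this (by linarith)

end

variable {S : Type*} [MeasurableSpace S] {μ : Measure (S × (Fin d → ℝ))} [IsProbabilityMeasure μ] {κ : S × (Fin d → ℝ) → ℝ}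

/-- The constant in the domination of the derivatives of the splines by the plateau function. -/
def splineConst (d : ℕ) (r : ℝ) : ℝ := 6 ^ d * (1 + r⁻¹)

lemma splineConst_nonneg {r : ℝ} (hr : 0 < r) : 0 ≤ splineConst d r := by
  unfold splineConst; positivity

/-- Young's inequality for the conditional expectations of `∑ₒ (∂ₒ φ) gₒ κ`. -/
lemma ae_abs_fiberIntegral_le (hκ : Measurable κ)
    (h01 : ∀ p, κ p ∈ Set.Icc (0 : ℝ) 1) {r : ℝ} (hr : 0 < r) (z : Fin d → ℤ)
    {g : Option (Fin d) → S × (Fin d → ℝ) → ℝ} (hg : ∀ o, Measurable (g o))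
    (hg2 : ∀ o, Integrable (fun p => g o p ^ 2 * κ p) μ) :
    ∀ᵐ s ∂μ.fst, (∀ o, Integrable (fun x => odrv o (rescale (outerSpline none) r z) x *
        g o (s, x) * κ (s, x)) (μ.condKernel s)) ∧ ∀ t : ℝ, 0 ≤ t →
      2 * t * |∫ x, ∑ o, odrv o (rescale (outerSpline none) r z) x * g o (s, x) * κ (s, x)
        ∂μ.condKernel s| ≤
      t ^ 2 * (∫ x, rescale (plateauTensor d) r z x * κ (s, x) ∂μ.condKernel s) +
        splineConst d r ^ 2 * (d + 1) *
          ∫ x, ∑ o, g o (s, x) ^ 2 * κ (s, x) ∂μ.condKernel s := by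
  set K := splineConst d r with hK
  have hK0 : 0 ≤ K := splineConst_nonneg hr
  have hfi : ∀ᵐ s ∂μ.fst, ∀ o, Integrable (fun x => g o (s, x) ^ 2 * κ (s, x)) (μ.condKernel s) :=
    ae_all_iff.2 fun o => (hg2 o).condKernel_ae
  filter_upwards [hfi] with s hs
  have hψ : ∀ o x, |odrv o (rescale (outerSpline none) r z) x| ≤
      K * rescale (plateauTensor d) r z x := fun o x => abs_odrv_rescale_outer_le hr o z x
  have hθ := fun x => isPrimal_plateauTensor.rescale_mem_Icc r z x
  have hθm := measurable_rescale (isPrimal_plateauTensor (d := d)).measurable r z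
  have hκs : Measurable fun x => κ (s, x) := hκ.comp measurable_prodMk_left
  have hh : Integrable (fun x => rescale (plateauTensor d) r z x * κ (s, x)) (μ.condKernel s) :=
    integrable_of_abs_le (hθm.mul hκs) (C := 1) fun x => by
      rw [abs_of_nonneg (mul_nonneg (hθ x).1 (h01 _).1)]
      exact mul_le_one₀ (hθ x).2 (h01 _).1 (h01 _).2
  have hψm : ∀ o, Measurable (odrv o (rescale (outerSpline (none : Option (Fin d))) r z)) :=
    fun o => (continuous_odrv (contDiff_rescale_outer r z) o).measurable
  have hint : ∀ o, Integrable (fun x => odrv o (rescale (outerSpline none) r z) x *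
      g o (s, x) * κ (s, x)) (μ.condKernel s) := by
    intro o
    have hdom : Integrable (fun x => K * (rescale (plateauTensor d) r z x * κ (s, x)) +
        K * (g o (s, x) ^ 2 * κ (s, x))) (μ.condKernel s) :=
      (hh.const_mul K).add ((hs o).const_mul K)
    refine hdom.mono' (((hψm o).mul ((hg o).comp measurable_prodMk_left)).mul
      hκs).aestronglyMeasurable (ae_of_all _ fun x => ?_)
    have hk0 := (h01 (s, x)).1
    rw [Real.norm_eq_abs, abs_mul, abs_mul, abs_of_nonneg hk0]
    have h1 : |g o (s, x)| ≤ 1 + g o (s, x) ^ 2 := by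
      rw [← sq_abs]; nlinarith [sq_nonneg (|g o (s, x)| - 1), abs_nonneg (g o (s, x))]
    have h2 := hψ o x
    have h3 := hθ x
    calc |odrv o (rescale (outerSpline none) r z) x| * |g o (s, x)| * κ (s, x)
        ≤ (K * rescale (plateauTensor d) r z x) * (1 + g o (s, x) ^ 2) * κ (s, x) := by
          have : 0 ≤ K * rescale (plateauTensor d) r z x := mul_nonneg hK0 h3.1
          gcongr
      _ ≤ _ := by
          have : K * rescale (plateauTensor d) r z x * (g o (s, x) ^ 2 * κ (s, x)) ≤
              K * 1 * (g o (s, x) ^ 2 * κ (s, x)) := by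
            have := mul_nonneg (sq_nonneg (g o (s, x))) hk0
            gcongr
            exact h3.2
          nlinarith
  refine ⟨hint, fun t ht => ?_⟩
  have hsumi : Integrable (fun x => ∑ o, g o (s, x) ^ 2 * κ (s, x)) (μ.condKernel s) :=
    integrable_finsetSum _ fun o _ => hs o
  rw [← integral_const_mul, ← integral_const_mul, ← integral_add (hh.const_mul _)
    (hsumi.const_mul _)]
  refine (mul_le_mul_of_nonneg_left abs_integral_le_integral_abs (by positivity)).trans ?_
  rw [← integral_const_mul]
  refine integral_mono_of_nonneg (ae_of_all _ fun x => by positivity)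
    ((hh.const_mul _).add (hsumi.const_mul _)) (ae_of_all _ fun x => ?_)
  have hk0 := (h01 (s, x)).1
  have h3 := hθ x
  set θ := rescale (plateauTensor d) r z x with hθx
  have hb : |∑ o, odrv o (rescale (outerSpline none) r z) x * g o (s, x) * κ (s, x)| ≤
      θ * κ (s, x) * (K * ∑ o, |g o (s, x)|) := by
    refine (Finset.abs_sum_le_sum_abs _ _).trans ?_
    rw [Finset.mul_sum, Finset.mul_sum]
    refine Finset.sum_le_sum fun o _ => ?_
    rw [abs_mul, abs_mul, abs_of_nonneg hk0]
    calc |odrv o (rescale (outerSpline none) r z) x| * |g o (s, x)| * κ (s, x)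
        ≤ (K * θ) * |g o (s, x)| * κ (s, x) := by
          have := hψ o x
          gcongr
      _ = _ := by ring
  have hcs : (∑ o, |g o (s, x)|) ^ 2 ≤ (d + 1) * ∑ o, g o (s, x) ^ 2 := by
    have := sq_sum_le_card_mul_sum_sq (s := (Finset.univ : Finset (Option (Fin d))))
      (f := fun o => |g o (s, x)|)
    simpa [sq_abs] using this
  set q := ∑ o, |g o (s, x)| with hq
  have hsm : ∑ o, g o (s, x) ^ 2 * κ (s, x) = (∑ o, g o (s, x) ^ 2) * κ (s, x) :=
    (Finset.sum_mul ..).symm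
  simp only [hsm]
  have hθκ : 0 ≤ θ * κ (s, x) := mul_nonneg h3.1 hk0
  have hsq0 : 0 ≤ ∑ o, g o (s, x) ^ 2 := Finset.sum_nonneg fun o _ => sq_nonneg _
  calc 2 * t * |∑ o, odrv o (rescale (outerSpline none) r z) x * g o (s, x) * κ (s, x)|
      ≤ 2 * t * (θ * κ (s, x) * (K * q)) := mul_le_mul_of_nonneg_left hb (by positivity)
    _ ≤ θ * κ (s, x) * (t ^ 2 + K ^ 2 * q ^ 2) := by
        nlinarith [mul_nonneg hθκ (sq_nonneg (t - K * q))]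
    _ ≤ t ^ 2 * (θ * κ (s, x)) + (1 * κ (s, x)) * (K ^ 2 * q ^ 2) := by
        have : θ * κ (s, x) * (K ^ 2 * q ^ 2) ≤ 1 * κ (s, x) * (K ^ 2 * q ^ 2) := by
          have := h3.2
          gcongr
        linarith
    _ ≤ t ^ 2 * (θ * κ (s, x)) + (1 * κ (s, x)) * (K ^ 2 * ((d + 1) * ∑ o, g o (s, x) ^ 2)) := by
        gcongr
    _ = _ := by ring

variable [TopologicalSpace S] [PolishSpace S] [BorelSpace S]

lemma continuous_xcoeff {η : (Fin d → ℝ) → ℝ} (hη : IsPrimal η) {r : ℝ} (hr : 0 < r)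
    (Y : (S × (Fin d → ℝ)) →ᵇ ℝ) (z : Fin d → ℤ) : Continuous (xcoeff η r Y z) := by
  refine continuous_const.mul (continuous_of_dominated (bound := fun x => rescale η r z x * ‖Y‖)
    (fun s => ?_) (fun s => ae_of_all _ fun x => ?_) ((hη.integrable_rescale hr z).mul_const _)
    (ae_of_all _ fun x => ?_))
  · exact ((measurable_rescale hη.measurable r z).mul
      (Y.continuous.measurable.comp measurable_prodMk_left)).aestronglyMeasurable
  · rw [norm_mul, Real.norm_eq_abs, abs_of_nonneg (hη.rescale_mem_Icc r z x).1]
    exact mul_le_mul_of_nonneg_left (Y.norm_coe_le_norm _) (hη.rescale_mem_Icc r z x).1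
  · exact continuous_const.mul (Y.continuous.comp (by fun_prop))

lemma continuous_xdual {r R : ℝ} (hr : 0 < r) (Y : (S × (Fin d → ℝ)) →ᵇ ℝ)
    (o : Option (Fin d)) : Continuous (xdual o r R Y) :=
  continuous_finsetSum _ fun z _ =>
    ((continuous_xcoeff (isPrimal_outer o) hr Y z).comp continuous_fst).mul
      ((continuous_rescale (continuous_inner_spline o) r z).comp continuous_snd)

/-- Approximating `b` itself by a bounded continuous `f`, orthogonality gives `∫ b² = ∫ b (b - f)`,
and half of the left side can be absorbed. -/
lemma ae_eq_zero_of_forall_integral_bcf_mul {ν : Measure S} [IsFiniteMeasure ν] {b : S → ℝ}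
    (hb : Measurable b) (hb2 : Integrable (fun s => b s ^ 2) ν)
    (h : ∀ f : S →ᵇ ℝ, ∫ s, f s * b s ∂ν = 0) : ∀ᵐ s ∂ν, b s = 0 := by
  have hbi : MemLp b 2 ν := (memLp_two_iff_integrable_sq hb.aestronglyMeasurable).2 hb2
  have key : ∀ ε : ℝ, 0 < ε → ∫ s, b s ^ 2 ∂ν ≤ ε ^ 2 := by
    intro ε hε
    obtain ⟨f, hfi, hf⟩ := exists_bcf_integral_sq_sub_le (μ := ν) (κ := fun _ => 1)
      measurable_const (fun _ => by simp) hb (by simpa using hb2) hε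
    simp only [mul_one] at hfi hf
    have hfb : Integrable (fun s => f s * b s) ν := by
      refine (hbi.integrable (by norm_num)).bdd_mul (c := ‖f‖) f.continuous.aestronglyMeasurable
        (ae_of_all _ fun s => f.norm_coe_le_norm s)
    have h1 : ∫ s, b s ^ 2 ∂ν = ∫ s, (b s ^ 2 - f s * b s) ∂ν := by
      rw [integral_sub hb2 hfb, h f, sub_zero]
    have h2 : ∫ s, (b s ^ 2 - f s * b s) ∂ν ≤
        ∫ s, (1 / 2 * b s ^ 2 + 1 / 2 * (b s - f s) ^ 2) ∂ν := by
      refine integral_mono (hb2.sub hfb) ((hb2.const_mul _).add (hfi.const_mul _)) fun s => ?_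
      simp only
      nlinarith [sq_nonneg (f s)]
    rw [integral_add (hb2.const_mul _) (hfi.const_mul _), integral_const_mul,
      integral_const_mul] at h2
    linarith
  have hz : ∫ s, b s ^ 2 ∂ν = 0 := by
    refine le_antisymm ?_ (integral_nonneg fun s => sq_nonneg _)
    refine le_of_forall_pos_le_add fun ε hε => ?_
    have := key (Real.sqrt ε) (Real.sqrt_pos.2 hε)
    rw [Real.sq_sqrt hε.le] at this
    linarith
  have := (integral_eq_zero_iff_of_nonneg (fun s => sq_nonneg (b s)) hb2).1 hz
  filter_upwards [this] with s hs
  simpa using hs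

/-- For `y` orthogonal to the graph of the form, the conditional expectations of
`∑ₒ (∂ₒ φ) Yₒ κ` are controlled by the distance of `Y` to `y`. -/
lemma integral_sq_div_le (hκ : Measurable κ)
    (h01 : ∀ p, κ p ∈ Set.Icc (0 : ℝ) 1) {r : ℝ} (hr : 0 < r) (z : Fin d → ℤ)
    {y : Option (Fin d) → S × (Fin d → ℝ) → ℝ} (hy : ∀ o, Measurable (y o))
    (hy2 : ∀ o, Integrable (fun p => y o p ^ 2 * κ p) μ)
    (horth : ∀ v ∈ productSpan S d, ∑ o, ∫ p, gdrv o v p * y o p * κ p ∂μ = 0)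
    {Y : Option (Fin d) → (S × (Fin d → ℝ)) →ᵇ ℝ}
    (hY : ∀ o, Integrable (fun p => (y o p - Y o p) ^ 2 * κ p) μ) :
    ∫ s, (∫ x, ∑ o, odrv o (rescale (outerSpline none) r z) x * Y o (s, x) * κ (s, x)
        ∂μ.condKernel s) ^ 2 /
      (∫ x, rescale (plateauTensor d) r z x * κ (s, x) ∂μ.condKernel s) ∂μ.fst ≤
      splineConst d r ^ 2 * (d + 1) * ∑ o, ∫ p, (y o p - Y o p) ^ 2 * κ p ∂μ := by
  set K := splineConst d r with hK
  have hK0 : 0 ≤ K := splineConst_nonneg hr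
  set ψ : Option (Fin d) → (Fin d → ℝ) → ℝ := fun o =>
    odrv o (rescale (outerSpline none) r z) with hψ
  have hψm : ∀ o, Measurable (ψ o) := fun o =>
    (continuous_odrv (contDiff_rescale_outer r z) o).measurable
  have hYm : ∀ o, Measurable (Y o) := fun o => (Y o).continuous.measurable
  have hθ := fun x => isPrimal_plateauTensor.rescale_mem_Icc r z x
  have hθm := measurable_rescale (isPrimal_plateauTensor (d := d)).measurable r z
  set h : S → ℝ := fun s => ∫ x, rescale (plateauTensor d) r z x * κ (s, x) ∂μ.condKernel s with hh
  have hh0 : ∀ s, 0 ≤ h s := fun s => integral_nonneg fun x => mul_nonneg (hθ x).1 (h01 _).1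
  have hh1 : ∀ s, h s ≤ 1 := fun s => (le_abs_self _).trans
    (abs_fiberIntegral_le μ (g := fun p => rescale (plateauTensor d) r z p.2 * κ p) (fun p => by
      rw [abs_of_nonneg (mul_nonneg (hθ _).1 (h01 _).1)]
      exact mul_le_one₀ (hθ _).2 (h01 _).1 (h01 _).2) s)
  -- the conditional expectations for `y` vanish
  have fy := ae_abs_fiberIntegral_le (μ := μ) hκ h01 hr z hy hy2
  set b : S → ℝ := fun s => ∫ x, ∑ o, ψ o x * y o (s, x) * κ (s, x) ∂μ.condKernel s with hb
  have hGm : Measurable fun p : S × (Fin d → ℝ) => ∑ o, ψ o p.2 * y o p * κ p :=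
    Finset.measurable_sum _ fun o _ => (((hψm o).comp measurable_snd).mul (hy o)).mul hκ
  have hbm : Measurable b := measurable_fiberIntegral μ hGm
  have hqint : Integrable (fun p => ∑ o, y o p ^ 2 * κ p) μ :=
    integrable_finsetSum _ fun o _ => hy2 o
  have hb2 : Integrable (fun s => b s ^ 2) μ.fst := by
    refine (hqint.integral_condKernel.const_mul (K ^ 2 * (d + 1))).mono'
      (hbm.pow_const 2).aestronglyMeasurable ?_
    filter_upwards [fy] with s hs
    -- With `t = |b s|` and `h ≤ 1`, the term `t ^ 2 * h` is absorbed on the left, which shows that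
    -- `b` is square integrable.
    have := hs.2 |b s| (abs_nonneg _)
    rw [Real.norm_eq_abs, abs_of_nonneg (sq_nonneg _)]
    have h2 : |b s| ^ 2 * h s ≤ |b s| ^ 2 := mul_le_of_le_one_right (sq_nonneg _) (hh1 s)
    rw [← sq_abs]
    change 2 * |b s| * |b s| ≤ |b s| ^ 2 * h s + _ at this
    nlinarith
  have hψint : ∀ o, Integrable (fun p => ψ o p.2 * y o p * κ p) μ := by
    intro o
    have hdom : Integrable (fun p => K * (1 + y o p ^ 2 * κ p)) μ :=
      ((integrable_const 1).add (hy2 o)).const_mul K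
    refine hdom.mono' ((((hψm o).comp measurable_snd).mul (hy o)).mul
      hκ).aestronglyMeasurable (ae_of_all _ fun p => ?_)
    have hk := h01 p
    rw [Real.norm_eq_abs, abs_mul, abs_mul, abs_of_nonneg hk.1]
    have h1 : |y o p| * κ p ≤ 1 + y o p ^ 2 * κ p := by
      rw [← sq_abs]
      nlinarith [mul_nonneg hk.1 (sq_nonneg (|y o p| - 1)), abs_nonneg (y o p), hk.2,
        mul_nonneg hk.1 (abs_nonneg (y o p))]
    have h2 : |ψ o p.2| ≤ K := (abs_odrv_rescale_outer_le hr o z p.2).trans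
      (mul_le_of_le_one_right hK0 (hθ _).2)
    rw [mul_assoc]
    exact mul_le_mul h2 h1 (mul_nonneg (abs_nonneg _) hk.1) hK0
  have hbz : ∀ᵐ s ∂μ.fst, b s = 0 := by
    refine ae_eq_zero_of_forall_integral_bcf_mul hbm hb2 fun f => ?_
    -- The test function is a product of a continuous function of `s` and one `C¹` spline in `x`. As
    -- `f` passes through the `x`-derivatives, orthogonality to products becomes orthogonality of
    -- `b` to every `f`.
    have hv := horth (fun p => f p.1 * rescale (outerSpline none) r z p.2)
      (Submodule.subset_span ⟨f, _, contDiff_rescale_outer r z,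
        (isPrimal_outer none).hasCompactSupport_rescale hr z, rfl⟩)
    have hg : ∀ o p, gdrv o (fun p : S × (Fin d → ℝ) =>
        f p.1 * rescale (outerSpline none) r z p.2) p = f p.1 * ψ o p.2 := by
      intro o p
      cases o with
      | none => rfl
      | some i =>
        simp only [gdrv, odrv, hψ]
        rw [fderiv_const_mul ((contDiff_rescale_outer r z).differentiable (by simp) _)]
        simp
    have hfi : ∀ o, Integrable (fun p : S × (Fin d → ℝ) => f p.1 * (ψ o p.2 * y o p * κ p)) μ :=
      fun o => (hψint o).bdd_mul (c := ‖f‖) (f.continuous.measurable.comp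
        measurable_fst).aestronglyMeasurable (ae_of_all _ fun p => f.norm_coe_le_norm _)
    have e1 : ∫ s, f s * b s ∂μ.fst =
        ∫ p, ∑ o, f p.1 * (ψ o p.2 * y o p * κ p) ∂μ := by
      rw [← Measure.integral_condKernel (integrable_finsetSum _ fun o _ => hfi o)]
      congr 1; funext s
      rw [hb, ← integral_const_mul]
      congr 1; funext x
      rw [Finset.mul_sum]
    rw [e1, integral_finsetSum _ fun o _ => hfi o, ← hv]
    refine Finset.sum_congr rfl fun o _ => ?_
    congr 1; funext p
    rw [hg]; ring
  have fY := ae_abs_fiberIntegral_le (μ := μ) hκ h01 hr z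
    (g := fun o p => y o p - Y o p) (fun o => (hy o).sub (hYm o)) hY
  have hDint : Integrable (fun p => ∑ o, (y o p - Y o p) ^ 2 * κ p) μ :=
    integrable_finsetSum _ fun o _ => hY o
  rw [← integral_finsetSum _ fun o _ => hY o, ← Measure.integral_condKernel hDint,
    ← integral_const_mul]
  refine integral_mono_of_nonneg (ae_of_all _ fun s => div_nonneg (sq_nonneg _) (hh0 s))
    (hDint.integral_condKernel.const_mul _) ?_
  filter_upwards [fy, fY, hbz] with s hsy hsY hs0
  set Γ := ∫ x, ∑ o, ψ o x * Y o (s, x) * κ (s, x) ∂μ.condKernel s with hΓ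
  have e2 : ∫ x, ∑ o, ψ o x * (y o (s, x) - Y o (s, x)) * κ (s, x) ∂μ.condKernel s = -Γ := by
    have hYi : ∀ o, Integrable (fun x => ψ o x * Y o (s, x) * κ (s, x)) (μ.condKernel s) := by
      intro o
      refine ((hsy.1 o).sub (hsY.1 o)).congr (ae_of_all _ fun x => ?_)
      simp only [Pi.sub_apply, hψ]; ring
    have : ∀ x, ∑ o, ψ o x * (y o (s, x) - Y o (s, x)) * κ (s, x) =
        (∑ o, ψ o x * y o (s, x) * κ (s, x)) - ∑ o, ψ o x * Y o (s, x) * κ (s, x) := by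
      intro x
      rw [← Finset.sum_sub_distrib]
      refine Finset.sum_congr rfl fun o _ => by ring
    simp only [this]
    rw [integral_sub (integrable_finsetSum _ fun o _ => hsy.1 o)
      (integrable_finsetSum _ fun o _ => hYi o)]
    change b s - Γ = -Γ
    rw [hs0, zero_sub]
  -- This `t` turns the inequality into a bound on `Γ² / h`; it depends on `s`, so the fibre
  -- estimate had to hold for all `t` simultaneously. If `h s = 0` then `t = 0`, the quotient is
  -- zero by convention, and only non-negativity of the right side is left.
  have hfin := hsY.2 (|Γ| / h s) (div_nonneg (abs_nonneg _) (hh0 s))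
  change 2 * (|Γ| / h s) * |∫ x, ∑ o, ψ o x * (y o (s, x) - Y o (s, x)) * κ (s, x)
    ∂μ.condKernel s| ≤ (|Γ| / h s) ^ 2 * h s + _ at hfin
  rw [e2, abs_neg] at hfin
  by_cases hz : h s = 0
  · rw [hz, div_zero, mul_zero, zero_mul, mul_zero, zero_add] at hfin
    change Γ ^ 2 / h s ≤ _
    rw [hz, div_zero]
    exact hfin
  · have e3 : 2 * (|Γ| / h s) * |Γ| = 2 * (Γ ^ 2 / h s) := by rw [← sq_abs Γ]; ring
    have e4 : (|Γ| / h s) ^ 2 * h s = Γ ^ 2 / h s := by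
      rw [← sq_abs Γ]; field_simp
    rw [e3, e4] at hfin
    change Γ ^ 2 / h s ≤ K ^ 2 * (d + 1) *
      ∫ x, ∑ o, (y o (s, x) - Y o (s, x)) ^ 2 * κ (s, x) ∂μ.condKernel s
    linarith

end Orthogonality


/-! ### Passage to the limit in the interpolated functions -/

section LimitOrthogonality

variable {d : ℕ} {S : Type*} [TopologicalSpace S] [PolishSpace S] [MeasurableSpace S]
  [BorelSpace S] {M : ℕ → Measure (S × (Fin d → ℝ))} [∀ N, IsProbabilityMeasure (M N)]
  {M' : Measure (S × (Fin d → ℝ))} [IsProbabilityMeasure M'] {κ : S × (Fin d → ℝ) → ℝ}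
  {l : Filter ℕ} {u : ℕ → S × (Fin d → ℝ) → ℝ} {r R C A : ℝ}
  {y : Option (Fin d) → S × (Fin d → ℝ) → ℝ} {Y : Option (Fin d) → (S × (Fin d → ℝ)) →ᵇ ℝ}

/-- Expansion over the nodes leaves finitely many pairings of coefficients with conditional
expectations of fixed bounded continuous functions. Each is treated by `eventually_abs_pairing_le`:
the coefficients are bounded by stability, the limiting expectations by `integral_sq_div_le`. The
bound contains the number of nodes and `splineConst`, so it is only useful at fixed mesh. -/
lemma eventually_abs_sum_xinterp_le_card
    (hM : ∀ g : (S × (Fin d → ℝ)) →ᵇ ℝ,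
      Tendsto (fun N => ∫ p, g p ∂M N) atTop (𝓝 (∫ p, g p ∂M')))
    (hD : DisintegrationConv M M') (hac : ∀ N, ∀ᵐ s ∂(M N).fst, (M N).condKernel s ≪ volume)
    (hκ : Continuous κ) (h01 : ∀ p, κ p ∈ Set.Icc (0 : ℝ) 1) (hr : 0 < r) (hC0 : 0 ≤ C)
    (hC : ∀ N, ∀ᵐ s ∂(M N).fst,
      pertConst (fun x => κ (s, x)) r ((M N).condKernel s) ≤ ENNReal.ofReal C)
    (hl : l ≤ atTop) (hu : ∀ N, FiberC1 (u N)) (hR : ∀ N s x, R < ‖x‖ → u N (s, x) = 0)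
    (hA : ∀ᶠ N in l, ∀ o, ∫ p, gdrv o (u N) p ^ 2 ∂M N ≤ A) (hy : ∀ o, Measurable (y o))
    (hy2 : ∀ o, Integrable (fun p => y o p ^ 2 * κ p) M')
    (horth : ∀ v ∈ productSpan S d, ∑ o, ∫ p, gdrv o v p * y o p * κ p ∂M' = 0)
    (hY : ∀ o, Integrable (fun p => (y o p - Y o p) ^ 2 * κ p) M') {t e : ℝ} (ht : 0 < t)
    (he : 0 < e) :
    ∀ᶠ N in l, |∑ o, ∫ p, xinterp o r R (u N) p * Y o p * κ p ∂M N| ≤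
      (nodes d R r).card * (t * (C * A) + (2 * t)⁻¹ *
        (splineConst d r ^ 2 * (d + 1) * ∑ o, ∫ p, (y o p - Y o p) ^ 2 * κ p ∂M') + e) := by
  set K := splineConst d r with hK
  have hK0 : 0 ≤ K := splineConst_nonneg hr
  have hκ1 : ∀ p, |κ p| ≤ 1 := fun p => by rw [abs_of_nonneg (h01 p).1]; exact (h01 p).2
  set ψ : Option (Fin d) → (Fin d → ℤ) → (Fin d → ℝ) → ℝ := fun o z =>
    odrv o (rescale (outerSpline none) r z) with hψ
  have hψc : ∀ o z, Continuous (ψ o z) := fun o z =>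
    continuous_odrv (contDiff_rescale_outer r z) o
  have hθ := fun z x => (isPrimal_plateauTensor (d := d)).rescale_mem_Icc r z x
  have hψK : ∀ o z x, |ψ o z x| ≤ K * rescale (plateauTensor d) r z x := fun o z x =>
    abs_odrv_rescale_outer_le hr o z x
  have hθc : ∀ z, Continuous (rescale (plateauTensor d) r z) := fun z =>
    continuous_rescale continuous_plateauTensor r z
  let Hf : (Fin d → ℤ) → (S × (Fin d → ℝ)) →ᵇ ℝ := fun z =>
    BoundedContinuousFunction.ofNormedAddCommGroup
      (fun p => rescale (plateauTensor d) r z p.2 * κ p)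
      (((hθc z).comp continuous_snd).mul hκ) 1 fun p => by
        rw [norm_mul, Real.norm_eq_abs, Real.norm_eq_abs, abs_of_nonneg (hθ z _).1]
        exact mul_le_one₀ (hθ z _).2 (abs_nonneg _) (hκ1 p)
  set a := K * ∑ o, ‖Y o‖ with ha
  have ha0 : 0 ≤ a := mul_nonneg hK0 (Finset.sum_nonneg fun o _ => norm_nonneg _)
  have hγb : ∀ z (p : S × (Fin d → ℝ)), |∑ o, ψ o z p.2 * Y o p * κ p| ≤
      a * (rescale (plateauTensor d) r z p.2 * κ p) := by
    intro z p
    refine (Finset.abs_sum_le_sum_abs _ _).trans ?_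
    rw [ha, Finset.mul_sum, Finset.sum_mul]
    refine Finset.sum_le_sum fun o _ => ?_
    rw [abs_mul, abs_mul, abs_of_nonneg (h01 p).1]
    have h0 := (h01 p).1
    have h1 := hψK o z p.2
    have h2 := (hθ z p.2).1
    have h3 : |Y o p| ≤ ‖Y o‖ := (Y o).norm_coe_le_norm p
    calc |ψ o z p.2| * |Y o p| * κ p ≤ (K * rescale (plateauTensor d) r z p.2) * ‖Y o‖ * κ p := by
          gcongr
      _ = _ := by ring
  let γ : (Fin d → ℤ) → (S × (Fin d → ℝ)) →ᵇ ℝ := fun z =>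
    BoundedContinuousFunction.ofNormedAddCommGroup (fun p => ∑ o, ψ o z p.2 * Y o p * κ p)
      (continuous_finsetSum _ fun o _ =>
        (((hψc o z).comp continuous_snd).mul (Y o).continuous).mul hκ) a fun p =>
        (hγb z p).trans (mul_le_of_le_one_right ha0
          (mul_le_one₀ (hθ z _).2 (h01 p).1 (h01 p).2))
  set c : (Fin d → ℤ) → ℕ → S → ℝ := fun z N => xcoeff (innerSpline none) r (u N) z with hc
  have hcm : ∀ z N, Measurable (c z N) := fun z N =>
    measurable_xcoeff (isPrimal_inner none) r (hu N).measurable z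
  have hcb : ∀ z N, ∃ B, ∀ s, |c z N s| ≤ B := fun z N => by
    obtain ⟨B, hB⟩ := (hu N).bdd
    exact ⟨B, fun s => abs_coeff_le (isPrimal_inner none) hr (fun x => hB (s, x)) z⟩
  have hz : ∀ z ∈ nodes d R r, ∀ᶠ N in l,
      |∫ s, c z N s * ∫ x, γ z (s, x) ∂(M N).condKernel s ∂(M N).fst| ≤
      t * (C * A) + (2 * t)⁻¹ *
        (K ^ 2 * (d + 1) * ∑ o, ∫ p, (y o p - Y o p) ^ 2 * κ p ∂M') + e := by
    intro z hzn
    refine eventually_abs_pairing_le hM hD hl (H := Hf z) (γ := γ z)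
      (fun p => mul_nonneg (hθ z _).1 (h01 p).1) ha0 (hγb z) (hcm z) (hcb z) ?_ ?_ ht he
    · filter_upwards [hA] with N hN
      exact (integral_sq_xcoeff_le (hac N) h01 hr (hu N) (hR N) hC0 (hC N) hzn).trans
        (mul_le_mul_of_nonneg_left (hN none) hC0)
    · exact integral_sq_div_le hκ.measurable h01 hr z hy hy2 horth hY
  have hz' := (Finset.eventually_all (nodes d R r)).2 hz
  filter_upwards [hz'] with N hN
  have hγi : ∀ z, Integrable (fun p : S × (Fin d → ℝ) => c z N p.1 * γ z p) (M N) := by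
    intro z
    obtain ⟨B, hB⟩ := hcb z N
    refine integrable_of_abs_le (((hcm z N).comp measurable_fst).mul
      (γ z).continuous.measurable) (C := B * ‖γ z‖) fun p => ?_
    rw [abs_mul]
    exact mul_le_mul (hB _) ((γ z).norm_coe_le_norm p) (abs_nonneg _)
      ((abs_nonneg _).trans (hB p.1))
  have hWi : ∀ o, Integrable (fun p => xinterp o r R (u N) p * Y o p * κ p) (M N) := by
    intro o
    obtain ⟨B, hB⟩ := (hu N).exists_gdrv_bound
    refine integrable_of_abs_le (((measurable_xinterp (hu N) o r R).mul
      (Y o).continuous.measurable).mul hκ.measurable) (C := B * ‖Y o‖ * 1) fun p => ?_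
    have hB0 : 0 ≤ B := (abs_nonneg _).trans (hB none p)
    rw [abs_mul, abs_mul]
    have h1 : |xinterp o r R (u N) p| ≤ B :=
      abs_interp_le (isPrimal_outer o) (isPrimal_inner o) hr (fun x => hB o (p.1, x)) _ _
    have h2 : |Y o p| ≤ ‖Y o‖ := (Y o).norm_coe_le_norm p
    have := hκ1 p
    gcongr
  have key : ∑ o, ∫ p, xinterp o r R (u N) p * Y o p * κ p ∂M N =
      ∑ z ∈ nodes d R r, ∫ s, c z N s * ∫ x, γ z (s, x) ∂(M N).condKernel s ∂(M N).fst := by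
    have e1 : ∀ z, ∫ s, c z N s * ∫ x, γ z (s, x) ∂(M N).condKernel s ∂(M N).fst =
        ∫ p, c z N p.1 * γ z p ∂M N := by
      intro z
      rw [← Measure.integral_condKernel (hγi z)]
      simp only [integral_const_mul]
    simp only [e1]
    rw [← integral_finsetSum _ fun o _ => hWi o, ← integral_finsetSum _ fun z _ => hγi z]
    congr 1; funext p
    have e2 : ∀ z, c z N p.1 * γ z p = ∑ o, c z N p.1 * ψ o z p.2 * Y o p * κ p := by
      intro z
      change c z N p.1 * ∑ o, ψ o z p.2 * Y o p * κ p = _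
      rw [Finset.mul_sum]
      exact Finset.sum_congr rfl fun o _ => by ring
    simp only [e2]
    rw [Finset.sum_comm]
    refine Finset.sum_congr rfl fun o _ => ?_
    rw [xinterp_eq (hu N) hr (hR N) o p, Finset.sum_mul, Finset.sum_mul]
  rw [key]
  refine (Finset.abs_sum_le_sum_abs _ _).trans ?_
  rw [← nsmul_eq_mul]
  exact Finset.sum_le_card_nsmul _ _ _ hN

/-- The dependence on the mesh is removed in two stages. A second approximation `Y'` of `y`, as fine
as the mesh requires, makes the preceding bound small. The change from `Y'` back to `Y` costs only
the `L²`-stability constant, because `(Y - Y')² κ` is continuous and its integral passes to the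
limit. The final constant involves neither `r` nor `R`. -/
lemma eventually_abs_sum_xinterp_le
    (hM : ∀ g : (S × (Fin d → ℝ)) →ᵇ ℝ,
      Tendsto (fun N => ∫ p, g p ∂M N) atTop (𝓝 (∫ p, g p ∂M')))
    (hD : DisintegrationConv M M') (hac : ∀ N, ∀ᵐ s ∂(M N).fst, (M N).condKernel s ≪ volume)
    (hκ : Continuous κ) (h01 : ∀ p, κ p ∈ Set.Icc (0 : ℝ) 1) (hr : 0 < r) (hC0 : 0 ≤ C)
    (hC : ∀ N, ∀ᵐ s ∂(M N).fst,
      pertConst (fun x => κ (s, x)) r ((M N).condKernel s) ≤ ENNReal.ofReal C)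
    (hl : l ≤ atTop) (hu : ∀ N, FiberC1 (u N)) (hR : ∀ N s x, R < ‖x‖ → u N (s, x) = 0)
    (hA0 : 0 ≤ A)
    (hA : ∀ᶠ N in l, ∀ o, ∫ p, gdrv o (u N) p ^ 2 ∂M N ≤ A) (hy : ∀ o, Measurable (y o))
    (hy2 : ∀ o, Integrable (fun p => y o p ^ 2 * κ p) M')
    (horth : ∀ v ∈ productSpan S d, ∑ o, ∫ p, gdrv o v p * y o p * κ p ∂M' = 0)
    {ε : ℝ} (hε : 0 < ε)
    (hY : ∀ o, Integrable (fun p => (y o p - Y o p) ^ 2 * κ p) M')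
    (hYε : ∀ o, ∫ p, (y o p - Y o p) ^ 2 * κ p ∂M' ≤ ε ^ 2) :
    ∀ᶠ N in l, |∑ o, ∫ p, xinterp o r R (u N) p * Y o p * κ p ∂M N| ≤
      (1 + (d + 1) * (C * A + 5)) * ε := by
  have hκ1 : ∀ p, |κ p| ≤ 1 := fun p => by rw [abs_of_nonneg (h01 p).1]; exact (h01 p).2
  set n : ℝ := ((nodes d R r).card : ℝ) with hn
  have hn0 : 0 ≤ n := Nat.cast_nonneg _
  have hCA : 0 ≤ C * A := mul_nonneg hC0 hA0
  -- The quantities `t`, `e` and `ε'` make each of the three terms, multiplied by the number of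
  -- nodes, at most `ε / 3`. The order matters: `t` comes first, since `ε'` must compensate for
  -- `t⁻¹`.
  set t : ℝ := ε / (3 * (n * (C * A) + 1)) with ht
  have ht0 : 0 < t := by positivity
  set e : ℝ := ε / (3 * (n + 1)) with he
  have he0 : 0 < e := by positivity
  set Q : ℝ := n * ((2 * t)⁻¹ * (splineConst d r ^ 2 * (d + 1) * (d + 1))) with hQ
  have hQ0 : 0 ≤ Q := by positivity
  obtain ⟨ε', hε'0, hε'ε, hε'Q⟩ : ∃ ε', 0 < ε' ∧ ε' ≤ ε ∧ Q * ε' ^ 2 ≤ ε / 3 := by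
    have h1 : Tendsto (fun x : ℝ => Q * x ^ 2) (𝓝[>] 0) (𝓝 (Q * 0 ^ 2)) :=
      ((continuous_const.mul (continuous_pow 2)).tendsto 0).mono_left nhdsWithin_le_nhds
    have h2 : ∀ᶠ x in 𝓝[>] (0 : ℝ), Q * x ^ 2 ≤ ε / 3 :=
      (h1.eventually_lt_const (by simp; positivity)).mono fun x hx => hx.le
    have h3 : ∀ᶠ x in 𝓝[>] (0 : ℝ), x ∈ Set.Ioc 0 ε := Ioc_mem_nhdsGT hε
    obtain ⟨x, hx1, hx2⟩ := (h2.and h3).exists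
    exact ⟨x, hx2.1, hx2.2, hx1⟩
  choose Y' hY'i hY' using fun o => exists_bcf_integral_sq_sub_le hκ.measurable h01 (hy o) (hy2 o)
    hε'0
  have hfine := eventually_abs_sum_xinterp_le_card hM hD hac hκ h01 hr hC0 hC hl hu hR hA hy hy2
    horth hY'i ht0 he0
  -- the squared distance of the two approximations
  let q : Option (Fin d) → (S × (Fin d → ℝ)) →ᵇ ℝ := fun o =>
    BoundedContinuousFunction.ofNormedAddCommGroup (fun p => (Y o p - Y' o p) ^ 2 * κ p)
      (((Y o).continuous.sub (Y' o).continuous).pow 2 |>.mul hκ) (‖Y o - Y' o‖ ^ 2) fun p => by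
        rw [norm_mul, norm_pow]
        refine (mul_le_of_le_one_right (by positivity) (hκ1 p)).trans ?_
        exact pow_le_pow_left₀ (norm_nonneg _) ((Y o - Y' o).norm_coe_le_norm p) 2
  have hq' : ∀ o, ∫ p, q o p ∂M' ≤ 4 * ε ^ 2 := by
    intro o
    have h1 : ∫ p, q o p ∂M' ≤ ∫ p, (2 * ((y o p - Y o p) ^ 2 * κ p) +
        2 * ((y o p - Y' o p) ^ 2 * κ p)) ∂M' := by
      refine integral_mono ((q o).integrable M') (((hY o).const_mul 2).add ((hY'i o).const_mul 2))
        fun p => ?_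
      change (Y o p - Y' o p) ^ 2 * κ p ≤ _
      have := (h01 p).1
      have h2 : (Y o p - Y' o p) ^ 2 ≤ 2 * (y o p - Y o p) ^ 2 + 2 * (y o p - Y' o p) ^ 2 := by
        nlinarith [sq_nonneg ((y o p - Y o p) + (y o p - Y' o p))]
      nlinarith [mul_le_mul_of_nonneg_right h2 this]
    rw [integral_add ((hY o).const_mul 2) ((hY'i o).const_mul 2), integral_const_mul,
      integral_const_mul] at h1
    have := hYε o
    have h3 := hY' o
    have h4 : ε' ^ 2 ≤ ε ^ 2 := pow_le_pow_left₀ hε'0.le hε'ε 2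
    linarith
  -- In the limit the squared distance is at most `2 ε ^ 2 + 2 ε' ^ 2 ≤ 4 ε ^ 2`; the constant `5`
  -- gives the strict margin that survives for nearby `N`.
  have hqN : ∀ᶠ N in l, ∀ o, ∫ p, q o p ∂M N ≤ 5 * ε ^ 2 := by
    refine eventually_all.2 fun o => ?_
    have hlt : ∫ p, q o p ∂M' < 5 * ε ^ 2 := lt_of_le_of_lt (hq' o) (by nlinarith [sq_pos_of_pos hε])
    exact (((hM (q o)).mono_left hl).eventually_lt_const hlt).mono fun N hN => hN.le
  filter_upwards [hfine, hqN, hA] with N h1 h2 h3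
  have hbound : ∀ o, ∃ B, 0 ≤ B ∧ ∀ p, |xinterp o r R (u N) p| ≤ B := by
    intro o
    obtain ⟨B, hB⟩ := (hu N).exists_gdrv_bound
    obtain ⟨p₀⟩ : Nonempty (S × (Fin d → ℝ)) := (M N).nonempty_of_neZero
    exact ⟨B, (abs_nonneg _).trans (hB none p₀), fun p =>
      abs_interp_le (isPrimal_outer o) (isPrimal_inner o) hr (fun x => hB o (p.1, x)) _ _⟩
  have hWY : ∀ (Z : (S × (Fin d → ℝ)) →ᵇ ℝ) o,
      Integrable (fun p => xinterp o r R (u N) p * Z p * κ p) (M N) := by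
    intro Z o
    obtain ⟨B, hB0, hB⟩ := hbound o
    refine integrable_of_abs_le (((measurable_xinterp (hu N) o r R).mul
      Z.continuous.measurable).mul hκ.measurable) (C := B * ‖Z‖ * 1) fun p => ?_
    rw [abs_mul, abs_mul]
    have h2 : |Z p| ≤ ‖Z‖ := Z.norm_coe_le_norm p
    have := hκ1 p
    have := hB p
    gcongr
  have hW2 : ∀ o, Integrable (fun p => xinterp o r R (u N) p ^ 2 * κ p) (M N) := by
    intro o
    obtain ⟨B, hB0, hB⟩ := hbound o
    refine integrable_of_abs_le (((measurable_xinterp (hu N) o r R).pow_const 2).mul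
      hκ.measurable) (C := B ^ 2 * 1) fun p => ?_
    rw [abs_mul, abs_pow]
    have := hκ1 p
    have := hB p
    gcongr
  have hdiff : ∀ o, |(∫ p, xinterp o r R (u N) p * Y o p * κ p ∂M N) -
      ∫ p, xinterp o r R (u N) p * Y' o p * κ p ∂M N| ≤ (C * A + 5) * ε := by
    intro o
    rw [← integral_sub (hWY _ o) (hWY _ o)]
    have h4 : |∫ p, (xinterp o r R (u N) p * Y o p * κ p - xinterp o r R (u N) p * Y' o p * κ p)
        ∂M N| ≤ ∫ p, (ε * (xinterp o r R (u N) p ^ 2 * κ p) + ε⁻¹ * q o p) ∂M N := by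
      refine abs_integral_le_integral_abs.trans (integral_mono_of_nonneg
        (ae_of_all _ fun _ => abs_nonneg _) (((hW2 o).const_mul ε).add
          (((q o).integrable _).const_mul _)) (ae_of_all _ fun p => ?_))
      change |_| ≤ ε * (xinterp o r R (u N) p ^ 2 * κ p) + ε⁻¹ * ((Y o p - Y' o p) ^ 2 * κ p)
      have hk := (h01 p).1
      rw [show xinterp o r R (u N) p * Y o p * κ p - xinterp o r R (u N) p * Y' o p * κ p =
        (xinterp o r R (u N) p * (Y o p - Y' o p)) * κ p by ring, abs_mul, abs_of_nonneg hk, abs_mul]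
      set w := xinterp o r R (u N) p
      set v := Y o p - Y' o p
      have hy : |w| * |v| ≤ ε * w ^ 2 + ε⁻¹ * v ^ 2 := by
        have h5 : 0 ≤ ε⁻¹ * (ε * |w| - |v|) ^ 2 := by positivity
        have h6 : ε⁻¹ * (ε * |w| - |v|) ^ 2 = ε * w ^ 2 + ε⁻¹ * v ^ 2 - 2 * (|w| * |v|) := by
          rw [← sq_abs w, ← sq_abs v]; field_simp; ring
        have h7 : 0 ≤ |w| * |v| := by positivity
        linarith
      calc _ ≤ (ε * w ^ 2 + ε⁻¹ * v ^ 2) * κ p := mul_le_mul_of_nonneg_right hy hk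
        _ = _ := by ring
    rw [integral_add ((hW2 o).const_mul ε) (((q o).integrable _).const_mul _), integral_const_mul,
      integral_const_mul] at h4
    have h5 := (integral_sq_xinterp_le (hac N) hκ.measurable h01 hr (hu N) (hR N) hC0 (hC N)
      o).trans (mul_le_mul_of_nonneg_left (h3 o) hC0)
    have h6 : ε⁻¹ * ∫ p, q o p ∂M N ≤ 5 * ε := by
      calc _ ≤ ε⁻¹ * (5 * ε ^ 2) := mul_le_mul_of_nonneg_left (h2 o) (by positivity)
        _ = 5 * ε := by field_simp
    have h7 := mul_le_mul_of_nonneg_left h5 hε.le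
    linarith
  have hsum : |∑ o, ∫ p, xinterp o r R (u N) p * Y o p * κ p ∂M N| ≤
      |∑ o, ∫ p, xinterp o r R (u N) p * Y' o p * κ p ∂M N| + (d + 1) * ((C * A + 5) * ε) := by
    have e1 : ∑ o, ∫ p, xinterp o r R (u N) p * Y o p * κ p ∂M N =
        ∑ o, (∫ p, xinterp o r R (u N) p * Y' o p * κ p ∂M N) +
        ∑ o, ((∫ p, xinterp o r R (u N) p * Y o p * κ p ∂M N) -
          ∫ p, xinterp o r R (u N) p * Y' o p * κ p ∂M N) := by
      rw [← Finset.sum_add_distrib]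
      exact Finset.sum_congr rfl fun o _ => by ring
    rw [e1]
    refine (abs_add_le _ _).trans (add_le_add le_rfl ?_)
    refine (Finset.abs_sum_le_sum_abs _ _).trans ((Finset.sum_le_card_nsmul _ _ _ fun o _ =>
      hdiff o).trans_eq ?_)
    rw [nsmul_eq_mul, Finset.card_univ, Fintype.card_option, Fintype.card_fin]
    push_cast
    ring
  have hT : ∑ o, ∫ p, (y o p - Y' o p) ^ 2 * κ p ∂M' ≤ (d + 1) * ε' ^ 2 := by
    refine (Finset.sum_le_card_nsmul _ _ _ fun o _ => hY' o).trans_eq ?_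
    rw [nsmul_eq_mul, Finset.card_univ, Fintype.card_option, Fintype.card_fin]
    push_cast
    ring
  have hp1 : n * (t * (C * A)) ≤ ε / 3 := by
    have : n * (t * (C * A)) = ε / 3 * (n * (C * A) / (n * (C * A) + 1)) := by
      rw [ht]; field_simp
    rw [this]
    exact mul_le_of_le_one_right (by positivity) ((div_le_one (by positivity)).2 (by linarith))
  have hp2 : n * e ≤ ε / 3 := by
    have : n * e = ε / 3 * (n / (n + 1)) := by rw [he]; field_simp
    rw [this]
    exact mul_le_of_le_one_right (by positivity) ((div_le_one (by positivity)).2 (by linarith))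
  have hp3 : n * ((2 * t)⁻¹ * (splineConst d r ^ 2 * (d + 1) *
      ∑ o, ∫ p, (y o p - Y' o p) ^ 2 * κ p ∂M')) ≤ ε / 3 := by
    refine le_trans ?_ hε'Q
    calc _ ≤ n * ((2 * t)⁻¹ * (splineConst d r ^ 2 * (d + 1) * ((d + 1) * ε' ^ 2))) := by
          gcongr
      _ = _ := by rw [hQ]; ring
  have : (1 + (d + 1) * (C * A + 5)) * ε = ε + (d + 1) * ((C * A + 5) * ε) := by ring
  rw [this]
  refine hsum.trans (add_le_add (h1.trans ?_) le_rfl)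
  linarith

end LimitOrthogonality

/-! ### Limits of bounded sequences are orthogonal to the complement of the graph -/

section GraphLimit

variable {d : ℕ} {S : Type*} [MeasurableSpace S]

lemma integrable_mul_mul_of_sq {μ : Measure S} [IsFiniteMeasure μ] {κ f g : S → ℝ}
    (hκ : Measurable κ) (h01 : ∀ p, κ p ∈ Set.Icc (0 : ℝ) 1) (hf : Measurable f)
    (hg : Measurable g) (hf2 : Integrable (fun p => f p ^ 2) μ)
    (hg2 : Integrable (fun p => g p ^ 2 * κ p) μ) :
    Integrable (fun p => f p * g p * κ p) μ := by
  refine (hf2.add hg2).mono' ((hf.mul hg).mul hκ).aestronglyMeasurable (ae_of_all _ fun p => ?_)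
  have hk := h01 p
  rw [Real.norm_eq_abs, abs_mul, abs_mul, abs_of_nonneg hk.1]
  change _ ≤ f p ^ 2 + g p ^ 2 * κ p
  rw [← sq_abs (f p), ← sq_abs (g p)]
  have h1 : |f p| * |g p| * κ p ≤ (|f p| ^ 2 + |g p| ^ 2) * κ p :=
    mul_le_mul_of_nonneg_right
      (by nlinarith [sq_nonneg (|f p| - |g p|), abs_nonneg (f p), abs_nonneg (g p)]) hk.1
  have h2 : |f p| ^ 2 * κ p ≤ |f p| ^ 2 := mul_le_of_le_one_right (sq_nonneg _) hk.2
  linarith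

lemma abs_integral_mul_mul_le {μ : Measure S} [IsFiniteMeasure μ] {κ f g : S → ℝ}
    (h01 : ∀ p, κ p ∈ Set.Icc (0 : ℝ) 1) (hf2 : Integrable (fun p => f p ^ 2) μ)
    (hg2 : Integrable (fun p => g p ^ 2 * κ p) μ) {ε : ℝ} (hε : 0 < ε) :
    |∫ p, f p * g p * κ p ∂μ| ≤ ε * (∫ p, f p ^ 2 ∂μ) + ε⁻¹ * ∫ p, g p ^ 2 * κ p ∂μ := by
  rw [← integral_const_mul, ← integral_const_mul,
    ← integral_add (hf2.const_mul _) (hg2.const_mul _)]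
  refine abs_integral_le_integral_abs.trans (integral_mono_of_nonneg
    (ae_of_all _ fun _ => abs_nonneg _) ((hf2.const_mul _).add (hg2.const_mul _))
    (ae_of_all _ fun p => ?_))
  have hk := h01 p
  simp only
  rw [abs_mul, abs_mul, abs_of_nonneg hk.1]
  have hy : |f p| * |g p| ≤ ε * f p ^ 2 + ε⁻¹ * g p ^ 2 := by
    have h5 : 0 ≤ ε⁻¹ * (ε * |f p| - |g p|) ^ 2 := by positivity
    have h6 : ε⁻¹ * (ε * |f p| - |g p|) ^ 2 =
        ε * f p ^ 2 + ε⁻¹ * g p ^ 2 - 2 * (|f p| * |g p|) := by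
      rw [← sq_abs (f p), ← sq_abs (g p)]; field_simp; ring
    have h7 : 0 ≤ |f p| * |g p| := by positivity
    linarith
  have h1 := mul_le_mul_of_nonneg_right hy hk.1
  have h2 : ε * f p ^ 2 * κ p ≤ ε * f p ^ 2 := mul_le_of_le_one_right (by positivity) hk.2
  linarith

variable [TopologicalSpace S] [PolishSpace S] [BorelSpace S]
  {M : ℕ → Measure (S × (Fin d → ℝ))} [∀ N, IsProbabilityMeasure (M N)]
  {M' : Measure (S × (Fin d → ℝ))} [IsProbabilityMeasure M'] {κ : S × (Fin d → ℝ) → ℝ}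
  {l : Filter ℕ} {u : ℕ → S × (Fin d → ℝ) → ℝ} {R A : ℝ}
  {y u' : Option (Fin d) → S × (Fin d → ℝ) → ℝ}

/-- A chain of approximations, each with an error of order `ε`: `y` is replaced by a continuous `Y`,
then `Y` by its transposed interpolation at a fine mesh. Weak convergence passes from the limit to
`u N`, symmetry moves the interpolation onto `u N`, and the resulting pairing is small by
`eventually_abs_sum_xinterp_le`. The support condition keeps the number of nodes finite. -/
lemma sum_integral_eq_zero_of_support
    (hM : ∀ g : (S × (Fin d → ℝ)) →ᵇ ℝ,
      Tendsto (fun N => ∫ p, g p ∂M N) atTop (𝓝 (∫ p, g p ∂M')))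
    (hD : DisintegrationConv M M') (hac : ∀ N, ∀ᵐ s ∂(M N).fst, (M N).condKernel s ≪ volume)
    (hκ : Continuous κ) (h01 : ∀ p, κ p ∈ Set.Icc (0 : ℝ) 1)
    (hδ : Tendsto (fun m : ℕ => ⨆ N, (∫⁻ s, deltaConst (fun x => κ (s, x)) (1 / (m : ℝ))
      ((M N).condKernel s) ^ 2 ∂(M N).fst) ^ (1 / 2 : ℝ)) atTop (𝓝 0))
    (hP : limsup (fun m : ℕ => ⨆ N, essSup (fun s => pertConst (fun x => κ (s, x)) (1 / (m : ℝ))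
      ((M N).condKernel s)) (M N).fst) atTop < ⊤) [l.NeBot]
    (hl : l ≤ atTop) (hu : ∀ N, FiberC1 (u N)) (hR : ∀ N s x, R < ‖x‖ → u N (s, x) = 0)
    (hA0 : 0 ≤ A) (hA : ∀ᶠ N in l, ∀ o, ∫ p, gdrv o (u N) p ^ 2 ∂M N ≤ A)
    (hu' : ∀ o, Measurable (u' o)) (hu2 : ∀ o, Integrable (fun p => u' o p ^ 2) M')
    (hu'R : ∀ o s x, R < ‖x‖ → u' o (s, x) = 0)
    (hlim : ∀ o (φ : (S × (Fin d → ℝ)) →ᵇ ℝ),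
      Tendsto (fun N => ∫ p, gdrv o (u N) p * φ p ∂M N) l (𝓝 (∫ p, u' o p * φ p ∂M')))
    (hy : ∀ o, Measurable (y o)) (hy2 : ∀ o, Integrable (fun p => y o p ^ 2 * κ p) M')
    (horth : ∀ v ∈ productSpan S d, ∑ o, ∫ p, gdrv o v p * y o p * κ p ∂M' = 0) :
    ∑ o, ∫ p, u' o p * y o p * κ p ∂M' = 0 := by
  have hκ1 : ∀ p, |κ p| ≤ 1 := fun p => by rw [abs_of_nonneg (h01 p).1]; exact (h01 p).2
  obtain ⟨C, hC0, hC⟩ : ∃ C : ℝ, 0 ≤ C ∧ ∀ᶠ m : ℕ in atTop, ∀ N, ∀ᵐ s ∂(M N).fst,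
      pertConst (fun x => κ (s, x)) (1 / (m : ℝ)) ((M N).condKernel s) ≤ ENNReal.ofReal C := by
    obtain ⟨c, hc1, hc2⟩ := exists_between hP
    refine ⟨c.toReal, ENNReal.toReal_nonneg, ?_⟩
    filter_upwards [eventually_lt_of_limsup_lt hc1] with m hm N
    rw [ENNReal.ofReal_toReal hc2.ne]
    have h1 := (le_iSup (fun N => essSup (fun s => pertConst (fun x => κ (s, x)) (1 / (m : ℝ))
      ((M N).condKernel s)) (M N).fst) N).trans hm.le
    filter_upwards [ENNReal.ae_le_essSup fun s => pertConst (fun x => κ (s, x)) (1 / (m : ℝ))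
      ((M N).condKernel s)] with s hs
    exact hs.trans h1
  have hDel : ∀ D : ℝ, 0 < D → ∀ᶠ m : ℕ in atTop, ∀ N, ∫⁻ s, deltaConst (fun x => κ (s, x))
      (1 / (m : ℝ)) ((M N).condKernel s) ^ 2 ∂(M N).fst ≤ ENNReal.ofReal D := by
    intro D hD
    have hpos : (0 : ℝ≥0∞) < ENNReal.ofReal D ^ (1 / 2 : ℝ) :=
      ENNReal.rpow_pos (by simpa using hD) ENNReal.ofReal_ne_top
    filter_upwards [hδ.eventually_lt_const hpos] with m hm N
    have h1 := (le_iSup (fun N => (∫⁻ s, deltaConst (fun x => κ (s, x)) (1 / (m : ℝ))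
      ((M N).condKernel s) ^ 2 ∂(M N).fst) ^ (1 / 2 : ℝ)) N).trans hm.le
    exact (ENNReal.rpow_le_rpow_iff (by norm_num)).1 h1
  set V : ℝ := ∑ o, ∫ p, u' o p ^ 2 ∂M' with hV
  have hV0 : ∀ o, 0 ≤ ∫ p, u' o p ^ 2 ∂M' := fun o => integral_nonneg fun p => sq_nonneg _
  have hVo : ∀ o, ∫ p, u' o p ^ 2 ∂M' ≤ V := fun o =>
    Finset.single_le_sum (f := fun o => ∫ p, u' o p ^ 2 ∂M') (fun o _ => hV0 o) (Finset.mem_univ o)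
  have hcard : ∀ x : ℝ, (Finset.univ : Finset (Option (Fin d))).card • x = (d + 1) * x := by
    intro x
    rw [nsmul_eq_mul, Finset.card_univ, Fintype.card_option, Fintype.card_fin]
    push_cast
    ring
  set C3 : ℝ := (1 + (d + 1) * (C * A + 5)) + (d + 1) * (A + 1) + (d + 1) * (V + 1) with hC3
  have hmain : ∀ ε : ℝ, 0 < ε → |∑ o, ∫ p, u' o p * y o p * κ p ∂M'| ≤ C3 * ε := by
    intro ε hε
    choose Y hYi hY using fun o => exists_bcf_integral_sq_sub_le hκ.measurable h01 (hy o) (hy2 o)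
      hε
    set B : ℝ := ∑ o, ‖Y o‖ with hB
    have hB0 : 0 ≤ B := Finset.sum_nonneg fun o _ => norm_nonneg _
    have hYB : ∀ o p, |Y o p| ≤ B := fun o p => ((Y o).norm_coe_le_norm p).trans
      (Finset.single_le_sum (f := fun o => ‖Y o‖) (fun o _ => norm_nonneg _) (Finset.mem_univ o))
    -- The symmetry error for the parameter `t = ε` contains `ε⁻¹ B ^ 2 D`, which this choice keeps
    -- below `ε`. The `+ 1` covers `B = 0`.
    set D : ℝ := ε ^ 2 / (B ^ 2 + 1) with hDdef
    have hD0 : 0 < D := by positivity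
    have hBD : B ^ 2 * D ≤ ε ^ 2 := by
      rw [hDdef, mul_div_assoc', div_le_iff₀ (by positivity)]
      nlinarith [sq_nonneg ε]
    have hm : ∀ᶠ m : ℕ in atTop,
        |∑ o, ∫ p, u' o p * (xdual o (1 / (m : ℝ)) R (Y o) p * κ p) ∂M'| ≤
          ((1 + (d + 1) * (C * A + 5)) + (d + 1) * (A + 1)) * ε := by
      filter_upwards [hC, hDel D hD0, eventually_gt_atTop 0] with m hCm hDm hm0
      have hr : (0 : ℝ) < 1 / (m : ℝ) := by positivity
      set r : ℝ := 1 / (m : ℝ) with hrdef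
      -- The transposed interpolation of `Y o`, multiplied by `κ`, is bounded and continuous on `S ×
      -- ℝ^d`, hence an admissible test function for weak convergence. This is the gain from moving
      -- the interpolation off `u N`.
      let φ : Option (Fin d) → (S × (Fin d → ℝ)) →ᵇ ℝ := fun o =>
        BoundedContinuousFunction.ofNormedAddCommGroup (fun p => xdual o r R (Y o) p * κ p)
          ((continuous_xdual hr (Y o) o).mul hκ) ‖Y o‖ fun p => by
            rw [norm_mul]
            exact (mul_le_of_le_one_right (norm_nonneg _) (hκ1 p)).trans
              (abs_xdual_le hr R (Y o) o p)
      have ht : Tendsto (fun N => |∑ o, ∫ p, gdrv o (u N) p * φ o p ∂M N|) l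
          (𝓝 |∑ o, ∫ p, u' o p * φ o p ∂M'|) :=
        (tendsto_finsetSum _ fun o _ => hlim o (φ o)).abs
      refine le_of_tendsto ht ?_
      filter_upwards [hA, eventually_abs_sum_xinterp_le hM hD hac hκ h01 hr hC0 hCm hl hu hR hA0 hA
        hy hy2 horth hε hYi hY] with N hAN hN
      have hdual : ∀ o, |(∫ p, xinterp o r R (u N) p * Y o p * κ p ∂M N) -
          ∫ p, gdrv o (u N) p * φ o p ∂M N| ≤ (A + 1) * ε := by
        intro o
        have h1 := abs_xinterp_duality_le (hac N) hκ.measurable h01 hr (hu N) (hR N) hD0.le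
          (hDm N) (Y o).continuous.measurable (hYB o) o hε
        have h2 : ∀ p, gdrv o (u N) p * φ o p = gdrv o (u N) p * xdual o r R (Y o) p * κ p :=
          fun p => (mul_assoc _ _ _).symm
        simp only [h2]
        refine h1.trans ?_
        have h3 : ε⁻¹ * (B ^ 2 * D) ≤ ε := by
          calc _ ≤ ε⁻¹ * ε ^ 2 := by gcongr
            _ = ε := by field_simp
        have h4 := mul_le_mul_of_nonneg_left (hAN o) hε.le
        linarith
      have e1 : ∑ o, ∫ p, gdrv o (u N) p * φ o p ∂M N =
          (∑ o, ∫ p, xinterp o r R (u N) p * Y o p * κ p ∂M N) -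
          ∑ o, ((∫ p, xinterp o r R (u N) p * Y o p * κ p ∂M N) -
            ∫ p, gdrv o (u N) p * φ o p ∂M N) := by
        rw [← Finset.sum_sub_distrib]
        exact Finset.sum_congr rfl fun o _ => by ring
      rw [e1]
      refine (abs_sub _ _).trans ?_
      have h5 : |∑ o, ((∫ p, xinterp o r R (u N) p * Y o p * κ p ∂M N) -
            ∫ p, gdrv o (u N) p * φ o p ∂M N)| ≤ (d + 1) * ((A + 1) * ε) :=
        (Finset.abs_sum_le_sum_abs _ _).trans ((Finset.sum_le_card_nsmul _ _ _ fun o _ =>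
          hdual o).trans_eq (hcard _))
      linarith
    have htm : Tendsto (fun m : ℕ =>
        |∑ o, ∫ p, u' o p * (xdual o (1 / (m : ℝ)) R (Y o) p * κ p) ∂M'|) atTop
        (𝓝 |∑ o, ∫ p, u' o p * (Y o p * κ p) ∂M'|) := by
      refine (tendsto_finsetSum _ fun o _ => ?_).abs
      refine tendsto_integral_filter_of_dominated_convergence (fun p => (1 + u' o p ^ 2) * B)
        (Eventually.of_forall fun m => ?_) ?_ (((integrable_const 1).add (hu2 o)).mul_const B)
        (ae_of_all _ fun p => ?_)
      · exact ((hu' o).mul ((measurable_xdual (Y o).continuous.measurable o _ R).mul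
          hκ.measurable)).aestronglyMeasurable
      · filter_upwards [eventually_gt_atTop 0] with m hm0
        refine ae_of_all _ fun p => ?_
        have hr : (0 : ℝ) < 1 / (m : ℝ) := by positivity
        rw [Real.norm_eq_abs, abs_mul, abs_mul]
        have h1 : |u' o p| ≤ 1 + u' o p ^ 2 := by
          rw [← sq_abs]; nlinarith [sq_nonneg (|u' o p| - 1), abs_nonneg (u' o p)]
        have h2 : |xdual o (1 / (m : ℝ)) R (Y o) p| * |κ p| ≤ B * 1 := by
          refine mul_le_mul ((abs_xdual_le hr R (Y o) o p).trans ?_) (hκ1 p) (abs_nonneg _) hB0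
          exact Finset.single_le_sum (f := fun o => ‖Y o‖) (fun o _ => norm_nonneg _)
            (Finset.mem_univ o)
        rw [mul_one] at h2
        exact mul_le_mul h1 h2 (by positivity) (by positivity)
      · by_cases hp : R < ‖p.2‖
        · have : u' o p = 0 := hu'R o p.1 p.2 hp
          simp [this]
        · exact ((tendsto_xdual R (Y o) o (not_lt.1 hp)).mul_const _).const_mul _
    have hYlim := le_of_tendsto htm hm
    have hdiff : ∀ o, |(∫ p, u' o p * y o p * κ p ∂M') - ∫ p, u' o p * (Y o p * κ p) ∂M'| ≤
        (V + 1) * ε := by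
      intro o
      have hYm := (Y o).continuous.measurable
      have hi1 := integrable_mul_mul_of_sq hκ.measurable h01 (hu' o) (hy o) (hu2 o) (hy2 o)
      have hi2 : Integrable (fun p => u' o p * (y o p - Y o p) * κ p) M' :=
        integrable_mul_mul_of_sq hκ.measurable h01 (hu' o) ((hy o).sub hYm) (hu2 o) (hYi o)
      have e1 : ∀ p, u' o p * (Y o p * κ p) =
          u' o p * y o p * κ p - u' o p * (y o p - Y o p) * κ p := fun p => by ring
      simp only [e1]
      rw [integral_sub hi1 hi2, sub_sub_cancel]
      refine (abs_integral_mul_mul_le h01 (hu2 o) (hYi o) hε).trans ?_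
      have h1 := mul_le_mul_of_nonneg_left (hVo o) hε.le
      have h2 : ε⁻¹ * ∫ p, (y o p - Y o p) ^ 2 * κ p ∂M' ≤ ε := by
        calc _ ≤ ε⁻¹ * ε ^ 2 := mul_le_mul_of_nonneg_left (hY o) (by positivity)
          _ = ε := by field_simp
      linarith
    have e2 : ∑ o, ∫ p, u' o p * y o p * κ p ∂M' =
        ∑ o, (∫ p, u' o p * (Y o p * κ p) ∂M') +
        ∑ o, ((∫ p, u' o p * y o p * κ p ∂M') - ∫ p, u' o p * (Y o p * κ p) ∂M') := by
      rw [← Finset.sum_add_distrib]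
      exact Finset.sum_congr rfl fun o _ => by ring
    rw [e2]
    refine (abs_add_le _ _).trans ?_
    have h5 : |∑ o, ((∫ p, u' o p * y o p * κ p ∂M') - ∫ p, u' o p * (Y o p * κ p) ∂M')| ≤
        (d + 1) * ((V + 1) * ε) :=
      (Finset.abs_sum_le_sum_abs _ _).trans ((Finset.sum_le_card_nsmul _ _ _ fun o _ =>
        hdiff o).trans_eq (hcard _))
    rw [hC3]
    linarith
  have hz : |∑ o, ∫ p, u' o p * y o p * κ p ∂M'| ≤ 0 := by
    have ht : Tendsto (fun ε : ℝ => C3 * ε) (𝓝[>] 0) (𝓝 (C3 * 0)) :=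
      ((continuous_const.mul continuous_id).tendsto 0).mono_left nhdsWithin_le_nhds
    rw [mul_zero] at ht
    exact ge_of_tendsto ht (eventually_mem_nhdsWithin.mono fun ε hε => hmain ε hε)
  exact abs_nonpos_iff.1 hz

end GraphLimit

/-! ### Removing the support restriction -/

section Cutoff

variable {d : ℕ}

/-- The derivative in direction `o` of a cutoff, with the value `0` for `none`. -/
def cutoffDeriv (χ : (Fin d → ℝ) → ℝ) (o : Option (Fin d)) (x : Fin d → ℝ) : ℝ :=
  o.elim 0 fun i => fderiv ℝ χ x (Pi.single i 1)

/-- A sequence of smooth cutoffs on `ℝ^d`. -/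
structure IsCutoffSeq (χ : ℕ → (Fin d → ℝ) → ℝ) (C : ℝ) : Prop where
  contDiff : ∀ n, ContDiff ℝ 1 (χ n)
  mem_Icc : ∀ n x, χ n x ∈ Set.Icc (0 : ℝ) 1
  eq_zero : ∀ (n : ℕ) x, 2 * ((n : ℝ) + 1) < ‖x‖ → χ n x = 0
  eq_one : ∀ (n : ℕ) x, ‖x‖ < (n : ℝ) + 1 → χ n x = 1
  abs_deriv_le : ∀ n o x, |cutoffDeriv (χ n) o x| ≤ C

/-- Dilations of one bump function: the derivatives scale with `(n + 1)⁻¹`, so a single bound serves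
all `n`. -/
lemma exists_isCutoffSeq (d : ℕ) : ∃ (χ : ℕ → (Fin d → ℝ) → ℝ) (C : ℝ), IsCutoffSeq χ C := by
  let b : ContDiffBump (0 : Fin d → ℝ) := ⟨1, 2, one_pos, one_lt_two⟩
  have hb : ContDiff ℝ 1 b := b.contDiff
  have hbs : HasCompactSupport b := b.hasCompactSupport
  obtain ⟨C, hC⟩ := (hbs.fderiv ℝ).exists_bound_of_continuous (hb.continuous_fderiv (by norm_num))
  have hC0 : 0 ≤ C := (norm_nonneg _).trans (hC 0)
  have hn : ∀ n : ℕ, (0 : ℝ) < (n : ℝ) + 1 := fun n => by positivity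
  have hnorm : ∀ (n : ℕ) (x : Fin d → ℝ), ‖((n : ℝ) + 1)⁻¹ • x‖ = ((n : ℝ) + 1)⁻¹ * ‖x‖ := by
    intro n x
    rw [norm_smul, Real.norm_eq_abs, abs_of_pos (inv_pos.2 (hn n))]
  refine ⟨fun n x => b (((n : ℝ) + 1)⁻¹ • x), C, ?_, ?_, ?_, ?_, ?_⟩
  · exact fun n => hb.comp (contDiff_const_smul _)
  · exact fun n x => ⟨b.nonneg, b.le_one⟩
  · intro n x hx
    refine b.zero_of_le_dist ?_
    rw [dist_zero_right, hnorm]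
    change (2 : ℝ) ≤ _
    rw [le_inv_mul_iff₀ (hn n)]
    linarith
  · intro n x hx
    refine b.one_of_mem_closedBall ?_
    rw [mem_closedBall_zero_iff, hnorm]
    change _ ≤ (1 : ℝ)
    rw [inv_mul_le_iff₀ (hn n)]
    linarith
  · intro n o x
    cases o with
    | none => simpa [cutoffDeriv] using hC0
    | some i =>
      have h1 : HasFDerivAt (fun x => b (((n : ℝ) + 1)⁻¹ • x))
          ((fderiv ℝ b (((n : ℝ) + 1)⁻¹ • x)).comp
            (((n : ℝ) + 1)⁻¹ • ContinuousLinearMap.id ℝ (Fin d → ℝ))) x :=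
        HasFDerivAt.comp (g := b) x (hb.differentiable (by norm_num) _).hasFDerivAt
          ((((n : ℝ) + 1)⁻¹ • ContinuousLinearMap.id ℝ (Fin d → ℝ)).hasFDerivAt)
      simp only [cutoffDeriv, Option.elim_some]
      rw [h1.fderiv]
      simp only [ContinuousLinearMap.comp_apply, smul_apply,
        ContinuousLinearMap.id_apply, map_smul, smul_eq_mul]
      rw [abs_mul, abs_of_pos (inv_pos.2 (hn n))]
      have h2 : |fderiv ℝ b (((n : ℝ) + 1)⁻¹ • x) (Pi.single i 1)| ≤ C := by
        refine ((fderiv ℝ b (((n : ℝ) + 1)⁻¹ • x)).le_opNorm _).trans ?_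
        rw [Pi.norm_single, norm_one, mul_one]
        exact hC _
      have h3 : ((n : ℝ) + 1)⁻¹ ≤ 1 := inv_le_one_of_one_le₀ (by
        have : (0 : ℝ) ≤ n := Nat.cast_nonneg n
        linarith)
      calc _ ≤ 1 * |fderiv ℝ b (((n : ℝ) + 1)⁻¹ • x) (Pi.single i 1)| := by gcongr
        _ ≤ C := by rw [one_mul]; exact h2

lemma continuous_cutoffDeriv {χ : (Fin d → ℝ) → ℝ} (hχ : ContDiff ℝ 1 χ) (o : Option (Fin d)) :
    Continuous (cutoffDeriv χ o) := by
  cases o with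
  | none => exact continuous_const
  | some i => exact (hχ.continuous_fderiv (by norm_num)).clm_apply continuous_const

namespace IsCutoffSeq

variable {χ : ℕ → (Fin d → ℝ) → ℝ} {C : ℝ} (hχ : IsCutoffSeq χ C)

include hχ

lemma deriv_eq_zero (n : ℕ) {x : Fin d → ℝ} (hx : 2 * ((n : ℝ) + 1) < ‖x‖) (o : Option (Fin d)) :
    cutoffDeriv (χ n) o x = 0 := by
  cases o with
  | none => rfl
  | some i => exact odrv_eq_zero (hχ.eq_zero n) (some i) _ hx

lemma tendsto (x : Fin d → ℝ) : Tendsto (fun n => χ n x) atTop (𝓝 1) := by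
  obtain ⟨k, hk⟩ := exists_nat_gt ‖x‖
  refine tendsto_const_nhds.congr' ?_
  filter_upwards [eventually_ge_atTop k] with n hn
  have : (k : ℝ) ≤ n := by exact_mod_cast hn
  exact (hχ.eq_one n x (by linarith)).symm

lemma tendsto_deriv (o : Option (Fin d)) (x : Fin d → ℝ) :
    Tendsto (fun n => cutoffDeriv (χ n) o x) atTop (𝓝 0) := by
  obtain ⟨k, hk⟩ := exists_nat_gt ‖x‖
  refine tendsto_const_nhds.congr' ?_
  filter_upwards [eventually_ge_atTop k] with n hn
  have hkn : (k : ℝ) ≤ n := by exact_mod_cast hn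
  cases o with
  | none => rfl
  | some i =>
    have h1 : χ n =ᶠ[𝓝 x] fun _ => 1 := by
      have : Metric.ball (0 : Fin d → ℝ) ((n : ℝ) + 1) ∈ 𝓝 x :=
        Metric.isOpen_ball.mem_nhds (mem_ball_zero_iff.2 (by linarith))
      filter_upwards [this] with z hz
      exact hχ.eq_one n z (mem_ball_zero_iff.1 hz)
    simp only [cutoffDeriv, Option.elim_some]
    rw [h1.fderiv_eq]
    simp

variable {S : Type*} [MeasurableSpace S]

lemma gdrv_mul (n : ℕ) {u : S × (Fin d → ℝ) → ℝ} (hu : FiberC1 u) (o : Option (Fin d))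
    (p : S × (Fin d → ℝ)) : gdrv o (fun p => χ n p.2 * u p) p =
      χ n p.2 * gdrv o u p + cutoffDeriv (χ n) o p.2 * u p := by
  cases o with
  | none => simp [cutoffDeriv, gdrv, odrv]
  | some i =>
    simp only [cutoffDeriv, gdrv, odrv, Option.elim_some]
    rw [fderiv_fun_mul ((hχ.contDiff n).differentiable (by norm_num) _)
      ((hu.contDiff p.1).differentiable (by norm_num) _)]
    simp only [add_apply, smul_apply, smul_eq_mul]
    ring

lemma fiberC1_mul (n : ℕ) {u : S × (Fin d → ℝ) → ℝ} (hu : FiberC1 u) :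
    FiberC1 fun p => χ n p.2 * u p := by
  obtain ⟨B, hB⟩ := hu.exists_gdrv_bound
  have h1 : ∀ x, |χ n x| ≤ 1 := fun x => by
    rw [abs_of_nonneg (hχ.mem_Icc n x).1]; exact (hχ.mem_Icc n x).2
  refine ⟨((hχ.contDiff n).continuous.measurable.comp measurable_snd).mul hu.measurable,
    ⟨B, fun p => ?_⟩, fun s => (hχ.contDiff n).mul (hu.contDiff s), B + C * B, fun i p => ?_⟩
  · rw [abs_mul]
    exact (mul_le_of_le_one_left (abs_nonneg _) (h1 _)).trans (hB none p)
  · have h2 := hχ.gdrv_mul n hu (some i) p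
    change |gdrv (some i) (fun p => χ n p.2 * u p) p| ≤ _
    rw [h2]
    refine (abs_add_le _ _).trans (add_le_add ?_ ?_)
    · rw [abs_mul]
      exact (mul_le_of_le_one_left (abs_nonneg _) (h1 _)).trans (hB _ p)
    · rw [abs_mul]
      exact mul_le_mul (hχ.abs_deriv_le n _ _) (hB none p) (abs_nonneg _)
        ((abs_nonneg _).trans (hχ.abs_deriv_le n none p.2))

end IsCutoffSeq

variable {S : Type*} [TopologicalSpace S] [MeasurableSpace S] [PolishSpace S] [BorelSpace S]
  {M : ℕ → Measure (S × (Fin d → ℝ))} [∀ N, IsProbabilityMeasure (M N)]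
  {M' : Measure (S × (Fin d → ℝ))} [IsProbabilityMeasure M'] {κ : S × (Fin d → ℝ) → ℝ}
  {l : Filter ℕ} {u : ℕ → S × (Fin d → ℝ) → ℝ} {A : ℝ}
  {y u' : Option (Fin d) → S × (Fin d → ℝ) → ℝ}

/-- A limit of functions with bounded energy belongs to the double orthogonal complement of the
graph of the limit form with weight `κ`. -/
lemma sum_integral_eq_zero_of_orthogonal
    (hM : ∀ g : (S × (Fin d → ℝ)) →ᵇ ℝ,
      Tendsto (fun N => ∫ p, g p ∂M N) atTop (𝓝 (∫ p, g p ∂M')))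
    (hD : DisintegrationConv M M') (hac : ∀ N, ∀ᵐ s ∂(M N).fst, (M N).condKernel s ≪ volume)
    (hκ : Continuous κ) (h01 : ∀ p, κ p ∈ Set.Icc (0 : ℝ) 1)
    (hδ : Tendsto (fun m : ℕ => ⨆ N, (∫⁻ s, deltaConst (fun x => κ (s, x)) (1 / (m : ℝ))
      ((M N).condKernel s) ^ 2 ∂(M N).fst) ^ (1 / 2 : ℝ)) atTop (𝓝 0))
    (hP : limsup (fun m : ℕ => ⨆ N, essSup (fun s => pertConst (fun x => κ (s, x)) (1 / (m : ℝ))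
      ((M N).condKernel s)) (M N).fst) atTop < ⊤) [l.NeBot]
    (hl : l ≤ atTop) (hu : ∀ N, FiberC1 (u N))
    (hA0 : 0 ≤ A) (hA : ∀ᶠ N in l, ∀ o, ∫ p, gdrv o (u N) p ^ 2 ∂M N ≤ A)
    (hu' : ∀ o, Measurable (u' o)) (hu2 : ∀ o, Integrable (fun p => u' o p ^ 2) M')
    (hlim : ∀ o (φ : (S × (Fin d → ℝ)) →ᵇ ℝ),
      Tendsto (fun N => ∫ p, gdrv o (u N) p * φ p ∂M N) l (𝓝 (∫ p, u' o p * φ p ∂M')))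
    (hy : ∀ o, Measurable (y o)) (hy2 : ∀ o, Integrable (fun p => y o p ^ 2 * κ p) M')
    (horth : ∀ v ∈ productSpan S d, ∑ o, ∫ p, gdrv o v p * y o p * κ p ∂M' = 0) :
    ∑ o, ∫ p, u' o p * y o p * κ p ∂M' = 0 := by
  obtain ⟨χ, C, hχ⟩ := exists_isCutoffSeq d
  have hC0 : 0 ≤ C := (abs_nonneg _).trans (hχ.abs_deriv_le 0 none 0)
  have h1 : ∀ n x, |χ n x| ≤ 1 := fun n x => by
    rw [abs_of_nonneg (hχ.mem_Icc n x).1]; exact (hχ.mem_Icc n x).2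
  have hχc : ∀ n, Continuous fun p : S × (Fin d → ℝ) => χ n p.2 := fun n =>
    (hχ.contDiff n).continuous.comp continuous_snd
  have hχ'c : ∀ n o, Continuous fun p : S × (Fin d → ℝ) => cutoffDeriv (χ n) o p.2 := fun n o =>
    (continuous_cutoffDeriv (hχ.contDiff n) o).comp continuous_snd
  set w : ℕ → Option (Fin d) → S × (Fin d → ℝ) → ℝ := fun n o p =>
    χ n p.2 * u' o p + cutoffDeriv (χ n) o p.2 * u' none p with hw
  have hwm : ∀ n o, Measurable (w n o) := fun n o =>
    ((hχc n).measurable.mul (hu' o)).add ((hχ'c n o).measurable.mul (hu' none))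
  have hsq : ∀ (a b s t : ℝ), |a| ≤ 1 → |b| ≤ C →
      (a * s + b * t) ^ 2 ≤ 2 * s ^ 2 + 2 * C ^ 2 * t ^ 2 := by
    intro a b s t ha hb
    have h2 : a ^ 2 ≤ 1 := by rw [← sq_abs]; exact pow_le_one₀ (abs_nonneg _) ha
    have h3 : b ^ 2 ≤ C ^ 2 := by rw [← sq_abs]; exact pow_le_pow_left₀ (abs_nonneg _) hb 2
    nlinarith [sq_nonneg (a * s - b * t), mul_le_mul_of_nonneg_right h2 (sq_nonneg s),
      mul_le_mul_of_nonneg_right h3 (sq_nonneg t)]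
  have hdom : ∀ o, Integrable (fun p => 2 * u' o p ^ 2 + 2 * C ^ 2 * u' none p ^ 2) M' := fun o =>
    ((hu2 o).const_mul 2).add ((hu2 none).const_mul (2 * C ^ 2))
  have hw2 : ∀ n o, Integrable (fun p => w n o p ^ 2) M' := by
    intro n o
    refine (hdom o).mono' ((hwm n o).pow_const 2).aestronglyMeasurable (ae_of_all _ fun p => ?_)
    rw [Real.norm_eq_abs, abs_of_nonneg (sq_nonneg _)]
    exact hsq _ _ _ _ (h1 n _) (hχ.abs_deriv_le n o _)
  have hgi : ∀ N o (φ : (S × (Fin d → ℝ)) →ᵇ ℝ), Integrable (fun p => gdrv o (u N) p * φ p)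
      (M N) := by
    intro N o φ
    obtain ⟨B, hB⟩ := (hu N).exists_gdrv_bound
    refine integrable_of_abs_le (((hu N).measurable_gdrv o).mul φ.continuous.measurable)
      (C := B * ‖φ‖) fun p => ?_
    rw [abs_mul]
    exact mul_le_mul (hB o p) (φ.norm_coe_le_norm p) (abs_nonneg _)
      ((abs_nonneg _).trans (hB o p))
  have hui : ∀ o (φ : (S × (Fin d → ℝ)) →ᵇ ℝ), Integrable (fun p => u' o p * φ p) M' := by
    intro o φ
    have h2 : MemLp (u' o) 2 M' :=
      (memLp_two_iff_integrable_sq (hu' o).aestronglyMeasurable).2 (hu2 o)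
    exact (h2.integrable (by norm_num)).mul_bdd (c := ‖φ‖) φ.continuous.aestronglyMeasurable
      (ae_of_all _ fun p => φ.norm_coe_le_norm p)
  -- The Leibniz rule keeps the energies of the cut-off functions bounded and makes their
  -- derivatives converge weakly to `w n`. The second summand of `w n` comes from the derivative of
  -- the cutoff and disappears as `n → ∞`.
  have hn : ∀ n, ∑ o, ∫ p, w n o p * y o p * κ p ∂M' = 0 := by
    intro n
    refine sum_integral_eq_zero_of_support (u := fun N p => χ n p.2 * u N p)
      (R := 2 * ((n : ℝ) + 1)) (A := 2 * A + 2 * C ^ 2 * A) hM hD hac hκ h01 hδ hP hl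
      (fun N => hχ.fiberC1_mul n (hu N)) (fun N s x hx => ?_) (by positivity) ?_ (hwm n) (hw2 n)
      (fun o s x hx => ?_) (fun o φ => ?_) hy hy2 horth
    · simp only [hχ.eq_zero n x hx, zero_mul]
    · filter_upwards [hA] with N hN o
      obtain ⟨B, hB⟩ := (hu N).exists_gdrv_bound
      have hi : ∀ o, Integrable (fun p => gdrv o (u N) p ^ 2) (M N) := fun o =>
        integrable_of_abs_le (((hu N).measurable_gdrv o).pow_const 2) (C := B ^ 2) fun p => by
          rw [abs_pow]; exact pow_le_pow_left₀ (abs_nonneg _) (hB o p) 2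
      have h2 : ∫ p, gdrv o (fun p => χ n p.2 * u N p) p ^ 2 ∂M N ≤
          ∫ p, (2 * gdrv o (u N) p ^ 2 + 2 * C ^ 2 * gdrv none (u N) p ^ 2) ∂M N := by
        refine integral_mono_of_nonneg (ae_of_all _ fun p => sq_nonneg _)
          (((hi o).const_mul 2).add ((hi none).const_mul (2 * C ^ 2))) (ae_of_all _ fun p => ?_)
        simp only [hχ.gdrv_mul n (hu N)]
        exact hsq _ _ _ _ (h1 n _) (hχ.abs_deriv_le n o _)
      rw [integral_add ((hi o).const_mul 2) ((hi none).const_mul (2 * C ^ 2)), integral_const_mul,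
        integral_const_mul] at h2
      refine h2.trans (add_le_add (mul_le_mul_of_nonneg_left (hN o) (by norm_num))
        (mul_le_mul_of_nonneg_left (hN none) (by positivity)))
    · simp only [hw, hχ.eq_zero n x hx, hχ.deriv_eq_zero n hx, zero_mul, add_zero]
    · let φ₁ : (S × (Fin d → ℝ)) →ᵇ ℝ := BoundedContinuousFunction.ofNormedAddCommGroup
        (fun p => χ n p.2 * φ p) ((hχc n).mul φ.continuous) ‖φ‖ fun p => by
          rw [norm_mul]
          exact (mul_le_of_le_one_left (norm_nonneg _) (h1 n _)).trans (φ.norm_coe_le_norm p)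
      let φ₂ : (S × (Fin d → ℝ)) →ᵇ ℝ := BoundedContinuousFunction.ofNormedAddCommGroup
        (fun p => cutoffDeriv (χ n) o p.2 * φ p) ((hχ'c n o).mul φ.continuous) (C * ‖φ‖) fun p => by
          rw [norm_mul]
          exact mul_le_mul (hχ.abs_deriv_le n o _) (φ.norm_coe_le_norm p) (norm_nonneg _) hC0
      have ht := (hlim o φ₁).add (hlim none φ₂)
      have e1 : ∀ N, ∫ p, gdrv o (fun p => χ n p.2 * u N p) p * φ p ∂M N =
          (∫ p, gdrv o (u N) p * φ₁ p ∂M N) + ∫ p, gdrv none (u N) p * φ₂ p ∂M N := by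
        intro N
        rw [← integral_add (hgi N o φ₁) (hgi N none φ₂)]
        congr 1; funext p
        rw [hχ.gdrv_mul n (hu N)]
        change _ = gdrv o (u N) p * (χ n p.2 * φ p) + u N p * (cutoffDeriv (χ n) o p.2 * φ p)
        ring
      have e2 : ∫ p, w n o p * φ p ∂M' =
          (∫ p, u' o p * φ₁ p ∂M') + ∫ p, u' none p * φ₂ p ∂M' := by
        rw [← integral_add (hui o φ₁) (hui none φ₂)]
        congr 1; funext p
        change (χ n p.2 * u' o p + cutoffDeriv (χ n) o p.2 * u' none p) * φ p =
          u' o p * (χ n p.2 * φ p) + u' none p * (cutoffDeriv (χ n) o p.2 * φ p)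
        ring
      rw [e2]
      simp only [e1]
      exact ht
  have hlimn : Tendsto (fun n => ∑ o, ∫ p, w n o p * y o p * κ p ∂M') atTop
      (𝓝 (∑ o, ∫ p, u' o p * y o p * κ p ∂M')) := by
    refine tendsto_finsetSum _ fun o _ => ?_
    refine tendsto_integral_of_dominated_convergence
      (fun p => 2 * u' o p ^ 2 + 2 * C ^ 2 * u' none p ^ 2 + y o p ^ 2 * κ p)
      (fun n => (((hwm n o).mul (hy o)).mul hκ.measurable).aestronglyMeasurable)
      ((hdom o).add (hy2 o)) (fun n => ae_of_all _ fun p => ?_) (ae_of_all _ fun p => ?_)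
    · have hk := h01 p
      have h2 := hsq _ _ (u' o p) (u' none p) (h1 n p.2) (hχ.abs_deriv_le n o p.2)
      change w n o p ^ 2 ≤ _ at h2
      rw [Real.norm_eq_abs, abs_mul, abs_of_nonneg hk.1, abs_mul]
      have h3 : |w n o p| * |y o p| ≤ w n o p ^ 2 + y o p ^ 2 := by
        rw [← sq_abs (w n o p), ← sq_abs (y o p)]
        nlinarith [sq_nonneg (|w n o p| - |y o p|), abs_nonneg (w n o p), abs_nonneg (y o p)]
      have h4 := mul_le_mul_of_nonneg_right h3 hk.1
      have h5 : w n o p ^ 2 * κ p ≤ w n o p ^ 2 := mul_le_of_le_one_right (sq_nonneg _) hk.2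
      linarith
    · have h2 := ((hχ.tendsto p.2).mul_const (u' o p)).add
        ((hχ.tendsto_deriv o p.2).mul_const (u' none p))
      rw [one_mul, zero_mul, add_zero] at h2
      exact (h2.mul_const _).mul_const _
  refine tendsto_nhds_unique hlimn ?_
  simp only [hn]
  exact tendsto_const_nhds

end Cutoff

/-! ### Convergence in `L²` -/

section LTwo

variable {α F : Type*} [MeasurableSpace α] {μ : Measure α} [NormedAddCommGroup F]

lemma lintegral_norm_sq_eq (f : α → F) :
    ∫⁻ x, ENNReal.ofReal (‖f x‖ ^ 2) ∂μ = eLpNorm f 2 μ ^ 2 := by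
  rw [eLpNorm_eq_lintegral_rpow_enorm_toReal (by norm_num) (by norm_num)]
  simp only [ENNReal.toReal_ofNat]
  rw [← ENNReal.rpow_natCast, ← ENNReal.rpow_mul]
  norm_num

lemma lintegral_sq_eq (f : α → ℝ) :
    ∫⁻ x, ENNReal.ofReal (f x ^ 2) ∂μ = eLpNorm f 2 μ ^ 2 := by
  rw [← lintegral_norm_sq_eq]
  simp only [Real.norm_eq_abs, sq_abs]

lemma ofReal_integral_sq {f : α → ℝ} (hf : MemLp f 2 μ) :
    ENNReal.ofReal (∫ x, f x ^ 2 ∂μ) = eLpNorm f 2 μ ^ 2 := by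
  rw [← lintegral_sq_eq, ofReal_integral_eq_lintegral_ofReal hf.integrable_sq
    (ae_of_all _ fun x => sq_nonneg _)]

lemma tendsto_sq_zero_iff {ι : Type*} {l : Filter ι} {f : ι → ℝ≥0∞} :
    Tendsto (fun i => f i ^ 2) l (𝓝 0) ↔ Tendsto f l (𝓝 0) := by
  constructor
  · intro h
    have := h.ennrpow_const (1 / 2 : ℝ)
    rw [ENNReal.zero_rpow_of_pos (by norm_num)] at this
    refine this.congr fun i => ?_
    rw [← ENNReal.rpow_natCast, ← ENNReal.rpow_mul]
    norm_num
  · intro h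
    have := ENNReal.Tendsto.pow (n := 2) h
    simpa using this

lemma tendsto_eLpNorm_of_sub {ι : Type*} {l : Filter ι} {f : ι → α → F} {g : α → F}
    (hf : ∀ i, MemLp (f i) 2 μ) (hg : MemLp g 2 μ)
    (h : Tendsto (fun i => eLpNorm (f i - g) 2 μ) l (𝓝 0)) :
    Tendsto (fun i => eLpNorm (f i) 2 μ) l (𝓝 (eLpNorm g 2 μ)) := by
  have h1 := (Lp.tendsto_Lp_iff_tendsto_eLpNorm'' f hf g hg).2 h
  have h2 := (continuous_enorm.tendsto _).comp h1
  simpa [Function.comp_def, Lp.enorm_toLp] using h2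

lemma tendsto_eLpNorm_sub_sub {f : ℕ → α → F} {g : α → F}
    (hf : ∀ i, MemLp (f i) 2 μ) (hg : MemLp g 2 μ)
    (h : Tendsto (fun i => eLpNorm (f i - g) 2 μ) atTop (𝓝 0)) :
    Tendsto (fun p : ℕ × ℕ => eLpNorm (f p.1 - f p.2) 2 μ) atTop (𝓝 0) := by
  have h1 : Tendsto (fun p : ℕ × ℕ => eLpNorm (f p.1 - g) 2 μ + eLpNorm (f p.2 - g) 2 μ)
      atTop (𝓝 (0 + 0)) := by
    rw [← prod_atTop_atTop_eq]
    exact (h.comp tendsto_fst).add (h.comp tendsto_snd)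
  rw [add_zero] at h1
  refine tendsto_of_tendsto_of_tendsto_of_le_of_le tendsto_const_nhds h1 (fun _ => zero_le)
    fun p => ?_
  have : f p.1 - f p.2 = (f p.1 - g) - (f p.2 - g) := by abel
  rw [this]
  exact eLpNorm_sub_le ((hf _).sub hg).1 ((hf _).sub hg).1 (by norm_num)

lemma exists_tendsto_eLpNorm_of_cauchy [CompleteSpace F] {f : ℕ → α → F}
    (hf : ∀ n, MemLp (f n) 2 μ)
    (h : Tendsto (fun p : ℕ × ℕ => eLpNorm (f p.1 - f p.2) 2 μ) atTop (𝓝 0)) :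
    ∃ g : α → F, StronglyMeasurable g ∧ MemLp g 2 μ ∧
      Tendsto (fun n => eLpNorm (f n - g) 2 μ) atTop (𝓝 0) := by
  have hC : CauchySeq fun n => (hf n).toLp (f n) := by
    rw [Lp.cauchySeq_Lp_iff_cauchySeq_eLpNorm]
    refine h.congr fun p => eLpNorm_congr_ae ?_
    exact ((hf p.1).coeFn_toLp.sub (hf p.2).coeFn_toLp).symm
  obtain ⟨g, hg⟩ := cauchySeq_tendsto_of_complete hC
  refine ⟨g, Lp.stronglyMeasurable g, Lp.memLp g, ?_⟩
  rw [Lp.tendsto_Lp_iff_tendsto_eLpNorm'] at hg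
  refine hg.congr fun n => eLpNorm_congr_ae ?_
  exact (hf n).coeFn_toLp.sub (ae_eq_refl _)

lemma tendsto_eLpNorm_sub_of_sub {ι : Type*} {l : Filter ι} {f g : ι → α → F} {f' g' : α → F}
    (hf : ∀ i, MemLp (f i) 2 μ) (hg : ∀ i, MemLp (g i) 2 μ) (hf' : MemLp f' 2 μ)
    (hg' : MemLp g' 2 μ) (h1 : Tendsto (fun i => eLpNorm (f i - f') 2 μ) l (𝓝 0))
    (h2 : Tendsto (fun i => eLpNorm (g i - g') 2 μ) l (𝓝 0)) :
    Tendsto (fun i => eLpNorm ((f i - g i) - (f' - g')) 2 μ) l (𝓝 0) := by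
  have h3 := h1.add h2
  rw [add_zero] at h3
  refine tendsto_of_tendsto_of_tendsto_of_le_of_le tendsto_const_nhds h3 (fun _ => zero_le)
    fun i => ?_
  have : (f i - g i) - (f' - g') = (f i - f') - (g i - g') := by abel
  rw [this]
  exact eLpNorm_sub_le ((hf _).sub hf').1 ((hg _).sub hg').1 (by norm_num)

end LTwo

/-! ### The energies of fibrewise continuously differentiable functions -/

section Energy

variable {d : ℕ}

lemma isWeakPartial_fderiv {f : (Fin d → ℝ) → ℝ} (hf : ContDiff ℝ 1 f) (i : Fin d) :
    IsWeakPartial i f fun x => fderiv ℝ f x (Pi.single i 1) := by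
  have hc : Continuous fun x => fderiv ℝ f x (Pi.single i 1) :=
    (hf.continuous_fderiv (by norm_num)).clm_apply continuous_const
  refine ⟨hc.locallyIntegrable, fun φ hφ hφs => ?_⟩
  have hφ' : Continuous fun x => fderiv ℝ φ x (Pi.single i 1) :=
    (hφ.continuous_fderiv (by simp)).clm_apply continuous_const
  have hφs' : HasCompactSupport fun x => fderiv ℝ φ x (Pi.single i 1) :=
    hφs.fderiv_apply ℝ (Pi.single i 1)
  exact integral_mul_fderiv_eq_neg_fderiv_mul_of_integrable
    ((hc.mul hφ.continuous).integrable_of_hasCompactSupport hφs.mul_left)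
    ((hf.continuous.mul hφ').integrable_of_hasCompactSupport hφs'.mul_left)
    ((hf.continuous.mul hφ.continuous).integrable_of_hasCompactSupport hφs.mul_left)
    (fun x _ => hf.differentiable (by norm_num) x) fun x _ => hφ.differentiable (by simp) x

/-- The representative picked by choice is tested against the same smooth functions as the classical
derivative, and weak derivatives are unique almost everywhere. -/
lemma weakPartial_ae_eq {f : (Fin d → ℝ) → ℝ} (hf : ContDiff ℝ 1 f) (i : Fin d) :
    ∀ᵐ x, weakPartial i f x = fderiv ℝ f x (Pi.single i 1) := by
  have hw := isWeakPartial_fderiv hf i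
  have hex : ∃ g, IsWeakPartial i f g := ⟨_, hw⟩
  have hv : IsWeakPartial i f (weakPartial i f) := by
    rw [weakPartial, dif_pos hex]
    exact hex.choose_spec
  refine ae_eq_of_integral_contDiff_smul_eq hv.1 hw.1 fun g hg hgs => ?_
  have h1 := (hv.2 g hg hgs).symm.trans (hw.2 g hg hgs)
  have h2 := neg_injective h1
  simpa only [smul_eq_mul, mul_comm] using h2

variable {S : Type*} [MeasurableSpace S] {μ : Measure (S × (Fin d → ℝ))}

lemma FiberC1.memLp_gdrv [IsFiniteMeasure μ] {v : S × (Fin d → ℝ) → ℝ} (hv : FiberC1 v)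
    (o : Option (Fin d)) : MemLp (gdrv o v) 2 μ := by
  obtain ⟨B, hB⟩ := hv.exists_gdrv_bound
  exact MemLp.of_bound (hv.measurable_gdrv o).aestronglyMeasurable B (ae_of_all _ (hB o))

lemma FiberC1.gdrv_sub {v w : S × (Fin d → ℝ) → ℝ} (hv : FiberC1 v) (hw : FiberC1 w)
    (o : Option (Fin d)) : gdrv o (v - w) = gdrv o v - gdrv o w := by
  funext p
  cases o with
  | none => rfl
  | some i => exact hv.xderiv_sub hw i p

lemma FiberC1.gdrv_add {v w : S × (Fin d → ℝ) → ℝ} (hv : FiberC1 v) (hw : FiberC1 w)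
    (o : Option (Fin d)) : gdrv o (v + w) = gdrv o v + gdrv o w := by
  funext p
  cases o with
  | none => rfl
  | some i => exact hv.xderiv_add hw i p

lemma FiberC1.gdrv_smul {v : S × (Fin d → ℝ) → ℝ} (hv : FiberC1 v) (c : ℝ)
    (o : Option (Fin d)) : gdrv o (c • v) = c • gdrv o v := by
  funext p
  cases o with
  | none => rfl
  | some i => exact hv.xderiv_smul c i p

variable [IsFiniteMeasure μ]

lemma sliceEnergy_eq {v : S × (Fin d → ℝ) → ℝ} (hv : FiberC1 v) {s : S}
    (hac : μ.condKernel s ≪ volume) {κ : (Fin d → ℝ) → ℝ} (hκ : Measurable κ) :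
    sliceEnergy (fun x => ENNReal.ofReal (κ x) * leb (μ.condKernel s) x) (fun x => v (s, x)) =
      ∫⁻ x, (∑ i, ENNReal.ofReal (xderiv i v (s, x) ^ 2)) * ENNReal.ofReal (κ x)
        ∂μ.condKernel s := by
  have hm : Measurable fun x => (∑ i, ENNReal.ofReal (xderiv i v (s, x) ^ 2)) *
      ENNReal.ofReal (κ x) :=
    (Finset.measurable_sum _ fun i _ => (((hv.measurable_xderiv i).comp
      measurable_prodMk_left).pow_const 2).ennreal_ofReal).mul hκ.ennreal_ofReal
  rw [← lintegral_rnDeriv_mul hac hm.aemeasurable]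
  refine lintegral_congr_ae ?_
  have hall : ∀ᵐ x, ∀ i, weakPartial i (fun x => v (s, x)) x =
      fderiv ℝ (fun x => v (s, x)) x (Pi.single i 1) :=
    ae_all_iff.2 fun i => weakPartial_ae_eq (hv.contDiff s) i
  filter_upwards [hall] with x hx
  simp only [hx]
  change (∑ i, ENNReal.ofReal (xderiv i v (s, x) ^ 2)) *
    (ENNReal.ofReal (κ x) * (μ.condKernel s).rnDeriv volume x) = _
  rw [← mul_assoc, mul_comm]

/-- For `C¹` fibres the arbitrary choice of weak derivatives disappears. By disintegration the
energy becomes a sum of squared norms in `L²(κ μ)`, so that convergence of energies is ordinary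
`L²`-convergence. -/
lemma superEnergy_eq {v : S × (Fin d → ℝ) → ℝ} (hv : FiberC1 v)
    (hac : ∀ᵐ s ∂μ.fst, μ.condKernel s ≪ volume) {κ : S × (Fin d → ℝ) → ℝ} (hκ : Measurable κ) :
    superEnergy μ κ v = ∑ i, eLpNorm (gdrv (some i) v) 2
      (μ.withDensity fun p => ENNReal.ofReal (κ p)) ^ 2 := by
  have hm : Measurable fun p => (∑ i, ENNReal.ofReal (xderiv i v p ^ 2)) *
      ENNReal.ofReal (κ p) :=
    (Finset.measurable_sum _ fun i _ =>
      ((hv.measurable_xderiv i).pow_const 2).ennreal_ofReal).mul hκ.ennreal_ofReal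
  have h1 : superEnergy μ κ v = ∫⁻ p, (∑ i, ENNReal.ofReal (xderiv i v p ^ 2)) *
      ENNReal.ofReal (κ p) ∂μ := by
    rw [← Measure.lintegral_condKernel hm]
    refine lintegral_congr_ae ?_
    filter_upwards [hac] with s hs
    exact sliceEnergy_eq hv hs (hκ.comp measurable_prodMk_left)
  rw [h1]
  have h2 : ∀ i, eLpNorm (gdrv (some i) v) 2 (μ.withDensity fun p => ENNReal.ofReal (κ p)) ^ 2 =
      ∫⁻ p, ENNReal.ofReal (xderiv i v p ^ 2) * ENNReal.ofReal (κ p) ∂μ := by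
    intro i
    rw [← lintegral_sq_eq, lintegral_withDensity_eq_lintegral_mul _ hκ.ennreal_ofReal
      ((hv.measurable_gdrv (some i)).pow_const 2).ennreal_ofReal]
    refine lintegral_congr fun p => ?_
    rw [Pi.mul_apply, mul_comm]
    rfl
  simp only [h2, Finset.sum_mul]
  rw [lintegral_finsetSum]
  exact fun i _ => ((hv.measurable_xderiv i).pow_const 2).ennreal_ofReal.mul hκ.ennreal_ofReal

lemma mem_superPre {v : S × (Fin d → ℝ) → ℝ} (hv : FiberC1 v)
    (hac : ∀ᵐ s ∂μ.fst, μ.condKernel s ≪ volume) : v ∈ superPre μ := by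
  obtain ⟨B, hB⟩ := hv.exists_gdrv_bound
  have he : ∀ᵐ s ∂μ.fst, sliceEnergy (leb (μ.condKernel s)) (fun x => v (s, x)) =
      ∫⁻ x, (∑ i, ENNReal.ofReal (xderiv i v (s, x) ^ 2)) ∂μ.condKernel s := by
    filter_upwards [hac] with s hs
    simpa using sliceEnergy_eq hv hs (κ := fun _ => 1) measurable_const
  have hm : Measurable fun p => ∑ i, ENNReal.ofReal (xderiv i v p ^ 2) :=
    Finset.measurable_sum _ fun i _ => ((hv.measurable_xderiv i).pow_const 2).ennreal_ofReal
  refine ⟨hv.measurable, hv.bdd, fun s => ⟨(hv.contDiff s).continuous, ⟨B, fun x => hB none (s, x)⟩,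
    fun i => ⟨_, isWeakPartial_fderiv (hv.contDiff s) i, ?_⟩⟩, ?_, ?_⟩
  · exact memLp_top_of_bound (hv.continuous_xderiv i s).aestronglyMeasurable B
      (ae_of_all _ fun x => hB (some i) (s, x))
  · exact ⟨_, hm.lintegral_kernel_prod_right', he⟩
  · rw [lintegral_congr_ae he, Measure.lintegral_condKernel hm, lintegral_finsetSum _ fun i _ =>
      ((hv.measurable_xderiv i).pow_const 2).ennreal_ofReal]
    refine ENNReal.sum_lt_top.2 fun i _ => ?_
    rw [lintegral_sq_eq]
    exact ENNReal.pow_lt_top (hv.memLp_gdrv (some i)).2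

variable [TopologicalSpace S] [BorelSpace S]

lemma fiberC1_of_mem_productSpan {v : S × (Fin d → ℝ) → ℝ} (hv : v ∈ productSpan S d) :
    FiberC1 v := by
  refine Submodule.span_induction (p := fun v _ => FiberC1 v) ?_ FiberC1.zero
    (fun _ _ _ _ h1 h2 => h1.add h2) (fun c _ _ h => h.smul c) hv
  rintro _ ⟨f, g, hg, hgs, rfl⟩
  obtain ⟨B, hB⟩ := hgs.exists_bound_of_continuous hg.continuous
  obtain ⟨D, hD⟩ := (hgs.fderiv ℝ).exists_bound_of_continuous (hg.continuous_fderiv (by norm_num))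
  refine ⟨(f.continuous.measurable.comp measurable_fst).mul
    (hg.continuous.measurable.comp measurable_snd), ⟨‖f‖ * B, fun p => ?_⟩,
    fun s => (contDiff_const (c := f s)).mul hg, ‖f‖ * D, fun i p => ?_⟩
  · rw [abs_mul]
    exact mul_le_mul (f.norm_coe_le_norm _) (hB _) (abs_nonneg _) (norm_nonneg _)
  · have : xderiv i (fun p => f p.1 * g p.2) p = f p.1 * fderiv ℝ g p.2 (Pi.single i 1) := by
      simp only [xderiv]
      rw [fderiv_const_mul (hg.differentiable (by norm_num) _)]
      simp
    rw [this, abs_mul]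
    refine mul_le_mul (f.norm_coe_le_norm _) ?_ (abs_nonneg _) (norm_nonneg _)
    refine ((fderiv ℝ g p.2).le_opNorm _).trans ?_
    rw [Pi.norm_single, norm_one, mul_one]
    exact hD _

/-- Product functions belong to the larger class on which the superposed form is closed, so the
infimum defining the latter runs over more approximating sequences. -/
lemma superForm_le_minForm (hac : ∀ᵐ s ∂μ.fst, μ.condKernel s ≪ volume)
    (u : S × (Fin d → ℝ) → ℝ) : superForm μ u ≤ minForm μ (fun _ => 1) u := by
  refine sInf_le_sInf ?_
  rintro c ⟨v, ⟨hv, hC⟩, h1, h2⟩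
  refine ⟨v, ⟨fun n => mem_superPre (fiberC1_of_mem_productSpan (hv n)) hac, hC⟩, ?_, h2⟩
  simpa using h1

end Energy

/-! ### Limits of sequences with bounded energy on `S × ℝ^d` -/

section ComponentLimit

variable {d : ℕ} {S : Type*} [MeasurableSpace S] {κ : S × (Fin d → ℝ) → ℝ}

lemma isFiniteMeasure_weight {μ : Measure (S × (Fin d → ℝ))} [IsFiniteMeasure μ]
    (hκ : Measurable κ) (h01 : ∀ p, κ p ∈ Set.Icc (0 : ℝ) 1) :
    IsFiniteMeasure (μ.withDensity fun p => ENNReal.ofReal (κ p)) :=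
  isFiniteMeasure_withDensity_ofReal (integrable_of_abs_le hκ (C := 1) fun x => by
    rw [abs_of_nonneg (h01 x).1]; exact (h01 x).2).2

lemma weight_le {μ : Measure (S × (Fin d → ℝ))} (h01 : ∀ p, κ p ∈ Set.Icc (0 : ℝ) 1) :
    (μ.withDensity fun p => ENNReal.ofReal (κ p)) ≤ μ := by
  calc (μ.withDensity fun p => ENNReal.ofReal (κ p)) ≤ μ.withDensity 1 :=
        withDensity_mono (ae_of_all _ fun p => by
          simpa using ENNReal.ofReal_le_one.2 (h01 p).2)
    _ = μ := withDensity_one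

lemma lintegral_sq_mul_weight {μ : Measure (S × (Fin d → ℝ))} (hκ : Measurable κ)
    {f : S × (Fin d → ℝ) → ℝ} (hf : Measurable f) :
    ∫⁻ p, ENNReal.ofReal (f p ^ 2) * ENNReal.ofReal (κ p) ∂μ =
      eLpNorm f 2 (μ.withDensity fun p => ENNReal.ofReal (κ p)) ^ 2 := by
  rw [← lintegral_sq_eq, lintegral_withDensity_eq_lintegral_mul _ hκ.ennreal_ofReal
    (hf.pow_const 2).ennreal_ofReal]
  refine lintegral_congr fun p => ?_
  rw [Pi.mul_apply, mul_comm]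

variable [TopologicalSpace S] {M' : Measure (S × (Fin d → ℝ))} [IsProbabilityMeasure M']

lemma minForm_congr (h01 : ∀ p, κ p ∈ Set.Icc (0 : ℝ) 1) {u w : S × (Fin d → ℝ) → ℝ}
    (h : u =ᵐ[M'] w) : minForm M' κ u = minForm M' κ w := by
  have h1 : u =ᵐ[M'.withDensity fun p => ENNReal.ofReal (κ p)] w :=
    (Measure.absolutelyContinuous_of_le (weight_le h01)).ae_eq h
  have h2 : ∀ v : S × (Fin d → ℝ) → ℝ,
      eLpNorm (v - u) 2 (M'.withDensity fun p => ENNReal.ofReal (κ p)) =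
      eLpNorm (v - w) 2 (M'.withDensity fun p => ENNReal.ofReal (κ p)) := fun v =>
    eLpNorm_congr_ae ((ae_eq_refl v).sub h1)
  simp only [minForm, formClosure, h2]

/-- Differences of the two sequences tend to zero in `L²(κ μ)` with derivatives tending to `f - g`,
so closability applies. In `L²(κ μ)` nothing can be said where `κ` vanishes. -/
lemma ae_eq_of_tendsto_of_tendsto (hH : Hamza M') (hκ : Measurable κ)
    (hκc : ∀ s, Continuous fun x => κ (s, x))
    (h01 : ∀ p, κ p ∈ Set.Icc (0 : ℝ) 1) {v w : ℕ → S × (Fin d → ℝ) → ℝ}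
    (hv : ∀ n, FiberC1 (v n)) (hw : ∀ n, FiberC1 (w n)) {u f g : S × (Fin d → ℝ) → ℝ}
    (hu : MemLp u 2 M') (hfm : Measurable f) (hgm : Measurable g) (hf : MemLp f 2 M')
    (hg : MemLp g 2 M') (i : Fin d)
    (hv0 : Tendsto (fun n => eLpNorm (v n - u) 2
      (M'.withDensity fun p => ENNReal.ofReal (κ p))) atTop (𝓝 0))
    (hw0 : Tendsto (fun n => eLpNorm (w n - u) 2
      (M'.withDensity fun p => ENNReal.ofReal (κ p))) atTop (𝓝 0))
    (hvi : Tendsto (fun n => eLpNorm (gdrv (some i) (v n) - f) 2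
      (M'.withDensity fun p => ENNReal.ofReal (κ p))) atTop (𝓝 0))
    (hwi : Tendsto (fun n => eLpNorm (gdrv (some i) (w n) - g) 2
      (M'.withDensity fun p => ENNReal.ofReal (κ p))) atTop (𝓝 0)) :
    ∀ᵐ p ∂M', 0 < κ p → f p = g p := by
  have := isFiniteMeasure_weight (μ := M') hκ h01
  have hle : (M'.withDensity fun p => ENNReal.ofReal (κ p)) ≤ M' := weight_le h01
  have h0 : Tendsto (fun n => ∫⁻ p, ENNReal.ofReal ((v n - w n) p ^ 2) * ENNReal.ofReal (κ p) ∂M')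
      atTop (𝓝 0) := by
    have h1 := tendsto_eLpNorm_sub_of_sub (fun n => (hv n).memLp_gdrv none)
      (fun n => (hw n).memLp_gdrv none) (hu.mono_measure hle) (hu.mono_measure hle) hv0 hw0
    refine (tendsto_sq_zero_iff.2 h1).congr fun n => ?_
    rw [lintegral_sq_mul_weight hκ ((hv n).sub (hw n)).measurable, sub_self, sub_zero]
    rfl
  have h1 : Tendsto (fun n => ∫⁻ p, ENNReal.ofReal ((xderiv i (v n - w n) p - (f - g) p) ^ 2) *
      ENNReal.ofReal (κ p) ∂M') atTop (𝓝 0) := by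
    have h2 := tendsto_eLpNorm_sub_of_sub (fun n => (hv n).memLp_gdrv (some i))
      (fun n => (hw n).memLp_gdrv (some i)) (hf.mono_measure hle) (hg.mono_measure hle) hvi hwi
    refine (tendsto_sq_zero_iff.2 h2).congr fun n => ?_
    rw [lintegral_sq_mul_weight (f := fun p => xderiv i (v n - w n) p - (f - g) p) hκ
      ((((hv n).sub (hw n)).measurable_xderiv i).sub (hfm.sub hgm)),
      ← (hv n).gdrv_sub (hw n)]
    rfl
  filter_upwards [xderiv_closable hH hκ hκc i (fun n => (hv n).sub (hw n)) (hfm.sub hgm) h0 h1]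
    with p hp hκp
  exact sub_eq_zero.1 (hp hκp)

/-- Closability of the partial derivatives on `L²(μ)`. -/
lemma gdrv_ae_eq_of_tendsto (hH : Hamza M') {v w : ℕ → S × (Fin d → ℝ) → ℝ}
    (hv : ∀ n, FiberC1 (v n)) (hw : ∀ n, FiberC1 (w n)) {u f g : S × (Fin d → ℝ) → ℝ}
    (hu : MemLp u 2 M') (hfm : Measurable f) (hgm : Measurable g) (hf : MemLp f 2 M')
    (hg : MemLp g 2 M') (i : Fin d)
    (hv0 : Tendsto (fun n => eLpNorm (v n - u) 2 M') atTop (𝓝 0))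
    (hw0 : Tendsto (fun n => eLpNorm (w n - u) 2 M') atTop (𝓝 0))
    (hvi : Tendsto (fun n => eLpNorm (gdrv (some i) (v n) - f) 2 M') atTop (𝓝 0))
    (hwi : Tendsto (fun n => eLpNorm (gdrv (some i) (w n) - g) 2 M') atTop (𝓝 0)) :
    f =ᵐ[M'] g := by
  have hone : (M'.withDensity fun _ => ENNReal.ofReal 1) = M' := by simp
  have h := ae_eq_of_tendsto_of_tendsto (κ := fun _ => 1) hH measurable_const
    (fun _ => continuous_const) (fun _ => by simp) hv hw hu hfm hgm hf hg i (by rwa [hone])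
    (by rwa [hone]) (by rwa [hone]) (by rwa [hone])
  filter_upwards [h] with p hp
  exact hp one_pos

variable [BorelSpace S]

/-- The graph of the gradient on the product span, in `L²(μ)`. -/
def productGraph (μ : Measure (S × (Fin d → ℝ))) [IsFiniteMeasure μ] :
    Submodule ℝ (PiLp 2 fun _ : Option (Fin d) => Lp ℝ 2 μ) where
  carrier := {h | ∃ v ∈ productSpan S d, ∀ o, h o =ᵐ[μ] gdrv o v}
  add_mem' := by
    rintro a b ⟨v, hv, hav⟩ ⟨w, hw, hbw⟩
    refine ⟨v + w, Submodule.add_mem _ hv hw, fun o => ?_⟩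
    rw [(fiberC1_of_mem_productSpan hv).gdrv_add (fiberC1_of_mem_productSpan hw)]
    exact (Lp.coeFn_add _ _).trans ((hav o).add (hbw o))
  zero_mem' := by
    refine ⟨0, Submodule.zero_mem _, fun o => ?_⟩
    have h0 : gdrv o (0 : S × (Fin d → ℝ) → ℝ) = 0 := by
      have := (FiberC1.zero (S := S) (d := d)).gdrv_smul 0 o
      simpa using this
    rw [h0]
    exact Lp.coeFn_zero _ _ _
  smul_mem' := by
    rintro c a ⟨v, hv, hav⟩
    refine ⟨c • v, Submodule.smul_mem _ c hv, fun o => ?_⟩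
    rw [(fiberC1_of_mem_productSpan hv).gdrv_smul]
    exact (Lp.coeFn_smul _ _).trans ((hav o).const_smul c)

/-- In the Hilbert sum of copies of `L²(μ)`, the double orthogonal complement of the graph is its
closure. Membership in the closure is thereby reduced to the vanishing of pairings, which is
accessible by passing to limits. -/
lemma exists_seq_of_orthogonal {μ : Measure (S × (Fin d → ℝ))} [IsFiniteMeasure μ]
    {u' : Option (Fin d) → S × (Fin d → ℝ) → ℝ} (hu' : ∀ o, MemLp (u' o) 2 μ)
    (h : ∀ y : Option (Fin d) → S × (Fin d → ℝ) → ℝ, (∀ o, Measurable (y o)) →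
      (∀ o, MemLp (y o) 2 μ) →
      (∀ v ∈ productSpan S d, ∑ o, ∫ p, gdrv o v p * y o p ∂μ = 0) →
      ∑ o, ∫ p, u' o p * y o p ∂μ = 0) :
    ∃ v : ℕ → S × (Fin d → ℝ) → ℝ, (∀ n, v n ∈ productSpan S d) ∧
      ∀ o, Tendsto (fun n => eLpNorm (gdrv o (v n) - u' o) 2 μ) atTop (𝓝 0) := by
  let z : PiLp 2 fun _ : Option (Fin d) => Lp ℝ 2 μ := WithLp.toLp 2 fun o => (hu' o).toLp (u' o)
  have hzo : ∀ o, z o =ᵐ[μ] u' o := fun o => (hu' o).coeFn_toLp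
  have hz : z ∈ (productGraph μ)ᗮᗮ := by
    rw [Submodule.mem_orthogonal]
    intro y hy
    have hy' : ∀ v ∈ productSpan S d, ∑ o, ∫ p, gdrv o v p * y o p ∂μ = 0 := by
      intro v hv
      have hvC := fiberC1_of_mem_productSpan hv
      have hg : (WithLp.toLp 2 fun o => (hvC.memLp_gdrv (μ := μ) o).toLp (gdrv o v) :
          PiLp 2 fun _ : Option (Fin d) => Lp ℝ 2 μ) ∈ productGraph μ :=
        ⟨v, hv, fun o => (hvC.memLp_gdrv o).coeFn_toLp⟩
      have h1 := (Submodule.mem_orthogonal _ _).1 hy _ hg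
      rw [PiLp.inner_apply] at h1
      rw [← h1]
      refine Finset.sum_congr rfl fun o _ => ?_
      rw [L2.inner_def]
      refine integral_congr_ae ?_
      filter_upwards [(hvC.memLp_gdrv (μ := μ) o).coeFn_toLp] with p hp
      simp only [hp, RCLike.inner_apply, conj_trivial]
      ring
    have h2 := h (fun o => y o) (fun o => (Lp.stronglyMeasurable (y o)).measurable)
      (fun o => Lp.memLp (y o)) hy'
    rw [PiLp.inner_apply, ← h2]
    refine Finset.sum_congr rfl fun o _ => ?_
    rw [L2.inner_def]
    refine integral_congr_ae ?_
    filter_upwards [hzo o] with p hp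
    simp only [hp, RCLike.inner_apply, conj_trivial]
  rw [Submodule.orthogonal_orthogonal_eq_closure] at hz
  obtain ⟨x, hx, hxz⟩ := mem_closure_iff_seq_limit.1 hz
  choose v hv hxv using hx
  refine ⟨v, hv, fun o => ?_⟩
  have h3 : Tendsto (fun n => x n o) atTop (𝓝 (z o)) :=
    ((PiLp.continuous_apply 2 _ o).tendsto z).comp hxz
  rw [Lp.tendsto_Lp_iff_tendsto_eLpNorm'] at h3
  refine h3.congr fun n => eLpNorm_congr_ae ?_
  exact (hxv n o).sub (hzo o)

/-- The value of the minimal form at the limit of a sequence that converges with its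
derivatives. -/
lemma minForm_le_of_tendsto (hac : ∀ᵐ s ∂M'.fst, M'.condKernel s ≪ volume)
    (hκ : Measurable κ) (h01 : ∀ p, κ p ∈ Set.Icc (0 : ℝ) 1)
    {v : ℕ → S × (Fin d → ℝ) → ℝ} (hv : ∀ n, v n ∈ productSpan S d)
    {u' : Option (Fin d) → S × (Fin d → ℝ) → ℝ} (hu' : ∀ o, MemLp (u' o) 2 M')
    (h : ∀ o, Tendsto (fun n => eLpNorm (gdrv o (v n) - u' o) 2
      (M'.withDensity fun p => ENNReal.ofReal (κ p))) atTop (𝓝 0)) :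
    minForm M' κ (u' none) ≤ ∑ i, eLpNorm (u' (some i)) 2
      (M'.withDensity fun p => ENNReal.ofReal (κ p)) ^ 2 := by
  have := isFiniteMeasure_weight (μ := M') hκ h01
  have hC := fun n => fiberC1_of_mem_productSpan (hv n)
  have hm := fun o => (hu' o).mono_measure (weight_le h01)
  refine sInf_le ⟨v, ⟨hv, ?_⟩, h none, ?_⟩
  · have h1 : ∀ p : ℕ × ℕ, superEnergy M' κ (v p.1 - v p.2) =
        ∑ i, eLpNorm (gdrv (some i) (v p.1) - gdrv (some i) (v p.2)) 2
          (M'.withDensity fun p => ENNReal.ofReal (κ p)) ^ 2 := by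
      intro p
      rw [superEnergy_eq ((hC _).sub (hC _)) hac hκ]
      simp only [(hC _).gdrv_sub (hC _)]
    simp only [h1]
    have h2 := tendsto_finsetSum Finset.univ fun i _ => tendsto_sq_zero_iff.2
      (tendsto_eLpNorm_sub_sub (fun n => (hC n).memLp_gdrv _) (hm _) (h (some i)))
    rwa [Finset.sum_const_zero] at h2
  · simp only [superEnergy_eq (hC _) hac hκ]
    exact tendsto_finsetSum _ fun i _ => ENNReal.Tendsto.pow (tendsto_eLpNorm_of_sub
      (fun n => (hC n).memLp_gdrv _) (hm _) (h (some i)))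

variable [PolishSpace S] {M : ℕ → Measure (S × (Fin d → ℝ))} [∀ N, IsProbabilityMeasure (M N)]
  {l : Filter ℕ} {u : ℕ → S × (Fin d → ℝ) → ℝ} {A : ℝ}
  {u' : Option (Fin d) → S × (Fin d → ℝ) → ℝ}

/-- A limit of functions with bounded energy belongs, with the limits of the derivatives, to the
closure of the graph of the gradient on the product span. -/
theorem exists_productSpan_seq (hcond : ComponentConditions M M')
    (hM : ∀ g : (S × (Fin d → ℝ)) →ᵇ ℝ,
      Tendsto (fun N => ∫ p, g p ∂M N) atTop (𝓝 (∫ p, g p ∂M'))) [l.NeBot]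
    (hl : l ≤ atTop) (hu : ∀ N, FiberC1 (u N))
    (hA0 : 0 ≤ A) (hA : ∀ᶠ N in l, ∀ o, ∫ p, gdrv o (u N) p ^ 2 ∂M N ≤ A)
    (hu' : ∀ o, Measurable (u' o)) (hu2 : ∀ o, MemLp (u' o) 2 M')
    (hlim : ∀ o (φ : (S × (Fin d → ℝ)) →ᵇ ℝ),
      Tendsto (fun N => ∫ p, gdrv o (u N) p * φ p ∂M N) l (𝓝 (∫ p, u' o p * φ p ∂M'))) :
    ∃ v : ℕ → S × (Fin d → ℝ) → ℝ, (∀ n, v n ∈ productSpan S d) ∧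
      ∀ o, Tendsto (fun n => eLpNorm (gdrv o (v n) - u' o) 2 M') atTop (𝓝 0) := by
  obtain ⟨U, hU⟩ := hcond.weights
  have hac := hcond.hamza_limit.1
  have hone : (M'.withDensity fun _ => ENNReal.ofReal 1) = M' := by simp
  have hw : ∀ κ ∈ U, ∃ v : ℕ → S × (Fin d → ℝ) → ℝ, (∀ n, v n ∈ productSpan S d) ∧
      ∀ o, Tendsto (fun n => eLpNorm (gdrv o (v n) - u' o) 2
        (M'.withDensity fun p => ENNReal.ofReal (κ p))) atTop (𝓝 0) := by
    intro κ hκU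
    have hκ := hU.continuous κ hκU
    have h01 := hU.mem_Icc κ hκU
    have := isFiniteMeasure_weight (μ := M') hκ.measurable h01
    have hint : ∀ f : S × (Fin d → ℝ) → ℝ,
        ∫ p, f p ∂(M'.withDensity fun p => ENNReal.ofReal (κ p)) = ∫ p, f p * κ p ∂M' := by
      intro f
      rw [integral_withDensity_eq_integral_toReal_smul hκ.measurable.ennreal_ofReal
        (ae_of_all _ fun p => ENNReal.ofReal_lt_top)]
      refine integral_congr_ae (ae_of_all _ fun p => ?_)
      simp only [ENNReal.toReal_ofReal (h01 p).1, smul_eq_mul, mul_comm]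
    refine exists_seq_of_orthogonal (fun o => (hu2 o).mono_measure (weight_le h01)) ?_
    intro y hy hy2 horth
    simp only [hint] at horth ⊢
    refine sum_integral_eq_zero_of_orthogonal hM hcond.disintegration
      (fun N => (hcond.hamza N).1) hκ h01 (hU.tendsto_delta κ hκU) (hU.limsup_pert κ hκU) hl hu hA0
      hA hu' (fun o => (hu2 o).integrable_sq) hlim hy (fun o => ?_) horth
    have h1 := (hy2 o).integrable_sq
    rw [integrable_withDensity_iff hκ.measurable.ennreal_ofReal
      (ae_of_all _ fun p => ENNReal.ofReal_lt_top)] at h1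
    refine h1.congr (ae_of_all _ fun p => ?_)
    simp only [ENNReal.toReal_ofReal (h01 p).1]
  -- the limit belongs to the domain of the minimal form
  set z : Lp ℝ 2 M' := (hu2 none).toLp (u' none) with hz
  have hzu : z =ᵐ[M'] u' none := (hu2 none).coeFn_toLp
  set Q : ℝ≥0∞ := ∑ i : Fin d, eLpNorm (u' (some i)) 2 M' ^ 2 with hQ
  have hQt : Q < ⊤ := ENNReal.sum_lt_top.2 fun i _ => ENNReal.pow_lt_top (hu2 (some i)).2
  have hle : ∀ κ ∈ U, minForm M' κ z ≤ Q := by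
    intro κ hκU
    have h01 := hU.mem_Icc κ hκU
    obtain ⟨w, hw1, hw2⟩ := hw κ hκU
    rw [minForm_congr h01 hzu]
    refine (minForm_le_of_tendsto hac (hU.continuous κ hκU).measurable h01 hw1 hu2 hw2).trans ?_
    refine Finset.sum_le_sum fun i _ => ?_
    exact pow_le_pow_left₀ zero_le (eLpNorm_mono_measure _ (weight_le h01)) 2
  -- Since `κ ≤ 1`, the bound `Q` holds for all weights at once, and the domain identity for the
  -- weight family removes the weight.
  have hdom : minForm M' (fun _ => 1) z < ⊤ := by
    have : z ∈ {u : Lp ℝ 2 M' | (∀ κ ∈ U, minForm M' κ u < ⊤) ∧ (⨆ κ ∈ U, minForm M' κ u) < ⊤} :=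
      ⟨fun κ hκ => (hle κ hκ).trans_lt hQt, (iSup₂_le hle).trans_lt hQt⟩
    rw [← hU.domain_eq] at this
    exact this
  rw [minForm_congr (fun _ => by simp) hzu, minForm, formClosure, sInf_lt_iff] at hdom
  obtain ⟨c, ⟨v, ⟨hv, hvC⟩, hv0, -⟩, -⟩ := hdom
  have hC := fun n => fiberC1_of_mem_productSpan (hv n)
  rw [hone] at hv0
  -- Membership in the domain provides derivatives `k i` of `u' none` for the weight `1`; that they
  -- agree with the weak limits `u' (some i)` is still to be shown.
  have hk : ∀ i : Fin d, ∃ k, StronglyMeasurable k ∧ MemLp k 2 M' ∧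
      Tendsto (fun n => eLpNorm (gdrv (some i) (v n) - k) 2 M') atTop (𝓝 0) := by
    intro i
    refine exists_tendsto_eLpNorm_of_cauchy (fun n => (hC n).memLp_gdrv _) ?_
    rw [← tendsto_sq_zero_iff]
    refine tendsto_of_tendsto_of_tendsto_of_le_of_le tendsto_const_nhds hvC (fun _ => zero_le)
      fun p => ?_
    simp only
    rw [superEnergy_eq ((hC _).sub (hC _)) hac measurable_const, hone, ← (hC _).gdrv_sub (hC _)]
    exact Finset.single_le_sum (f := fun i => eLpNorm (gdrv (some i) (v p.1 - v p.2)) 2 M' ^ 2)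
      (fun _ _ => zero_le) (Finset.mem_univ i)
  choose k hkm hk2 hkt using hk
  refine ⟨v, hv, fun o => ?_⟩
  cases o with
  | none => exact hv0
  | some i =>
    refine (hkt i).congr fun n => eLpNorm_congr_ae ((ae_eq_refl _).sub ?_)
    have hall : ∀ᵐ p ∂M', ∀ κ ∈ U, 0 < κ p → k i p = u' (some i) p := by
      rw [ae_ball_iff hU.countable]
      intro κ hκU
      have hκ := hU.continuous κ hκU
      have h01 := hU.mem_Icc κ hκU
      obtain ⟨w, hw1, hw2⟩ := hw κ hκU
      have hmono : ∀ {f : ℕ → S × (Fin d → ℝ) → ℝ},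
          Tendsto (fun n => eLpNorm (f n) 2 M') atTop (𝓝 0) →
          Tendsto (fun n => eLpNorm (f n) 2 (M'.withDensity fun p => ENNReal.ofReal (κ p)))
            atTop (𝓝 0) := fun h =>
        tendsto_of_tendsto_of_tendsto_of_le_of_le tendsto_const_nhds h (fun _ => zero_le)
          fun n => eLpNorm_mono_measure _ (weight_le h01)
      exact ae_eq_of_tendsto_of_tendsto hcond.hamza_limit hκ.measurable
        (fun s => hκ.comp (by fun_prop)) h01 hC (fun n => fiberC1_of_mem_productSpan (hw1 n))
        (hu2 none) (hkm i).measurable (hu' (some i)) (hk2 i) (hu2 (some i)) i (hmono hv0)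
        (hw2 none) (hmono (hkt i)) (hw2 (some i))
    filter_upwards [hall, hU.isLUB_one] with p hp hlub
    -- The weights have supremum one at almost every point, so some weight is positive there and the
    -- identity on `{κ > 0}` applies.
    obtain ⟨_, ⟨κ, hκU, rfl⟩, hpos⟩ := (lt_isLUB_iff hlub).1 zero_lt_one
    exact hp κ hκU hpos

end ComponentLimit

/-! ### Cylindrical functions -/

section CylindricalFunctions

variable {E : Type*} [AddCommGroup E] [Module ℝ E] [TopologicalSpace E]
  {H : Type*} [NormedAddCommGroup H] [InnerProductSpace ℝ H] [CompleteSpace H]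
  (j : H →L[ℝ] E) {F F' : E → ℝ}

lemma zero_mem_cylindrical : (0 : E → ℝ) ∈ Cylindrical E := by
  refine ⟨0, fun _ => 0, fun i => i.elim0, contDiff_const, fun k => ⟨0, fun x => ?_⟩, rfl⟩
  simp [iteratedFDeriv_fun_zero]

lemma continuous_of_mem_cylindrical (hF : F ∈ Cylindrical E) : Continuous F := by
  obtain ⟨m, f, l, hf, -, rfl⟩ := hF
  exact hf.continuous.comp (continuous_pi fun i => (l i).continuous)

lemma exists_bound_of_mem_cylindrical (hF : F ∈ Cylindrical E) : ∃ C, ∀ z, |F z| ≤ C := by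
  obtain ⟨m, f, l, -, hb, rfl⟩ := hF
  obtain ⟨C, hC⟩ := hb 0
  exact ⟨C, fun z => by simpa using hC fun i => l i z⟩

/-- By the chain rule through finitely many functionals, the gradient is the Riesz representative of
a continuous bounded function of `l z`. Its continuity, boundedness and linearity in `F` are read
off from this formula. -/
lemma exists_hGradient_eq (hF : F ∈ Cylindrical E) :
    ∃ (m : ℕ) (f : (Fin m → ℝ) → ℝ) (l : E →L[ℝ] (Fin m → ℝ)), ContDiff ℝ ∞ f ∧
      (∃ C, ∀ x, ‖fderiv ℝ f x‖ ≤ C) ∧ ∀ z,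
      HasFDerivAt (fun h : H => F (z + j h)) ((fderiv ℝ f (l z)).comp (l.comp j)) 0 ∧
      hGradient j F z = (InnerProductSpace.toDual ℝ H).symm
        ((fderiv ℝ f (l z)).comp (l.comp j)) := by
  obtain ⟨m, f, l, hf, hb, rfl⟩ := hF
  obtain ⟨C, hC⟩ := hb 1
  have key : ∀ z, HasFDerivAt (fun h : H => f fun i => l i (z + j h))
      ((fderiv ℝ f (ContinuousLinearMap.pi l z)).comp ((ContinuousLinearMap.pi l).comp j)) 0 := by
    intro z
    have h1 : HasFDerivAt (fun h : H => ContinuousLinearMap.pi l (z + j h))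
        ((ContinuousLinearMap.pi l).comp j) 0 := by
      simp only [map_add]
      exact (((ContinuousLinearMap.pi l).comp j).hasFDerivAt).const_add _
    have h2 : HasFDerivAt f (fderiv ℝ f (ContinuousLinearMap.pi l z))
        (ContinuousLinearMap.pi l (z + j 0)) := by
      rw [map_zero, add_zero]
      exact (hf.differentiable (by simp) _).hasFDerivAt
    exact h2.comp (0 : H) h1
  refine ⟨m, f, ContinuousLinearMap.pi l, hf, ⟨C, fun x => ?_⟩, fun z => ⟨key z, ?_⟩⟩
  · rw [← norm_iteratedFDeriv_one]
    exact hC x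
  · rw [hGradient, gradient, (key z).fderiv]

lemma continuous_hGradient (hF : F ∈ Cylindrical E) : Continuous (hGradient j F) := by
  obtain ⟨m, f, l, hf, -, h⟩ := exists_hGradient_eq j hF
  have he : hGradient j F = fun z => (InnerProductSpace.toDual ℝ H).symm
      ((fderiv ℝ f (l z)).comp (l.comp j)) := funext fun z => (h z).2
  rw [he]
  exact (InnerProductSpace.toDual ℝ H).symm.continuous.comp
    (((hf.continuous_fderiv (by simp)).comp l.continuous).clm_comp continuous_const)

lemma exists_bound_hGradient (hF : F ∈ Cylindrical E) : ∃ C, ∀ z, ‖hGradient j F z‖ ≤ C := by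
  obtain ⟨m, f, l, -, ⟨C, hC⟩, h⟩ := exists_hGradient_eq j hF
  refine ⟨C * ‖l.comp j‖, fun z => ?_⟩
  rw [(h z).2, LinearIsometryEquiv.norm_map]
  exact (ContinuousLinearMap.opNorm_comp_le _ _).trans
    (mul_le_mul_of_nonneg_right (hC _) (norm_nonneg _))

lemma hGradient_sub (hF : F ∈ Cylindrical E) (hF' : F' ∈ Cylindrical E) :
    hGradient j (F - F') = hGradient j F - hGradient j F' := by
  obtain ⟨_, _, _, -, -, h⟩ := exists_hGradient_eq j hF
  obtain ⟨_, _, _, -, -, h'⟩ := exists_hGradient_eq j hF'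
  funext z
  have h1 := ((h z).1.sub (h' z).1).fderiv
  rw [Pi.sub_apply, (h z).2, (h' z).2, ← map_sub, ← h1, hGradient, gradient]
  rfl

variable [PolishSpace E] [MeasurableSpace E] [BorelSpace E] {μ : Measure E} [IsFiniteMeasure μ]

omit [PolishSpace E] in
lemma memLp_of_mem_cylindrical (hF : F ∈ Cylindrical E) : MemLp F 2 μ := by
  obtain ⟨C, hC⟩ := exists_bound_of_mem_cylindrical hF
  exact MemLp.of_bound (continuous_of_mem_cylindrical hF).aestronglyMeasurable C (ae_of_all _ hC)

lemma memLp_hGradient (hF : F ∈ Cylindrical E) : MemLp (hGradient j F) 2 μ := by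
  obtain ⟨C, hC⟩ := exists_bound_hGradient j hF
  exact MemLp.of_bound (continuous_hGradient j hF).aestronglyMeasurable C (ae_of_all _ hC)

omit [PolishSpace E] [BorelSpace E] [IsFiniteMeasure μ] in
lemma gradEnergy_eq (F : E → ℝ) : gradEnergy j μ F = eLpNorm (hGradient j F) 2 μ ^ 2 :=
  lintegral_norm_sq_eq _

/-- The gradients along an energy-Cauchy sequence converge. -/
lemma EnergyCauchy.exists_gradient_limit {v : ℕ → E → ℝ}
    (hv : EnergyCauchy (Cylindrical E) (gradEnergy j μ) v) :
    ∃ G : E → H, StronglyMeasurable G ∧ MemLp G 2 μ ∧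
      Tendsto (fun n => eLpNorm (hGradient j (v n) - G) 2 μ) atTop (𝓝 0) := by
  refine exists_tendsto_eLpNorm_of_cauchy (fun n => memLp_hGradient j (hv.1 n)) ?_
  rw [← tendsto_sq_zero_iff]
  refine hv.2.congr fun p => ?_
  rw [gradEnergy_eq, hGradient_sub j (hv.1 _) (hv.1 _)]

end CylindricalFunctions

/-! ### Transport to the components -/

section Transport

variable {E : Type*} [AddCommGroup E] [Module ℝ E] [TopologicalSpace E] [IsTopologicalAddGroup E]
  [ContinuousSMul ℝ E] {H : Type*} [NormedAddCommGroup H] [InnerProductSpace ℝ H]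
  {j : H →L[ℝ] E} {d : ℕ}

namespace Splitting

variable (P : Splitting j d)

lemma continuous_J : Continuous P.J := by
  refine Continuous.prodMk (Continuous.subtype_mk ?_ _) P.π.continuous
  exact continuous_id.sub (continuous_finsetSum _ fun i _ =>
    ((continuous_apply i).comp P.π.continuous).smul continuous_const)

lemma continuous_Jinv : Continuous P.Jinv :=
  (continuous_subtype_val.comp continuous_fst).add (continuous_finsetSum _ fun i _ =>
    ((continuous_apply i).comp continuous_snd).smul continuous_const)

/-- The splitting as a homeomorphism. -/
def homeo : E ≃ₜ P.S × (Fin d → ℝ) where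
  toFun := P.J
  invFun := P.Jinv
  left_inv := P.Jinv_J
  right_inv := P.J_Jinv
  continuous_toFun := P.continuous_J
  continuous_invFun := P.continuous_Jinv

omit [IsTopologicalAddGroup E] [ContinuousSMul ℝ E] in
lemma Jinv_add_single (s : P.S) (x : Fin d → ℝ) (i : Fin d) (t : ℝ) :
    P.Jinv (s, x + t • Pi.single i 1) = P.Jinv (s, x) + t • j (P.ξ i) := by
  have : ∑ k, (x + t • Pi.single i (1 : ℝ) : Fin d → ℝ) k • j (P.ξ k) =
      ∑ k, x k • j (P.ξ k) + t • j (P.ξ i) := by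
    simp only [Pi.add_apply, Pi.smul_apply, add_smul, Finset.sum_add_distrib, smul_assoc]
    congr 1
    rw [Finset.sum_eq_single i]
    · simp
    · intro k _ hk
      simp [hk]
    · simp
  simp only [Jinv]
  rw [this, add_assoc]

omit [IsTopologicalAddGroup E] [ContinuousSMul ℝ E] in
lemma contDiff_section {F : E → ℝ} (hF : F ∈ Cylindrical E) (s : P.S) :
    ContDiff ℝ 1 fun x => F (P.Jinv (s, x)) := by
  obtain ⟨m, f, l, hf, -, rfl⟩ := hF
  refine (hf.of_le (by simp)).comp (contDiff_pi.2 fun i => ?_)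
  simp only [Jinv, map_add, map_sum, map_smul, smul_eq_mul]
  fun_prop

variable [MeasurableSpace E] [BorelSpace E]

lemma measurableEmbedding_J : MeasurableEmbedding P.J :=
  P.homeo.measurableEmbedding

variable (μ : Measure E)

lemma isProbabilityMeasure_image [IsProbabilityMeasure μ] : IsProbabilityMeasure (P.image μ) :=
  Measure.isProbabilityMeasure_map P.measurableEmbedding_J.measurable.aemeasurable

lemma integral_image (f : P.S × (Fin d → ℝ) → ℝ) :
    ∫ p, f p ∂P.image μ = ∫ z, f (P.J z) ∂μ :=
  P.measurableEmbedding_J.integral_map f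

lemma eLpNorm_image {F : Type*} [NormedAddCommGroup F] (f : P.S × (Fin d → ℝ) → F) :
    eLpNorm f 2 (P.image μ) = eLpNorm (fun z => f (P.J z)) 2 μ :=
  P.measurableEmbedding_J.eLpNorm_map_measure

lemma ae_image_iff (p : P.S × (Fin d → ℝ) → Prop) :
    (∀ᵐ x ∂P.image μ, p x) ↔ ∀ᵐ z ∂μ, p (P.J z) :=
  P.measurableEmbedding_J.ae_map_iff

lemma eLpNorm_image_comp_Jinv {F : Type*} [NormedAddCommGroup F] (f : E → F) :
    eLpNorm (fun p => f (P.Jinv p)) 2 (P.image μ) = eLpNorm f 2 μ := by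
  rw [eLpNorm_image]
  simp only [P.Jinv_J]

lemma memLp_image_comp_Jinv {f : E → ℝ} (hf : MemLp f 2 μ) :
    MemLp (fun p => f (P.Jinv p)) 2 (P.image μ) := by
  refine P.measurableEmbedding_J.memLp_map_measure_iff.2 ?_
  simpa only [Function.comp_def, P.Jinv_J] using hf

variable [CompleteSpace H]

-- Moving the `i`-th coordinate translates the point of `E` along `j (P.ξ i)`, so both sides are the
-- derivative of the same function of one real variable.
omit [IsTopologicalAddGroup E] [ContinuousSMul ℝ E] [MeasurableSpace E] [BorelSpace E] in
lemma xderiv_comp_Jinv {F : E → ℝ} (hF : F ∈ Cylindrical E) (i : Fin d)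
    (p : P.S × (Fin d → ℝ)) :
    xderiv i (fun p => F (P.Jinv p)) p = inner ℝ (hGradient j F (P.Jinv p)) (P.ξ i) := by
  have h1 := hasDerivAt_hGradient j hF (P.Jinv p) (P.ξ i)
  have h2 : HasFDerivAt (fun x => F (P.Jinv (p.1, x)))
      (fderiv ℝ (fun x => F (P.Jinv (p.1, x))) p.2) p.2 :=
    ((P.contDiff_section hF p.1).differentiable (by norm_num) _).hasFDerivAt
  have h3 := h2.hasLineDerivAt (Pi.single i 1)
  have h4 : HasDerivAt (fun t : ℝ => F (P.Jinv p + t • j (P.ξ i)))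
      (fderiv ℝ (fun x => F (P.Jinv (p.1, x))) p.2 (Pi.single i 1)) 0 := by
    simpa only [HasLineDerivAt, P.Jinv_add_single] using h3
  exact h4.unique h1

omit [IsTopologicalAddGroup E] [ContinuousSMul ℝ E] [MeasurableSpace E] [BorelSpace E] in
lemma gdrv_comp_Jinv {F : E → ℝ} (hF : F ∈ Cylindrical E) (i : Fin d) :
    gdrv (some i) (fun p => F (P.Jinv p)) =
      fun p => inner ℝ (hGradient j F (P.Jinv p)) (P.ξ i) :=
  funext fun p => P.xderiv_comp_Jinv hF i p

variable [PolishSpace E]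

omit [IsTopologicalAddGroup E] [ContinuousSMul ℝ E] [MeasurableSpace E] [BorelSpace E]
  [CompleteSpace H] in
lemma polishSpace_S : PolishSpace P.S :=
  (isClosed_eq P.π.continuous continuous_const : IsClosed {s : E | P.π s = 0}).polishSpace

lemma fiberC1_comp_Jinv {F : E → ℝ} (hF : F ∈ Cylindrical E) :
    FiberC1 fun p => F (P.Jinv p) := by
  have := P.polishSpace_S
  obtain ⟨B, hB⟩ := exists_bound_of_mem_cylindrical hF
  obtain ⟨C, hC⟩ := exists_bound_hGradient j hF
  have hC0 : 0 ≤ C := (norm_nonneg _).trans (hC 0)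
  refine ⟨((continuous_of_mem_cylindrical hF).comp P.continuous_Jinv).measurable,
    ⟨B, fun p => hB _⟩, P.contDiff_section hF, C * ∑ i, ‖P.ξ i‖, fun i p => ?_⟩
  rw [P.xderiv_comp_Jinv hF]
  refine (abs_real_inner_le_norm _ _).trans (mul_le_mul (hC _) ?_ (norm_nonneg _) hC0)
  exact Finset.single_le_sum (f := fun i => ‖P.ξ i‖) (fun _ _ => norm_nonneg _) (Finset.mem_univ i)

end Splitting

end Transport

/-! ### Closability of the gradient -/

section Closability

variable {E : Type*} [AddCommGroup E] [Module ℝ E] [TopologicalSpace E] [IsTopologicalAddGroup E]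
  [ContinuousSMul ℝ E] [PolishSpace E] [MeasurableSpace E] [BorelSpace E]
  {H : Type*} [NormedAddCommGroup H] [InnerProductSpace ℝ H] [CompleteSpace H]
  {j : H →L[ℝ] E} {μ : Measure E}

omit [PolishSpace E] in
lemma Splitting.tendsto_gdrv_comp_Jinv {d : ℕ} (P : Splitting j d) {F : ℕ → E → ℝ}
    (hF : ∀ n, F n ∈ Cylindrical E) {G : E → H}
    (h : Tendsto (fun n => eLpNorm (hGradient j (F n) - G) 2 μ) atTop (𝓝 0)) (k : Fin d) :
    Tendsto (fun n => eLpNorm (gdrv (some k) (fun p => F n (P.Jinv p)) -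
      fun p => inner ℝ (G (P.Jinv p)) (P.ξ k)) 2 (P.image μ)) atTop (𝓝 0) := by
  have h1 := ENNReal.Tendsto.const_mul (a := ENNReal.ofReal ‖P.ξ k‖) h
    (Or.inr ENNReal.ofReal_ne_top)
  rw [mul_zero] at h1
  refine tendsto_of_tendsto_of_tendsto_of_le_of_le tendsto_const_nhds h1 (fun _ => zero_le)
    fun n => ?_
  simp only
  rw [P.gdrv_comp_Jinv (hF n), P.eLpNorm_image]
  refine eLpNorm_le_mul_eLpNorm_of_ae_le_mul (ae_of_all _ fun z => ?_) 2
  rw [Pi.sub_apply, P.Jinv_J, ← inner_sub_left, Pi.sub_apply, mul_comm]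
  exact norm_inner_le_norm _ _

omit [CompleteSpace H] in
lemma Splitting.measurable_inner_comp_Jinv {d : ℕ} (P : Splitting j d) {G : E → H}
    (hG : StronglyMeasurable G) (k : Fin d) :
    Measurable fun p => (inner ℝ (G (P.Jinv p)) (P.ξ k) : ℝ) := by
  have := P.polishSpace_S
  have h : StronglyMeasurable fun z => (inner ℝ (G z) (P.ξ k) : ℝ) :=
    hG.inner stronglyMeasurable_const
  exact h.measurable.comp P.continuous_Jinv.measurable

variable {d : ℕ → ℕ} {P : ∀ i, Splitting j (d i)} [IsProbabilityMeasure μ]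

/-- The inner product with each `ξ k` is a partial derivative in the corresponding splitting, where
closability gives uniqueness. There are countably many pairs `i`, `k`, so one null set suffices, and
`htot` recovers the vectors from their inner products. -/
lemma gradient_ae_eq
    (htot : ∀ h : H, (∀ i k, inner ℝ h ((P i).ξ k) = 0) → h = 0)
    (hH : ∀ i, Hamza ((P i).image μ)) {F F' : ℕ → E → ℝ} (hF : ∀ n, F n ∈ Cylindrical E)
    (hF' : ∀ n, F' n ∈ Cylindrical E) {u : E → ℝ} (hu : MemLp u 2 μ)
    {G G' : E → H} (hGm : StronglyMeasurable G) (hGm' : StronglyMeasurable G')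
    (hG : MemLp G 2 μ) (hG' : MemLp G' 2 μ)
    (h0 : Tendsto (fun n => eLpNorm (F n - u) 2 μ) atTop (𝓝 0))
    (h0' : Tendsto (fun n => eLpNorm (F' n - u) 2 μ) atTop (𝓝 0))
    (h1 : Tendsto (fun n => eLpNorm (hGradient j (F n) - G) 2 μ) atTop (𝓝 0))
    (h1' : Tendsto (fun n => eLpNorm (hGradient j (F' n) - G') 2 μ) atTop (𝓝 0)) :
    G =ᵐ[μ] G' := by
  have key : ∀ᵐ z ∂μ, ∀ i k, (inner ℝ (G z) ((P i).ξ k) : ℝ) = inner ℝ (G' z) ((P i).ξ k) := by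
    refine ae_all_iff.2 fun i => ae_all_iff.2 fun k => ?_
    have := (P i).isProbabilityMeasure_image μ
    have h2 := gdrv_ae_eq_of_tendsto (hH i) (fun n => (P i).fiberC1_comp_Jinv (hF n))
      (fun n => (P i).fiberC1_comp_Jinv (hF' n)) ((P i).memLp_image_comp_Jinv μ hu)
      ((P i).measurable_inner_comp_Jinv hGm k) ((P i).measurable_inner_comp_Jinv hGm' k)
      ((P i).memLp_image_comp_Jinv μ (hG.inner_const ((P i).ξ k)))
      ((P i).memLp_image_comp_Jinv μ (hG'.inner_const ((P i).ξ k))) k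
      (h0.congr fun n => ((P i).eLpNorm_image_comp_Jinv μ (F n - u)).symm)
      (h0'.congr fun n => ((P i).eLpNorm_image_comp_Jinv μ (F' n - u)).symm)
      ((P i).tendsto_gdrv_comp_Jinv hF h1 k) ((P i).tendsto_gdrv_comp_Jinv hF' h1' k)
    have h3 := ((P i).ae_image_iff μ _).1 h2
    simpa only [(P i).Jinv_J] using h3
  filter_upwards [key] with z hz
  refine sub_eq_zero.1 (htot _ fun i k => ?_)
  rw [inner_sub_left, hz i k, sub_self]

/-- The gradient limit of a sequence tending to zero is compared with that of the constant sequence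
`0`. -/
theorem formClosable_gradEnergy
    (htot : ∀ h : H, (∀ i k, inner ℝ h ((P i).ξ k) = 0) → h = 0)
    (hH : ∀ i, Hamza ((P i).image μ)) :
    FormClosable μ (Cylindrical E) (gradEnergy j μ) := by
  intro v hv h0
  obtain ⟨G, hGm, hG, hvG⟩ := hv.exists_gradient_limit j
  have hz : hGradient j (0 : E → ℝ) = 0 := by
    have := hGradient_sub j (zero_mem_cylindrical (E := E)) zero_mem_cylindrical
    simpa using this
  have h1 : G =ᵐ[μ] 0 := by
    refine gradient_ae_eq (F' := fun _ => 0) (u := 0) htot hH hv.1 (fun _ => zero_mem_cylindrical)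
      MemLp.zero hGm stronglyMeasurable_zero hG MemLp.zero (by simpa using h0) ?_ hvG ?_
    · simp
    · simp [hz]
  have h2 := ENNReal.Tendsto.pow (n := 2)
    (tendsto_eLpNorm_of_sub (fun n => memLp_hGradient j (hv.1 n)) hG hvG)
  rw [eLpNorm_congr_ae h1] at h2
  simpa [gradEnergy_eq] using h2

/-- The minimal gradient form is the squared norm of the gradient. -/
lemma formClosure_gradEnergy_eq
    (htot : ∀ h : H, (∀ i k, inner ℝ h ((P i).ξ k) = 0) → h = 0)
    (hH : ∀ i, Hamza ((P i).image μ)) {u : E → ℝ} (hu : MemLp u 2 μ) {v : ℕ → E → ℝ}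
    (hv : EnergyCauchy (Cylindrical E) (gradEnergy j μ) v)
    (h0 : Tendsto (fun n => eLpNorm (v n - u) 2 μ) atTop (𝓝 0)) {G : E → H}
    (hGm : StronglyMeasurable G) (hG : MemLp G 2 μ)
    (h1 : Tendsto (fun n => eLpNorm (hGradient j (v n) - G) 2 μ) atTop (𝓝 0)) :
    formClosure μ (Cylindrical E) (gradEnergy j μ) u = eLpNorm G 2 μ ^ 2 := by
  have hlim : ∀ {w : ℕ → E → ℝ} {G' : E → H}, (∀ n, w n ∈ Cylindrical E) → MemLp G' 2 μ →
      Tendsto (fun n => eLpNorm (hGradient j (w n) - G') 2 μ) atTop (𝓝 0) →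
      Tendsto (fun n => gradEnergy j μ (w n)) atTop (𝓝 (eLpNorm G' 2 μ ^ 2)) := by
    intro w G' hw hG' h
    simp only [gradEnergy_eq]
    exact ENNReal.Tendsto.pow (tendsto_eLpNorm_of_sub (fun n => memLp_hGradient j (hw n)) hG' h)
  refine le_antisymm (sInf_le ⟨v, hv, h0, hlim hv.1 hG h1⟩) (le_sInf ?_)
  rintro c ⟨w, hw, hw0, hwc⟩
  obtain ⟨G', hGm', hG', hwG'⟩ := hw.exists_gradient_limit j
  have h2 := gradient_ae_eq htot hH hv.1 hw.1 hu hGm hGm' hG hG' h0 hw0 h1 hwG'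
  rw [eLpNorm_congr_ae h2]
  exact (tendsto_nhds_unique (hlim hw.1 hG' hwG') hwc).le

lemma formClosure_gradEnergy_of_mem
    (htot : ∀ h : H, (∀ i k, inner ℝ h ((P i).ξ k) = 0) → h = 0)
    (hH : ∀ i, Hamza ((P i).image μ)) {F u : E → ℝ} (hF : F ∈ Cylindrical E) (hu : u =ᵐ[μ] F) :
    formClosure μ (Cylindrical E) (gradEnergy j μ) u = eLpNorm (hGradient j F) 2 μ ^ 2 := by
  have hz : hGradient j (F - F) = 0 := by
    rw [hGradient_sub j hF hF, sub_self]
  refine formClosure_gradEnergy_eq (v := fun _ => F) htot hH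
    ((memLp_congr_ae hu).2 (memLp_of_mem_cylindrical hF)) ⟨fun _ => hF, ?_⟩ ?_
    (continuous_hGradient j hF).stronglyMeasurable (memLp_hGradient j hF) ?_
  · simp only [gradEnergy_eq, hz]
    simp
  · have : F - u =ᵐ[μ] 0 := by
      filter_upwards [hu] with z hz
      simp [hz]
    simp only [eLpNorm_congr_ae this]
    simp
  · simp

end Closability

/-! ### Recovery sequences -/

section Recovery

/-- Diagonal sequences. -/
lemma exists_diagonal {C : ℕ → ℕ → Prop} (h : ∀ n, ∀ᶠ N in atTop, C n N) :
    ∃ n : ℕ → ℕ, Tendsto n atTop atTop ∧ ∀ᶠ N in atTop, C (n N) N := by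
  classical
  choose T hT using fun n => eventually_atTop.1 (h n)
  -- The index attached to `N` is the largest `n ≤ N` for which all thresholds `T 0, …, T n` have
  -- been passed. Asking for all of them makes the index eventually exceed any given value.
  set Q : ℕ → ℕ → Prop := fun N n => ∀ m ≤ n, T m ≤ N with hQ
  refine ⟨fun N => Nat.findGreatest (Q N) N, tendsto_atTop.2 fun b => ?_, ?_⟩
  · filter_upwards [eventually_ge_atTop b, eventually_ge_atTop ((Finset.range (b + 1)).sup T)]
      with N hb hN
    refine Nat.le_findGreatest hb fun m hm => ?_
    exact (Finset.le_sup (f := T) (Finset.mem_range.2 (Nat.lt_succ_of_le hm))).trans hN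
  · filter_upwards [eventually_ge_atTop (T 0)] with N hN
    have h0 : Q N 0 := fun m hm => by rwa [Nat.le_zero.1 hm]
    exact hT _ N (Nat.findGreatest_spec (P := Q N) (Nat.zero_le N) h0 _ le_rfl)

variable {E : Type*} [TopologicalSpace E] [PolishSpace E] [MeasurableSpace E] [BorelSpace E]
  {X : Type*} [NormedAddCommGroup X] [InnerProductSpace ℝ X]

lemma enorm_toLp_eq (μ : Measure E) [IsFiniteMeasure μ] (f : E →ᵇ X) :
    ‖BoundedContinuousFunction.toLp 2 μ ℝ f‖ₑ = eLpNorm f 2 μ := by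
  rw [Lp.enorm_def]
  exact eLpNorm_congr_ae (BoundedContinuousFunction.coeFn_toLp _ _ ℝ f)

lemma inner_toLp (μ : Measure E) [IsFiniteMeasure μ] (u : Lp X 2 μ) (f : E →ᵇ X) :
    inner ℝ u (BoundedContinuousFunction.toLp 2 μ ℝ f) = ∫ z, inner ℝ (u z) (f z) ∂μ := by
  rw [L2.inner_def]
  refine integral_congr_ae ?_
  filter_upwards [BoundedContinuousFunction.coeFn_toLp 2 μ ℝ f] with z hz
  rw [hz]

lemma inner_toLp_toLp (μ : Measure E) [IsFiniteMeasure μ] (f g : E →ᵇ X) :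
    inner ℝ (BoundedContinuousFunction.toLp 2 μ ℝ f) (BoundedContinuousFunction.toLp 2 μ ℝ g) =
      ∫ z, inner ℝ (f z) (g z) ∂μ := by
  rw [inner_toLp]
  refine integral_congr_ae ?_
  filter_upwards [BoundedContinuousFunction.coeFn_toLp 2 μ ℝ f] with z hz
  rw [hz]

lemma norm_toLp_le_norm (μ : Measure E) [IsProbabilityMeasure μ] (f : E →ᵇ X) :
    ‖BoundedContinuousFunction.toLp 2 μ ℝ f‖ ≤ ‖f‖ := by
  have h : ‖BoundedContinuousFunction.toLp 2 μ ℝ f‖ ^ 2 ≤ ‖f‖ ^ 2 := by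
    rw [← real_inner_self_eq_norm_sq, inner_toLp_toLp]
    have h1 : ∀ z, ‖(inner ℝ (f z) (f z) : ℝ)‖ ≤ ‖f‖ ^ 2 := fun z => by
      rw [real_inner_self_eq_norm_sq, norm_pow, norm_norm]
      exact pow_le_pow_left₀ (norm_nonneg _) (f.norm_coe_le_norm z) 2
    have h2 := norm_integral_le_of_norm_le_const (μ := μ) (ae_of_all _ h1)
    rw [probReal_univ, mul_one] at h2
    exact (le_abs_self _).trans h2
  exact le_of_sq_le_sq h (norm_nonneg _)

variable {μ : ℕ → ProbabilityMeasure E} {μ' : ProbabilityMeasure E}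

lemma tendsto_inner_toLp (hμ : Tendsto μ atTop (𝓝 μ')) (f g : E →ᵇ X) :
    Tendsto (fun N => (inner ℝ (BoundedContinuousFunction.toLp 2 (μ N : Measure E) ℝ f)
        (BoundedContinuousFunction.toLp 2 (μ N : Measure E) ℝ g) : ℝ)) atTop
      (𝓝 (inner ℝ (BoundedContinuousFunction.toLp 2 (μ' : Measure E) ℝ f)
        (BoundedContinuousFunction.toLp 2 (μ' : Measure E) ℝ g))) := by
  simp only [inner_toLp_toLp]
  let q : E →ᵇ ℝ := BoundedContinuousFunction.ofNormedAddCommGroup (fun z => inner ℝ (f z) (g z))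
    (f.continuous.inner g.continuous) (‖f‖ * ‖g‖) fun z => (norm_inner_le_norm _ _).trans
      (mul_le_mul (f.norm_coe_le_norm z) (g.norm_coe_le_norm z) (norm_nonneg _) (norm_nonneg _))
  exact (ProbabilityMeasure.tendsto_iff_forall_integral_tendsto.1 hμ) q

lemma tendsto_norm_toLp (hμ : Tendsto μ atTop (𝓝 μ')) (f : E →ᵇ X) :
    Tendsto (fun N => ‖BoundedContinuousFunction.toLp 2 (μ N : Measure E) ℝ f‖) atTop
      (𝓝 ‖BoundedContinuousFunction.toLp 2 (μ' : Measure E) ℝ f‖) := by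
  have h := (Real.continuous_sqrt.tendsto _).comp (tendsto_inner_toLp hμ f f)
  simp only [real_inner_self_eq_norm_sq, Function.comp_def] at h
  simpa only [Real.sqrt_sq (norm_nonneg _)] using h

lemma strongConv_toLp (hμ : Tendsto μ atTop (𝓝 μ')) (f : E →ᵇ ℝ) :
    StrongConv μ μ' (fun N => BoundedContinuousFunction.toLp 2 (μ N : Measure E) ℝ f)
      (BoundedContinuousFunction.toLp 2 (μ' : Measure E) ℝ f) :=
  ⟨fun g => tendsto_inner_toLp hμ f g, tendsto_norm_toLp hμ f⟩

/-- A diagonal sequence of bounded continuous functions converges strongly. -/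
lemma strongConv_diagonal (hμ : Tendsto μ atTop (𝓝 μ')) {f : ℕ → E →ᵇ ℝ}
    {u' : Lp ℝ 2 (μ' : Measure E)}
    (hf : Tendsto (fun n => BoundedContinuousFunction.toLp 2 (μ' : Measure E) ℝ (f n)) atTop
      (𝓝 u')) {n : ℕ → ℕ} (hn : Tendsto n atTop atTop)
    (hd : ∀ᶠ N in atTop, ∀ k ≤ n N,
      |‖BoundedContinuousFunction.toLp 2 (μ N : Measure E) ℝ (f (n N) - f k)‖ -
        ‖BoundedContinuousFunction.toLp 2 (μ' : Measure E) ℝ (f (n N) - f k)‖| ≤ 1 / ((n N : ℝ) + 1))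
    (hd' : ∀ᶠ N in atTop, |‖BoundedContinuousFunction.toLp 2 (μ N : Measure E) ℝ (f (n N))‖ -
        ‖BoundedContinuousFunction.toLp 2 (μ' : Measure E) ℝ (f (n N))‖| ≤ 1 / ((n N : ℝ) + 1)) :
    StrongConv μ μ' (fun N => BoundedContinuousFunction.toLp 2 (μ N : Measure E) ℝ (f (n N))) u' := by
  have hinv : Tendsto (fun N => 1 / ((n N : ℝ) + 1)) atTop (𝓝 0) :=
    tendsto_one_div_add_atTop_nhds_zero_nat.comp hn
  set T := fun N => BoundedContinuousFunction.toLp (E := ℝ) 2 (μ N : Measure E) ℝ with hT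
  set T' := BoundedContinuousFunction.toLp (E := ℝ) 2 (μ' : Measure E) ℝ with hT'
  constructor
  · intro φ
    rw [Metric.tendsto_atTop']
    intro ε hε
    set Φ : ℝ := ‖φ‖ + 1 with hΦ
    have hΦ0 : 0 < Φ := by positivity
    set δ : ℝ := ε / (8 * Φ) with hδ
    have hδ0 : 0 < δ := by positivity
    have hδΦ : δ * Φ = ε / 8 := by rw [hδ]; field_simp
    obtain ⟨K, hK⟩ := Metric.tendsto_atTop.1 hf δ hδ0
    have e1 := (Metric.tendsto_nhds.1 (tendsto_inner_toLp hμ (f K) φ)) (ε / 8) (by positivity)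
    have e2 : ∀ᶠ N in atTop, 1 / ((n N : ℝ) + 1) < δ := hinv.eventually_lt_const hδ0
    have e3 := hn.eventually_ge_atTop K
    obtain ⟨N₀, hN₀⟩ := eventually_atTop.1 (((e1.and e2).and e3).and hd)
    refine ⟨N₀, fun N hN => ?_⟩
    obtain ⟨⟨⟨h1, h2⟩, h3⟩, h4⟩ := hN₀ N hN.le
    have hφN : ‖T N φ‖ ≤ Φ := (norm_toLp_le_norm _ φ).trans (by linarith)
    have hφ' : ‖T' φ‖ ≤ Φ := (norm_toLp_le_norm _ φ).trans (by linarith)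
    rw [Real.dist_eq] at h1 ⊢
    have hA : |(inner ℝ (T N (f (n N) - f K)) (T N φ) : ℝ)| ≤ (3 * δ) * Φ := by
      refine (abs_real_inner_le_norm _ _).trans (mul_le_mul ?_ hφN (norm_nonneg _) (by positivity))
      have h5 := (abs_le.1 (h4 K h3)).2
      have h6 : ‖T' (f (n N) - f K)‖ ≤ 2 * δ := by
        rw [map_sub, ← dist_eq_norm]
        refine (dist_triangle_right _ _ u').trans ?_
        have := (hK (n N) h3).le
        have := (hK K le_rfl).le
        linarith
      have h7 : ‖T N (f (n N) - f K)‖ - ‖T' (f (n N) - f K)‖ ≤ 1 / ((n N : ℝ) + 1) := h5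
      linarith
    have hB : |(inner ℝ (T' (f K) - u') (T' φ) : ℝ)| ≤ δ * Φ := by
      refine (abs_real_inner_le_norm _ _).trans (mul_le_mul ?_ hφ' (norm_nonneg _) hδ0.le)
      rw [← dist_eq_norm]
      exact (hK K le_rfl).le
    -- The moving index is compared with a fixed one, `K`. The norm of `f (n N) - f K` in `L²(μ N)`
    -- is close to its norm in `L²(μ')` by `hd`, which applies because `K ≤ n N`; for the fixed `f
    -- K` weak convergence suffices.
    have hsplit : (inner ℝ (T N (f (n N))) (T N φ) : ℝ) - inner ℝ u' (T' φ) =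
        inner ℝ (T N (f (n N) - f K)) (T N φ) +
        (inner ℝ (T N (f K)) (T N φ) - inner ℝ (T' (f K)) (T' φ)) +
        inner ℝ (T' (f K) - u') (T' φ) := by
      rw [map_sub, inner_sub_left, inner_sub_left]
      ring
    change |(inner ℝ (T N (f (n N))) (T N φ) : ℝ) - inner ℝ u' (T' φ)| < ε
    rw [hsplit]
    refine (abs_add_three _ _ _).trans_lt ?_
    have h8 : |(inner ℝ (T N (f K)) (T N φ) : ℝ) - inner ℝ (T' (f K)) (T' φ)| < ε / 8 := h1
    linarith
  · have h1 : Tendsto (fun N => ‖T' (f (n N))‖) atTop (𝓝 ‖u'‖) := (hf.comp hn).norm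
    have h2 : Tendsto (fun N => ‖T N (f (n N))‖ - ‖T' (f (n N))‖) atTop (𝓝 0) :=
      squeeze_zero_norm' hd' hinv
    have h3 := h2.add h1
    rw [zero_add] at h3
    exact h3.congr fun N => by ring

end Recovery

/-! ### Recovery sequences for the minimal gradient form -/

section RecoveryGradient

variable {E : Type*} [AddCommGroup E] [Module ℝ E] [TopologicalSpace E] [IsTopologicalAddGroup E]
  [ContinuousSMul ℝ E] [PolishSpace E] [MeasurableSpace E] [BorelSpace E]
  {H : Type*} [NormedAddCommGroup H] [InnerProductSpace ℝ H] [CompleteSpace H]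
  {j : H →L[ℝ] E} {μ : ℕ → ProbabilityMeasure E} {μ' : ProbabilityMeasure E}
  {d : ℕ → ℕ} {P : ∀ i, Splitting j (d i)}

/-- Cylindrical functions approximating `u'` with their gradients are bounded and continuous, and so
are the gradients. For each fixed index all relevant norms converge along `μ N`, and a diagonal
choice gives strong convergence and convergence of energies together. Closability for every `N`
ensures that the form of the diagonal element is its gradient energy. -/
theorem exists_recovery_sequence (hμ : Tendsto μ atTop (𝓝 μ'))
    (htot : ∀ h : H, (∀ i k, inner ℝ h ((P i).ξ k) = 0) → h = 0)
    (hH : ∀ i N, Hamza ((P i).image (μ N : Measure E)))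
    (hH' : ∀ i, Hamza ((P i).image (μ' : Measure E)))
    (u' : Lp ℝ 2 (μ' : Measure E)) (hu' : minGradForm j (μ' : Measure E) u' < ⊤) :
    ∃ u : ∀ N, Lp ℝ 2 (μ N : Measure E), (∀ N, minGradForm j (μ N : Measure E) (u N) < ⊤) ∧
      StrongConv μ μ' u u' ∧
      Tendsto (fun N => minGradForm j (μ N : Measure E) (u N)) atTop
        (𝓝 (minGradForm j (μ' : Measure E) u')) := by
  rw [minGradForm, formClosure, sInf_lt_iff] at hu'
  obtain ⟨c, ⟨v, hv, hv0, -⟩, -⟩ := hu'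
  obtain ⟨G, hGm, hG, hvG⟩ := hv.exists_gradient_limit j
  have hval : minGradForm j (μ' : Measure E) u' = eLpNorm G 2 (μ' : Measure E) ^ 2 :=
    formClosure_gradEnergy_eq htot hH' (Lp.memLp u') hv hv0 hGm hG hvG
  choose B hB using fun n => exists_bound_of_mem_cylindrical (hv.1 n)
  choose D hD using fun n => exists_bound_hGradient j (hv.1 n)
  let f : ℕ → E →ᵇ ℝ := fun n => BoundedContinuousFunction.ofNormedAddCommGroup (v n)
    (continuous_of_mem_cylindrical (hv.1 n)) (B n) (hB n)
  let g : ℕ → E →ᵇ H := fun n => BoundedContinuousFunction.ofNormedAddCommGroup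
    (hGradient j (v n)) (continuous_hGradient j (hv.1 n)) (D n) (hD n)
  set T := fun N => BoundedContinuousFunction.toLp (E := ℝ) 2 (μ N : Measure E) ℝ with hT
  set T' := BoundedContinuousFunction.toLp (E := ℝ) 2 (μ' : Measure E) ℝ with hT'
  set V := fun N => BoundedContinuousFunction.toLp (E := H) 2 (μ N : Measure E) ℝ with hV
  set V' := BoundedContinuousFunction.toLp (E := H) 2 (μ' : Measure E) ℝ with hV'
  have hf : Tendsto (fun n => T' (f n)) atTop (𝓝 u') := by
    rw [Lp.tendsto_Lp_iff_tendsto_eLpNorm']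
    refine hv0.congr fun n => eLpNorm_congr_ae ?_
    exact ((BoundedContinuousFunction.coeFn_toLp 2 (μ' : Measure E) ℝ (f n)).sub
      (ae_eq_refl _)).symm
  have hpos : ∀ n : ℕ, (0 : ℝ) < 1 / ((n : ℝ) + 1) := fun n => by positivity
  have hclose : ∀ {a : ℕ → ℝ} {b e : ℝ}, Tendsto a atTop (𝓝 b) → 0 < e →
      ∀ᶠ N in atTop, |a N - b| ≤ e := fun h he =>
    (Metric.tendsto_nhds.1 h _ he).mono fun N hN => by
      rw [Real.dist_eq] at hN; exact hN.le
  have hdiag : ∀ n, ∀ᶠ N in atTop,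
      (∀ k ≤ n, |‖T N (f n - f k)‖ - ‖T' (f n - f k)‖| ≤ 1 / ((n : ℝ) + 1)) ∧
      |‖T N (f n)‖ - ‖T' (f n)‖| ≤ 1 / ((n : ℝ) + 1) ∧
      |‖V N (g n)‖ - ‖V' (g n)‖| ≤ 1 / ((n : ℝ) + 1) := by
    intro n
    refine Eventually.and ?_ ((hclose (tendsto_norm_toLp hμ (f n)) (hpos n)).and
      (hclose (tendsto_norm_toLp hμ (g n)) (hpos n)))
    have := (Finset.eventually_all (Finset.range (n + 1))).2 fun k _ =>
      hclose (tendsto_norm_toLp hμ (f n - f k)) (hpos n)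
    filter_upwards [this] with N hN k hk
    exact hN k (Finset.mem_range.2 (Nat.lt_succ_of_le hk))
  obtain ⟨n, hn, hnN⟩ := exists_diagonal hdiag
  have hEN : ∀ N, minGradForm j (μ N : Measure E) (T N (f (n N))) = ‖V N (g (n N))‖ₑ ^ 2 := by
    intro N
    have h1 := formClosure_gradEnergy_of_mem htot (fun i => hH i N) (hv.1 (n N))
      (BoundedContinuousFunction.coeFn_toLp 2 (μ N : Measure E) ℝ (f (n N)))
    rw [minGradForm]
    refine h1.trans ?_
    rw [hV, enorm_toLp_eq]
    rfl
  refine ⟨fun N => T N (f (n N)), fun N => ?_, strongConv_diagonal hμ hf hn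
    (hnN.mono fun N h => h.1) (hnN.mono fun N h => h.2.1), ?_⟩
  · rw [hEN]
    exact ENNReal.pow_lt_top enorm_lt_top
  · simp only [hEN]
    rw [hval]
    refine ENNReal.Tendsto.pow ?_
    have hGl : Tendsto (fun N => ‖V' (g N)‖) atTop (𝓝 (eLpNorm G 2 (μ' : Measure E)).toReal) := by
      have h1 := tendsto_eLpNorm_of_sub (fun n => memLp_hGradient j (hv.1 n)) hG hvG
      have h2 := (ENNReal.tendsto_toReal hG.2.ne).comp h1
      refine h2.congr fun n => ?_
      rw [← toReal_enorm, hV', enorm_toLp_eq]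
      rfl
    have hinv : Tendsto (fun N => 1 / ((n N : ℝ) + 1)) atTop (𝓝 0) :=
      tendsto_one_div_add_atTop_nhds_zero_nat.comp hn
    have h2 : Tendsto (fun N => ‖V N (g (n N))‖ - ‖V' (g (n N))‖) atTop (𝓝 0) :=
      squeeze_zero_norm' (hnN.mono fun N h => h.2.2) hinv
    have h3 := h2.add (hGl.comp hn)
    rw [zero_add] at h3
    have h4 := ENNReal.tendsto_ofReal h3
    rw [ENNReal.ofReal_toReal hG.2.ne] at h4
    refine h4.congr fun N => ?_
    rw [Function.comp_apply, sub_add_cancel, ofReal_norm]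

end RecoveryGradient

/-! ### Weak limits -/

section WeakLimits

/-- A functional on a vector space which is dominated by the norm of a linear map into a Hilbert
space is represented by an element of the Hilbert space. -/
lemma exists_riesz_of_le {V L : Type*} [AddCommGroup V] [Module ℝ V] [NormedAddCommGroup L]
    [InnerProductSpace ℝ L] [CompleteSpace L] (T : V →ₗ[ℝ] L) (Λ : V →ₗ[ℝ] ℝ) {C : ℝ}
    (hC : 0 ≤ C) (h : ∀ x, |Λ x| ≤ C * ‖T x‖) :
    ∃ g : L, ‖g‖ ≤ C ∧ ∀ x, Λ x = inner ℝ g (T x) := by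
  -- A linear section of `T` over its range. The bound on `Λ` makes it vanish on the kernel of `T`,
  -- so the choice of the section is immaterial.
  obtain ⟨s, hs⟩ := T.rangeRestrict.exists_rightInverse_of_surjective T.range_rangeRestrict
  have hTs : ∀ y : LinearMap.range T, T (s y) = y := fun y => by
    have := LinearMap.congr_fun hs y
    exact congrArg Subtype.val this
  let f : LinearMap.range T →L[ℝ] ℝ := (Λ.comp s).mkContinuous C fun y => by
    have := h (s y)
    rw [hTs] at this
    exact this
  obtain ⟨g, hg, hgn⟩ := exists_extension_norm_eq (LinearMap.range T) f
  refine ⟨(InnerProductSpace.toDual ℝ L).symm g, ?_, fun x => ?_⟩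
  · rw [LinearIsometryEquiv.norm_map, hgn]
    exact LinearMap.mkContinuous_norm_le _ hC _
  · rw [InnerProductSpace.toDual_symm_apply]
    have h1 := hg ⟨T x, LinearMap.mem_range_self T x⟩
    have h2 : g (T x) = Λ (s ⟨T x, LinearMap.mem_range_self T x⟩) := h1
    rw [h2, ← sub_eq_zero, ← map_sub]
    have h3 := h (x - s ⟨T x, LinearMap.mem_range_self T x⟩)
    rw [map_sub T, hTs, sub_self, norm_zero, mul_zero] at h3
    exact abs_nonpos_iff.1 h3

lemma exists_tendsto_ultrafilter (𝒰 : Ultrafilter ℕ) {a : ℕ → ℝ} {B : ℝ}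
    (h : ∀ᶠ N in 𝒰, |a N| ≤ B) : ∃ L, Tendsto a 𝒰 (𝓝 L) := by
  have h1 : ((𝒰.map a : Ultrafilter ℝ) : Filter ℝ) ≤ 𝓟 (Set.Icc (-B) B) := by
    rw [le_principal_iff]
    exact h.mono fun N hN => abs_le.1 hN
  obtain ⟨L, -, hL⟩ := isCompact_Icc.ultrafilter_le_nhds (𝒰.map a) h1
  exact ⟨L, hL⟩

variable {E : Type*} [TopologicalSpace E] [PolishSpace E] [MeasurableSpace E] [BorelSpace E]
  {μ : ℕ → ProbabilityMeasure E} {μ' : ProbabilityMeasure E}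

/-- A gliding argument in place of uniform boundedness, as the spaces vary: if the norms were
unbounded, a strongly null section could be built whose pairings with `u` are unbounded. -/
lemma WeakConv.exists_norm_le {u : ∀ N, Lp ℝ 2 (μ N : Measure E)} {u' : Lp ℝ 2 (μ' : Measure E)}
    (h : WeakConv μ μ' u u') : ∃ B, ∀ᶠ N in atTop, ‖u N‖ ≤ B := by
  classical
  by_contra hcon
  push Not at hcon
  obtain ⟨σ, hσ, hσu⟩ := extraction_forall_of_frequently
    (P := fun n N => (n : ℝ) < ‖u N‖) fun n =>
      ((hcon n).mono fun N hN => by simpa using hN)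
  set R : ℕ → Prop := fun N => ∃ n, σ n = N with hR
  -- The vector is `u N` divided by `‖u N‖ ^ (3/2)`: its norm `‖u N‖ ^ (-1/2)` tends to zero along
  -- the subsequence, but its pairing with `u N` equals `‖u N‖ ^ (1/2)`. Off the subsequence the
  -- value is zero, so that the whole section is strongly null.
  let v : ∀ N, Lp ℝ 2 (μ N : Measure E) := fun N =>
    if R N then (‖u N‖ * √‖u N‖)⁻¹ • u N else 0
  have hbig : ∀ K : ℕ, ∀ N, σ K ≤ N → R N → (K : ℝ) < ‖u N‖ := by
    rintro K _ hKN ⟨n, rfl⟩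
    have : K ≤ n := hσ.le_iff_le.1 hKN
    exact lt_of_le_of_lt (by exact_mod_cast this) (hσu n)
  have hvn : ∀ N, R N → 0 < ‖u N‖ → ‖v N‖ = (√‖u N‖)⁻¹ := by
    intro N hN hpos
    have hs := Real.sqrt_pos.2 hpos
    simp only [v, if_pos hN, norm_smul, norm_inv, norm_mul, Real.norm_eq_abs,
      abs_of_pos hs, abs_of_pos hpos]
    field_simp
  have hv0 : Tendsto (fun N => ‖v N‖) atTop (𝓝 0) := by
    rw [Metric.tendsto_atTop]
    intro ε hε
    obtain ⟨K, hK⟩ := exists_nat_gt ((ε⁻¹) ^ 2)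
    refine ⟨σ K, fun N hN => ?_⟩
    rw [Real.dist_eq, sub_zero, abs_of_nonneg (norm_nonneg _)]
    by_cases hRN : R N
    · have h1 := hbig K N hN hRN
      have hpos : 0 < ‖u N‖ := lt_of_le_of_lt (Nat.cast_nonneg K) h1
      rw [hvn N hRN hpos]
      refine inv_lt_of_inv_lt₀ hε ?_
      exact Real.lt_sqrt_of_sq_lt (hK.trans h1)
    · simpa [v, hRN] using hε
  have hstrong : StrongConv μ μ' v 0 := by
    refine ⟨fun φ => ?_, by simpa using hv0⟩
    rw [inner_zero_left]
    have h1 := hv0.mul_const ‖φ‖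
    rw [zero_mul] at h1
    refine squeeze_zero_norm (fun N => ?_) h1
    refine (norm_inner_le_norm _ _).trans (mul_le_mul_of_nonneg_left ?_ (norm_nonneg _))
    exact norm_toLp_le_norm _ φ
  have hlim := h v 0 hstrong
  rw [inner_zero_right] at hlim
  have h1 := (Metric.tendsto_nhds.1 (hlim.comp hσ.tendsto_atTop)) 1 one_pos
  obtain ⟨n, hn, hn1⟩ := (h1.and (eventually_ge_atTop 1)).exists
  have hpos : (1 : ℝ) < ‖u (σ n)‖ := lt_of_le_of_lt (by exact_mod_cast hn1) (hσu n)
  have hs : 0 < √‖u (σ n)‖ := Real.sqrt_pos.2 (by linarith)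
  rw [Function.comp_apply, Real.dist_eq, sub_zero] at hn
  have hval : (inner ℝ (u (σ n)) (v (σ n)) : ℝ) = √‖u (σ n)‖ := by
    have hRn : R (σ n) := ⟨n, rfl⟩
    simp only [v, if_pos hRn, inner_smul_right, real_inner_self_eq_norm_sq]
    have h2 : √‖u (σ n)‖ ^ 2 = ‖u (σ n)‖ := Real.sq_sqrt (norm_nonneg _)
    have h3 : ‖u (σ n)‖ ≠ 0 := by linarith
    field_simp
    rw [h2]
  rw [hval, abs_of_pos hs] at hn
  have : 1 < √‖u (σ n)‖ := Real.lt_sqrt_of_sq_lt (by simpa using hpos)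
  linarith

variable {X : Type*} [NormedAddCommGroup X] [InnerProductSpace ℝ X] [CompleteSpace X]

/-- Weak compactness along an ultrafilter for vector valued functions on varying `L²` spaces. -/
lemma exists_weak_limit (hμ : Tendsto μ atTop (𝓝 μ')) {𝒰 : Ultrafilter ℕ}
    (h𝒰 : (𝒰 : Filter ℕ) ≤ atTop) (g : ∀ N, Lp X 2 (μ N : Measure E)) {C : ℝ} (hC : 0 ≤ C)
    (hg : ∀ᶠ N in 𝒰, ‖g N‖ ≤ C) :
    ∃ G : Lp X 2 (μ' : Measure E), ‖G‖ ≤ C ∧ ∀ φ : E →ᵇ X,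
      Tendsto (fun N => (inner ℝ (g N)
        (BoundedContinuousFunction.toLp 2 (μ N : Measure E) ℝ φ) : ℝ)) 𝒰
        (𝓝 (inner ℝ G (BoundedContinuousFunction.toLp 2 (μ' : Measure E) ℝ φ))) := by
  set V := fun N => BoundedContinuousFunction.toLp (E := X) 2 (μ N : Measure E) ℝ with hV
  set V' := BoundedContinuousFunction.toLp (E := X) 2 (μ' : Measure E) ℝ with hV'
  have hle : ∀ φ : E →ᵇ X, ∀ᶠ N in 𝒰, |(inner ℝ (g N) (V N φ) : ℝ)| ≤ C * ‖V N φ‖ := by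
    intro φ
    filter_upwards [hg] with N hN
    exact (abs_real_inner_le_norm _ _).trans (mul_le_mul_of_nonneg_right hN (norm_nonneg _))
  have hex : ∀ φ : E →ᵇ X, ∃ L, Tendsto (fun N => (inner ℝ (g N) (V N φ) : ℝ)) 𝒰 (𝓝 L) := by
    intro φ
    refine exists_tendsto_ultrafilter 𝒰 (B := C * ‖φ‖) ?_
    filter_upwards [hle φ] with N hN
    exact hN.trans (mul_le_mul_of_nonneg_left (norm_toLp_le_norm _ φ) hC)
  choose Λ hΛ using hex
  let Λ' : (E →ᵇ X) →ₗ[ℝ] ℝ :=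
    { toFun := Λ
      map_add' := fun φ ψ => by
        refine tendsto_nhds_unique (hΛ (φ + ψ)) (((hΛ φ).add (hΛ ψ)).congr fun N => ?_)
        rw [map_add, inner_add_right]
      map_smul' := fun c φ => by
        refine tendsto_nhds_unique (hΛ (c • φ)) (((hΛ φ).const_mul c).congr fun N => ?_)
        rw [map_smul, inner_smul_right] }
  -- The bounds by `C * ‖V N φ‖` pass to the limit because the norms of a fixed `φ` converge; the
  -- limit functional is thus dominated by the norm in `L²(μ')`.
  obtain ⟨G, hGC, hG⟩ := exists_riesz_of_le (V'.toLinearMap) Λ' hC fun φ => by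
    refine le_of_tendsto_of_tendsto (hΛ φ).abs
      (((tendsto_norm_toLp hμ φ).mono_left h𝒰).const_mul C) ?_
    exact hle φ
  refine ⟨G, hGC, fun φ => ?_⟩
  have := hΛ φ
  rwa [show Λ φ = inner ℝ G (V' φ) from hG φ] at this

end WeakLimits

/-! ### The lower bound -/

section LowerBound

lemma eLpNorm_inner_le {E H : Type*} [MeasurableSpace E] [NormedAddCommGroup H]
    [InnerProductSpace ℝ H] {ν : Measure E} {G : E → H} (h : H) :
    eLpNorm (fun z => (inner ℝ (G z) h : ℝ)) 2 ν ≤ ENNReal.ofReal ‖h‖ * eLpNorm G 2 ν := by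
  refine eLpNorm_le_mul_eLpNorm_of_ae_le_mul (ae_of_all _ fun z => ?_) 2
  rw [mul_comm]
  exact norm_inner_le_norm _ _

variable {E : Type*} [AddCommGroup E] [Module ℝ E] [TopologicalSpace E] [IsTopologicalAddGroup E]
  [ContinuousSMul ℝ E] [PolishSpace E] [MeasurableSpace E] [BorelSpace E]
  {H : Type*} [NormedAddCommGroup H] [InnerProductSpace ℝ H] [CompleteSpace H]
  {j : H →L[ℝ] E} {μ : ℕ → ProbabilityMeasure E} {μ' : ProbabilityMeasure E}

/-- The weak limits of cylindrical functions and of their gradients are limits in the component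
form. -/
lemma Splitting.exists_productSpan_seq {d : ℕ} (P : Splitting j d) (hμ : Tendsto μ atTop (𝓝 μ'))
    (hcond : ComponentConditions (fun N => P.image (μ N : Measure E))
      (P.image (μ' : Measure E)))
    {l : Filter ℕ} [l.NeBot] (hl : l ≤ atTop) {F : ℕ → E → ℝ} (hF : ∀ N, F N ∈ Cylindrical E)
    {A C : ℝ} (hA : ∀ᶠ N in l, eLpNorm (F N) 2 (μ N : Measure E) ≤ ENNReal.ofReal A)
    (hC : ∀ᶠ N in l, eLpNorm (hGradient j (F N)) 2 (μ N : Measure E) ≤ ENNReal.ofReal C)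
    {u : E → ℝ} {G : E → H} (hum : Measurable u) (hGm : StronglyMeasurable G)
    (hu : MemLp u 2 (μ' : Measure E)) (hG : MemLp G 2 (μ' : Measure E))
    (hlu : ∀ φ : E →ᵇ ℝ, Tendsto (fun N => ∫ z, F N z * φ z ∂(μ N : Measure E)) l
      (𝓝 (∫ z, u z * φ z ∂(μ' : Measure E))))
    (hlG : ∀ φ : E →ᵇ H, Tendsto (fun N => ∫ z, inner ℝ (hGradient j (F N) z) (φ z)
      ∂(μ N : Measure E)) l (𝓝 (∫ z, inner ℝ (G z) (φ z) ∂(μ' : Measure E)))) :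
    ∃ v : ℕ → P.S × (Fin d → ℝ) → ℝ, (∀ n, v n ∈ productSpan P.S d) ∧
      Tendsto (fun n => eLpNorm (v n - fun p => u (P.Jinv p)) 2 (P.image (μ' : Measure E)))
        atTop (𝓝 0) ∧
      ∀ k, Tendsto (fun n => eLpNorm (gdrv (some k) (v n) -
        fun p => inner ℝ (G (P.Jinv p)) (P.ξ k)) 2 (P.image (μ' : Measure E))) atTop (𝓝 0) := by
  have := P.polishSpace_S
  have hprob : ∀ N, IsProbabilityMeasure (P.image (μ N : Measure E)) := fun N =>
    P.isProbabilityMeasure_image _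
  have := P.isProbabilityMeasure_image (μ' : Measure E)
  let w : Option (Fin d) → P.S × (Fin d → ℝ) → ℝ := fun o => o.elim (fun p => u (P.Jinv p))
    fun k p => inner ℝ (G (P.Jinv p)) (P.ξ k)
  set Ξ : ℝ := ∑ k, ‖P.ξ k‖ with hΞ
  have hΞ0 : 0 ≤ Ξ := Finset.sum_nonneg fun _ _ => norm_nonneg _
  have hΞk : ∀ k, ‖P.ξ k‖ ≤ Ξ := fun k =>
    Finset.single_le_sum (f := fun k => ‖P.ξ k‖) (fun _ _ => norm_nonneg _) (Finset.mem_univ k)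
  set A₀ : ℝ := max A (Ξ * max C 0) with hA₀
  have hC' := fun N => P.fiberC1_comp_Jinv (hF N)
  have hbound : ∀ᶠ N in l, ∀ o, ∫ p, gdrv o (fun p => F N (P.Jinv p)) p ^ 2
      ∂P.image (μ N : Measure E) ≤ A₀ ^ 2 := by
    filter_upwards [hA, hC] with N hAN hCN o
    have hA0 : 0 ≤ A₀ := le_max_of_le_right (mul_nonneg hΞ0 (le_max_right _ _))
    have h1 := ofReal_integral_sq ((hC' N).memLp_gdrv (μ := P.image (μ N : Measure E)) o)
    rw [← ENNReal.ofReal_le_ofReal_iff (by positivity), h1, ENNReal.ofReal_pow hA0]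
    refine pow_le_pow_left₀ zero_le ?_ 2
    cases o with
    | none =>
      refine le_trans (le_of_eq ?_) (hAN.trans (ENNReal.ofReal_le_ofReal (le_max_left _ _)))
      exact P.eLpNorm_image_comp_Jinv _ (F N)
    | some k =>
      rw [P.gdrv_comp_Jinv (hF N), P.eLpNorm_image_comp_Jinv (μ N : Measure E)
        fun z => (inner ℝ (hGradient j (F N) z) (P.ξ k) : ℝ)]
      refine (eLpNorm_inner_le (P.ξ k)).trans ?_
      refine (mul_le_mul' (ENNReal.ofReal_le_ofReal (hΞk k)) (hCN.trans
        (ENNReal.ofReal_le_ofReal (le_max_left C 0)))).trans ?_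
      rw [← ENNReal.ofReal_mul hΞ0]
      exact ENNReal.ofReal_le_ofReal (le_max_right _ _)
  have hJ : ∀ φ : (P.S × (Fin d → ℝ)) →ᵇ ℝ, ∃ ψ : E →ᵇ ℝ, ∀ z, ψ z = φ (P.J z) := fun φ =>
    ⟨φ.compContinuous ⟨P.J, P.continuous_J⟩, fun _ => rfl⟩
  suffices h : ∃ v : ℕ → P.S × (Fin d → ℝ) → ℝ, (∀ n, v n ∈ productSpan P.S d) ∧
      ∀ o, Tendsto (fun n => eLpNorm (gdrv o (v n) - w o) 2 (P.image (μ' : Measure E)))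
        atTop (𝓝 0) by
    obtain ⟨v, hv, hvt⟩ := h
    exact ⟨v, hv, hvt none, fun k => hvt (some k)⟩
  refine MoscoGradient.exists_productSpan_seq (u' := w) (A := A₀ ^ 2) hcond
    (fun g => ?_) hl hC' (by positivity) hbound (fun o => ?_) (fun o => ?_) (fun o φ => ?_)
  · obtain ⟨ψ, hψ⟩ := hJ g
    simp only [P.integral_image, ← hψ]
    exact (ProbabilityMeasure.tendsto_iff_forall_integral_tendsto.1 hμ) ψ
  · cases o with
    | none => exact hum.comp P.continuous_Jinv.measurable
    | some k => exact P.measurable_inner_comp_Jinv hGm k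
  · cases o with
    | none => exact P.memLp_image_comp_Jinv _ hu
    | some k => exact P.memLp_image_comp_Jinv _ (hG.inner_const (P.ξ k))
  · obtain ⟨ψ, hψ⟩ := hJ φ
    cases o with
    | none =>
      have h1 : ∀ N, ∫ p, gdrv none (fun p => F N (P.Jinv p)) p * φ p ∂P.image (μ N : Measure E) =
          ∫ z, F N z * ψ z ∂(μ N : Measure E) := by
        intro N
        rw [P.integral_image]
        refine integral_congr_ae (ae_of_all _ fun z => ?_)
        simp only [hψ]
        change F N (P.Jinv (P.J z)) * _ = _
        rw [P.Jinv_J]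
      have h2 : ∫ p, w none p * φ p ∂P.image (μ' : Measure E) =
          ∫ z, u z * ψ z ∂(μ' : Measure E) := by
        rw [P.integral_image]
        refine integral_congr_ae (ae_of_all _ fun z => ?_)
        simp only [hψ]
        change u (P.Jinv (P.J z)) * _ = _
        rw [P.Jinv_J]
      simp only [h1, h2]
      exact hlu ψ
    | some k =>
      -- A scalar test function in the component corresponds to the vector valued test function `ψ •
      -- ξ k`, so weak convergence of the gradients gives weak convergence of each partial
      -- derivative.
      let Φ : E →ᵇ H := BoundedContinuousFunction.ofNormedAddCommGroup (fun z => ψ z • P.ξ k)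
        (ψ.continuous.smul continuous_const) (‖ψ‖ * ‖P.ξ k‖) fun z => by
          rw [norm_smul]
          exact mul_le_mul_of_nonneg_right (ψ.norm_coe_le_norm z) (norm_nonneg _)
      have h1 : ∀ N, ∫ p, gdrv (some k) (fun p => F N (P.Jinv p)) p * φ p
          ∂P.image (μ N : Measure E) =
          ∫ z, inner ℝ (hGradient j (F N) z) (Φ z) ∂(μ N : Measure E) := by
        intro N
        rw [P.integral_image, P.gdrv_comp_Jinv (hF N)]
        refine integral_congr_ae (ae_of_all _ fun z => ?_)
        change (inner ℝ (hGradient j (F N) (P.Jinv (P.J z))) (P.ξ k) : ℝ) * _ =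
          (inner ℝ (hGradient j (F N) z) (ψ z • P.ξ k) : ℝ)
        rw [inner_smul_right, hψ, P.Jinv_J, mul_comm]
      have h2 : ∫ p, w (some k) p * φ p ∂P.image (μ' : Measure E) =
          ∫ z, inner ℝ (G z) (Φ z) ∂(μ' : Measure E) := by
        rw [P.integral_image]
        refine integral_congr_ae (ae_of_all _ fun z => ?_)
        change (inner ℝ (G (P.Jinv (P.J z))) (P.ξ k) : ℝ) * _ =
          (inner ℝ (G z) (ψ z • P.ξ k) : ℝ)
        rw [inner_smul_right, hψ, P.Jinv_J, mul_comm]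
      simp only [h1, h2]
      exact hlG Φ

-- The approximating product functions bound the minimal form of the component, which dominates the
-- superposed form.
omit [PolishSpace E] [CompleteSpace H] in
lemma Splitting.superForm_comp_Jinv_le {d : ℕ} (P : Splitting j d) {ν : Measure E}
    [IsProbabilityMeasure ν]
    (hac : ∀ᵐ s ∂(P.image ν).fst, (P.image ν).condKernel s ≪ volume)
    {u : E → ℝ} {G : E → H} (hu : MemLp u 2 ν) (hG : MemLp G 2 ν)
    {v : ℕ → P.S × (Fin d → ℝ) → ℝ} (hv : ∀ n, v n ∈ productSpan P.S d)
    (hv0 : Tendsto (fun n => eLpNorm (v n - fun p => u (P.Jinv p)) 2 (P.image ν)) atTop (𝓝 0))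
    (hvk : ∀ k, Tendsto (fun n => eLpNorm (gdrv (some k) (v n) -
      fun p => inner ℝ (G (P.Jinv p)) (P.ξ k)) 2 (P.image ν)) atTop (𝓝 0)) :
    superForm (P.image ν) (fun p => u (P.Jinv p)) ≤
      ∑ k, eLpNorm (fun z => (inner ℝ (G z) (P.ξ k) : ℝ)) 2 ν ^ 2 := by
  have := P.isProbabilityMeasure_image ν
  have hone : ((P.image ν).withDensity fun _ => ENNReal.ofReal 1) = P.image ν := by simp
  let w : Option (Fin d) → P.S × (Fin d → ℝ) → ℝ := fun o =>
    o.elim (fun p => u (P.Jinv p)) fun k p => inner ℝ (G (P.Jinv p)) (P.ξ k)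
  have h1 := minForm_le_of_tendsto (κ := fun _ => 1) (u' := w) hac measurable_const
    (fun _ => by simp) hv (fun o => by
      cases o with
      | none => exact P.memLp_image_comp_Jinv _ hu
      | some k => exact P.memLp_image_comp_Jinv _ (hG.inner_const (P.ξ k)))
    (fun o => by
      rw [hone]
      cases o with
      | none => exact hv0
      | some k => exact hvk k)
  rw [hone] at h1
  refine (superForm_le_minForm hac _).trans (h1.trans (le_of_eq ?_))
  refine Finset.sum_congr rfl fun k _ => ?_
  congr 1
  exact P.eLpNorm_image_comp_Jinv _ fun z => (inner ℝ (G z) (P.ξ k) : ℝ)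

variable {d : ℕ → ℕ} {P : ∀ i, Splitting j (d i)}

/-- The argument of `gradient_ae_eq`, but the second approximation consists of product functions
which may differ from one component to the next. This compares the true gradient of a domain element
with a weak limit of gradients. -/
lemma gradient_ae_eq_of_productSpan {ν : Measure E} [IsProbabilityMeasure ν]
    (htot : ∀ h : H, (∀ i k, inner ℝ h ((P i).ξ k) = 0) → h = 0)
    (hH : ∀ i, Hamza ((P i).image ν)) {F : ℕ → E → ℝ} (hF : ∀ n, F n ∈ Cylindrical E)
    {u : E → ℝ} (hu : MemLp u 2 ν) {G G' : E → H} (hGm : StronglyMeasurable G)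
    (hGm' : StronglyMeasurable G') (hG : MemLp G 2 ν) (hG' : MemLp G' 2 ν)
    (h0 : Tendsto (fun n => eLpNorm (F n - u) 2 ν) atTop (𝓝 0))
    (h1 : Tendsto (fun n => eLpNorm (hGradient j (F n) - G) 2 ν) atTop (𝓝 0))
    (hex : ∀ i, ∃ v : ℕ → (P i).S × (Fin (d i) → ℝ) → ℝ,
      (∀ n, v n ∈ productSpan (P i).S (d i)) ∧
      Tendsto (fun n => eLpNorm (v n - fun p => u ((P i).Jinv p)) 2 ((P i).image ν)) atTop (𝓝 0) ∧
      ∀ k, Tendsto (fun n => eLpNorm (gdrv (some k) (v n) -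
        fun p => inner ℝ (G' ((P i).Jinv p)) ((P i).ξ k)) 2 ((P i).image ν)) atTop (𝓝 0)) :
    G =ᵐ[ν] G' := by
  have key : ∀ᵐ z ∂ν, ∀ i k,
      (inner ℝ (G z) ((P i).ξ k) : ℝ) = inner ℝ (G' z) ((P i).ξ k) := by
    refine ae_all_iff.2 fun i => ae_all_iff.2 fun k => ?_
    have := (P i).polishSpace_S
    have := (P i).isProbabilityMeasure_image ν
    obtain ⟨v, hv, hv0, hvk⟩ := hex i
    have h2 := gdrv_ae_eq_of_tendsto (hH i)
      (fun n => (P i).fiberC1_comp_Jinv (hF n)) (fun n => fiberC1_of_mem_productSpan (hv n))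
      ((P i).memLp_image_comp_Jinv ν hu)
      ((P i).measurable_inner_comp_Jinv hGm k) ((P i).measurable_inner_comp_Jinv hGm' k)
      ((P i).memLp_image_comp_Jinv ν (hG.inner_const ((P i).ξ k)))
      ((P i).memLp_image_comp_Jinv ν (hG'.inner_const ((P i).ξ k))) k
      (h0.congr fun n => ((P i).eLpNorm_image_comp_Jinv ν (F n - u)).symm) hv0
      ((P i).tendsto_gdrv_comp_Jinv hF h1 k) (hvk k)
    have h3 := ((P i).ae_image_iff ν _).1 h2
    simpa only [(P i).Jinv_J] using h3
  filter_upwards [key] with z hz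
  refine sub_eq_zero.1 (htot _ fun i k => ?_)
  rw [inner_sub_left, hz i k, sub_self]

/-- If the inequality failed, some `c` would lie strictly between the two sides and the energies
would be below `c` infinitely often. Cylindrical approximations at these indices have gradients with
a weak limit `G` of norm at most `√c`. The components show that `u'` is in the domain with gradient
`G`, so its energy is at most `c`. The hypothesis `hdom` states the domain condition in a form
common to both systems of splittings. -/
theorem minGradForm_le_liminf (hμ : Tendsto μ atTop (𝓝 μ'))
    (htot : ∀ h : H, (∀ i k, inner ℝ h ((P i).ξ k) = 0) → h = 0)
    (hcond : ∀ i, ComponentConditions (fun N => (P i).image (μ N : Measure E))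
      ((P i).image (μ' : Measure E)))
    (hdom : ∀ (u : Lp ℝ 2 (μ' : Measure E)) (G : Lp H 2 (μ' : Measure E)),
      (∀ i, (P i).componentForm (μ' : Measure E) u ≤
        ∑ k, eLpNorm (fun z => (inner ℝ (G z) ((P i).ξ k) : ℝ)) 2 (μ' : Measure E) ^ 2) →
      minGradForm j (μ' : Measure E) u < ⊤)
    {u : ∀ N, Lp ℝ 2 (μ N : Measure E)} {u' : Lp ℝ 2 (μ' : Measure E)}
    (hu : WeakConv μ μ' u u') :
    minGradForm j (μ' : Measure E) u' ≤
      liminf (fun N => minGradForm j (μ N : Measure E) (u N)) atTop := by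
  by_contra hcon
  rw [not_le] at hcon
  obtain ⟨c, hc1, hc2⟩ := exists_between hcon
  have hct : c ≠ ⊤ := (hc2.trans_le le_top).ne
  refine absurd hc2 (not_lt.2 ?_)
  have hfreq : ∃ᶠ N in atTop, minGradForm j (μ N : Measure E) (u N) < c :=
    frequently_lt_of_liminf_lt (by isBoundedDefault) hc1
  -- cylindrical approximations
  have hF : ∀ N, ∃ F ∈ Cylindrical E, minGradForm j (μ N : Measure E) (u N) < c →
      gradEnergy j (μ N : Measure E) F ≤ c ∧
      eLpNorm (F - ⇑(u N)) 2 (μ N : Measure E) ≤ ENNReal.ofReal (1 / ((N : ℝ) + 1)) := by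
    intro N
    by_cases hN : minGradForm j (μ N : Measure E) (u N) < c
    · have hN' := hN
      rw [minGradForm, formClosure, sInf_lt_iff] at hN'
      obtain ⟨c', ⟨v, hv, hv0, hvc⟩, hc'⟩ := hN'
      have hpos : (0 : ℝ≥0∞) < ENNReal.ofReal (1 / ((N : ℝ) + 1)) := by
        rw [ENNReal.ofReal_pos]; positivity
      obtain ⟨n, hn1, hn2⟩ := ((hvc.eventually_lt_const hc').and
        (hv0.eventually_lt_const hpos)).exists
      exact ⟨v n, hv.1 n, fun _ => ⟨hn1.le, hn2.le⟩⟩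
    · exact ⟨0, zero_mem_cylindrical, fun h => absurd h hN⟩
  choose F hFc hFN using hF
  choose B hB using fun N => exists_bound_of_mem_cylindrical (hFc N)
  choose D hD using fun N => exists_bound_hGradient j (hFc N)
  let f : ℕ → E →ᵇ ℝ := fun n => BoundedContinuousFunction.ofNormedAddCommGroup (F n)
    (continuous_of_mem_cylindrical (hFc n)) (B n) (hB n)
  let g : ℕ → E →ᵇ H := fun n => BoundedContinuousFunction.ofNormedAddCommGroup
    (hGradient j (F n)) (continuous_hGradient j (hFc n)) (D n) (hD n)
  set T := fun N => BoundedContinuousFunction.toLp (E := ℝ) 2 (μ N : Measure E) ℝ with hT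
  set T' := BoundedContinuousFunction.toLp (E := ℝ) 2 (μ' : Measure E) ℝ with hT'
  set V := fun N => BoundedContinuousFunction.toLp (E := H) 2 (μ N : Measure E) ℝ with hV
  set V' := BoundedContinuousFunction.toLp (E := H) 2 (μ' : Measure E) ℝ with hV'
  have hne : (atTop ⊓ 𝓟 {N | minGradForm j (μ N : Measure E) (u N) < c}).NeBot :=
    frequently_mem_iff_neBot.1 hfreq
  -- An ultrafilter concentrated on the indices with energy below `c` provides all limits
  -- simultaneously, with no extraction of subsequences and no separability of the space of test
  -- functions.
  set 𝒰 := Ultrafilter.of (atTop ⊓ 𝓟 {N | minGradForm j (μ N : Measure E) (u N) < c}) with h𝒰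
  have hle : (𝒰 : Filter ℕ) ≤ atTop := (Ultrafilter.of_le _).trans inf_le_left
  have hmem : ∀ᶠ N in (𝒰 : Filter ℕ), minGradForm j (μ N : Measure E) (u N) < c := by
    have h1 : (𝒰 : Filter ℕ) ≤ 𝓟 {N | minGradForm j (μ N : Measure E) (u N) < c} :=
      (Ultrafilter.of_le _).trans inf_le_right
    exact le_principal_iff.1 h1
  -- bounds
  set C : ℝ := √c.toReal with hC
  have hC0 : 0 ≤ C := Real.sqrt_nonneg _
  have hCc : ENNReal.ofReal C ^ 2 = c := by
    rw [← ENNReal.ofReal_pow hC0, hC, Real.sq_sqrt ENNReal.toReal_nonneg, ENNReal.ofReal_toReal hct]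
  have hgrad : ∀ᶠ N in (𝒰 : Filter ℕ),
      eLpNorm (hGradient j (F N)) 2 (μ N : Measure E) ≤ ENNReal.ofReal C := by
    filter_upwards [hmem] with N hN
    have h1 := (hFN N hN).1
    rw [gradEnergy_eq, ← hCc] at h1
    exact (ENNReal.pow_le_pow_left_iff two_ne_zero).1 h1
  have hgV : ∀ᶠ N in (𝒰 : Filter ℕ), ‖V N (g N)‖ ≤ C := by
    filter_upwards [hgrad] with N hN
    have h1 : ‖V N (g N)‖ₑ ≤ ENNReal.ofReal C := by
      rw [hV, enorm_toLp_eq]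
      exact hN
    rwa [← ofReal_norm, ENNReal.ofReal_le_ofReal_iff hC0] at h1
  obtain ⟨G, hGC, hGlim⟩ := exists_weak_limit hμ hle (fun N => V N (g N)) hC0 hgV
  obtain ⟨B₀, hB₀⟩ := hu.exists_norm_le
  have hdist : ∀ᶠ N in (𝒰 : Filter ℕ), ‖T N (f N) - u N‖ ≤ 1 / ((N : ℝ) + 1) := by
    filter_upwards [hmem] with N hN
    have h1 := (hFN N hN).2
    have h2 : ‖T N (f N) - u N‖ₑ ≤ ENNReal.ofReal (1 / ((N : ℝ) + 1)) := by
      rw [Lp.enorm_def]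
      refine le_trans (le_of_eq (eLpNorm_congr_ae ?_)) h1
      exact (Lp.coeFn_sub _ _).trans
        ((BoundedContinuousFunction.coeFn_toLp 2 (μ N : Measure E) ℝ (f N)).sub (ae_eq_refl _))
    rwa [← ofReal_norm, ENNReal.ofReal_le_ofReal_iff (by positivity)] at h2
  have hnorm : ∀ᶠ N in (𝒰 : Filter ℕ),
      eLpNorm (F N) 2 (μ N : Measure E) ≤ ENNReal.ofReal (B₀ + 1) := by
    filter_upwards [hdist, hle hB₀] with N h1 h2
    have h3 : eLpNorm (F N) 2 (μ N : Measure E) = ‖T N (f N)‖ₑ := (enorm_toLp_eq _ (f N)).symm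
    rw [h3, ← ofReal_norm]
    refine ENNReal.ofReal_le_ofReal ?_
    have h4 : ‖T N (f N)‖ ≤ ‖T N (f N) - u N‖ + ‖u N‖ := norm_le_norm_sub_add _ _
    have h5 : 1 / ((N : ℝ) + 1) ≤ 1 := by
      rw [div_le_one (by positivity)]
      have : (0 : ℝ) ≤ N := Nat.cast_nonneg N
      linarith
    have h6 : ‖u N‖ ≤ B₀ := h2
    linarith
  have hlu : ∀ φ : E →ᵇ ℝ, Tendsto (fun N => ∫ z, F N z * φ z ∂(μ N : Measure E)) 𝒰
      (𝓝 (∫ z, u' z * φ z ∂(μ' : Measure E))) := by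
    intro φ
    have h1 : Tendsto (fun N => (inner ℝ (u N) (T N φ) : ℝ)) 𝒰 (𝓝 (inner ℝ u' (T' φ))) :=
      (hu _ _ (strongConv_toLp hμ φ)).mono_left hle
    have h2 : Tendsto (fun N => (inner ℝ (T N (f N) - u N) (T N φ) : ℝ)) 𝒰 (𝓝 0) := by
      have h3 : Tendsto (fun N : ℕ => 1 / ((N : ℝ) + 1) * ‖φ‖) 𝒰 (𝓝 0) := by
        have := (tendsto_one_div_add_atTop_nhds_zero_nat (𝕜 := ℝ)).mul_const ‖φ‖
        rw [zero_mul] at this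
        exact this.mono_left hle
      refine squeeze_zero_norm' ?_ h3
      filter_upwards [hdist] with N hN
      exact (norm_inner_le_norm _ _).trans
        (mul_le_mul hN (norm_toLp_le_norm _ φ) (norm_nonneg _) (by positivity))
    have h3 := h1.add h2
    rw [add_zero, inner_toLp] at h3
    have e1 : ∀ N, (inner ℝ (u N) (T N φ) : ℝ) + inner ℝ (T N (f N) - u N) (T N φ) =
        ∫ z, F N z * φ z ∂(μ N : Measure E) := by
      intro N
      rw [← inner_add_left, add_sub_cancel, hT, inner_toLp_toLp]
      refine integral_congr_ae (ae_of_all _ fun z => ?_)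
      simp only [RCLike.inner_apply, conj_trivial]
      exact mul_comm _ _
    have e2 : ∫ z, (inner ℝ (u' z) (φ z) : ℝ) ∂(μ' : Measure E) =
        ∫ z, u' z * φ z ∂(μ' : Measure E) := by
      refine integral_congr_ae (ae_of_all _ fun z => ?_)
      simp only [RCLike.inner_apply, conj_trivial]
      exact mul_comm _ _
    rw [e2] at h3
    exact h3.congr e1
  have hlG : ∀ φ : E →ᵇ H, Tendsto (fun N => ∫ z, inner ℝ (hGradient j (F N) z) (φ z)
      ∂(μ N : Measure E)) 𝒰 (𝓝 (∫ z, inner ℝ (G z) (φ z) ∂(μ' : Measure E))) := by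
    intro φ
    have h1 := hGlim φ
    rw [inner_toLp] at h1
    exact h1.congr fun N => inner_toLp_toLp _ (g N) φ
  have hum : Measurable u' := (Lp.stronglyMeasurable u').measurable
  have hGm := Lp.stronglyMeasurable G
  have hcomp := fun i => (P i).exists_productSpan_seq hμ (hcond i) hle hFc hnorm hgrad hum hGm
    (Lp.memLp u') (Lp.memLp G) hlu hlG
  -- the limit belongs to the domain
  have hfin : minGradForm j (μ' : Measure E) u' < ⊤ := by
    refine hdom u' G fun i => ?_
    obtain ⟨v, hv, hv0, hvk⟩ := hcomp i
    exact (P i).superForm_comp_Jinv_le (hcond i).hamza_limit.1 (Lp.memLp u') (Lp.memLp G) hv hv0 hvk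
  rw [minGradForm, formClosure, sInf_lt_iff] at hfin
  obtain ⟨-, ⟨w, hw, hw0, -⟩, -⟩ := hfin
  obtain ⟨G', hGm', hG', hwG'⟩ := hw.exists_gradient_limit j
  have hval : minGradForm j (μ' : Measure E) u' = eLpNorm G' 2 (μ' : Measure E) ^ 2 :=
    formClosure_gradEnergy_eq htot (fun i => (hcond i).hamza_limit) (Lp.memLp u') hw hw0 hGm' hG'
      hwG'
  have hGG : G' =ᵐ[(μ' : Measure E)] G :=
    gradient_ae_eq_of_productSpan htot (fun i => (hcond i).hamza_limit) hw.1 (Lp.memLp u') hGm' hGm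
      hG' (Lp.memLp G) hw0 hwG' hcomp
  -- The true gradient `G'` has the norm of `G`, at most `C = √c`, so the energy of `u'` is at most
  -- `c`.
  rw [hval, eLpNorm_congr_ae hGG, ← Lp.enorm_def, ← hCc, ← ofReal_norm]
  exact pow_le_pow_left₀ zero_le (ENNReal.ofReal_le_ofReal hGC) 2

/-- Mosco convergence under a family of component conditions. -/
theorem moscoConv_of_splittings (hμ : Tendsto μ atTop (𝓝 μ'))
    (htot : ∀ h : H, (∀ i k, inner ℝ h ((P i).ξ k) = 0) → h = 0)
    (hcond : ∀ i, ComponentConditions (fun N => (P i).image (μ N : Measure E))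
      ((P i).image (μ' : Measure E)))
    (hdom : ∀ (u : Lp ℝ 2 (μ' : Measure E)) (G : Lp H 2 (μ' : Measure E)),
      (∀ i, (P i).componentForm (μ' : Measure E) u ≤
        ∑ k, eLpNorm (fun z => (inner ℝ (G z) ((P i).ξ k) : ℝ)) 2 (μ' : Measure E) ^ 2) →
      minGradForm j (μ' : Measure E) u < ⊤) :
    (∀ N, FormClosable (μ N : Measure E) (Cylindrical E) (gradEnergy j (μ N : Measure E))) ∧
    FormClosable (μ' : Measure E) (Cylindrical E) (gradEnergy j (μ' : Measure E)) ∧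
    MoscoConv μ μ' (fun N => minGradForm j (μ N : Measure E)) (minGradForm j (μ' : Measure E)) :=
  ⟨fun N => formClosable_gradEnergy htot fun i => (hcond i).hamza N,
    formClosable_gradEnergy htot fun i => (hcond i).hamza_limit,
    fun _ _ hu => minGradForm_le_liminf hμ htot hcond hdom hu,
    fun u' hu' => exists_recovery_sequence hμ htot (fun i N => (hcond i).hamza N)
      (fun i => (hcond i).hamza_limit) u' hu'⟩

end LowerBound

/-! ### The two systems of components -/

section Systems

variable {E : Type*} [MeasurableSpace E] {H : Type*} [NormedAddCommGroup H]

lemma lintegral_norm_sq_lt_top {ν : Measure E} (G : Lp H 2 ν) :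
    ∫⁻ z, ENNReal.ofReal (‖G z‖ ^ 2) ∂ν < ⊤ := by
  rw [lintegral_norm_sq_eq]
  exact ENNReal.pow_lt_top (Lp.memLp G).2

variable [InnerProductSpace ℝ H]

lemma sum_eLpNorm_inner_sq {ν : Measure E} {G : E → H} (hG : StronglyMeasurable G)
    {n : ℕ} (ξ : Fin n → H) :
    ∑ k, eLpNorm (fun z => (inner ℝ (G z) (ξ k) : ℝ)) 2 ν ^ 2 =
      ∫⁻ z, ∑ k, ENNReal.ofReal (inner ℝ (G z) (ξ k) ^ 2) ∂ν := by
  rw [lintegral_finsetSum]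
  · simp only [lintegral_sq_eq]
  · exact fun k _ => ((hG.inner stronglyMeasurable_const).measurable.pow_const 2).ennreal_ofReal

lemma tsum_ofReal_inner_sq_le (η : HilbertBasis ℕ ℝ H) (h : H) :
    ∑' i, ENNReal.ofReal (inner ℝ h (η i) ^ 2) ≤ ENNReal.ofReal (‖h‖ ^ 2) := by
  have hs := η.orthonormal.inner_products_summable h
  have hle := η.orthonormal.tsum_inner_products_le h
  rw [← ENNReal.ofReal_tsum_of_nonneg (fun i => sq_nonneg _) ?_]
  · refine ENNReal.ofReal_le_ofReal (le_trans (le_of_eq ?_) hle)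
    refine tsum_congr fun i => ?_
    rw [Real.norm_eq_abs, sq_abs, real_inner_comm]
  · refine hs.congr fun i => ?_
    rw [Real.norm_eq_abs, sq_abs, real_inner_comm]

lemma eq_zero_of_inner_hilbertBasis (η : HilbertBasis ℕ ℝ H) {h : H}
    (hh : ∀ i, inner ℝ h (η i) = 0) : h = 0 := by
  refine η.repr.injective ?_
  rw [map_zero]
  ext i
  rw [η.repr_apply_apply, real_inner_comm, hh i]
  rfl

end Systems

end MoscoGradient

end

/-- Both conditions reduce to `moscoConv_of_splittings`. What remains is that the vectors separate
points and that the components of `u` are summable, respectively bounded, as soon as they are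
dominated by squared inner products of some `G` in `L²`. For a basis this follows from Bessel's
inequality integrated over `E`; for the families `K_d`, from the upper bound `‖h‖ ^ 2` on each sum.
-/
theorem theorem4p2
    {E : Type*} [AddCommGroup E] [Module ℝ E] [TopologicalSpace E] [IsTopologicalAddGroup E]
    [ContinuousSMul ℝ E] [LocallyConvexSpace ℝ E] [PolishSpace E] [MeasurableSpace E]
    [BorelSpace E]
    {H : Type*} [NormedAddCommGroup H] [InnerProductSpace ℝ H] [CompleteSpace H]
    (j : H →L[ℝ] E) (hj : Function.Injective j) (hj' : DenseRange j)
    (μ : ℕ → ProbabilityMeasure E) (μ' : ProbabilityMeasure E)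
    (hμ : Tendsto μ atTop (𝓝 μ'))
    (hsupp : ∀ N, (μ N : Measure E).support ⊆ (μ' : Measure E).support)
    (hcond : MoscoGradient.BasisCondition j μ μ' ∨ MoscoGradient.FamilyCondition j μ μ') :
    (∀ N, MoscoGradient.FormClosable (μ N : Measure E) (MoscoGradient.Cylindrical E)
      (MoscoGradient.gradEnergy j (μ N : Measure E))) ∧
    MoscoGradient.FormClosable (μ' : Measure E) (MoscoGradient.Cylindrical E)
      (MoscoGradient.gradEnergy j (μ' : Measure E)) ∧
    MoscoGradient.MoscoConv μ μ' (fun N => MoscoGradient.minGradForm j (μ N : Measure E))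
      (MoscoGradient.minGradForm j (μ' : Measure E)) := by
  rcases hcond with ⟨η, P, hξ, hcomp, hdom⟩ | ⟨P, hlub, hcomp, hdom⟩
  · refine MoscoGradient.moscoConv_of_splittings (P := P) hμ (fun h hh => ?_) hcomp
      fun u G hG => ?_
    · refine MoscoGradient.eq_zero_of_inner_hilbertBasis η fun i => ?_
      rw [← hξ i]
      exact hh i 0
    · have hGm := Lp.stronglyMeasurable G
      have hle : ∀ i, (P i).componentForm (μ' : Measure E) u ≤
          ∫⁻ z, ENNReal.ofReal (inner ℝ (G z) (η i) ^ 2) ∂(μ' : Measure E) := by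
        intro i
        have h1 := hG i
        rw [MoscoGradient.sum_eLpNorm_inner_sq hGm] at h1
        simpa [hξ i] using h1
      have htsum : (∑' i, (P i).componentForm (μ' : Measure E) u) < ⊤ := by
        refine lt_of_le_of_lt ((ENNReal.tsum_le_tsum hle).trans ?_)
          (MoscoGradient.lintegral_norm_sq_lt_top G)
        rw [← lintegral_tsum fun i => ((hGm.inner stronglyMeasurable_const).measurable.pow_const
          2).ennreal_ofReal.aemeasurable]
        exact lintegral_mono fun z => MoscoGradient.tsum_ofReal_inner_sq_le η (G z)
      exact hdom.subset ⟨fun i => (ENNReal.le_tsum i).trans_lt htsum, htsum⟩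
  · refine MoscoGradient.moscoConv_of_splittings (P := P) hμ (fun h hh => ?_) hcomp
      fun u G hG => ?_
    -- If all inner products vanish, then `0` is an upper bound of the sums, and the least upper
    -- bound is `‖h‖ ^ 2`.
    · have h1 : ‖h‖ ^ 2 ≤ 0 := (hlub h).2 (by
        rintro _ ⟨i, rfl⟩
        simp [hh i])
      have h2 : ‖h‖ = 0 := by nlinarith [norm_nonneg h]
      exact norm_eq_zero.1 h2
    · have hGm := Lp.stronglyMeasurable G
      have hle : ∀ i, (P i).componentForm (μ' : Measure E) u ≤
          ∫⁻ z, ENNReal.ofReal (‖G z‖ ^ 2) ∂(μ' : Measure E) := by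
        intro i
        refine (hG i).trans ?_
        rw [MoscoGradient.sum_eLpNorm_inner_sq hGm]
        refine lintegral_mono fun z => ?_
        rw [← ENNReal.ofReal_sum_of_nonneg fun k _ => sq_nonneg _]
        exact ENNReal.ofReal_le_ofReal ((hlub (G z)).1 ⟨i, rfl⟩)
      have hfin := MoscoGradient.lintegral_norm_sq_lt_top G
      exact hdom.subset ⟨fun i => (hle i).trans_lt hfin, (iSup_le hle).trans_lt hfin⟩
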